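/- Let $\alpha_1,\alpha_2,\alpha_3$ be the $4\times4$ matrices $$\alpha_1=\begin{pmatrix}0&0&0&1\\0&0&1&0\\0&1&0&0\\1&0&0&0\end{pmatrix},\quad \alpha_2=\begin{pmatrix}0&0&0&-i\\0&0&i&0\\0&-i&0&0\\i&0&0&0\end{pmatrix},\quad \alpha_3=\begin{pmatrix}0&0&1&0\\0&0&0&-1\\1&0&0&0\\0&-1&0&0\end{pmatrix},$$ let $\mathcal D=\frac1i\sum_{k=1}^3\alpha_k\partial_k$ be the free massless Dirac operator, selfadjoint in $L^2(\mathbb R^3;\mathbb C^4)$ (domain: the $u\in L^2$ with $\mathcal Du\in L^2$ in the sense of distributions), and let $-\Delta$ be the selfadjoint Laplacian acting componentwise. For $z\in\mathbb C\setminus\mathbb R$ write $R_{\mathcal D}(z)=(\mathcal D-z)^{-1}$ and $R_0(z)=(-\Delta-z)^{-1}$. For fixed $\beta>1$ let $w_\beta(x)=|x|(|\log|x||+1)^\beta$ on $\mathbb R^3$, and let $L^2(w_\beta^{\pm1}dx)$ be the corresponding weighted spaces of $\mathbb C^4$-valued functions. Let $H^1(w_\beta^{-1}dx)$ be the space of all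 $u\in L^2(w_\beta^{-1}dx)$ whose distributional gradient is in $L^2(w_\beta^{-1}dx)$, with norm $(\|u\|^2_{L^2(w_\beta^{-1}dx)}+\|\nabla u\|^2_{L^2(w_\beta^{-1}dx)})^{1/2}$. For $z\in\mathbb C\setminus\mathbb R$ the resolvents $R_{\mathcal D}(z)$, $R_0(z)$ exist as bounded operators on $L^2(\mathbb R^3;\mathbb C^4)$, and $R_{\mathcal D}(z)$, restricted to $L^2\cap L^2(w_\beta dx)$, extends to a bounded operator from $L^2(w_\beta dx)$ to $L^2(w_\beta^{-1}dx)$, again denoted by $R_{\mathcal D}(z)$. For all $\lambda\in\mathbb R$ and each choice of sign $\pm$ there is a bounded operator $R_{\mathcal D}(\lambda\pm i0)$ from $L^2(w_\beta dx)$ to $L^2(w_\beta^{-1}dx)$ such that the following holds. 1. $R_{\mathcal D}(\lambda\pm i\varepsilon)\to R_{\mathcal D}(\lambda\pm i0)$ as $\varepsilon\downarrow0$ in the operator norm from $L^2(w_\beta dx)$ to $H^1(w_\beta^{-1}dx)$; that is, for all small $\varepsilon>0$ the differences $R_{\mathcal D}(\lambda\pm i\varepsilon)-R_{\mathcal D}(\lambda\pm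 i0)$ are bounded from $L^2(w_\beta dx)$ to $H^1(w_\beta^{-1}dx)$, and their norms tend to $0$. 2. $R_{\mathcal D}(\lambda\pm i0)=R_0\big((\lambda\pm i0)^2\big)(\mathcal D+\lambda)$ on $C_c^\infty(\mathbb R^3;\mathbb C^4)$, which is dense in $L^2(w_\beta dx)$. Here $R_0((\lambda\pm i0)^2)$ is $R_0(\lambda^2\pm i0)$ for $\lambda>0$, is $R_0(\lambda^2\mp i0)$ for $\lambda<0$, and is either of $R_0(0+i0)$, $R_0(0-i0)$ for $\lambda=0$; and $R_0(\mu\pm i0)g$ is the limit of $R_0(\mu\pm i\varepsilon)g$ in $L^2(w_\beta^{-1}dx)$ as $\varepsilon\downarrow0$. 3. There is a constant $C=C(\beta)$ with $$\|R_{\mathcal D}(z)f\|_{L^2(w_\beta^{-1}dx)}\le C\,\|f\|_{L^2(w_\beta dx)}$$ for all $f\in L^2(w_\beta dx)$ and all $z\in\mathbb C$, where for real $z=\lambda$ this is meant for both $R_{\mathcal D}(\lambda+i0)$ and $R_{\mathcal D}(\lambda-i0)$. 4. For all $f\in L^2(w_\beta dx)$ and almost all $x\in\mathbb R^3$, with absolutely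 convergent integrals, $$R_{\mathcal D}(\lambda\pm i0)f(x)=\frac{\lambda}{4\pi}\int_{\mathbb R^3}\frac{e^{\pm i\lambda|x-y|}}{|x-y|}\Big(I_4\pm\sum_{j=1}^3\alpha_j\frac{x_j-y_j}{|x-y|}\Big)f(y)\,dy+\frac{i}{4\pi}\int_{\mathbb R^3}\frac{e^{\pm i\lambda|x-y|}}{|x-y|^2}\sum_{j=1}^3\alpha_j\frac{x_j-y_j}{|x-y|}f(y)\,dy .$$ -/

import Mathlib

open MeasureTheory Filter Topology
open scoped ENNReal ContDiff

namespace DiracLAP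

/-- Euclidean three-space. -/
abbrev Space : Type := EuclideanSpace ℝ (Fin 3)

/-- The value space `ℂ⁴`. -/
abbrev Spinor : Type := EuclideanSpace ℂ (Fin 4)

/-- The Hilbert space `L²(ℝ³; ℂ⁴)`. -/
abbrev L2 : Type := Lp Spinor 2 (volume : Measure Space)

/-- The weight `w_β(x) = |x| (|log |x|| + 1)^β`. It is positive for `x ≠ 0`. -/
noncomputable def weight (β : ℝ) (x : Space) : ℝ :=
  ‖x‖ * (|Real.log ‖x‖| + 1) ^ β

/-- The measure `w_β(x) dx`. -/
noncomputable def weightMeasure (β : ℝ) : Measure Space :=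
  volume.withDensity fun x => ENNReal.ofReal (weight β x)

/-- The measure `w_β(x)⁻¹ dx`. -/
noncomputable def invWeightMeasure (β : ℝ) : Measure Space :=
  volume.withDensity fun x => ENNReal.ofReal (weight β x)⁻¹

/-- The weighted space `L²(w_β dx)` of `ℂ⁴`-valued functions. -/
abbrev L2Weight (β : ℝ) : Type := Lp Spinor 2 (weightMeasure β)

/-- The weighted space `L²(w_β⁻¹ dx)` of `ℂ⁴`-valued functions. -/
abbrev L2InvWeight (β : ℝ) : Type := Lp Spinor 2 (invWeightMeasure β)

/-- The Dirac matrices `α₁, α₂, α₃`. -/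
noncomputable def diracMatrix : Fin 3 → Matrix (Fin 4) (Fin 4) ℂ :=
  ![!![0, 0, 0, 1;
       0, 0, 1, 0;
       0, 1, 0, 0;
       1, 0, 0, 0],
    !![0, 0, 0, -Complex.I;
       0, 0, Complex.I, 0;
       0, -Complex.I, 0, 0;
       Complex.I, 0, 0, 0],
    !![0, 0, 1, 0;
       0, 0, 0, -1;
       1, 0, 0, 0;
       0, -1, 0, 0]]

/-- The Dirac matrices acting on `ℂ⁴`. -/
noncomputable def alpha (k : Fin 3) : Spinor →L[ℂ] Spinor :=
  Matrix.toEuclideanCLM (n := Fin 4) (𝕜 := ℂ) (diracMatrix k)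

/-- `C_c^∞` functions. -/
def IsTest {F : Type*} [NormedAddCommGroup F] [NormedSpace ℝ F] (φ : Space → F) : Prop :=
  ContDiff ℝ ∞ φ ∧ HasCompactSupport φ

/-- The classical partial derivative `∂ₖ φ`. -/
noncomputable def partialDeriv {F : Type*} [NormedAddCommGroup F] [NormedSpace ℝ F]
    (k : Fin 3) (φ : Space → F) (x : Space) : F :=
  fderiv ℝ φ x (EuclideanSpace.single k 1)

/-- The Dirac operator `𝒟 = (1/i) ∑ₖ αₖ ∂ₖ` on smooth functions. -/
noncomputable def diracSmooth (f : Space → Spinor) (x : Space) : Spinor :=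
  (-Complex.I) • ∑ k, alpha k (partialDeriv k f x)

/-- Graph of the selfadjoint operator `𝒟` in `L²`: `u` belongs to the domain and `𝒟 u = v`, that is
`u, v ∈ L²` and `(1/i) ∑ₖ αₖ ∂ₖ u = v` in the sense of distributions. -/
def IsDirac (u v : L2) : Prop :=
  ∀ φ : Space → ℂ, IsTest φ →
    Complex.I • ∑ k, ∫ x, partialDeriv k φ x • alpha k (u x) = ∫ x, φ x • v x

/-- Graph of the selfadjoint operator `-Δ I₄` in `L²`: `u, v ∈ L²` and `-Δ u = v` in the sense of
distributions. -/
def IsNegLaplacian (u v : L2) : Prop :=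
  ∀ φ : Space → ℂ, IsTest φ →
    -∫ x, (∑ k, partialDeriv k (partialDeriv k φ) x) • u x = ∫ x, φ x • v x

/-- `R` is the bounded everywhere defined two-sided inverse `(A - z)⁻¹` of the operator with
graph `A`: `R f = u` exactly when `u` is in the domain of `A` and `A u - z u = f`. -/
def IsResolvent (A : L2 → L2 → Prop) (z : ℂ) (R : L2 →L[ℂ] L2) : Prop :=
  ∀ f u : L2, R f = u ↔ A u (f + z • u)

open Classical in
/-- The resolvent `(A - z)⁻¹` (with value `0` when `z` is not in the resolvent set). -/
noncomputable def resolvent (A : L2 → L2 → Prop) (z : ℂ) : L2 →L[ℂ] L2 :=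
  if h : ∃ R, IsResolvent A z R then h.choose else 0

/-- `R_𝒟(z) = (𝒟 - z)⁻¹`. -/
noncomputable def diracResolvent (z : ℂ) : L2 →L[ℂ] L2 := resolvent IsDirac z

/-- `R₀(z) = (-Δ - z)⁻¹`. -/
noncomputable def freeResolvent (z : ℂ) : L2 →L[ℂ] L2 := resolvent IsNegLaplacian z

/-- `u = R₀(μ + i s 0) g` for a sign `s`: `R₀(μ + i s ε) g → u` in `L²(w_β⁻¹ dx)` as `ε ↓ 0`. -/
def IsFreeBoundaryValue (β μ : ℝ) (s : ℤˣ) (g : L2) (u : L2InvWeight β) : Prop :=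
  Tendsto (fun ε : ℝ => eLpNorm
      (fun x => freeResolvent ((μ : ℂ) + Complex.I * ((s : ℤ) : ℂ) * (ε : ℂ)) g x - u x)
      2 (invWeightMeasure β))
    (𝓝[>] 0) (𝓝 0)

/-- `∂ₖ u = v` in the sense of distributions. -/
def HasWeakPartial (k : Fin 3) (u v : Space → Spinor) : Prop :=
  ∀ φ : Space → ℂ, IsTest φ → ∫ x, partialDeriv k φ x • u x = -∫ x, φ x • v x

/-- `u ∈ H¹(w_β⁻¹ dx)` and `‖u‖_{H¹(w_β⁻¹ dx)} ≤ M`, where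
`‖u‖² = ‖u‖²_{L²(w_β⁻¹ dx)} + ‖∇u‖²_{L²(w_β⁻¹ dx)}`. -/
def H1InvWeightNormLE (β : ℝ) (u : L2InvWeight β) (M : ℝ) : Prop :=
  ∃ v : Fin 3 → L2InvWeight β,
    (∀ k, HasWeakPartial k u (v k)) ∧ √(‖u‖ ^ 2 + ∑ k, ‖v k‖ ^ 2) ≤ M

/-- Convergence `S ε → S₀` as `ε ↓ 0` in the operator norm of `L²(w_β dx) → H¹(w_β⁻¹ dx)`: the
differences map into `H¹(w_β⁻¹ dx)` and their operator norms tend to zero. -/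
def TendstoInL2H1 (β : ℝ) (S : ℝ → L2Weight β →L[ℂ] L2InvWeight β)
    (S₀ : L2Weight β →L[ℂ] L2InvWeight β) : Prop :=
  ∀ δ : ℝ, 0 < δ → ∀ᶠ ε in 𝓝[>] (0 : ℝ), ∀ f : L2Weight β,
    H1InvWeightNormLE β (S ε f - S₀ f) (δ * ‖f‖)

/-- `∑ₖ αₖ rₖ / |r|`. -/
noncomputable def alphaDir (r : Space) : Spinor →L[ℂ] Spinor :=
  ∑ k, ((r k / ‖r‖ : ℝ) : ℂ) • alpha k

/-- The oscillating factor `e^{i σ l |r|}`, `σ` a sign. -/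
noncomputable def phase (σ : ℤˣ) (l : ℝ) (r : Space) : ℂ :=
  Complex.exp (Complex.I * ((σ : ℤ) : ℂ) * (l : ℂ) * (‖r‖ : ℂ))

/-- `e^{iσl|x-y|} / |x-y| (I₄ + σ ∑ₖ αₖ (xₖ-yₖ)/|x-y|) f(y)`. -/
noncomputable def farIntegrand (σ : ℤˣ) (l : ℝ) (f : Space → Spinor) (x y : Space) : Spinor :=
  (phase σ l (x - y) / (‖x - y‖ : ℂ)) • (f y + ((σ : ℤ) : ℂ) • alphaDir (x - y) (f y))

/-- `e^{iσl|x-y|} / |x-y|² ∑ₖ αₖ (xₖ-yₖ)/|x-y| f(y)`. -/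
noncomputable def nearIntegrand (σ : ℤˣ) (l : ℝ) (f : Space → Spinor) (x y : Space) : Spinor :=
  (phase σ l (x - y) / (‖x - y‖ : ℂ) ^ 2) • alphaDir (x - y) (f y)

end DiracLAP

/-! For a sign s and Im(sz) ≥ 0 consider convolution with `kern s z`, which is 𝒟 + z applied to the
kernel e^{isz|r|}/(4π|r|) of (-Δ - z²)⁻¹. The Dirac matrices anticommute, so 𝒟² = -Δ and this
convolution inverts 𝒟 - z. If Im(sz) > 0 the kernel is integrable and the convolution is the L²
resolvent (`exists_dirac_resolvent`). If z is real the kernel is only locally integrable, and the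
convolution is the boundary value. Resolvents and boundary values thus form one family `kernOp s z`,
and the theorem reduces to estimates for this family that are uniform up to the real axis.

Uniform bound. The operator is the Laplace transform in time of i s e^{-ist𝒟}
(`kernOp_eq_integral_prop`), where the propagator is given by spherical means and is bounded on L²
uniformly in t. In three dimensions Huygens' principle is sharp: if f lives in |y| < R₁, then at a
point x only times in an interval of length 2R₁ contribute. Cauchy–Schwarz in t gives ∫_{|x|<R₂}
|Kf|² ≤ c R₁R₂ ‖f‖² with c independent of z, when R₁ ≤ R₂; duality covers R₁ > R₂
(`lintegral_kernOp_ball_le`). Cutting f into the shells e^j ≤ |y| < e^{j+1}, and then the x-space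
likewise, turns this into the weighted bound, because the weight costs (1+|j|)^{-β} on each shell
and this is summable for β > 1 (`exists_uniform_bound`).

Convergence. In a difference of two kernels the |r|⁻² singularity cancels. What remains is at most a
constant times min(ε(|r|+1), 1)|r|⁻¹, and the function |x-y|⁻² w_{β'}(y)⁻¹ is integrable in y
uniformly in x for every β' > 1. Choosing β' strictly between 1 and β leaves a power of the
logarithm that gives smallness for large |y|. So the difference is small almost everywhere on
bounded sets; for large |x| the uniform bound with exponent β' and the same spare power finish
(`eventually_lintegral_kernOp_sub_le`).

Gradient. For test functions ‖𝒟v‖ = ‖∇v‖ in L². Applied to v = Wu with W a smooth cut-off version of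
w_β^{-1/2}, this bounds ∇u in the weighted norm by 𝒟u and by |x|⁻¹u (`exists_gradient_bound`). For u
the difference of two kernel operators applied to a test function, 𝒟u is again expressed through
such operators, and |x|⁻²w_β⁻¹ is integrable, so both terms are small. A closed graph argument
extends the weak derivatives from test functions to all of L²(w_β dx).

The relation with R₀ holds because on test functions the convolution is that of 𝒟φ + zφ with the
Helmholtz kernel, and because the square root of l² + isε in the upper half-plane tends to σl when
sσl ≥ 0. The explicit formula is the kernel written out. -/

namespace DiracLAP

/-! ### Radial integrals and the logarithmic weight. -/

lemma integrable_radial_iff {f : ℝ → ℝ} :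
    Integrable (fun x : Space => f ‖x‖) ↔ IntegrableOn (fun r => r ^ 2 * f r) (Set.Ioi 0) := by
  have h := integrable_fun_norm_addHaar (E := Space) (F := ℝ) volume (f := f)
  simpa using h

lemma integral_radial (f : ℝ → ℝ) : ∫ x : Space, f ‖x‖ =
    3 * (volume.real (Metric.ball (0 : Space) 1)) * ∫ r in Set.Ioi (0 : ℝ), r ^ 2 * f r := by
  have h := integral_fun_norm_addHaar (E := Space) (F := ℝ) volume f
  simp at h
  rw [h]; ring

lemma integrable_one_add_abs_rpow {β : ℝ} (hβ : 1 < β) :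
    Integrable (fun τ : ℝ => (|τ| + 1) ^ (-β)) := by
  have h := integrable_one_add_norm (E := ℝ) (μ := volume) (r := β) (by simpa using hβ)
  refine h.congr (Eventually.of_forall fun τ => ?_)
  simp [add_comm]

/-- The substitution r = e^τ turns dr/r into dτ and leaves (|τ|+1)^{-β} on the line. Here β > 1 is
needed; the discrete counterpart is `summable_shellWeight`. -/
lemma integrableOn_inv_mul_log_rpow {β : ℝ} (hβ : 1 < β) :
    IntegrableOn (fun r : ℝ => r⁻¹ * (|Real.log r| + 1) ^ (-β)) (Set.Ioi 0) := by
  have h := integrableOn_image_iff_integrableOn_abs_deriv_smul (s := Set.univ) (f := Real.exp)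
    (f' := Real.exp) MeasurableSet.univ (fun x _ => (Real.hasDerivAt_exp x).hasDerivWithinAt)
    Real.exp_injective.injOn (fun r : ℝ => r⁻¹ * (|Real.log r| + 1) ^ (-β))
  rw [Set.image_univ, Real.range_exp] at h
  rw [h, integrableOn_univ]
  refine (integrable_one_add_abs_rpow hβ).congr (Eventually.of_forall fun τ => ?_)
  simp [Real.exp_ne_zero]

lemma weight_nonneg (β : ℝ) (x : Space) : 0 ≤ weight β x := by
  unfold weight; positivity

lemma weight_pos (β : ℝ) {x : Space} (hx : x ≠ 0) : 0 < weight β x := by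
  have : 0 < ‖x‖ := norm_pos_iff.2 hx
  unfold weight; positivity

lemma measurable_weight (β : ℝ) : Measurable (weight β) := by
  unfold weight; fun_prop

lemma ae_ne_zero : ∀ᵐ x : Space, x ≠ 0 := by
  simp [ae_iff]

lemma le_weight {β : ℝ} (hβ : 0 ≤ β) (x : Space) : ‖x‖ ≤ weight β x := by
  unfold weight
  have : (1 : ℝ) ≤ (|Real.log ‖x‖| + 1) ^ β :=
    Real.one_le_rpow (by linarith [abs_nonneg (Real.log ‖x‖)]) hβ
  nlinarith [norm_nonneg x]

/-- The factor r² of polar coordinates cancels r⁻², so only the logarithmic integral remains. Both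
the origin and infinity are borderline and are saved by the logarithm. -/
lemma integrable_inv_sq_mul_inv_weight {β : ℝ} (hβ : 1 < β) :
    Integrable (fun x : Space => (‖x‖⁻¹) ^ 2 * (weight β x)⁻¹) := by
  have h : Integrable (fun x : Space =>
      (fun r : ℝ => (r⁻¹) ^ 2 * (r * (|Real.log r| + 1) ^ β)⁻¹) ‖x‖) := by
    refine (integrable_radial_iff (f := fun r : ℝ => (r⁻¹) ^ 2 *
      (r * (|Real.log r| + 1) ^ β)⁻¹)).2 ?_
    refine (integrableOn_inv_mul_log_rpow hβ).congr_fun (fun r hr => ?_) measurableSet_Ioi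
    have hr : 0 < r := hr
    simp only
    rw [Real.rpow_neg (by positivity), mul_inv]
    field_simp
  exact h

lemma inv_weight_le_mul {β R : ℝ} {x : Space} (hx : ‖x‖ ≤ R) :
    (weight β x)⁻¹ ≤ R ^ 2 * ((‖x‖⁻¹) ^ 2 * (weight β x)⁻¹) := by
  rcases eq_or_ne x 0 with rfl | h0
  -- At the origin the weight is 0 and so is its inverse, by the convention for division.
  · simp [weight]
  have h1 : 0 < ‖x‖ := norm_pos_iff.2 h0
  have h2 : 0 ≤ (weight β x)⁻¹ := inv_nonneg.2 (weight_nonneg β x)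
  have h3 : 1 ≤ R ^ 2 * (‖x‖⁻¹) ^ 2 := by
    rw [← mul_pow]
    have : 1 ≤ R * ‖x‖⁻¹ := by
      rw [← div_eq_mul_inv, le_div_iff₀ h1]; linarith
    exact one_le_pow₀ this
  nlinarith

lemma integrableOn_inv_weight {β : ℝ} (hβ : 1 < β) (R : ℝ) :
    IntegrableOn (fun x : Space => (weight β x)⁻¹) (Metric.closedBall 0 R) := by
  refine Integrable.mono' (((integrable_inv_sq_mul_inv_weight hβ).const_mul (R ^ 2)).integrableOn)
    (measurable_weight β).inv.aestronglyMeasurable ?_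
  filter_upwards [ae_restrict_mem measurableSet_closedBall] with x hx
  rw [Real.norm_of_nonneg (inv_nonneg.2 (weight_nonneg β x))]
  exact inv_weight_le_mul (by simpa using hx)

lemma weight_le_of_norm_le {β : ℝ} (hβ : 1 < β) (R : ℝ) :
    ∃ C : ℝ, 0 ≤ C ∧ ∀ x : Space, ‖x‖ ≤ R → weight β x ≤ C := by
  have hβ0 : 0 < β := by linarith
  refine ⟨(β + 1) ^ β + |R| * (|Real.log R| + 1) ^ β, by positivity, fun x hx => ?_⟩
  rcases eq_or_ne x 0 with rfl | h0
  · simp only [weight, norm_zero, zero_mul]; positivity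
  have h1 : 0 < ‖x‖ := norm_pos_iff.2 h0
  rcases le_total ‖x‖ 1 with h | h
  -- Near the origin the weight is the β-th power of r^{1/β}(|log r| + 1), and r^{1/β}|log r| < β
  -- for 0 < r ≤ 1. Hence the constant (β+1)^β.
  · have h2 := Real.abs_log_mul_self_rpow_lt ‖x‖ (1 / β) h1 h (by positivity)
    have h3 : weight β x = (‖x‖ ^ (1 / β) * (|Real.log ‖x‖| + 1)) ^ β := by
      rw [Real.mul_rpow (by positivity) (by positivity), ← Real.rpow_mul h1.le,
        one_div_mul_cancel hβ0.ne', Real.rpow_one, weight]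
    have h4 : ‖x‖ ^ (1 / β) ≤ 1 := Real.rpow_le_one h1.le h (by positivity)
    have h5 : ‖x‖ ^ (1 / β) * (|Real.log ‖x‖| + 1) ≤ β + 1 := by
      rw [abs_mul, abs_of_pos (Real.rpow_pos_of_pos h1 _), one_div_one_div] at h2
      linarith
    have h6 : weight β x ≤ (β + 1) ^ β := by
      rw [h3]; exact Real.rpow_le_rpow (by positivity) h5 hβ0.le
    have : 0 ≤ |R| * (|Real.log R| + 1) ^ β := by positivity
    linarith
  · have hR : 1 ≤ R := h.trans hx
    have h2 : |Real.log ‖x‖| ≤ |Real.log R| := by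
      rw [abs_of_nonneg (Real.log_nonneg h), abs_of_nonneg (Real.log_nonneg hR)]
      exact Real.log_le_log h1 hx
    have h3 : weight β x ≤ |R| * (|Real.log R| + 1) ^ β := by
      unfold weight
      gcongr
      exact hx.trans (le_abs_self R)
    have : 0 ≤ (β + 1) ^ β := by positivity
    linarith

lemma integrableOn_inv_norm_sq (R : ℝ) :
    IntegrableOn (fun x : Space => (‖x‖⁻¹) ^ 2) (Metric.ball 0 R) := by
  have h := integrableOn_fun_norm_addHaar (E := Space) (F := ℝ) volume
    (f := fun r => (r⁻¹) ^ 2) (r := R)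
  rw [h]
  refine (integrableOn_const (C := (1 : ℝ)) (by simp)).congr_fun (fun r hr => ?_) measurableSet_Ioo
  have hr : 0 < r := hr.1
  simp
  field_simp

/-- Three times the volume of the unit ball is the area of the unit sphere. The growth is linear in
R, which makes the bound near x in the next lemma independent of |x|. -/
lemma lintegral_inv_norm_sq_ball (R : ℝ) (hR : 0 ≤ R) :
    ∫⁻ x : Space in Metric.ball 0 R, ENNReal.ofReal ((‖x‖⁻¹) ^ 2) =
      ENNReal.ofReal (3 * volume.real (Metric.ball (0 : Space) 1) * R) := by
  rw [← ofReal_integral_eq_lintegral_ofReal (integrableOn_inv_norm_sq R)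
    (Eventually.of_forall fun x => by positivity)]
  congr 1
  rw [← integral_indicator measurableSet_ball]
  have h := integral_radial (fun r => (Set.Iio R).indicator (fun r => (r⁻¹) ^ 2) r)
  have h2 : ∀ x : Space, (Metric.ball (0 : Space) R).indicator (fun x => (‖x‖⁻¹) ^ 2) x =
      (Set.Iio R).indicator (fun r => (r⁻¹) ^ 2) ‖x‖ := by
    intro x; simp [Set.indicator]
  simp_rw [h2]
  rw [h]
  congr 1
  have h3 : ∀ r ∈ Set.Ioi (0 : ℝ), r ^ 2 * (Set.Iio R).indicator (fun r => (r⁻¹) ^ 2) r =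
      (Set.Iio R).indicator (fun _ => (1 : ℝ)) r := by
    intro r hr
    have hr : 0 < r := hr
    by_cases hrR : r < R
    · simp [hrR]; field_simp
    · simp [hrR]
  rw [setIntegral_congr_fun measurableSet_Ioi h3, setIntegral_indicator measurableSet_Iio]
  simp [Set.Ioi_inter_Iio, hR]

/-- The kernel `|x - y|⁻² w_β(y)⁻¹` is integrable in `y`, uniformly in `x`. -/
lemma exists_lintegral_inv_sq_sub_mul_inv_weight_le {β : ℝ} (hβ : 1 < β) :
    ∃ A : ℝ, 0 ≤ A ∧ ∀ x : Space,
      ∫⁻ y, ENNReal.ofReal ((‖x - y‖⁻¹) ^ 2 * (weight β y)⁻¹) ≤ ENNReal.ofReal A := by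
  set c := 3 * volume.real (Metric.ball (0 : Space) 1) with hc
  have hc0 : 0 ≤ c := by positivity
  set J := ∫ y : Space, (‖y‖⁻¹) ^ 2 * (weight β y)⁻¹ with hJ
  have hJ0 : 0 ≤ J := integral_nonneg fun y => by
    have := weight_nonneg β y
    simp only [Pi.zero_apply]; positivity
  refine ⟨9 * J + c, by positivity, fun x => ?_⟩
  -- If |x-y| < |x|/2 then |y| ≥ |x|/2, so w(y)⁻¹ ≤ 2/|x|, while |x-y|⁻² integrates to c|x|/2 over
  -- that ball. Otherwise |y| ≤ 3|x-y|, which costs a factor 9 against the integral centred at the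
  -- origin.
  have key : ∀ y, ENNReal.ofReal ((‖x - y‖⁻¹) ^ 2 * (weight β y)⁻¹) ≤
      ENNReal.ofReal (9 * ((‖y‖⁻¹) ^ 2 * (weight β y)⁻¹)) +
      ENNReal.ofReal (2 / ‖x‖) * (Metric.ball x (‖x‖ / 2)).indicator
        (fun y => ENNReal.ofReal ((‖x - y‖⁻¹) ^ 2)) y := by
    intro y
    have hw := weight_nonneg β y
    rcases eq_or_ne y 0 with rfl | hy
    · simp [weight]
    have hy0 : 0 < ‖y‖ := norm_pos_iff.2 hy
    by_cases h : ‖x - y‖ < ‖x‖ / 2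
    · have hmem : y ∈ Metric.ball x (‖x‖ / 2) := by
        rw [Metric.mem_ball, dist_comm, dist_eq_norm]; exact h
      have hx0 : 0 < ‖x‖ := by linarith [norm_nonneg (x - y)]
      have hyx : ‖x‖ / 2 ≤ ‖y‖ := by
        have := norm_sub_norm_le x y
        linarith
      refine le_add_left ?_
      rw [Set.indicator_of_mem hmem, ← ENNReal.ofReal_mul (by positivity), mul_comm]
      apply ENNReal.ofReal_le_ofReal
      have h1 : (weight β y)⁻¹ ≤ 2 / ‖x‖ := by
        rw [inv_le_comm₀ (weight_pos β hy) (by positivity), inv_div]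
        exact hyx.trans (le_weight (by linarith) y)
      gcongr
    · push Not at h
      have hyx : ‖y‖ ≤ 3 * ‖x - y‖ := by
        have := norm_sub_norm_le y x
        rw [norm_sub_rev] at this
        linarith
      have hxy : 0 < ‖x - y‖ := by linarith
      refine le_add_right (ENNReal.ofReal_le_ofReal ?_)
      have h1 : ‖x - y‖⁻¹ ≤ 3 * ‖y‖⁻¹ := by
        rw [← div_eq_mul_inv, le_div_iff₀ hy0, inv_mul_le_iff₀ hxy]; linarith
      calc (‖x - y‖⁻¹) ^ 2 * (weight β y)⁻¹ ≤ (3 * ‖y‖⁻¹) ^ 2 * (weight β y)⁻¹ := by gcongr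
        _ = _ := by ring
  refine (lintegral_mono key).trans ?_
  rw [lintegral_add_left (by have := measurable_weight β; fun_prop),
    lintegral_const_mul' _ _ ENNReal.ofReal_ne_top,
    lintegral_indicator measurableSet_ball]
  have e1 : ∫⁻ y : Space, ENNReal.ofReal (9 * ((‖y‖⁻¹) ^ 2 * (weight β y)⁻¹)) =
      ENNReal.ofReal (9 * J) := by
    rw [hJ, ← integral_const_mul, ofReal_integral_eq_lintegral_ofReal
      ((integrable_inv_sq_mul_inv_weight hβ).const_mul 9)]
    exact Eventually.of_forall fun y => by
      have := weight_nonneg β y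
      simp only [Pi.zero_apply]; positivity
  have e2 : ∫⁻ y in Metric.ball x (‖x‖ / 2), ENNReal.ofReal ((‖x - y‖⁻¹) ^ 2) =
      ENNReal.ofReal (c * (‖x‖ / 2)) := by
    rw [hc, ← lintegral_inv_norm_sq_ball (‖x‖ / 2) (by positivity),
      ← lintegral_indicator measurableSet_ball, ← lintegral_indicator measurableSet_ball,
      ← lintegral_sub_left_eq_self _ x]
    refine lintegral_congr fun y => ?_
    simp only [Set.indicator, Metric.mem_ball, dist_eq_norm]
    simp
  rw [e1, e2, ENNReal.ofReal_add (by positivity) hc0]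
  gcongr
  rw [← ENNReal.ofReal_mul (by positivity)]
  apply ENNReal.ofReal_le_ofReal
  rcases eq_or_ne x 0 with rfl | hx
  · simpa using hc0
  have : 0 < ‖x‖ := norm_pos_iff.2 hx
  apply le_of_eq; field_simp

/-! ### Cauchy–Schwarz and Young inequalities. -/

lemma sq_lintegral_mul_le {α : Type*} [MeasurableSpace α] {μ : Measure α} {a b : α → ℝ≥0∞}
    (ha : AEMeasurable a μ) (hb : AEMeasurable b μ) :
    (∫⁻ x, a x * b x ∂μ) ^ 2 ≤ (∫⁻ x, a x ^ 2 ∂μ) * ∫⁻ x, b x ^ 2 ∂μ := by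
  have h := ENNReal.lintegral_mul_le_Lp_mul_Lq μ Real.HolderConjugate.two_two ha hb
  simp only [Pi.mul_apply, ENNReal.rpow_two] at h
  calc (∫⁻ x, a x * b x ∂μ) ^ 2
      ≤ ((∫⁻ x, a x ^ 2 ∂μ) ^ (1 / (2 : ℝ)) * (∫⁻ x, b x ^ 2 ∂μ) ^ (1 / (2 : ℝ))) ^ 2 := by gcongr
    _ = _ := by
      rw [mul_pow, ← ENNReal.rpow_two, ← ENNReal.rpow_two, ← ENNReal.rpow_mul,
        ← ENNReal.rpow_mul]
      norm_num

/-- Cauchy–Schwarz for the measure a dμ, obtained by splitting a into two square roots. -/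
lemma sq_lintegral_mul_le_mul {α : Type*} [MeasurableSpace α] {μ : Measure α} {a b : α → ℝ≥0∞}
    (ha : AEMeasurable a μ) (hb : AEMeasurable b μ) :
    (∫⁻ x, a x * b x ∂μ) ^ 2 ≤ (∫⁻ x, a x ∂μ) * ∫⁻ x, a x * b x ^ 2 ∂μ := by
  have hs : ∀ t : ℝ≥0∞, t ^ (1 / 2 : ℝ) * t ^ (1 / 2 : ℝ) = t := fun t => by
    rw [← ENNReal.rpow_add_of_nonneg _ _ (by norm_num) (by norm_num)]; norm_num
  have h := sq_lintegral_mul_le (μ := μ) (ha.pow_const (1 / 2 : ℝ))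
    ((ha.pow_const (1 / 2 : ℝ)).mul hb)
  simp only [Pi.mul_apply, ← mul_assoc, hs] at h
  simpa only [mul_pow, sq (_ ^ (1 / 2 : ℝ)), hs] using h

/-- The weighted Cauchy–Schwarz inequality for counting measure; the c i will be the summable shell
weights. -/
lemma sq_tsum_le {ι : Type*} [Countable ι] (a c : ι → ℝ≥0∞) (hc : ∀ i, c i ≠ 0)
    (hc' : ∀ i, c i ≠ ⊤) :
    (∑' i, a i) ^ 2 ≤ (∑' i, c i) * ∑' i, (c i)⁻¹ * a i ^ 2 := by
  let _ : MeasurableSpace ι := ⊤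
  have _ : MeasurableSingletonClass ι := ⟨fun _ => trivial⟩
  have h := sq_lintegral_mul_le_mul (μ := Measure.count) (a := c) (b := fun i => (c i)⁻¹ * a i)
    (measurable_from_top.aemeasurable) (measurable_from_top.aemeasurable)
  rw [lintegral_count, lintegral_count, lintegral_count] at h
  have e1 : ∀ i, c i * ((c i)⁻¹ * a i) = a i := fun i => by
    rw [← mul_assoc, ENNReal.mul_inv_cancel (hc i) (hc' i), one_mul]
  have e2 : ∀ i, c i * ((c i)⁻¹ * a i) ^ 2 = (c i)⁻¹ * a i ^ 2 := fun i => by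
    rw [sq, ← mul_assoc, e1, sq]; ring
  simp_rw [e1, e2] at h
  exact h

/-- Cauchy–Schwarz form of Young's inequality for convolution operators on `L²`. -/
lemma lintegral_sq_convolution_le {h g : Space → ℝ≥0∞} (hh : Measurable h) (hg : Measurable g) :
    ∫⁻ x, (∫⁻ y, h (x - y) * g y) ^ 2 ≤ (∫⁻ r, h r) ^ 2 * ∫⁻ y, g y ^ 2 := by
  calc ∫⁻ x, (∫⁻ y, h (x - y) * g y) ^ 2
      ≤ ∫⁻ x, (∫⁻ r, h r) * ∫⁻ y, h (x - y) * g y ^ 2 := by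
        refine lintegral_mono fun x => ?_
        have := sq_lintegral_mul_le_mul (μ := (volume : Measure Space)) (a := fun y => h (x - y))
          (b := g) (by fun_prop) hg.aemeasurable
        rwa [lintegral_sub_left_eq_self (fun r => h r) x] at this
    _ = (∫⁻ r, h r) * ∫⁻ y, ∫⁻ x, h (x - y) * g y ^ 2 := by
        rw [lintegral_const_mul _ (by fun_prop), lintegral_lintegral_swap (by fun_prop)]
    _ = (∫⁻ r, h r) * ∫⁻ y, (∫⁻ r, h r) * g y ^ 2 := by
        congr 1
        refine lintegral_congr fun y => ?_
        rw [lintegral_mul_const _ (by fun_prop), lintegral_sub_right_eq_self (fun r => h r) y]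
    _ = _ := by
        rw [lintegral_const_mul _ (by fun_prop), ← mul_assoc, sq]

/-! ### The resolvent kernels and their size. -/

/-- The kernel `e^{iκ|r|} / (4π|r|)` of `(-Δ - κ²)⁻¹`. -/
noncomputable def gK (κ : ℂ) (r : Space) : ℂ :=
  Complex.exp (Complex.I * κ * (‖r‖ : ℂ)) / (4 * (Real.pi : ℂ) * (‖r‖ : ℂ))

/-- The classical partial derivatives of `gK` away from the origin. -/
noncomputable def dgK (κ : ℂ) (k : Fin 3) (r : Space) : ℂ :=
  (Complex.I * κ / (‖r‖ : ℂ) - 1 / (‖r‖ : ℂ) ^ 2) * Complex.exp (Complex.I * κ * (‖r‖ : ℂ)) /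
    (4 * (Real.pi : ℂ)) * ((r k / ‖r‖ : ℝ) : ℂ)

/-- The kernel of `(𝒟 - z)⁻¹`, with `e^{isz|r|}` as oscillating factor. -/
noncomputable def kern (s : ℤˣ) (z : ℂ) (r : Space) : Spinor →L[ℂ] Spinor :=
  (z * gK (((s : ℤ) : ℂ) * z) r) • ContinuousLinearMap.id ℂ Spinor +
    ∑ k, (-Complex.I * dgK (((s : ℤ) : ℂ) * z) k r) • alpha k

/-- The integral operator with kernel `kern s z (x - y)`. -/
noncomputable def kernOp (s : ℤˣ) (z : ℂ) (f : Space → Spinor) (x : Space) : Spinor :=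
  ∫ y, kern s z (x - y) (f y)

lemma measurable_gK (κ : ℂ) : Measurable (gK κ) := by
  unfold gK; fun_prop

lemma measurable_dgK (κ : ℂ) (k : Fin 3) : Measurable (dgK κ k) := by
  unfold dgK; fun_prop

lemma measurable_kern (s : ℤˣ) (z : ℂ) : Measurable (kern s z) := by
  unfold kern
  have h1 := measurable_gK (((s : ℤ) : ℂ) * z)
  have h2 := measurable_dgK (((s : ℤ) : ℂ) * z)
  fun_prop

lemma norm_units_int (s : ℤˣ) : ‖((s : ℤ) : ℂ)‖ = 1 := by
  rcases Int.units_eq_one_or s with rfl | rfl <;> simp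

lemma norm_exp_I_mul (κ : ℂ) (t : ℝ) :
    ‖Complex.exp (Complex.I * κ * (t : ℂ))‖ = Real.exp (-κ.im * t) := by
  rw [Complex.norm_exp]; congr 1; simp

lemma abs_apply_div_norm_le (r : Space) (k : Fin 3) : |r k / ‖r‖| ≤ 1 := by
  rw [abs_div, abs_norm]
  exact div_le_one_of_le₀ (by simpa using PiLp.norm_apply_le r k) (norm_nonneg r)

lemma norm_gK_le_exp (κ : ℂ) (r : Space) : ‖gK κ r‖ ≤ Real.exp (-κ.im * ‖r‖) * ‖r‖⁻¹ := by
  unfold gK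
  rw [norm_div, norm_exp_I_mul, div_eq_mul_inv]
  simp only [norm_mul, Complex.norm_real, norm_norm, mul_inv, RCLike.norm_ofNat]
  have h1 : ‖Real.pi‖⁻¹ ≤ 1 := by
    rw [Real.norm_of_nonneg Real.pi_pos.le]
    exact inv_le_one_of_one_le₀ (by linarith [Real.pi_gt_three])
  have h2 : (4⁻¹ : ℝ) * ‖Real.pi‖⁻¹ ≤ 1 := by
    have := inv_nonneg.2 (norm_nonneg Real.pi); linarith
  calc Real.exp (-κ.im * ‖r‖) * (4⁻¹ * ‖Real.pi‖⁻¹ * ‖r‖⁻¹)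
      ≤ Real.exp (-κ.im * ‖r‖) * (1 * ‖r‖⁻¹) := by gcongr
    _ = _ := by rw [one_mul]

lemma norm_dgK_le_exp (κ : ℂ) (k : Fin 3) (r : Space) :
    ‖dgK κ k r‖ ≤ Real.exp (-κ.im * ‖r‖) * (‖κ‖ * ‖r‖⁻¹ + (‖r‖⁻¹) ^ 2) := by
  unfold dgK
  rw [norm_mul, norm_div, norm_mul, norm_exp_I_mul, Complex.norm_real, Real.norm_eq_abs]
  have h0 := abs_apply_div_norm_le r k
  have h1 : ‖Complex.I * κ / (‖r‖ : ℂ) - 1 / (‖r‖ : ℂ) ^ 2‖ ≤ ‖κ‖ * ‖r‖⁻¹ + (‖r‖⁻¹) ^ 2 := by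
    refine (norm_sub_le _ _).trans (le_of_eq ?_)
    simp [div_eq_mul_inv]
  have h2 : (1 : ℝ) ≤ ‖(4 * (Real.pi : ℂ))‖ := by
    simp only [norm_mul, RCLike.norm_ofNat, Complex.norm_real]
    rw [Real.norm_of_nonneg Real.pi_pos.le]
    linarith [Real.pi_gt_three]
  have h3 : 0 ≤ ‖κ‖ * ‖r‖⁻¹ + (‖r‖⁻¹) ^ 2 := by positivity
  calc _ ≤ (‖κ‖ * ‖r‖⁻¹ + (‖r‖⁻¹) ^ 2) * Real.exp (-κ.im * ‖r‖) / 1 * 1 := by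
        gcongr
    _ = _ := by ring

/-- A constant in the bound for `kern`. -/
noncomputable def alphaConst : ℝ := 1 + ∑ k, ‖alpha k‖

lemma alphaConst_pos : 0 < alphaConst := by
  unfold alphaConst
  have : 0 ≤ ∑ k, ‖alpha k‖ := Finset.sum_nonneg fun _ _ => norm_nonneg _
  linarith

/-- The exponential factor is kept: it yields integrability when Im(sz) > 0, and it is at most 1 up
to the boundary, which gives the bound of `norm_kern_le`. -/
lemma norm_kern_le_exp (s : ℤˣ) (z : ℂ) (r : Space) :
    ‖kern s z r‖ ≤ Real.exp (-(((s : ℤ) : ℂ) * z).im * ‖r‖) *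
      (alphaConst * (‖z‖ * ‖r‖⁻¹ + (‖r‖⁻¹) ^ 2)) := by
  unfold kern
  set E := Real.exp (-(((s : ℤ) : ℂ) * z).im * ‖r‖)
  set B := ‖z‖ * ‖r‖⁻¹ + (‖r‖⁻¹) ^ 2
  have hz : ‖((s : ℤ) : ℂ) * z‖ = ‖z‖ := by rw [norm_mul, norm_units_int, one_mul]
  have h1 : ‖(z * gK (((s : ℤ) : ℂ) * z) r) • ContinuousLinearMap.id ℂ Spinor‖ ≤ E * B := by
    rw [norm_smul, norm_mul]
    have h := norm_gK_le_exp (((s : ℤ) : ℂ) * z) r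
    have h' : ‖ContinuousLinearMap.id ℂ Spinor‖ ≤ 1 := ContinuousLinearMap.norm_id_le
    calc ‖z‖ * ‖gK (((s : ℤ) : ℂ) * z) r‖ * ‖ContinuousLinearMap.id ℂ Spinor‖
        ≤ ‖z‖ * (E * ‖r‖⁻¹) * 1 := by gcongr
      _ = E * (‖z‖ * ‖r‖⁻¹) := by ring
      _ ≤ E * B := by
        have : 0 ≤ (‖r‖⁻¹) ^ 2 := by positivity
        have : 0 ≤ E := (Real.exp_pos _).le
        gcongr; simp only [B]; linarith
  have h2 : ‖∑ k, (-Complex.I * dgK (((s : ℤ) : ℂ) * z) k r) • alpha k‖ ≤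
      ∑ k, (E * B) * ‖alpha k‖ := by
    refine norm_sum_le_of_le _ fun k _ => ?_
    rw [norm_smul, norm_mul, norm_neg, Complex.norm_I, one_mul]
    have h := norm_dgK_le_exp (((s : ℤ) : ℂ) * z) k r
    rw [hz] at h
    gcongr
  refine (norm_add_le_of_le h1 h2).trans (le_of_eq ?_)
  rw [← Finset.mul_sum]; unfold alphaConst; ring

lemma norm_kern_le {s : ℤˣ} {z : ℂ} (hz : 0 ≤ (((s : ℤ) : ℂ) * z).im) (r : Space) :
    ‖kern s z r‖ ≤ alphaConst * (‖z‖ * ‖r‖⁻¹ + (‖r‖⁻¹) ^ 2) := by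
  refine (norm_kern_le_exp s z r).trans ?_
  have h : Real.exp (-(((s : ℤ) : ℂ) * z).im * ‖r‖) ≤ 1 := by
    rw [Real.exp_le_one_iff]
    have := mul_nonneg hz (norm_nonneg r); linarith
  have := alphaConst_pos
  calc _ ≤ 1 * (alphaConst * (‖z‖ * ‖r‖⁻¹ + (‖r‖⁻¹) ^ 2)) := by gcongr
    _ = _ := one_mul _

lemma exp_neg_mul_le_one {a t : ℝ} (ha : 0 ≤ a) (ht : 0 ≤ t) : Real.exp (-a * t) ≤ 1 := by
  rw [Real.exp_le_one_iff]
  have := mul_nonneg ha ht; linarith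

lemma norm_gK_le {κ : ℂ} (hκ : 0 ≤ κ.im) (r : Space) : ‖gK κ r‖ ≤ ‖r‖⁻¹ :=
  (norm_gK_le_exp κ r).trans
    (mul_le_of_le_one_left (by positivity) (exp_neg_mul_le_one hκ (norm_nonneg r)))

lemma norm_dgK_le {κ : ℂ} (hκ : 0 ≤ κ.im) (k : Fin 3) (r : Space) :
    ‖dgK κ k r‖ ≤ ‖κ‖ * ‖r‖⁻¹ + (‖r‖⁻¹) ^ 2 :=
  (norm_dgK_le_exp κ k r).trans
    (mul_le_of_le_one_left (by positivity) (exp_neg_mul_le_one hκ (norm_nonneg r)))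

lemma integrable_exp_mul_inv_sq {a : ℝ} (ha : 0 < a) :
    Integrable (fun r : Space => Real.exp (-a * ‖r‖) * (‖r‖⁻¹) ^ 2) := by
  refine (integrable_radial_iff (f := fun r => Real.exp (-a * r) * (r⁻¹) ^ 2)).2 ?_
  refine (integrableOn_exp_mul_Ioi (a := -a) (by linarith) 0).congr_fun (fun r hr => ?_)
    measurableSet_Ioi
  have hr : 0 < r := hr
  simp only; field_simp

lemma integrable_exp_mul_inv {a : ℝ} (ha : 0 < a) :
    Integrable (fun r : Space => Real.exp (-a * ‖r‖) * ‖r‖⁻¹) := by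
  refine (integrable_radial_iff (f := fun r => Real.exp (-a * r) * r⁻¹)).2 ?_
  refine IntegrableOn.congr_fun (f := fun r => r ^ (1 : ℝ) * Real.exp (-a * r ^ (1 : ℝ))) ?_
    (fun r hr => ?_) measurableSet_Ioi
  · exact integrableOn_rpow_mul_exp_neg_mul_rpow (by norm_num) one_pos ha
  · have hr : 0 < r := hr
    simp only [Real.rpow_one]; field_simp

lemma integrable_gK {κ : ℂ} (hκ : 0 < κ.im) : Integrable (gK κ) :=
  (integrable_exp_mul_inv hκ).mono' (measurable_gK κ).aestronglyMeasurable
    (Eventually.of_forall (norm_gK_le_exp κ))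

lemma integrable_kern {s : ℤˣ} {z : ℂ} (hz : 0 < (((s : ℤ) : ℂ) * z).im) :
    Integrable (kern s z) := by
  refine Integrable.mono' (((integrable_exp_mul_inv hz).const_mul (alphaConst * ‖z‖)).add
    ((integrable_exp_mul_inv_sq hz).const_mul alphaConst))
    (measurable_kern s z).aestronglyMeasurable (Eventually.of_forall fun r => ?_)
  refine (norm_kern_le_exp s z r).trans (le_of_eq ?_)
  simp only [Pi.add_apply]; ring

lemma locallyIntegrable_inv_norm_sq : LocallyIntegrable (fun r : Space => (‖r‖⁻¹) ^ 2) := by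
  intro x
  exact ⟨Metric.ball 0 (‖x‖ + 1), Metric.isOpen_ball.mem_nhds (by simp),
    integrableOn_inv_norm_sq _⟩

lemma locallyIntegrable_inv_norm : LocallyIntegrable (fun r : Space => ‖r‖⁻¹) := by
  intro x
  refine ⟨Metric.ball 0 (‖x‖ + 1), Metric.isOpen_ball.mem_nhds (by simp), ?_⟩
  refine Integrable.mono' ((integrableOn_inv_norm_sq (‖x‖ + 1)).add
    (integrableOn_const (C := (1 : ℝ)) (by finiteness)))
    (by fun_prop) (Eventually.of_forall fun r => ?_)
  simp only [norm_inv, norm_norm, Pi.add_apply]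
  nlinarith [sq_nonneg (‖r‖⁻¹ - 1), sq_nonneg (‖r‖⁻¹)]

lemma locallyIntegrable_gK {κ : ℂ} (hκ : 0 ≤ κ.im) : LocallyIntegrable (gK κ) :=
  locallyIntegrable_inv_norm.mono (measurable_gK κ).aestronglyMeasurable
    (Eventually.of_forall fun r => by simpa using norm_gK_le hκ r)

lemma locallyIntegrable_dgK {κ : ℂ} (hκ : 0 ≤ κ.im) (k : Fin 3) : LocallyIntegrable (dgK κ k) :=
  ((locallyIntegrable_inv_norm.smul ‖κ‖).add locallyIntegrable_inv_norm_sq).mono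
    (measurable_dgK κ k).aestronglyMeasurable
    (Eventually.of_forall fun r => by
      refine (norm_dgK_le hκ k r).trans (le_of_eq ?_)
      simp only [Pi.add_apply, Pi.smul_apply, smul_eq_mul]
      rw [Real.norm_of_nonneg (by positivity)])

lemma locallyIntegrable_kern {s : ℤˣ} {z : ℂ} (hz : 0 ≤ (((s : ℤ) : ℂ) * z).im) :
    LocallyIntegrable (kern s z) :=
  (((locallyIntegrable_inv_norm.smul ‖z‖).add locallyIntegrable_inv_norm_sq).smul alphaConst).mono
    (measurable_kern s z).aestronglyMeasurable
    (Eventually.of_forall fun r => by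
      refine (norm_kern_le hz r).trans (le_of_eq ?_)
      simp only [Pi.add_apply, Pi.smul_apply, smul_eq_mul]
      have := alphaConst_pos
      rw [Real.norm_of_nonneg (by positivity)])

/-! ### Calculus of test functions. -/

section Test

variable {F : Type*} [NormedAddCommGroup F] [NormedSpace ℝ F]
  {G : Type*} [NormedAddCommGroup G] [NormedSpace ℝ G]

lemma IsTest.continuous {φ : Space → F} (h : IsTest φ) : Continuous φ := h.1.continuous

lemma IsTest.differentiable {φ : Space → F} (h : IsTest φ) : Differentiable ℝ φ :=
  h.1.differentiable (by simp)

lemma IsTest.integrable {φ : Space → F} (h : IsTest φ) : Integrable φ :=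
  h.continuous.integrable_of_hasCompactSupport h.2

lemma IsTest.exists_radius {φ : Space → F} (h : IsTest φ) :
    ∃ R : ℝ, 0 < R ∧ ∀ x, R ≤ ‖x‖ → φ x = 0 := by
  obtain ⟨R, hR, h'⟩ := h.2.isCompact.isBounded.exists_pos_norm_lt
  refine ⟨R, hR, fun x hx => ?_⟩
  by_contra h0
  exact absurd (h' x (subset_tsupport _ h0)) (not_lt.2 hx)

lemma IsTest.memLp {φ : Space → F} (h : IsTest φ) (p : ℝ≥0∞) : MemLp φ p :=
  h.continuous.memLp_of_hasCompactSupport h.2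

lemma IsTest.partialDeriv {φ : Space → F} (h : IsTest φ) (k : Fin 3) :
    IsTest (partialDeriv k φ) := by
  refine ⟨?_, ?_⟩
  · have := h.1.fderiv_right (m := ∞) (by simp)
    exact this.clm_apply contDiff_const
  · exact (h.2.fderiv ℝ).comp_left (g := fun L : Space →L[ℝ] F => L (EuclideanSpace.single k 1))
      (by simp)

lemma IsTest.clm {φ : Space → F} (h : IsTest φ) (L : F →L[ℝ] G) : IsTest (fun x => L (φ x)) :=
  ⟨L.contDiff.comp h.1, h.2.comp_left (map_zero L)⟩

lemma IsTest.add {φ ψ : Space → F} (h : IsTest φ) (h' : IsTest ψ) : IsTest (fun x => φ x + ψ x) :=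
  ⟨h.1.add h'.1, h.2.add h'.2⟩

lemma IsTest.zero : IsTest (fun _ : Space => (0 : F)) :=
  ⟨contDiff_const, HasCompactSupport.zero⟩

lemma IsTest.sum {ι : Type*} (s : Finset ι) {φ : ι → Space → F} (h : ∀ i ∈ s, IsTest (φ i)) :
    IsTest (fun x => ∑ i ∈ s, φ i x) := by
  classical
  induction s using Finset.induction_on with
  | empty => simpa using IsTest.zero
  | insert i s hi ih =>
    simp_rw [Finset.sum_insert hi]
    exact (h i (by simp)).add (ih fun j hj => h j (by simp [hj]))

lemma IsTest.const_smul {𝕜 : Type*} [RCLike 𝕜] [NormedSpace 𝕜 F]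
    {φ : Space → F} (h : IsTest φ) (c : 𝕜) [SMulCommClass ℝ 𝕜 F] : IsTest (fun x => c • φ x) :=
  ⟨h.1.const_smul c, h.2.comp_left (smul_zero c)⟩

lemma IsTest.comp_sub_left {φ : Space → F} (h : IsTest φ) (x : Space) :
    IsTest (fun r => φ (x - r)) :=
  ⟨h.1.comp (contDiff_const.sub contDiff_id), h.2.comp_homeomorph (Homeomorph.subLeft x)⟩

lemma IsTest.comp_add_left {φ : Space → F} (h : IsTest φ) (x : Space) :
    IsTest (fun r => φ (x + r)) :=
  ⟨h.1.comp (contDiff_const.add contDiff_id), h.2.comp_homeomorph (Homeomorph.addLeft x)⟩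

lemma partialDeriv_comp_sub_left {φ : Space → F} (h : Differentiable ℝ φ) (x r : Space) (k : Fin 3) :
    partialDeriv k (fun r => φ (x - r)) r = -partialDeriv k φ (x - r) := by
  unfold partialDeriv
  have h1 : HasFDerivAt (fun r : Space => x - r) (-ContinuousLinearMap.id ℝ Space) r :=
    (hasFDerivAt_id r).const_sub x
  have h2 := ((h (x - r)).hasFDerivAt.comp r h1).fderiv
  change fderiv ℝ (φ ∘ fun r => x - r) r _ = _
  rw [h2]
  simp

lemma partialDeriv_comp_add_left (φ : Space → F) (x r : Space) (k : Fin 3) :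
    partialDeriv k (fun r => φ (x + r)) r = partialDeriv k φ (x + r) := by
  unfold partialDeriv
  rw [fderiv_comp_add_left]

lemma partialDeriv_clm {φ : Space → F} (h : Differentiable ℝ φ) (L : F →L[ℝ] G) (k : Fin 3)
    (x : Space) : partialDeriv k (fun x => L (φ x)) x = L (partialDeriv k φ x) := by
  unfold partialDeriv
  have := (L.hasFDerivAt.comp x (h x).hasFDerivAt).fderiv
  change fderiv ℝ (L ∘ φ) x _ = _
  rw [this]; rfl

lemma partialDeriv_add {φ ψ : Space → F} (h : Differentiable ℝ φ) (h' : Differentiable ℝ ψ)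
    (k : Fin 3) (x : Space) : partialDeriv k (fun x => φ x + ψ x) x =
      partialDeriv k φ x + partialDeriv k ψ x := by
  unfold partialDeriv
  rw [fderiv_fun_add (h x) (h' x)]; rfl

lemma partialDeriv_sum {ι : Type*} (s : Finset ι) {φ : ι → Space → F}
    (h : ∀ i ∈ s, Differentiable ℝ (φ i)) (k : Fin 3) (x : Space) :
    partialDeriv k (fun x => ∑ i ∈ s, φ i x) x = ∑ i ∈ s, partialDeriv k (φ i) x := by
  unfold partialDeriv
  rw [fderiv_fun_sum fun i hi => h i hi x]
  simp

lemma partialDeriv_comm {φ : Space → F} (h : ContDiff ℝ ∞ φ) (j k : Fin 3) (x : Space) :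
    partialDeriv j (partialDeriv k φ) x = partialDeriv k (partialDeriv j φ) x := by
  have hd : DifferentiableAt ℝ (fderiv ℝ φ) x :=
    (h.fderiv_right (m := ∞) (by simp)).differentiable (by simp) x
  have e : ∀ i l : Fin 3, partialDeriv i (partialDeriv l φ) x =
      fderiv ℝ (fderiv ℝ φ) x (EuclideanSpace.single i 1) (EuclideanSpace.single l 1) := by
    intro i l
    unfold partialDeriv
    rw [fderiv_clm_apply hd (differentiableAt_const _)]
    simp
  rw [e, e]
  exact (h.contDiffAt.isSymmSndFDerivAt (by simpa using WithTop.coe_le_coe.2 (le_top : (2 : ℕ∞) ≤ ⊤))).eq _ _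

lemma hasDerivAt_line {φ : Space → F} (h : Differentiable ℝ φ) (x : Space) (k : Fin 3) :
    HasLineDerivAt ℝ φ (partialDeriv k φ x) x (EuclideanSpace.single k 1) :=
  (h x).hasFDerivAt.hasLineDerivAt _

end Test

/-! ### The distributional gradient of the Helmholtz kernel. -/

section IntegrationByParts

lemma integrable_locallyIntegrable_mul_norm {F : Type*} [NormedAddCommGroup F]
    {h : Space → ℝ} (hh : LocallyIntegrable h)
    {φ : Space → F} (hφ : Continuous φ) (hc : HasCompactSupport φ) :
    Integrable (fun r => h r * ‖φ r‖) := by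
  have := hh.integrable_smul_right_of_hasCompactSupport (g := fun r => ‖φ r‖) hφ.norm hc.norm
  simpa [mul_comm] using this

variable {F : Type*} [NormedAddCommGroup F] [NormedSpace ℂ F]

/-- Smooth approximation of `gK`, with `|r|` replaced by `√(|r|² + δ)`. -/
noncomputable def gReg (κ : ℂ) (δ : ℝ) (r : Space) : ℂ :=
  Complex.exp (Complex.I * κ * (√(‖r‖ ^ 2 + δ) : ℂ)) / (4 * (Real.pi : ℂ) * (√(‖r‖ ^ 2 + δ) : ℂ))

/-- The derivative of `gReg κ δ` along the k-th axis: the radius ρ = √(|r|²+δ) has partial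
derivative r_k/ρ. -/
noncomputable def dgReg (κ : ℂ) (δ : ℝ) (k : Fin 3) (r : Space) : ℂ :=
  (Complex.I * κ / (√(‖r‖ ^ 2 + δ) : ℂ) - 1 / (√(‖r‖ ^ 2 + δ) : ℂ) ^ 2) *
    Complex.exp (Complex.I * κ * (√(‖r‖ ^ 2 + δ) : ℂ)) /
    (4 * (Real.pi : ℂ)) * ((r k / √(‖r‖ ^ 2 + δ) : ℝ) : ℂ)

lemma norm_add_smul_single_sq (r : Space) (k : Fin 3) (t : ℝ) :
    ‖r + t • EuclideanSpace.single k (1 : ℝ)‖ ^ 2 = ‖r‖ ^ 2 + 2 * t * r k + t ^ 2 := by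
  rw [norm_add_sq_real, inner_smul_right, norm_smul, EuclideanSpace.inner_single_right]
  simp
  ring

lemma hasLineDerivAt_gReg (κ : ℂ) {δ : ℝ} (hδ : 0 < δ) (k : Fin 3) (r : Space) :
    HasLineDerivAt ℝ (gReg κ δ) (dgReg κ δ k r) r (EuclideanSpace.single k 1) := by
  unfold HasLineDerivAt
  have hpos : 0 < ‖r‖ ^ 2 + δ := by positivity
  set ρ := √(‖r‖ ^ 2 + δ) with hρ
  have hρ0 : 0 < ρ := Real.sqrt_pos.2 hpos
  have h1 : HasDerivAt (fun t : ℝ => √(‖r + t • EuclideanSpace.single k (1 : ℝ)‖ ^ 2 + δ))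
      (r k / ρ) 0 := by
    simp_rw [norm_add_smul_single_sq]
    have h : HasDerivAt (fun t : ℝ => ‖r‖ ^ 2 + 2 * t * r k + t ^ 2 + δ) (2 * r k) 0 := by
      have h2 : HasDerivAt (fun t : ℝ => 2 * t * r k) (2 * r k) 0 := by
        simpa using ((hasDerivAt_id (0 : ℝ)).const_mul 2).mul_const (r k)
      have h3 : HasDerivAt (fun t : ℝ => t ^ 2) 0 0 := by
        simpa using (hasDerivAt_pow 2 (0 : ℝ))
      simpa using ((h2.const_add (‖r‖ ^ 2)).add h3).add_const δ
    have h4 := h.sqrt (by simpa using hpos.ne')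
    convert h4 using 1
    simp [hρ]
    field_simp
  have h2 := h1.ofReal_comp
  have h0 : ((√(‖r + (0 : ℝ) • EuclideanSpace.single k (1 : ℝ)‖ ^ 2 + δ) : ℝ) : ℂ) = (ρ : ℂ) := by
    simp [hρ]
  have hρc : (ρ : ℂ) ≠ 0 := by exact_mod_cast hρ0.ne'
  have hπ : (Real.pi : ℂ) ≠ 0 := by exact_mod_cast Real.pi_ne_zero
  have h3 := ((h2.const_mul (Complex.I * κ)).cexp).div (h2.const_mul (4 * (Real.pi : ℂ)))
    (by rw [h0]; simp [hρc, hπ])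
  simp only [h0] at h3
  refine h3.congr_deriv ?_
  unfold dgReg
  rw [← hρ]
  push_cast
  field_simp

lemma tendsto_gReg (κ : ℂ) {r : Space} (hr : r ≠ 0) :
    Tendsto (fun δ => gReg κ δ r) (𝓝 0) (𝓝 (gK κ r)) := by
  have h1 : 0 < ‖r‖ := norm_pos_iff.2 hr
  have hc : ContinuousAt (fun δ => gReg κ δ r) 0 := by
    unfold gReg
    refine ContinuousAt.div (by fun_prop) (by fun_prop) ?_
    simp [Real.pi_ne_zero, hr]
  have := hc.tendsto
  have e : gReg κ 0 r = gK κ r := by simp [gReg, gK]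
  rwa [e] at this

lemma tendsto_dgReg (κ : ℂ) (k : Fin 3) {r : Space} (hr : r ≠ 0) :
    Tendsto (fun δ => dgReg κ δ k r) (𝓝 0) (𝓝 (dgK κ k r)) := by
  have h1 : 0 < ‖r‖ := norm_pos_iff.2 hr
  have h2 : (√(‖r‖ ^ 2 + 0) : ℂ) ≠ 0 := by simp [hr]
  have h3 : √(‖r‖ ^ 2 + 0) ≠ 0 := by simp [hr]
  have hs : ContinuousAt (fun δ : ℝ => √(‖r‖ ^ 2 + δ)) 0 := by fun_prop
  have hc : ContinuousAt (fun δ => dgReg κ δ k r) 0 := by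
    unfold dgReg
    have hs' : ContinuousAt (fun δ : ℝ => ((√(‖r‖ ^ 2 + δ) : ℝ) : ℂ)) 0 :=
      Complex.continuous_ofReal.continuousAt.comp hs
    refine ContinuousAt.mul ?_ (Complex.continuous_ofReal.continuousAt.comp
      (continuousAt_const.div hs h3))
    refine ContinuousAt.div_const (ContinuousAt.mul ?_ (by fun_prop)) _
    exact (continuousAt_const.div hs' h2).sub (continuousAt_const.div (hs'.pow 2) (pow_ne_zero 2 h2))
  have := hc.tendsto
  have e : dgReg κ 0 k r = dgK κ k r := by simp [dgReg, dgK]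
  rwa [e] at this

lemma norm_le_sqrt {δ : ℝ} (hδ : 0 ≤ δ) (r : Space) : ‖r‖ ≤ √(‖r‖ ^ 2 + δ) :=
  Real.le_sqrt_of_sq_le (by linarith)

lemma one_le_norm_four_pi : (1 : ℝ) ≤ ‖(4 * (Real.pi : ℂ))‖ := by
  simp only [norm_mul, RCLike.norm_ofNat, Complex.norm_real]
  rw [Real.norm_of_nonneg Real.pi_pos.le]
  linarith [Real.pi_gt_three]

lemma norm_gReg_le {κ : ℂ} (hκ : 0 ≤ κ.im) {δ : ℝ} (hδ : 0 ≤ δ) {r : Space} (hr : r ≠ 0) :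
    ‖gReg κ δ r‖ ≤ ‖r‖⁻¹ := by
  have h1 : 0 < ‖r‖ := norm_pos_iff.2 hr
  have hle := norm_le_sqrt hδ r
  unfold gReg
  set ρ := √(‖r‖ ^ 2 + δ)
  have hρ : 0 < ρ := h1.trans_le hle
  rw [norm_div, norm_exp_I_mul, norm_mul, Complex.norm_real, Real.norm_of_nonneg hρ.le]
  have h4 := one_le_norm_four_pi
  calc _ ≤ 1 / (1 * ‖r‖) := by
        gcongr
        exact exp_neg_mul_le_one hκ hρ.le
    _ = _ := by simp

lemma norm_dgReg_le {κ : ℂ} (hκ : 0 ≤ κ.im) {δ : ℝ} (hδ : 0 ≤ δ) (k : Fin 3) {r : Space}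
    (hr : r ≠ 0) : ‖dgReg κ δ k r‖ ≤ ‖κ‖ * ‖r‖⁻¹ + (‖r‖⁻¹) ^ 2 := by
  have h1 : 0 < ‖r‖ := norm_pos_iff.2 hr
  have hle := norm_le_sqrt hδ r
  unfold dgReg
  set ρ := √(‖r‖ ^ 2 + δ)
  have hρ : 0 < ρ := h1.trans_le hle
  rw [norm_mul, norm_div, norm_mul, norm_exp_I_mul, Complex.norm_real, Real.norm_eq_abs]
  have h0 : |r k / ρ| ≤ 1 := by
    rw [abs_div, abs_of_pos hρ]
    exact div_le_one_of_le₀ (le_trans (by simpa using PiLp.norm_apply_le r k) hle) hρ.le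
  have h1 : ‖Complex.I * κ / (ρ : ℂ) - 1 / (ρ : ℂ) ^ 2‖ ≤ ‖κ‖ * ‖r‖⁻¹ + (‖r‖⁻¹) ^ 2 := by
    have h5 : ‖Complex.I * κ / (ρ : ℂ) - 1 / (ρ : ℂ) ^ 2‖ ≤ ‖κ‖ * ρ⁻¹ + (ρ⁻¹) ^ 2 := by
      refine (norm_sub_le _ _).trans (le_of_eq ?_)
      simp [div_eq_mul_inv, abs_of_pos hρ]
    refine h5.trans ?_
    gcongr
  have h4 := one_le_norm_four_pi
  have h6 := exp_neg_mul_le_one hκ hρ.le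
  calc _ ≤ (‖κ‖ * ‖r‖⁻¹ + (‖r‖⁻¹) ^ 2) * 1 / 1 * 1 := by gcongr
    _ = _ := by ring

lemma measurable_gReg (κ : ℂ) (δ : ℝ) : Measurable (gReg κ δ) := by unfold gReg; fun_prop

lemma measurable_dgReg (κ : ℂ) (δ : ℝ) (k : Fin 3) : Measurable (dgReg κ δ k) := by
  unfold dgReg; fun_prop

/-- `dgK κ k` is the distributional partial derivative of the locally integrable function `gK κ`. -/
lemma integral_gK_smul_partialDeriv [CompleteSpace F] {κ : ℂ} (hκ : 0 ≤ κ.im) (k : Fin 3)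
    {φ : Space → F} (hφ : IsTest φ) :
    ∫ r, gK κ r • partialDeriv k φ r = -∫ r, dgK κ k r • φ r := by
  have hφ' := hφ.partialDeriv k
  have b1 : LocallyIntegrable (fun r : Space => ‖κ‖ * ‖r‖⁻¹ + (‖r‖⁻¹) ^ 2) :=
    (locallyIntegrable_inv_norm.smul ‖κ‖).add locallyIntegrable_inv_norm_sq
  have i0 := integrable_locallyIntegrable_mul_norm locallyIntegrable_inv_norm hφ.continuous hφ.2
  have i1 := integrable_locallyIntegrable_mul_norm locallyIntegrable_inv_norm hφ'.continuous hφ'.2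
  have i2 := integrable_locallyIntegrable_mul_norm b1 hφ.continuous hφ.2
  have m1 : ∀ δ, AEStronglyMeasurable (fun r => gReg κ δ r • partialDeriv k φ r) :=
    fun δ => (measurable_gReg κ δ).aestronglyMeasurable.smul
      hφ'.continuous.aestronglyMeasurable
  have m2 : ∀ δ, AEStronglyMeasurable (fun r => dgReg κ δ k r • φ r) :=
    fun δ => (measurable_dgReg κ δ k).aestronglyMeasurable.smul
      hφ.continuous.aestronglyMeasurable
  have d1 : ∀ δ : ℝ, 0 ≤ δ → ∀ᵐ r : Space, ‖gReg κ δ r • partialDeriv k φ r‖ ≤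
      ‖r‖⁻¹ * ‖partialDeriv k φ r‖ := fun δ hδ => by
    filter_upwards [ae_ne_zero] with r hr
    rw [norm_smul]; gcongr; exact norm_gReg_le hκ hδ hr
  have d2 : ∀ δ : ℝ, 0 ≤ δ → ∀ᵐ r : Space, ‖dgReg κ δ k r • φ r‖ ≤
      (‖κ‖ * ‖r‖⁻¹ + (‖r‖⁻¹) ^ 2) * ‖φ r‖ := fun δ hδ => by
    filter_upwards [ae_ne_zero] with r hr
    rw [norm_smul]; gcongr; exact norm_dgReg_le hκ hδ k hr
  -- For δ > 0 there is no singularity, so ordinary integration by parts applies. Since ρ ≥ |r|,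
  -- both integrands are dominated uniformly in δ by locally integrable powers of |r|⁻¹, and the
  -- limit δ → 0 produces no term at the origin.
  have key : ∀ δ : ℝ, 0 < δ →
      ∫ r, gReg κ δ r • partialDeriv k φ r = -∫ r, dgReg κ δ k r • φ r := by
    intro δ hδ
    refine integral_bilinear_hasLineDerivAt_right_eq_neg_left_of_integrable
      (B := ContinuousLinearMap.lsmul ℝ ℂ) (v := EuclideanSpace.single k (1 : ℝ))
      (i2.mono' (m2 δ) (d2 δ hδ.le)) (i1.mono' (m1 δ) (d1 δ hδ.le)) (i0.mono' ?_ ?_)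
      (fun r _ => hasLineDerivAt_gReg κ hδ k r) (fun r _ => hasDerivAt_line hφ.differentiable r k)
    · exact (measurable_gReg κ δ).aestronglyMeasurable.smul hφ.continuous.aestronglyMeasurable
    · filter_upwards [ae_ne_zero] with r hr
      simp only [ContinuousLinearMap.lsmul_apply]
      rw [norm_smul]; gcongr; exact norm_gReg_le hκ hδ.le hr
  have t1 : Tendsto (fun δ => ∫ r, gReg κ δ r • partialDeriv k φ r) (𝓝[>] 0)
      (𝓝 (∫ r, gK κ r • partialDeriv k φ r)) := by
    refine tendsto_integral_filter_of_dominated_convergence _ (Eventually.of_forall m1)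
      (eventually_mem_nhdsWithin.mono fun δ (hδ : 0 < δ) => d1 δ hδ.le) i1 ?_
    filter_upwards [ae_ne_zero] with r hr
    exact ((tendsto_gReg κ hr).mono_left nhdsWithin_le_nhds).smul_const _
  have t2 : Tendsto (fun δ => -∫ r, dgReg κ δ k r • φ r) (𝓝[>] 0)
      (𝓝 (-∫ r, dgK κ k r • φ r)) := by
    refine Tendsto.neg ?_
    refine tendsto_integral_filter_of_dominated_convergence _ (Eventually.of_forall m2)
      (eventually_mem_nhdsWithin.mono fun δ (hδ : 0 < δ) => d2 δ hδ.le) i2 ?_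
    filter_upwards [ae_ne_zero] with r hr
    exact ((tendsto_dgReg κ k hr).mono_left nhdsWithin_le_nhds).smul_const _
  refine tendsto_nhds_unique (t1.congr' ?_) t2
  exact eventually_mem_nhdsWithin.mono fun δ hδ => key δ hδ

end IntegrationByParts

/-! ### Polar coordinates. -/

/-- Surface measure on the unit sphere of `ℝ³`. -/
noncomputable abbrev sphereMeasure : Measure (Metric.sphere (0 : Space) 1) :=
  (volume : Measure Space).toSphere

section Polar

lemma integrable_polar {E : Type*} [NormedAddCommGroup E] {F : Space → E} (hF : Integrable F) :
    Integrable (fun p : Metric.sphere (0 : Space) 1 × Set.Ioi (0 : ℝ) => F (p.2.1 • p.1.1))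
      (sphereMeasure.prod (Measure.volumeIoiPow 2)) := by
  have h := (volume : Measure Space).measurePreserving_homeomorphUnitSphereProd
  rw [show Module.finrank ℝ Space - 1 = 2 by simp] at h
  have h1 : Integrable (fun x : ({0}ᶜ : Set Space) => F x.1)
      (Measure.comap Subtype.val volume) := by
    have := (integrableOn_iff_comap_subtypeVal (μ := (volume : Measure Space)) (f := F)
      (measurableSet_singleton (0 : Space)).compl).1 hF.integrableOn
    exact this
  have h2 := h.integrable_comp_emb (Homeomorph.measurableEmbedding _)
    (g := fun p : Metric.sphere (0 : Space) 1 × Set.Ioi (0 : ℝ) => F (p.2.1 • p.1.1))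
  refine h2.1 (h1.congr (Eventually.of_forall fun x => ?_))
  have := congrArg Subtype.val ((homeomorphUnitSphereProd Space).symm_apply_apply x)
  simp only [homeomorphUnitSphereProd_symm_apply_coe] at this
  exact congrArg F this.symm

variable {E : Type*} [NormedAddCommGroup E] [NormedSpace ℝ E]

lemma integral_polar_prod (F : Space → E) : ∫ x, F x =
    ∫ p : Metric.sphere (0 : Space) 1 × Set.Ioi (0 : ℝ), F (p.2.1 • p.1.1)
      ∂(sphereMeasure.prod (Measure.volumeIoiPow 2)) := by
  have h := (volume : Measure Space).measurePreserving_homeomorphUnitSphereProd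
  rw [show Module.finrank ℝ Space - 1 = 2 by simp] at h
  have h2 := h.integral_comp (Homeomorph.measurableEmbedding _)
    (fun p : Metric.sphere (0 : Space) 1 × Set.Ioi (0 : ℝ) => F (p.2.1 • p.1.1))
  rw [← h2]
  have h3 := integral_subtype_comap (μ := (volume : Measure Space))
    (measurableSet_singleton (0 : Space)).compl F
  rw [restrict_compl_singleton] at h3
  rw [← h3]
  refine integral_congr_ae (Eventually.of_forall fun x => ?_)
  have := congrArg Subtype.val ((homeomorphUnitSphereProd Space).symm_apply_apply x)
  simp only [homeomorphUnitSphereProd_symm_apply_coe] at this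
  exact congrArg F this.symm

lemma integral_volumeIoiPow (G : ℝ → E) :
    ∫ r : Set.Ioi (0 : ℝ), G r ∂(Measure.volumeIoiPow 2) =
      ∫ r in Set.Ioi (0 : ℝ), r ^ 2 • G r := by
  simp only [Measure.volumeIoiPow, ENNReal.ofReal]
  rw [integral_withDensity_eq_integral_smul,
    integral_subtype_comap measurableSet_Ioi fun a => Real.toNNReal (a ^ 2) • G a]
  · refine setIntegral_congr_fun measurableSet_Ioi fun x hx => ?_
    rw [NNReal.smul_def, Real.coe_toNNReal _ (pow_nonneg hx.out.le _)]
  · exact (measurable_subtype_coe.pow_const _).real_toNNReal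

/-- Integration in polar coordinates. -/
lemma integral_polar {F : Space → E} (hF : Integrable F) :
    ∫ x, F x = ∫ t in Set.Ioi (0 : ℝ), t ^ 2 • ∫ u, F (t • u.1) ∂sphereMeasure := by
  rw [integral_polar_prod, integral_prod_symm _ (integrable_polar hF)]
  exact integral_volumeIoiPow fun t => ∫ u, F (t • u.1) ∂sphereMeasure

end Polar

/-! ### The Fourier transform of the unit sphere. -/

section SphereTransform

/-- `ℝ × ℝ²` with its Euclidean norm. -/
abbrev Cyl : Type := WithLp 2 (ℝ × EuclideanSpace ℝ (Fin 2))

/-- Coordinates in which the plane wave with frequency ξ depends only on the first, one-dimensional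
variable. -/
lemma exists_isometry_cyl (ξ : Space) :
    ∃ L : Cyl ≃ₗᵢ[ℝ] Space, ∀ p : Cyl, inner ℝ (L p) ξ = ‖ξ‖ * p.fst := by
  have hd : Module.finrank ℝ Cyl = Module.finrank ℝ Space := by
    have : Module.finrank ℝ Cyl = Module.finrank ℝ (ℝ × EuclideanSpace ℝ (Fin 2)) :=
      (WithLp.linearEquiv 2 ℝ (ℝ × EuclideanSpace ℝ (Fin 2))).finrank_eq
    rw [this]; simp
  let L₀ : Cyl ≃ₗᵢ[ℝ] Space := 
    ((stdOrthonormalBasis ℝ Cyl).reindex (finCongr (hd.trans (by simp)))).repr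
  let v : Cyl := WithLp.toLp 2 (‖ξ‖, 0)
  have hv : ‖v‖ = ‖L₀.symm ξ‖ := by
    rw [L₀.symm.norm_map, WithLp.prod_norm_eq_of_L2]
    simp [v]
  -- The reflection in the hyperplane orthogonal to the difference of two vectors of equal length
  -- exchanges them.
  let ρ := Submodule.reflection (ℝ ∙ (v - L₀.symm ξ))ᗮ
  have hρ : ρ v = L₀.symm ξ := Submodule.reflection_sub hv
  refine ⟨ρ.trans L₀, fun p => ?_⟩
  have h1 : ξ = (ρ.trans L₀) v := by simp [hρ]
  conv_lhs => rw [h1]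
  rw [(ρ.trans L₀).inner_map_map, WithLp.prod_inner_apply]
  simp [v]

/-- Slice the ball orthogonally to ξ: at height a the slice is a disc of radius √(R²-a²), and the
exponential is constant on it. -/
lemma integral_ball_exp_eq_slices {ξ : Space} {R : ℝ} (hR : 0 ≤ R) :
    ∫ x in Metric.ball (0 : Space) R, Complex.exp (Complex.I * ((inner ℝ x ξ : ℝ) : ℂ)) =
      ∫ a in (-R)..R, ((Real.pi * (R ^ 2 - a ^ 2) : ℝ) : ℂ) *
        Complex.exp (Complex.I * ((‖ξ‖ * a : ℝ) : ℂ)) := by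
  obtain ⟨L, hL⟩ := exists_isometry_cyl ξ
  set D : Set (ℝ × EuclideanSpace ℝ (Fin 2)) := {p | p.1 ^ 2 + ‖p.2‖ ^ 2 < R ^ 2} with hD
  have hDm : MeasurableSet D := measurableSet_lt (by fun_prop) (by fun_prop)
  have hsec : ∀ a : ℝ, volume.real (Prod.mk a ⁻¹' D) =
      (Set.Ioc (-R) R).indicator (fun a => Real.pi * (R ^ 2 - a ^ 2)) a := by
    intro a
    have hpre : Prod.mk a ⁻¹' D =
        Metric.ball (0 : EuclideanSpace ℝ (Fin 2)) (√(R ^ 2 - a ^ 2)) := by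
      ext w
      simp only [hD, Set.mem_preimage, Set.mem_ofPred_eq, mem_ball_zero_iff,
        Real.lt_sqrt (norm_nonneg w)]
      constructor <;> intro h <;> linarith
    rw [hpre, measureReal_def, EuclideanSpace.volume_ball_fin_two]
    simp only [ENNReal.toReal_mul, ENNReal.toReal_pow, ENNReal.toReal_ofReal (Real.sqrt_nonneg _),
      ENNReal.toReal_ofReal Real.pi_pos.le]
    by_cases ha : a ∈ Set.Ioc (-R) R
    · rw [Set.indicator_of_mem ha, Real.sq_sqrt, mul_comm]
      nlinarith [ha.1, ha.2]
    · rw [Set.indicator_of_notMem ha, Real.sqrt_eq_zero_of_nonpos]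
      · simp
      · rw [Set.mem_Ioc, not_and_or, not_lt, not_le] at ha
        rcases ha with h | h <;> nlinarith
  have h1 : ∫ x in Metric.ball (0 : Space) R, Complex.exp (Complex.I * ((inner ℝ x ξ : ℝ) : ℂ)) =
      ∫ p : ℝ × EuclideanSpace ℝ (Fin 2),
        D.indicator (fun p => Complex.exp (Complex.I * ((‖ξ‖ * p.1 : ℝ) : ℂ))) p := by
    rw [← integral_indicator measurableSet_ball,
      ← (L.measurePreserving).integral_comp L.toHomeomorph.measurableEmbedding,
      ← (WithLp.volume_preserving_toLp (U := ℝ)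
        (V := EuclideanSpace ℝ (Fin 2))).integral_comp
        (MeasurableEquiv.toLp 2 _).measurableEmbedding]
    refine integral_congr_ae (Eventually.of_forall fun p => ?_)
    have hn : ‖L (WithLp.toLp 2 p)‖ < R ↔ p.1 ^ 2 + ‖p.2‖ ^ 2 < R ^ 2 := by
      rw [L.norm_map, ← sq_lt_sq₀ (norm_nonneg _) hR, WithLp.prod_norm_sq_eq_of_L2]
      simp
    by_cases hp : p ∈ D
    · rw [Set.indicator_of_mem hp]
      beta_reduce
      rw [Set.indicator_of_mem (mem_ball_zero_iff.2 (hn.2 hp)), hL]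
      rfl
    · rw [Set.indicator_of_notMem hp]
      beta_reduce
      rw [Set.indicator_of_notMem fun h => hp (hn.1 (mem_ball_zero_iff.1 h))]
  rw [h1, integral_indicator hDm]
  have hfin : volume D ≠ ⊤ := by
    have : D ⊆ Metric.closedBall (0 : ℝ × EuclideanSpace ℝ (Fin 2)) R := by
      rintro ⟨a, w⟩ h
      have h : a ^ 2 + ‖w‖ ^ 2 < R ^ 2 := h
      rw [mem_closedBall_zero_iff, Prod.norm_def, max_le_iff]
      constructor
      · exact abs_le.2 (abs_le_of_sq_le_sq' (by nlinarith [sq_nonneg ‖w‖]) hR)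
      · exact (abs_le_of_sq_le_sq' (by nlinarith [sq_nonneg a]) hR).2
    exact ((measure_mono this).trans_lt measure_closedBall_lt_top).ne
  have hint : Integrable (D.indicator
      (fun p => Complex.exp (Complex.I * ((‖ξ‖ * p.1 : ℝ) : ℂ)))) (volume.prod volume) := by
    rw [integrable_indicator_iff hDm]
    refine Integrable.mono' (integrableOn_const (C := (1 : ℝ)) hfin) (by fun_prop)
      (Eventually.of_forall fun p => ?_)
    rw [Complex.norm_exp]; simp
  rw [← integral_indicator hDm, Measure.volume_eq_prod, integral_prod _ hint,
    intervalIntegral.integral_of_le (by linarith), ← integral_indicator measurableSet_Ioc]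
  refine integral_congr_ae (Eventually.of_forall fun a => ?_)
  have h2 : ∀ w : EuclideanSpace ℝ (Fin 2), D.indicator
      (fun p => Complex.exp (Complex.I * ((‖ξ‖ * p.1 : ℝ) : ℂ))) (a, w) =
      (Prod.mk a ⁻¹' D).indicator
        (fun _ => Complex.exp (Complex.I * ((‖ξ‖ * a : ℝ) : ℂ))) w := by
    intro w; simp [Set.indicator]
  simp_rw [h2]
  rw [integral_indicator (measurable_prodMk_left hDm), setIntegral_const, hsec]
  by_cases ha : a ∈ Set.Ioc (-R) R <;> simp [ha]

lemma hasDerivAt_exp_I_mul (b a : ℝ) :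
    HasDerivAt (fun a : ℝ => Complex.exp (Complex.I * ((b * a : ℝ) : ℂ)))
      (Complex.I * b * Complex.exp (Complex.I * ((b * a : ℝ) : ℂ))) a := by
  have h1 : HasDerivAt (fun a : ℝ => Complex.I * ((b * a : ℝ) : ℂ)) (Complex.I * b) a := by
    have := (((hasDerivAt_id a).const_mul b).ofReal_comp).const_mul Complex.I
    simpa using this
  simpa [mul_comm] using h1.cexp

lemma integral_slices {b : ℝ} (hb : b ≠ 0) (R : ℝ) :
    ∫ a in (-R)..R, ((Real.pi * (R ^ 2 - a ^ 2) : ℝ) : ℂ) *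
        Complex.exp (Complex.I * ((b * a : ℝ) : ℂ)) =
      ((4 * Real.pi * (Real.sin (b * R) / b ^ 3 - R * Real.cos (b * R) / b ^ 2) : ℝ) : ℂ) := by
  have hbc : (b : ℂ) ≠ 0 := by exact_mod_cast hb
  -- An explicit antiderivative, as produced by integrating the quadratic polynomial by parts
  -- repeatedly.
  set P : ℝ → ℂ := fun a => (Real.pi : ℂ) * (Complex.exp (Complex.I * ((b * a : ℝ) : ℂ)) *
    (-Complex.I * (((R ^ 2 - a ^ 2 : ℝ) : ℂ)) / b - 2 * a / b ^ 2 - 2 * Complex.I / b ^ 3)) with hP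
  have hder : ∀ a : ℝ, HasDerivAt P (((Real.pi * (R ^ 2 - a ^ 2) : ℝ) : ℂ) *
        Complex.exp (Complex.I * ((b * a : ℝ) : ℂ))) a := by
    intro a
    have h1 := hasDerivAt_exp_I_mul b a
    have h2 : HasDerivAt (fun a : ℝ => ((R ^ 2 - a ^ 2 : ℝ) : ℂ)) ((-(2 * a) : ℝ) : ℂ) a := by
      have := ((hasDerivAt_pow 2 a).const_sub (R ^ 2)).ofReal_comp
      simpa using this
    have h3 : HasDerivAt (fun a : ℝ => 2 * (a : ℂ)) 2 a := by
      simpa using (((hasDerivAt_id a).ofReal_comp).const_mul 2)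
    have h4 := (h1.mul ((((h2.const_mul (-Complex.I)).div_const (b : ℂ)).sub
      (h3.div_const ((b : ℂ) ^ 2))).sub_const (2 * Complex.I / (b : ℂ) ^ 3))).const_mul
      (Real.pi : ℂ)
    refine h4.congr_deriv ?_
    simp only [Pi.sub_apply]
    push_cast
    field_simp
    ring_nf
    simp only [Complex.I_sq]
    ring
  rw [intervalIntegral.integral_eq_sub_of_hasDerivAt (fun a _ => hder a)
    (Continuous.intervalIntegrable (by fun_prop) _ _)]
  simp only [hP]
  have e1 : Complex.exp (Complex.I * ((b * R : ℝ) : ℂ)) =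
      Complex.cos ((b * R : ℝ) : ℂ) + Complex.sin ((b * R : ℝ) : ℂ) * Complex.I := by
    rw [mul_comm, Complex.exp_mul_I]
  have e2 : Complex.exp (Complex.I * ((b * -R : ℝ) : ℂ)) =
      Complex.cos ((b * R : ℝ) : ℂ) - Complex.sin ((b * R : ℝ) : ℂ) * Complex.I := by
    rw [mul_comm, Complex.exp_mul_I]; push_cast
    rw [mul_neg, Complex.cos_neg, Complex.sin_neg]; ring
  rw [e1, e2]
  push_cast
  field_simp
  ring_nf
  simp only [Complex.I_sq]
  ring

lemma continuous_sphere_exp (ξ : Space) : Continuous (fun t : ℝ =>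
    ∫ u, Complex.exp (Complex.I * ((t * inner ℝ u.1 ξ : ℝ) : ℂ)) ∂sphereMeasure) := by
  refine continuous_of_dominated (bound := fun _ => 1) (fun t => ?_) (fun t => ?_)
    (integrable_const _) (Eventually.of_forall fun u => by fun_prop)
  · exact Continuous.aestronglyMeasurable (by fun_prop)
  · refine Eventually.of_forall fun u => ?_
    rw [Complex.norm_exp]; simp

/-- The Fourier transform of the surface measure of the unit sphere. -/
lemma integral_sphere_exp {ξ : Space} (hξ : ξ ≠ 0) {t : ℝ} (ht : 0 < t) :
    ∫ u, Complex.exp (Complex.I * ((t * inner ℝ u.1 ξ : ℝ) : ℂ)) ∂sphereMeasure =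
      ((4 * Real.pi * Real.sin (‖ξ‖ * t) / (‖ξ‖ * t) : ℝ) : ℂ) := by
  have hb : ‖ξ‖ ≠ 0 := norm_ne_zero_iff.2 hξ
  set b := ‖ξ‖ with hbdef
  set Φ : ℝ → ℂ := fun t =>
    ∫ u, Complex.exp (Complex.I * ((t * inner ℝ u.1 ξ : ℝ) : ℂ)) ∂sphereMeasure with hΦ
  have hΦc : Continuous Φ := continuous_sphere_exp ξ
  -- The transform of the ball is known from slicing, and in polar coordinates it is the integral of
  -- r²Φ(r) up to R. Differentiating both expressions in R at t recovers Φ(t).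
  have key : ∀ R : ℝ, 0 ≤ R → ∫ r in (0 : ℝ)..R, r ^ 2 • Φ r =
      ((4 * Real.pi * (Real.sin (b * R) / b ^ 3 - R * Real.cos (b * R) / b ^ 2) : ℝ) : ℂ) := by
    intro R hR
    rw [← integral_slices hb, ← integral_ball_exp_eq_slices hR,
      ← integral_indicator measurableSet_ball, integral_polar]
    · rw [intervalIntegral.integral_of_le hR, integral_Ioc_eq_integral_Ioo,
        ← integral_indicator measurableSet_Ioo, ← integral_indicator measurableSet_Ioi]
      refine integral_congr_ae (Eventually.of_forall fun r => ?_)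
      beta_reduce
      by_cases h0 : 0 < r
      · have hmem : ∀ u : Metric.sphere (0 : Space) 1, r • u.1 ∈ Metric.ball (0 : Space) R ↔ r < R := by
          intro u
          rw [mem_ball_zero_iff, norm_smul, Real.norm_of_nonneg h0.le, norm_eq_of_mem_sphere, mul_one]
        by_cases hr : r < R
        · rw [Set.indicator_of_mem (show r ∈ Set.Ioo 0 R from ⟨h0, hr⟩),
            Set.indicator_of_mem (show r ∈ Set.Ioi 0 from h0)]
          congr 1
          refine integral_congr_ae (Eventually.of_forall fun u => ?_)
          beta_reduce
          rw [Set.indicator_of_mem ((hmem u).2 hr), real_inner_smul_left]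
        · rw [Set.indicator_of_notMem (fun h => hr h.2),
            Set.indicator_of_mem (show r ∈ Set.Ioi 0 from h0)]
          have : ∀ u : Metric.sphere (0 : Space) 1, (Metric.ball (0 : Space) R).indicator
              (fun x => Complex.exp (Complex.I * ((inner ℝ x ξ : ℝ) : ℂ))) (r • u.1) = 0 :=
            fun u => Set.indicator_of_notMem (fun h => hr ((hmem u).1 h)) _
          simp [this]
      · rw [Set.indicator_of_notMem (fun h => h0 h.1),
          Set.indicator_of_notMem (show r ∉ Set.Ioi 0 from h0)]
    · rw [integrable_indicator_iff measurableSet_ball]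
      refine Integrable.mono' (integrableOn_const (C := (1 : ℝ)) (by finiteness)) (by fun_prop)
        (Eventually.of_forall fun p => ?_)
      rw [Complex.norm_exp]; simp
  have hd1 : HasDerivAt (fun R => ∫ r in (0 : ℝ)..R, r ^ 2 • Φ r) (t ^ 2 • Φ t) t := by
    have hc : Continuous fun r : ℝ => r ^ 2 • Φ r := by fun_prop
    exact intervalIntegral.integral_hasDerivAt_right (hc.intervalIntegrable _ _)
      hc.aestronglyMeasurable.stronglyMeasurableAtFilter hc.continuousAt
  have hd2 : HasDerivAt (fun R : ℝ =>
      ((4 * Real.pi * (Real.sin (b * R) / b ^ 3 - R * Real.cos (b * R) / b ^ 2) : ℝ) : ℂ))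
      ((4 * Real.pi * (t * Real.sin (b * t) / b) : ℝ) : ℂ) t := by
    have hbt : HasDerivAt (fun R : ℝ => b * R) b t := by
      simpa using (hasDerivAt_id t).const_mul b
    have := (((hbt.sin.div_const (b ^ 3)).sub
      (((hasDerivAt_id t).mul hbt.cos).div_const (b ^ 2))).const_mul (4 * Real.pi)).ofReal_comp
    refine this.congr_deriv ?_
    congr 1
    simp only [id]
    field_simp
    ring
  have hd3 := hd1.congr_of_eventuallyEq (f₁ := fun R : ℝ =>
      ((4 * Real.pi * (Real.sin (b * R) / b ^ 3 - R * Real.cos (b * R) / b ^ 2) : ℝ) : ℂ))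
    (by filter_upwards [lt_mem_nhds ht] with R hR using (key R hR.le).symm)
  have heq := hd3.unique hd2
  have htc : (t : ℂ) ≠ 0 := by exact_mod_cast ht.ne'
  have hbc : (b : ℂ) ≠ 0 := by exact_mod_cast hb
  change Φ t = _
  rw [Complex.real_smul] at heq
  push_cast at heq ⊢
  have h5 : (t : ℂ) ^ 2 * (Φ t * (b * t) - 4 * Real.pi * Complex.sin (b * t)) = 0 := by
    rw [mul_sub, ← mul_assoc, heq]; field_simp; ring
  rw [eq_div_iff (mul_ne_zero hbc htc)]
  exact sub_eq_zero.1 ((mul_eq_zero.1 h5).resolve_left (pow_ne_zero 2 htc))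

end SphereTransform

/-! ### Fourier transforms of derivatives and of the Helmholtz kernel. -/

open scoped FourierTransform

section Fourier

variable {F : Type*} [NormedAddCommGroup F] [NormedSpace ℂ F]

lemma fourierChar_neg_inner (x ξ : Space) :
    ((Real.fourierChar (-inner ℝ x ξ) : Circle) : ℂ) =
      Complex.exp (Complex.I * ((inner ℝ x (-(2 * Real.pi) • ξ) : ℝ) : ℂ)) := by
  rw [Real.fourierChar_apply, inner_smul_right]
  congr 1; push_cast; ring

lemma IsTest.integrable_fourier {φ : Space → F} (h : IsTest φ) : Integrable (𝓕 φ) := by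
  have := (𝓕 (h.2.toSchwartzMap h.1)).integrable (μ := (volume : Measure Space))
  rw [SchwartzMap.fourier_coe] at this
  exact this

lemma fourier_partialDeriv [CompleteSpace F] {φ : Space → F} (h : IsTest φ) (k : Fin 3)
    (ξ : Space) : 𝓕 (partialDeriv k φ) ξ =
      (2 * (Real.pi : ℂ) * Complex.I * (ξ k : ℂ)) • 𝓕 φ ξ := by
  have hi : Integrable (fderiv ℝ φ) :=
    (h.1.continuous_fderiv (by simp)).integrable_of_hasCompactSupport (h.2.fderiv ℝ)
  have h1 := congrFun (Real.fourier_fderiv h.integrable h.differentiable hi) ξ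
  have h2 := congrArg (fun L : Space →L[ℝ] F => L (EuclideanSpace.single k 1)) h1
  simp only [VectorFourier.fourierSMulRight_apply] at h2
  have h3 : 𝓕 (partialDeriv k φ) ξ = (𝓕 (fderiv ℝ φ) ξ) (EuclideanSpace.single k 1) := by
    rw [Real.fourier_eq, Real.fourier_eq, ContinuousLinearMap.integral_apply]
    · rfl
    · exact (Real.fourierIntegral_convergent_iff ξ).2 hi
  rw [h3, h2]
  have h4 : (-innerSL ℝ) ξ (EuclideanSpace.single k (1 : ℝ)) = -(ξ k) := by
    change -(inner ℝ ξ (EuclideanSpace.single k (1 : ℝ))) = _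
    rw [EuclideanSpace.inner_single_right]; simp
  rw [h4, ← Complex.coe_smul, smul_smul]
  congr 1; push_cast; ring

/-- The Laplacian of a smooth function. -/
noncomputable def lap (φ : Space → F) (x : Space) : F := ∑ k, partialDeriv k (partialDeriv k φ) x

lemma IsTest.lap {φ : Space → F} (h : IsTest φ) : IsTest (lap φ) :=
  IsTest.sum _ fun k _ => (h.partialDeriv k).partialDeriv k

lemma fourier_add {f g : Space → F} (hf : Integrable f) (hg : Integrable g) (ξ : Space) :
    𝓕 (fun x => f x + g x) ξ = 𝓕 f ξ + 𝓕 g ξ := by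
  simp only [Real.fourier_eq, smul_add]
  exact integral_add ((Real.fourierIntegral_convergent_iff ξ).2 hf)
    ((Real.fourierIntegral_convergent_iff ξ).2 hg)

lemma fourier_const_smul (c : ℂ) (f : Space → F) (ξ : Space) :
    𝓕 (fun x => c • f x) ξ = c • 𝓕 f ξ := by
  simp only [Real.fourier_eq]
  rw [← integral_smul]
  congr 1; ext x; rw [smul_comm]

lemma fourier_lap [CompleteSpace F] {φ : Space → F} (h : IsTest φ) (ξ : Space) :
    𝓕 (lap φ) ξ = -((4 * Real.pi ^ 2 * ‖ξ‖ ^ 2 : ℝ) : ℂ) • 𝓕 φ ξ := by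
  have e : lap φ = fun x => (partialDeriv 0 (partialDeriv 0 φ) x +
      partialDeriv 1 (partialDeriv 1 φ) x) + partialDeriv 2 (partialDeriv 2 φ) x := by
    ext x; simp [lap, Fin.sum_univ_three]
  have hi : ∀ k, Integrable (partialDeriv k (partialDeriv k φ)) := fun k =>
    ((h.partialDeriv k).partialDeriv k).integrable
  rw [e, fourier_add (f := fun x => partialDeriv 0 (partialDeriv 0 φ) x +
    partialDeriv 1 (partialDeriv 1 φ) x) ((hi 0).add (hi 1)) (hi 2), fourier_add (hi 0) (hi 1)]
  simp only [fourier_partialDeriv (h.partialDeriv _), fourier_partialDeriv h, smul_smul, ← add_smul]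
  congr 1
  rw [EuclideanSpace.norm_sq_eq, Fin.sum_univ_three]
  simp only [Real.norm_eq_abs, sq_abs]
  push_cast
  ring_nf
  simp only [Complex.I_sq]
  ring

end Fourier

/-- `∫₀^∞ e^{iκt} sin(bt)/b dt = 1/(b² - κ²)`. -/
lemma integral_exp_mul_sin {κ : ℂ} (hκ : 0 < κ.im) {b : ℝ} (hb : b ≠ 0) :
    ∫ t in Set.Ioi (0 : ℝ), Complex.exp (Complex.I * κ * t) * ((Real.sin (b * t) / b : ℝ) : ℂ) =
      ((b : ℂ) ^ 2 - κ ^ 2)⁻¹ := by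
  have hbc : (b : ℂ) ≠ 0 := by exact_mod_cast hb
  have hne : ∀ c : ℝ, κ ≠ c := fun c h => by rw [h] at hκ; simp at hκ
  have h1 : κ + b ≠ 0 := fun h => hne (-b) (by push_cast; linear_combination h)
  have h2 : κ - b ≠ 0 := fun h => hne b (by linear_combination h)
  have r1 : (Complex.I * (κ + b)).re < 0 := by simpa using hκ
  have r2 : (Complex.I * (κ - b)).re < 0 := by simpa using hκ
  -- The sine splits into two exponentials with exponents i(κ ± b)t. Both decay because Im κ > 0,
  -- which also keeps κ ± b away from zero.
  have e : ∀ t : ℝ, Complex.exp (Complex.I * κ * t) * ((Real.sin (b * t) / b : ℝ) : ℂ) =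
      (2 * Complex.I * b)⁻¹ * Complex.exp (Complex.I * (κ + b) * t) -
      (2 * Complex.I * b)⁻¹ * Complex.exp (Complex.I * (κ - b) * t) := by
    intro t
    have s1 : Complex.exp (Complex.I * (κ + b) * t) =
        Complex.exp (Complex.I * κ * t) * Complex.exp (((b * t : ℝ) : ℂ) * Complex.I) := by
      rw [← Complex.exp_add]; congr 1; push_cast; ring
    have s2 : Complex.exp (Complex.I * (κ - b) * t) =
        Complex.exp (Complex.I * κ * t) * Complex.exp (((-(b * t) : ℝ) : ℂ) * Complex.I) := by
      rw [← Complex.exp_add]; congr 1; push_cast; ring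
    rw [s1, s2, Complex.exp_mul_I, Complex.exp_mul_I]
    push_cast
    rw [Complex.cos_neg, Complex.sin_neg]
    field_simp
    ring
  simp_rw [e]
  rw [integral_sub, integral_const_mul, integral_const_mul, integral_exp_mul_complex_Ioi r1,
    integral_exp_mul_complex_Ioi r2]
  · simp only [Complex.ofReal_zero, mul_zero, Complex.exp_zero]
    have h3 : (b : ℂ) ^ 2 - κ ^ 2 ≠ 0 := by
      rw [show (b : ℂ) ^ 2 - κ ^ 2 = -((κ + b) * (κ - b)) by ring]
      exact neg_ne_zero.2 (mul_ne_zero h1 h2)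
    field_simp
    ring_nf
    simp only [Complex.I_sq]
    ring
  · exact (integrableOn_exp_mul_complex_Ioi r1 0).const_mul _
  · exact (integrableOn_exp_mul_complex_Ioi r2 0).const_mul _

lemma gK_smul_sphere (κ : ℂ) {t : ℝ} (ht : 0 < t) (u : Metric.sphere (0 : Space) 1) :
    gK κ (t • u.1) = Complex.exp (Complex.I * κ * t) / (4 * (Real.pi : ℂ) * t) := by
  unfold gK
  rw [norm_smul, norm_eq_of_mem_sphere, Real.norm_of_nonneg ht.le, mul_one]

/-- The angular integral is the transform of the sphere. Its factor 4π/t and the Jacobian t² cancel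
the denominator 4πt of the kernel, leaving the one-dimensional integral `integral_exp_mul_sin` with
b = 2π|ξ|. -/
lemma fourier_gK {κ : ℂ} (hκ : 0 < κ.im) {ξ : Space} (hξ : ξ ≠ 0) :
    𝓕 (gK κ) ξ = (((4 * Real.pi ^ 2 * ‖ξ‖ ^ 2 : ℝ) : ℂ) - κ ^ 2)⁻¹ := by
  set η : Space := -(2 * Real.pi) • ξ with hη
  have hπ := Real.pi_pos
  have hη0 : η ≠ 0 := smul_ne_zero (by simp [Real.pi_ne_zero]) hξ
  have hn : ‖η‖ ^ 2 = 4 * Real.pi ^ 2 * ‖ξ‖ ^ 2 := by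
    rw [hη, norm_smul, mul_pow, Real.norm_eq_abs, sq_abs]; ring
  rw [← hn]
  push_cast
  rw [← integral_exp_mul_sin hκ (norm_ne_zero_iff.2 hη0), Real.fourier_eq]
  simp only [Circle.smul_def, fourierChar_neg_inner, smul_eq_mul, ← hη]
  rw [integral_polar]
  · refine setIntegral_congr_fun measurableSet_Ioi fun t ht => ?_
    have ht : 0 < t := ht
    simp only [gK_smul_sphere κ ht, real_inner_smul_left]
    rw [integral_mul_const, integral_sphere_exp hη0 ht]
    have htc : (t : ℂ) ≠ 0 := by exact_mod_cast ht.ne'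
    have hbc : (‖η‖ : ℂ) ≠ 0 := by exact_mod_cast (norm_ne_zero_iff.2 hη0)
    have hπc : (Real.pi : ℂ) ≠ 0 := by exact_mod_cast Real.pi_ne_zero
    rw [Complex.real_smul]
    push_cast
    field_simp
  · refine (integrable_gK hκ).norm.mono' ?_ (Eventually.of_forall fun x => ?_)
    · exact Continuous.aestronglyMeasurable (by fun_prop) |>.mul
        (measurable_gK κ).aestronglyMeasurable
    · rw [norm_mul, Complex.norm_exp]; simp

/-! ### The fundamental solution of the Helmholtz operator. -/

section Fundamental

variable {F : Type*} [NormedAddCommGroup F] [NormedSpace ℂ F] [CompleteSpace F]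

/-- Both sides are continuous and integrable, and their integrable Fourier transforms agree off the
origin. Fourier inversion therefore gives equality at every point, not only almost everywhere. -/
lemma integral_gK_smul_of_im_pos {κ : ℂ} (hκ : 0 < κ.im) {φ : Space → F} (h : IsTest φ)
    (x : Space) :
    ∫ r, gK κ r • (lap φ (x - r) + κ ^ 2 • φ (x - r)) = -φ x := by
  set ψ : Space → F := fun x => lap φ x + κ ^ 2 • φ x with hψ
  have hκφ : IsTest (fun x => κ ^ 2 • φ x) := h.const_smul (κ ^ 2)
  have hψt : IsTest ψ := h.lap.add hκφ
  set H : Space → F := convolution (gK κ) ψ (ContinuousLinearMap.lsmul ℂ ℂ) volume with hH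
  have hHc : Continuous H :=
    hψt.2.continuous_convolution_right _ (locallyIntegrable_gK hκ.le) hψt.continuous
  have hHi : Integrable H := (integrable_gK hκ).integrable_convolution _ hψt.integrable
  have hF : ∀ ξ : Space, ξ ≠ 0 → 𝓕 H ξ = 𝓕 (fun x => (-1 : ℂ) • φ x) ξ := by
    intro ξ hξ
    rw [hH, Real.fourier_smul_convolution_eq (integrable_gK hκ) hψt.integrable, fourier_gK hκ hξ,
      hψ, fourier_add h.lap.integrable hκφ.integrable, fourier_lap h, fourier_const_smul,
      fourier_const_smul, ← add_smul, smul_smul]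
    congr 1
    -- If κ² were real and nonnegative, its vanishing imaginary part would force Re κ = 0, and then
    -- κ² = -(Im κ)² < 0.
    have hne : ((4 * Real.pi ^ 2 * ‖ξ‖ ^ 2 : ℝ) : ℂ) - κ ^ 2 ≠ 0 := by
      intro h0
      have h1 : (κ ^ 2).im = 0 := by
        rw [← sub_eq_zero.1 h0]; exact Complex.ofReal_im _
      have h2 : 0 ≤ (κ ^ 2).re := by
        rw [← sub_eq_zero.1 h0, Complex.ofReal_re]; positivity
      simp only [sq, Complex.mul_im, Complex.mul_re] at h1 h2
      have h3 : κ.re = 0 := by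
        have : 2 * (κ.re * κ.im) = 0 := by linarith
        simpa [hκ.ne'] using this
      rw [h3] at h2
      nlinarith
    rw [inv_mul_eq_iff_eq_mul₀ hne]; ring
  have hm : IsTest (fun x => (-1 : ℂ) • φ x) := h.const_smul (-1 : ℂ)
  have hae : 𝓕 H =ᵐ[volume] 𝓕 (fun x => (-1 : ℂ) • φ x) := ae_ne_zero.mono hF
  have e1 := hHc.fourierInv_fourier_eq hHi (hm.integrable_fourier.congr hae.symm)
  have e2 := hm.continuous.fourierInv_fourier_eq hm.integrable hm.integrable_fourier
  have e3 : H x = -φ x := by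
    have : H x = (-1 : ℂ) • φ x := by
      rw [← congrFun e1 x, ← congrFun e2 x, Real.fourierInv_eq, Real.fourierInv_eq]
      refine integral_congr_ae (hae.mono fun ξ hξ => ?_)
      beta_reduce
      rw [hξ]
    simpa using this
  rw [← e3, hH]
  rfl

/-- `gK κ` is a fundamental solution of `-Δ - κ²`. -/
lemma integral_gK_smul {κ : ℂ} (hκ : 0 ≤ κ.im) {φ : Space → F} (h : IsTest φ) (x : Space) :
    ∫ r, gK κ r • (lap φ (x - r) + κ ^ 2 • φ (x - r)) = -φ x := by
  have hφ := h.comp_sub_left x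
  have hl := h.lap.comp_sub_left x
  have b1 := integrable_locallyIntegrable_mul_norm locallyIntegrable_inv_norm hl.continuous hl.2
  have b2 := integrable_locallyIntegrable_mul_norm locallyIntegrable_inv_norm hφ.continuous hφ.2
  -- Real κ are reached from the open half-plane; |gK| ≤ |r|⁻¹ holds up to the boundary and provides
  -- the dominating function.
  set κε : ℝ → ℂ := fun ε => κ + Complex.I * ε with hκε
  have him : ∀ ε, (κε ε).im = κ.im + ε := fun ε => by simp [hκε]
  have t1 : Tendsto (fun ε => ∫ r, gK (κε ε) r • (lap φ (x - r) + (κε ε) ^ 2 • φ (x - r)))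
      (𝓝[>] 0) (𝓝 (∫ r, gK κ r • (lap φ (x - r) + κ ^ 2 • φ (x - r)))) := by
    refine tendsto_integral_filter_of_dominated_convergence
      (fun r => ‖r‖⁻¹ * ‖lap φ (x - r)‖ + (‖κ‖ + 1) ^ 2 * (‖r‖⁻¹ * ‖φ (x - r)‖))
      (Eventually.of_forall fun ε => ?_) ?_ (b1.add (b2.const_mul _)) ?_
    · exact (measurable_gK _).aestronglyMeasurable.smul
        (hl.continuous.add (hφ.continuous.const_smul _)).aestronglyMeasurable
    · have h1 : ∀ᶠ ε : ℝ in 𝓝[>] 0, ε < 1 := nhdsWithin_le_nhds (gt_mem_nhds one_pos)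
      filter_upwards [eventually_mem_nhdsWithin, h1] with ε hε hε1
      have hε : 0 < ε := hε
      refine Eventually.of_forall fun r => ?_
      have hk : ‖κε ε‖ ≤ ‖κ‖ + 1 := by
        refine (norm_add_le _ _).trans ?_
        simp [abs_of_pos hε, hε1.le]
      rw [norm_smul]
      calc ‖gK (κε ε) r‖ * ‖lap φ (x - r) + (κε ε) ^ 2 • φ (x - r)‖
          ≤ ‖r‖⁻¹ * (‖lap φ (x - r)‖ + (‖κ‖ + 1) ^ 2 * ‖φ (x - r)‖) := by
            gcongr
            · exact norm_gK_le (by rw [him]; linarith) r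
            · refine (norm_add_le _ _).trans ?_
              rw [norm_smul, norm_pow]
              gcongr
        _ = _ := by ring
    · refine Eventually.of_forall fun r => ?_
      have hc : Continuous fun ε : ℝ => gK (κε ε) r • (lap φ (x - r) + (κε ε) ^ 2 • φ (x - r)) := by
        unfold gK; simp only [hκε]; fun_prop
      have := (hc.tendsto 0).mono_left (nhdsWithin_le_nhds (s := Set.Ioi 0))
      simpa [hκε] using this
  have t2 : Tendsto (fun ε => ∫ r, gK (κε ε) r • (lap φ (x - r) + (κε ε) ^ 2 • φ (x - r)))
      (𝓝[>] 0) (𝓝 (-φ x)) := by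
    refine tendsto_const_nhds.congr' ?_
    filter_upwards [eventually_mem_nhdsWithin] with ε hε
    have hε : 0 < ε := hε
    exact (integral_gK_smul_of_im_pos (by rw [him]; linarith) h x).symm
  exact tendsto_nhds_unique t1 t2

end Fundamental

/-! ### L² norms and convolution operators on L². -/

section L2Tools

variable {α : Type*} [MeasurableSpace α] {μ : Measure α}
  {F : Type*} [NormedAddCommGroup F]

lemma eLpNorm_two_sq (f : α → F) (μ : Measure α) :
    eLpNorm f 2 μ ^ 2 = ∫⁻ x, ‖f x‖ₑ ^ 2 ∂μ := by
  have h := eLpNorm_nnreal_pow_eq_lintegral (f := f) (μ := μ) (p := 2) (by norm_num)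
  simpa using h

lemma memLp_two_iff_lintegral {f : α → F} (hf : AEStronglyMeasurable f μ) :
    MemLp f 2 μ ↔ ∫⁻ x, ‖f x‖ₑ ^ 2 ∂μ < ⊤ := by
  rw [← eLpNorm_two_sq]
  simp [MemLp, hf, lt_top_iff_ne_top]

lemma lintegral_enorm_sq_Lp (f : Lp F 2 μ) :
    ∫⁻ x, ‖f x‖ₑ ^ 2 ∂μ = ENNReal.ofReal (‖f‖ ^ 2) := by
  rw [← eLpNorm_two_sq, Lp.norm_def, ENNReal.ofReal_pow ENNReal.toReal_nonneg,
    ENNReal.ofReal_toReal (Lp.eLpNorm_ne_top f)]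

lemma norm_Lp_le_of_lintegral {f : Lp F 2 μ} {C : ℝ} (hC : 0 ≤ C)
    (h : ∫⁻ x, ‖f x‖ₑ ^ 2 ∂μ ≤ ENNReal.ofReal (C ^ 2)) : ‖f‖ ≤ C := by
  rw [lintegral_enorm_sq_Lp] at h
  have := (ENNReal.ofReal_le_ofReal_iff (sq_nonneg C)).1 h
  exact le_of_sq_le_sq this hC

end L2Tools

section Convolution

variable {k : Space → Spinor →L[ℂ] Spinor}

lemma stronglyMeasurable_conv (hk : Measurable k) {f : Space → Spinor}
    (hf : StronglyMeasurable f) : StronglyMeasurable (fun x => ∫ y, k (x - y) (f y)) := by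
  have h : StronglyMeasurable (fun p : Space × Space => k (p.1 - p.2) (f p.2)) := by
    have h1 : StronglyMeasurable (fun p : Space × Space => k (p.1 - p.2)) :=
      (hk.comp (measurable_fst.sub measurable_snd)).stronglyMeasurable
    have h2 : StronglyMeasurable (fun p : Space × Space => f p.2) :=
      hf.comp_measurable measurable_snd
    exact (ContinuousLinearMap.apply ℂ Spinor).flip.continuous₂.comp_stronglyMeasurable
      (h1.prodMk h2)
  exact h.integral_prod_right'

lemma lintegral_enorm_conv_le (x : Space) (f : Space → Spinor) :
    ‖∫ y, k (x - y) (f y)‖ₑ ≤ ∫⁻ y, ‖k (x - y)‖ₑ * ‖f y‖ₑ :=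
  (enorm_integral_le_lintegral_enorm _).trans
    (lintegral_mono fun _ => ContinuousLinearMap.le_opENorm _ _)

lemma lintegral_sq_conv_le (hk : Measurable k) {f : Space → Spinor} (hf : StronglyMeasurable f) :
    ∫⁻ x, (∫⁻ y, ‖k (x - y)‖ₑ * ‖f y‖ₑ) ^ 2 ≤ (∫⁻ r, ‖k r‖ₑ) ^ 2 * ∫⁻ y, ‖f y‖ₑ ^ 2 :=
  lintegral_sq_convolution_le (h := fun r => ‖k r‖ₑ) (g := fun y => ‖f y‖ₑ) hk.enorm
    hf.measurable.enorm

lemma stronglyMeasurable_conv_integrand (hk : Measurable k) {f : Space → Spinor}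
    (hf : StronglyMeasurable f) (x : Space) : StronglyMeasurable (fun y => k (x - y) (f y)) :=
  (ContinuousLinearMap.apply ℂ Spinor).flip.continuous₂.comp_stronglyMeasurable
    ((hk.comp (measurable_const.sub measurable_id)).stronglyMeasurable.prodMk hf)

lemma integrable_conv_of_lintegral (hk : Measurable k) {f : Space → Spinor}
    (hf : StronglyMeasurable f) {x : Space} (h : ∫⁻ y, ‖k (x - y)‖ₑ * ‖f y‖ₑ < ⊤) :
    Integrable (fun y => k (x - y) (f y)) :=
  ⟨(stronglyMeasurable_conv_integrand hk hf x).aestronglyMeasurable,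
    (lintegral_mono fun _ => ContinuousLinearMap.le_opENorm _ _).trans_lt h⟩

lemma ae_integrable_conv (hkm : Measurable k) (hk : Integrable k) {f : Space → Spinor}
    (hf : StronglyMeasurable f) (hf2 : ∫⁻ y, ‖f y‖ₑ ^ 2 < ⊤) :
    ∀ᵐ x, Integrable (fun y => k (x - y) (f y)) := by
  have h := (lintegral_sq_conv_le hkm hf).trans_lt
    (ENNReal.mul_lt_top (ENNReal.pow_lt_top hk.2) hf2)
  have hm : Measurable fun x => ∫⁻ y, ‖k (x - y)‖ₑ * ‖f y‖ₑ := by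
    refine Measurable.lintegral_prod_right' (f := fun p : Space × Space =>
      ‖k (p.1 - p.2)‖ₑ * ‖f p.2‖ₑ) ?_
    exact (hkm.comp (measurable_fst.sub measurable_snd)).enorm.mul
      (hf.measurable.comp measurable_snd).enorm
  filter_upwards [ae_lt_top (hm.pow_const 2) h.ne] with x hx
  refine integrable_conv_of_lintegral hkm hf ?_
  by_contra h0
  rw [not_lt, top_le_iff] at h0
  simp [h0] at hx

lemma memLp_conv (hkm : Measurable k) (hk : Integrable k) (f : L2) :
    MemLp (fun x => ∫ y, k (x - y) (f y)) 2 := by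
  have hf := Lp.stronglyMeasurable f
  rw [memLp_two_iff_lintegral (stronglyMeasurable_conv hkm hf).aestronglyMeasurable]
  refine ((lintegral_mono fun x => ?_).trans (lintegral_sq_conv_le hkm hf)).trans_lt
    (ENNReal.mul_lt_top (ENNReal.pow_lt_top hk.2) ?_)
  · exact pow_le_pow_left' (lintegral_enorm_conv_le x f) 2
  · exact (memLp_two_iff_lintegral hf.aestronglyMeasurable).1 (Lp.memLp f)

/-- Young's inequality bounds the operator by the L¹ norm of the kernel. The integrals converge only
for almost every x, so additivity is verified almost everywhere. -/
lemma exists_convCLM (hkm : Measurable k) (hk : Integrable k) :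
    ∃ R : L2 →L[ℂ] L2, ∀ f : L2, R f =ᵐ[volume] fun x => ∫ y, k (x - y) (f y) := by
  have hfin : ∀ f : L2, ∫⁻ y, ‖f y‖ₑ ^ 2 < ⊤ := fun f =>
    (memLp_two_iff_lintegral (Lp.stronglyMeasurable f).aestronglyMeasurable).1 (Lp.memLp f)
  let R : L2 →ₗ[ℂ] L2 :=
    { toFun := fun f => (memLp_conv hkm hk f).toLp
      map_add' := fun f g => by
        rw [← MemLp.toLp_add]
        apply MemLp.toLp_congr
        filter_upwards [ae_integrable_conv hkm hk (Lp.stronglyMeasurable f) (hfin f),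
          ae_integrable_conv hkm hk (Lp.stronglyMeasurable g) (hfin g)] with x h1 h2
        simp only [Pi.add_apply]
        rw [← integral_add h1 h2]
        have : ∀ᵐ y, k (x - y) ((f + g : L2) y) = k (x - y) (f y) + k (x - y) (g y) := by
          filter_upwards [Lp.coeFn_add f g] with y hy
          rw [hy, Pi.add_apply, map_add]
        exact integral_congr_ae this
      map_smul' := fun c f => by
        rw [RingHom.id_apply, ← MemLp.toLp_const_smul]
        apply MemLp.toLp_congr
        refine Eventually.of_forall fun x => ?_
        simp only [Pi.smul_apply]
        rw [← integral_smul]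
        have : ∀ᵐ y, k (x - y) ((c • f : L2) y) = c • k (x - y) (f y) := by
          filter_upwards [Lp.coeFn_smul c f] with y hy
          rw [hy, Pi.smul_apply, map_smul]
        exact integral_congr_ae this }
  have hb : ∀ f, ‖R f‖ ≤ (∫⁻ r, ‖k r‖ₑ).toReal * ‖f‖ := fun f => by
    refine norm_Lp_le_of_lintegral (by positivity) ?_
    have h1 : ∫⁻ x, ‖R f x‖ₑ ^ 2 = ∫⁻ x, ‖∫ y, k (x - y) (f y)‖ₑ ^ 2 := by
      refine lintegral_congr_ae ?_
      filter_upwards [(memLp_conv hkm hk f).coeFn_toLp] with x hx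
      exact congrArg (fun v => ‖v‖ₑ ^ 2) hx
    rw [h1]
    refine ((lintegral_mono fun x => pow_le_pow_left' (lintegral_enorm_conv_le x f) 2).trans
      (lintegral_sq_conv_le hkm (Lp.stronglyMeasurable f))).trans (le_of_eq ?_)
    rw [lintegral_enorm_sq_Lp, mul_pow, ENNReal.ofReal_mul (by positivity),
      ENNReal.ofReal_pow ENNReal.toReal_nonneg, ENNReal.ofReal_toReal hk.2.ne]
  exact ⟨R.mkContinuous _ hb, fun f => (memLp_conv hkm hk f).coeFn_toLp⟩

end Convolution

/-! ### Algebra of the Dirac matrices. -/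

section Algebra

lemma alpha_apply (k : Fin 3) (v : Spinor) (i : Fin 4) :
    alpha k v i = ∑ j, diracMatrix k i j * v j := by
  simp [alpha, Matrix.mulVec, dotProduct]

lemma alpha_zero_apply (v : Spinor) : alpha 0 v = !₂[v 3, v 2, v 1, v 0] := by
  ext i; fin_cases i <;> simp [alpha_apply, Fin.sum_univ_four, diracMatrix]

lemma alpha_one_apply (v : Spinor) : alpha 1 v =
    !₂[-Complex.I * v 3, Complex.I * v 2, -Complex.I * v 1, Complex.I * v 0] := by
  ext i; fin_cases i <;> simp [alpha_apply, Fin.sum_univ_four, diracMatrix]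

lemma alpha_two_apply (v : Spinor) : alpha 2 v = !₂[v 2, -v 3, v 0, -v 1] := by
  ext i; fin_cases i <;> simp [alpha_apply, Fin.sum_univ_four, diracMatrix]

lemma diracMatrix_conjTranspose (k : Fin 3) : (diracMatrix k).conjTranspose = diracMatrix k := by
  fin_cases k <;> ext a b <;> fin_cases a <;> fin_cases b <;>
    simp [diracMatrix, Matrix.conjTranspose_apply]

/-- The Clifford relations, which are what makes 𝒟² equal to -Δ. -/
lemma alpha_anticomm (j k : Fin 3) (v : Spinor) :
    alpha j (alpha k v) + alpha k (alpha j v) = if j = k then (2 : ℂ) • v else 0 := by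
  fin_cases j <;> fin_cases k <;> ext i <;> fin_cases i <;>
    simp [alpha_zero_apply, alpha_one_apply, alpha_two_apply, ← mul_assoc] <;> ring

lemma inner_alpha_left (k : Fin 3) (v w : Spinor) :
    inner ℂ (alpha k v) w = inner ℂ v (alpha k w) := by
  have h : ContinuousLinearMap.adjoint (alpha k) = alpha k := by
    rw [← ContinuousLinearMap.star_eq_adjoint, alpha, ← map_star, Matrix.star_eq_conjTranspose,
      diracMatrix_conjTranspose]
  conv_rhs => rw [← h]
  rw [ContinuousLinearMap.adjoint_inner_right]

end Algebra

/-! ### Convolution with the kernels on test functions. -/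

section SmoothConvolution

variable {F : Type*} [NormedAddCommGroup F] [NormedSpace ℂ F]

/-- Convolution with the kernel `gK κ`. -/
noncomputable def gConv (κ : ℂ) (ψ : Space → F) (x : Space) : F := ∫ r, gK κ r • ψ (x - r)

lemma gConv_eq_convolution (κ : ℂ) (ψ : Space → F) :
    gConv κ ψ = convolution (gK κ) ψ (ContinuousLinearMap.lsmul ℝ ℂ) volume := rfl

lemma integrable_gK_smul {κ : ℂ} (hκ : 0 ≤ κ.im) {ψ : Space → F} (h : IsTest ψ) (x : Space) :
    Integrable (fun r => gK κ r • ψ (x - r)) :=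
  (locallyIntegrable_gK hκ).integrable_smul_right_of_hasCompactSupport
    (h.comp_sub_left x).continuous (h.comp_sub_left x).2

lemma contDiff_gConv [CompleteSpace F] {κ : ℂ} (hκ : 0 ≤ κ.im) {ψ : Space → F} (h : IsTest ψ) :
    ContDiff ℝ ∞ (gConv κ ψ) := by
  rw [gConv_eq_convolution]
  exact h.2.contDiff_convolution_right _ (locallyIntegrable_gK hκ) h.1

lemma partialDeriv_gConv [CompleteSpace F] {κ : ℂ} (hκ : 0 ≤ κ.im) {ψ : Space → F}
    (h : IsTest ψ) (k : Fin 3) (x : Space) :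
    partialDeriv k (gConv κ ψ) x = gConv κ (partialDeriv k ψ) x := by
  have h1 := h.2.hasFDerivAt_convolution_right (ContinuousLinearMap.lsmul ℝ ℂ)
    (locallyIntegrable_gK hκ) (h.1.of_le (by simp)) x
  unfold partialDeriv
  rw [gConv_eq_convolution, h1.fderiv, convolution_precompR_apply _ (locallyIntegrable_gK hκ)
    (h.2.fderiv ℝ) (h.1.continuous_fderiv (by simp))]
  rfl

lemma gConv_add {κ : ℂ} (hκ : 0 ≤ κ.im) {ψ ψ' : Space → F} (h : IsTest ψ) (h' : IsTest ψ')
    (x : Space) : gConv κ (fun x => ψ x + ψ' x) x = gConv κ ψ x + gConv κ ψ' x := by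
  unfold gConv
  simp only [smul_add]
  exact integral_add (integrable_gK_smul hκ h x) (integrable_gK_smul hκ h' x)

lemma gConv_const_smul (κ c : ℂ) (ψ : Space → F) (x : Space) :
    gConv κ (fun x => c • ψ x) x = c • gConv κ ψ x := by
  unfold gConv
  rw [← integral_smul]
  congr 1; ext r; rw [smul_comm]

lemma gConv_sum {ι : Type*} (s : Finset ι) {κ : ℂ} (hκ : 0 ≤ κ.im) {ψ : ι → Space → F}
    (h : ∀ i ∈ s, IsTest (ψ i)) (x : Space) :
    gConv κ (fun x => ∑ i ∈ s, ψ i x) x = ∑ i ∈ s, gConv κ (ψ i) x := by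
  unfold gConv
  simp only [Finset.smul_sum]
  exact integral_finsetSum s fun i hi => integrable_gK_smul hκ (h i hi) x

lemma gConv_clm [CompleteSpace F] {κ : ℂ} (hκ : 0 ≤ κ.im) {ψ : Space → F} (h : IsTest ψ)
    (L : F →L[ℂ] F) (x : Space) : gConv κ (fun x => L (ψ x)) x = L (gConv κ ψ x) := by
  unfold gConv
  rw [← L.integral_comp_comm (integrable_gK_smul hκ h x)]
  simp

lemma gConv_lap [CompleteSpace F] {κ : ℂ} (hκ : 0 ≤ κ.im) {ψ : Space → F} (h : IsTest ψ)
    (x : Space) : gConv κ (lap ψ) x = -ψ x - κ ^ 2 • gConv κ ψ x := by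
  have h1 := integral_gK_smul hκ h x
  have h2 := gConv_add hκ h.lap (h.const_smul (κ ^ 2)) x
  rw [gConv_const_smul] at h2
  have h3 : gConv κ (fun x => lap ψ x + κ ^ 2 • ψ x) x = -ψ x := h1
  rw [h3] at h2
  rw [h2]; abel

end SmoothConvolution

section Dirac

lemma IsTest.alpha {φ : Space → Spinor} (h : IsTest φ) (k : Fin 3) :
    IsTest (fun x => alpha k (φ x)) :=
  h.clm ((DiracLAP.alpha k).restrictScalars ℝ)

lemma partialDeriv_alpha {φ : Space → Spinor} (h : Differentiable ℝ φ) (j k : Fin 3) (x : Space) :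
    partialDeriv j (fun x => alpha k (φ x)) x = alpha k (partialDeriv j φ x) :=
  partialDeriv_clm h ((DiracLAP.alpha k).restrictScalars ℝ) j x

lemma IsTest.diracSmooth {φ : Space → Spinor} (h : IsTest φ) : IsTest (diracSmooth φ) :=
  (IsTest.sum _ fun k _ => (h.partialDeriv k).alpha k).const_smul (-Complex.I)

lemma contDiff_partialDeriv {F : Type*} [NormedAddCommGroup F] [NormedSpace ℝ F] {φ : Space → F}
    (h : ContDiff ℝ ∞ φ) (k : Fin 3) : ContDiff ℝ ∞ (partialDeriv k φ) :=
  (h.fderiv_right (m := ∞) (by simp)).clm_apply contDiff_const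

/-- Second derivatives commute, so the double sum may be symmetrised in its two indices. Each
product of matrices is then replaced by half an anticommutator, and only the diagonal survives. -/
lemma diracSmooth_diracSmooth {φ : Space → Spinor} (h : ContDiff ℝ ∞ φ) (x : Space) :
    diracSmooth (diracSmooth φ) x = -lap φ x := by
  have hd : ∀ k, Differentiable ℝ (partialDeriv k φ) := fun k =>
    (contDiff_partialDeriv h k).differentiable (by simp)
  have hda : ∀ k, Differentiable ℝ (fun x => alpha k (partialDeriv k φ x)) := fun k =>
    ((alpha k).restrictScalars ℝ).differentiable.comp (hd k)
  have e : ∀ j, partialDeriv j (diracSmooth φ) x =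
      (-Complex.I) • ∑ k, alpha k (partialDeriv j (partialDeriv k φ) x) := by
    intro j
    have h1 : partialDeriv j (diracSmooth φ) x = (-Complex.I) • partialDeriv j
        (fun x => ∑ k, alpha k (partialDeriv k φ x)) x :=
      partialDeriv_clm (L := ((-Complex.I) • ContinuousLinearMap.id ℂ Spinor).restrictScalars ℝ)
        (Differentiable.fun_sum fun k _ => hda k) j x
    rw [h1, partialDeriv_sum _ fun k _ => hda k]
    congr 1
    exact Finset.sum_congr rfl fun k _ => partialDeriv_alpha (hd k) j k x
  have e2 : diracSmooth (diracSmooth φ) x =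
      -∑ j, ∑ k, alpha j (alpha k (partialDeriv j (partialDeriv k φ) x)) := by
    change (-Complex.I) • ∑ j, alpha j (partialDeriv j (diracSmooth φ) x) = _
    simp only [e, map_smul, map_sum, ← Finset.smul_sum, smul_smul]
    simp
  rw [e2]
  congr 1
  set S := ∑ j, ∑ k, alpha j (alpha k (partialDeriv j (partialDeriv k φ) x)) with hS
  have h2 : S + S = lap φ x + lap φ x := by
    have h3 : S = ∑ j, ∑ k, alpha k (alpha j (partialDeriv j (partialDeriv k φ) x)) := by
      rw [hS, Finset.sum_comm]
      refine Finset.sum_congr rfl fun j _ => Finset.sum_congr rfl fun k _ => ?_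
      rw [partialDeriv_comm h]
    conv_lhs => arg 1; rw [h3]
    rw [hS, ← Finset.sum_add_distrib]
    simp only [← Finset.sum_add_distrib]
    have h4 : ∀ j k, alpha k (alpha j (partialDeriv j (partialDeriv k φ) x)) +
        alpha j (alpha k (partialDeriv j (partialDeriv k φ) x)) =
        if k = j then (2 : ℂ) • partialDeriv j (partialDeriv k φ) x else 0 :=
      fun j k => alpha_anticomm k j _
    simp only [h4, Finset.sum_ite_eq', Finset.mem_univ, if_true]
    rw [← Finset.smul_sum, two_smul]
    rfl
  have h5 : (2 : ℂ) • S = (2 : ℂ) • lap φ x := by rw [two_smul, two_smul, h2]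
  exact smul_right_injective _ two_ne_zero h5

lemma kernOp_eq (s : ℤˣ) (z : ℂ) (f : Space → Spinor) (x : Space) :
    kernOp s z f x = ∫ r, kern s z r (f (x - r)) := by
  unfold kernOp
  rw [← integral_sub_left_eq_self _ volume x]
  simp

lemma units_mul_self (s : ℤˣ) : ((s : ℤ) : ℂ) * ((s : ℤ) : ℂ) = 1 := by
  rcases Int.units_eq_one_or s with rfl | rfl <;> simp

lemma units_mul_sq (s : ℤˣ) (z : ℂ) : (((s : ℤ) : ℂ) * z) ^ 2 = z ^ 2 := by
  rw [mul_pow, sq ((s : ℤ) : ℂ), units_mul_self, one_mul]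

/-- On test functions the operator with kernel `kern` is `R₀(z²)(𝒟 + z)`. -/
lemma kernOp_test {s : ℤˣ} {z : ℂ} (hz : 0 ≤ (((s : ℤ) : ℂ) * z).im) {φ : Space → Spinor}
    (h : IsTest φ) (x : Space) :
    kernOp s z φ x = gConv (((s : ℤ) : ℂ) * z) (fun x => diracSmooth φ x + z • φ x) x := by
  set κ := ((s : ℤ) : ℂ) * z with hκ
  have hφ := h.comp_sub_left x
  have i1 : Integrable (fun r => (z * gK κ r) • φ (x - r)) := by
    refine ((integrable_gK_smul hz h x).smul z).congr (Eventually.of_forall fun r => ?_)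
    simp [smul_smul]
  have i2 : ∀ k, Integrable (fun r => (-Complex.I * dgK κ k r) • alpha k (φ (x - r))) := by
    intro k
    refine (((locallyIntegrable_dgK hz k).integrable_smul_right_of_hasCompactSupport
      (hφ.alpha k).continuous (hφ.alpha k).2).smul (-Complex.I)).congr
      (Eventually.of_forall fun r => ?_)
    simp only [Pi.smul_apply, smul_smul]
  -- The derivative moves from the kernel to φ. The sign from integration by parts cancels the one
  -- from differentiating φ(x - r) in r.
  have e1 : ∀ k, ∫ r, (-Complex.I * dgK κ k r) • alpha k (φ (x - r)) =
      (-Complex.I) • gConv κ (fun x => alpha k (partialDeriv k φ x)) x := by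
    intro k
    have h1 := integral_gK_smul_partialDeriv hz k (hφ.alpha k)
    simp_rw [partialDeriv_alpha hφ.differentiable, partialDeriv_comp_sub_left h.differentiable,
      map_neg, smul_neg, integral_neg, neg_inj] at h1
    simp_rw [← smul_smul, integral_smul, ← h1]
    rfl
  rw [kernOp_eq, gConv_add hz h.diracSmooth (h.const_smul z), gConv_const_smul]
  have e2 : gConv κ (diracSmooth φ) x =
      (-Complex.I) • ∑ k, gConv κ (fun x => alpha k (partialDeriv k φ x)) x := by
    rw [← gConv_sum _ hz fun k _ => (h.partialDeriv k).alpha k, ← gConv_const_smul]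
    rfl
  rw [e2, Finset.smul_sum]
  simp_rw [← e1]
  unfold kern
  simp only [add_apply, sum_apply, smul_apply, ContinuousLinearMap.id_apply]
  rw [integral_add i1 (integrable_finsetSum _ fun k _ => i2 k),
    integral_finsetSum _ fun k _ => i2 k, add_comm]
  congr 1
  simp_rw [← smul_smul]
  rw [integral_smul]
  rfl

lemma isTest_dirac_add {φ : Space → Spinor} (h : IsTest φ) (z : ℂ) :
    IsTest (fun x => diracSmooth φ x + z • φ x) := h.diracSmooth.add (h.const_smul z)

lemma contDiff_kernOp {s : ℤˣ} {z : ℂ} (hz : 0 ≤ (((s : ℤ) : ℂ) * z).im) {φ : Space → Spinor}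
    (h : IsTest φ) : ContDiff ℝ ∞ (kernOp s z φ) := by
  rw [show kernOp s z φ = gConv (((s : ℤ) : ℂ) * z) (fun x => diracSmooth φ x + z • φ x) from
    funext fun x => kernOp_test hz h x]
  exact contDiff_gConv hz (isTest_dirac_add h z)

lemma diracSmooth_gConv {κ : ℂ} (hκ : 0 ≤ κ.im) {ψ : Space → Spinor} (h : IsTest ψ) (x : Space) :
    diracSmooth (gConv κ ψ) x = gConv κ (diracSmooth ψ) x := by
  have : gConv κ (diracSmooth ψ) x =
      (-Complex.I) • ∑ k, gConv κ (fun x => alpha k (partialDeriv k ψ x)) x := by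
    rw [← gConv_sum _ hκ fun k _ => (h.partialDeriv k).alpha k, ← gConv_const_smul]
    rfl
  rw [this]
  unfold diracSmooth
  congr 1
  refine Finset.sum_congr rfl fun k _ => ?_
  rw [gConv_clm hκ (h.partialDeriv k), partialDeriv_gConv hκ h]

lemma diracSmooth_add {φ ψ : Space → Spinor} (h : Differentiable ℝ φ) (h' : Differentiable ℝ ψ)
    (x : Space) : diracSmooth (fun x => φ x + ψ x) x = diracSmooth φ x + diracSmooth ψ x := by
  unfold diracSmooth
  simp only [partialDeriv_add h h', map_add, Finset.sum_add_distrib, smul_add]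

lemma diracSmooth_const_smul {φ : Space → Spinor} (h : Differentiable ℝ φ) (c : ℂ) (x : Space) :
    diracSmooth (fun x => c • φ x) x = c • diracSmooth φ x := by
  have : ∀ k, partialDeriv k (fun x => c • φ x) x = c • partialDeriv k φ x := fun k =>
    partialDeriv_clm (L := (c • ContinuousLinearMap.id ℂ Spinor).restrictScalars ℝ) h k x
  unfold diracSmooth
  simp only [this, map_smul, ← Finset.smul_sum]
  rw [smul_comm]

/-- `(𝒟 - z) K φ = φ` for the operator `K` with kernel `kern s z`. -/
lemma diracSmooth_kernOp {s : ℤˣ} {z : ℂ} (hz : 0 ≤ (((s : ℤ) : ℂ) * z).im) {φ : Space → Spinor}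
    (h : IsTest φ) (x : Space) :
    diracSmooth (kernOp s z φ) x = φ x + z • kernOp s z φ x := by
  rw [show kernOp s z φ = gConv (((s : ℤ) : ℂ) * z) (fun x => diracSmooth φ x + z • φ x) from
    funext fun x => kernOp_test hz h x]
  rw [diracSmooth_gConv hz (isTest_dirac_add h z)]
  set κ := ((s : ℤ) : ℂ) * z with hκ
  -- As 𝒟² = -Δ, one has 𝒟(𝒟+z) = (-Δ - z²) + z(𝒟+z), and convolution with the Helmholtz kernel
  -- inverts the first summand because κ² = z².
  have e : diracSmooth (fun x => diracSmooth φ x + z • φ x) =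
      fun x => (-1 : ℂ) • lap φ x + z • diracSmooth φ x := by
    ext1 x
    rw [diracSmooth_add h.diracSmooth.differentiable (h.const_smul z).differentiable,
      diracSmooth_diracSmooth h.1, diracSmooth_const_smul h.differentiable, neg_one_smul]
  rw [e, gConv_add hz (h.lap.const_smul (-1 : ℂ)) (h.diracSmooth.const_smul z), gConv_const_smul,
    gConv_const_smul, gConv_add hz h.diracSmooth (h.const_smul z), gConv_const_smul, gConv_lap hz h,
    hκ, units_mul_sq]
  rw [smul_add, smul_smul, neg_one_smul, sq]
  abel

/-- `K (𝒟 - z) φ = φ` for the operator `K` with kernel `kern s z`. -/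
lemma kernOp_dirac_sub {s : ℤˣ} {z : ℂ} (hz : 0 ≤ (((s : ℤ) : ℂ) * z).im) {φ : Space → Spinor}
    (h : IsTest φ) (x : Space) :
    kernOp s z (fun x => diracSmooth φ x + (-z) • φ x) x = φ x := by
  rw [kernOp_test hz (isTest_dirac_add h (-z))]
  set κ := ((s : ℤ) : ℂ) * z with hκ
  -- This is (𝒟+z)(𝒟-z) = -Δ - z².
  have e : (fun x => diracSmooth (fun x => diracSmooth φ x + (-z) • φ x) x +
      z • (diracSmooth φ x + (-z) • φ x)) =
      fun x => (-1 : ℂ) • lap φ x + (-z ^ 2) • φ x := by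
    ext1 x
    rw [diracSmooth_add h.diracSmooth.differentiable (h.const_smul (-z)).differentiable,
      diracSmooth_diracSmooth h.1, diracSmooth_const_smul h.differentiable, neg_one_smul,
      smul_add, smul_smul, neg_smul, show z * -z = -z ^ 2 by ring]
    abel
  rw [e, gConv_add hz (h.lap.const_smul (-1 : ℂ)) (h.const_smul (-z ^ 2)), gConv_const_smul,
    gConv_const_smul, gConv_lap hz h, hκ, units_mul_sq]
  rw [neg_one_smul, neg_smul]
  abel

end Dirac

/-! ### From a fundamental solution to the L² resolvent. -/

section ResolventKernel

lemma integrable_clm_apply {H : Space → Spinor →L[ℂ] Spinor} (hH : Continuous H)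
    (hc : HasCompactSupport H) (u : L2) : Integrable (fun x => H x (u x)) := by
  have h1 : MemLp (fun x => ‖H x‖) 2 :=
    (hH.norm.memLp_of_hasCompactSupport (p := 2) hc.norm)
  have h2 : MemLp (fun x => ‖u x‖) 2 := (Lp.memLp u).norm
  refine (h1.integrable_mul h2).mono' ?_ (Eventually.of_forall fun x => ?_)
  · exact ((ContinuousLinearMap.apply ℂ Spinor).flip.continuous₂.comp_stronglyMeasurable
      (hH.stronglyMeasurable.prodMk (Lp.stronglyMeasurable u))).aestronglyMeasurable
  · exact (H x).le_opNorm _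

lemma integrable_test_smul {φ : Space → ℂ} (h : IsTest φ) (u : L2) :
    Integrable (fun x => φ x • u x) := by
  have hc : Continuous fun x => φ x • ContinuousLinearMap.id ℂ Spinor :=
    h.continuous.smul continuous_const
  have := integrable_clm_apply hc (h.2.smul_right (f' := fun _ => ContinuousLinearMap.id ℂ Spinor)) u
  simpa using this

lemma integral_test_smul_add_smul {φ : Space → ℂ} (h : IsTest φ) (z : ℂ) (u f : L2) :
    ∫ x, φ x • (f + z • u : L2) x = (∫ x, φ x • f x) + z • ∫ x, φ x • u x := by
  have i2 : Integrable fun x => z • φ x • u x := (integrable_test_smul h u).smul z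
  rw [← integral_smul, ← integral_add (integrable_test_smul h f) i2]
  refine integral_congr_ae ?_
  filter_upwards [Lp.coeFn_add f (z • u), Lp.coeFn_smul z u] with x h1 h2
  rw [h1, Pi.add_apply, h2, Pi.smul_apply, smul_add, smul_comm]

lemma lintegral_enorm_sq_lt_top (u : L2) : ∫⁻ x, ‖u x‖ₑ ^ 2 < ⊤ :=
  (memLp_two_iff_lintegral (Lp.stronglyMeasurable u).aestronglyMeasurable).1 (Lp.memLp u)

lemma lintegral_enorm_sq_lt_top_of_compact {G : Type*} [NormedAddCommGroup G] {H : Space → G}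
    (hH : Continuous H) (hc : HasCompactSupport H) : ∫⁻ x, ‖H x‖ₑ ^ 2 < ⊤ := by
  have h1 : MemLp H 2 := hH.memLp_of_hasCompactSupport hc
  exact (memLp_two_iff_lintegral h1.1).1 h1

lemma lp_eq_zero_of_integral_test {v : L2}
    (h : ∀ φ : Space → ℂ, IsTest φ → ∫ x, φ x • v x = 0) : v = 0 := by
  have hl : LocallyIntegrable v := (Lp.memLp v).locallyIntegrable (by norm_num)
  have := ae_eq_zero_of_integral_contDiff_smul_eq_zero hl fun g hg hg' => by
    have h1 : IsTest (fun x => (g x : ℂ)) :=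
      ⟨Complex.ofRealCLM.contDiff.comp hg, hg'.comp_left (g := fun t : ℝ => (t : ℂ)) rfl⟩
    have h2 := h _ h1
    simpa using h2
  exact (Lp.eq_zero_iff_ae_eq_zero).2 this

/-- An operator whose weak form has the integral kernel `k (x - y)` as a left and right fundamental
solution has a resolvent, given by convolution with `k`. -/
lemma exists_resolvent_of_kernel {A : L2 → L2 → Prop} {z : ℂ} {k : Space → Spinor →L[ℂ] Spinor}
    (hkm : Measurable k) (hk : Integrable k)
    {H : (Space → ℂ) → Space → Spinor →L[ℂ] Spinor}
    (hA : ∀ u f : L2, A u (f + z • u) ↔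
      ∀ φ : Space → ℂ, IsTest φ → ∫ x, H φ x (u x) = ∫ x, φ x • f x)
    (hcont : ∀ φ : Space → ℂ, IsTest φ → Continuous (H φ))
    (hcomp : ∀ φ : Space → ℂ, IsTest φ → HasCompactSupport (H φ))
    (htrans : ∀ φ : Space → ℂ, ∀ r x, H (fun x => φ (r + x)) x = H φ (r + x))
    (hleft : ∀ φ : Space → ℂ, IsTest φ → ∀ x c, ∫ r, k r (H φ (x + r) c) = φ x • c)
    (hright : ∀ φ : Space → ℂ, IsTest φ → ∀ x c, ∫ r, H φ (x + r) (k r c) = φ x • c) :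
    ∃ R : L2 →L[ℂ] L2, IsResolvent A z R ∧
      ∀ f : L2, R f =ᵐ[volume] fun x => ∫ y, k (x - y) (f y) := by
  obtain ⟨R, hR⟩ := exists_convCLM hkm hk
  -- R f solves the equation weakly: exchange the two integrals and apply the right fundamental
  -- solution property to the inner one.
  have hkey : ∀ f : L2, ∀ φ : Space → ℂ, IsTest φ →
      ∫ x, H φ x (R f x) = ∫ x, φ x • f x := by
    intro f φ hφ
    have hf := Lp.stronglyMeasurable f
    have hHs := (hcont φ hφ).stronglyMeasurable
    have e1 : ∫ x, H φ x (R f x) = ∫ x, ∫ y, H φ x (k (x - y) (f y)) := by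
      refine integral_congr_ae ?_
      filter_upwards [hR f, ae_integrable_conv hkm hk hf (lintegral_enorm_sq_lt_top f)] with x hx hx'
      rw [hx, ContinuousLinearMap.integral_comp_comm _ hx']
    have hsm : StronglyMeasurable (fun p : Space × Space => H φ p.1 (k (p.1 - p.2) (f p.2))) := by
      have h1 : StronglyMeasurable (fun p : Space × Space => k (p.1 - p.2) (f p.2)) :=
        (ContinuousLinearMap.apply ℂ Spinor).flip.continuous₂.comp_stronglyMeasurable
          ((hkm.comp (measurable_fst.sub measurable_snd)).stronglyMeasurable.prodMk
            (hf.comp_measurable measurable_snd))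
      exact (ContinuousLinearMap.apply ℂ Spinor).flip.continuous₂.comp_stronglyMeasurable
        ((hHs.comp_measurable measurable_fst).prodMk h1)
    have hint : Integrable (Function.uncurry fun x y => H φ x (k (x - y) (f y)))
        (volume.prod volume) := by
      refine ⟨hsm.aestronglyMeasurable, ?_⟩
      change ∫⁻ p : Space × Space, ‖H φ p.1 (k (p.1 - p.2) (f p.2))‖ₑ ∂(volume.prod volume) < ⊤
      rw [lintegral_prod _ hsm.enorm.aemeasurable]
      have hm : Measurable fun x => ∫⁻ y, ‖k (x - y)‖ₑ * ‖f y‖ₑ :=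
        Measurable.lintegral_prod_right' (f := fun p : Space × Space =>
          ‖k (p.1 - p.2)‖ₑ * ‖f p.2‖ₑ) ((hkm.comp (measurable_fst.sub measurable_snd)).enorm.mul
          (hf.measurable.comp measurable_snd).enorm)
      have h2 : ∫⁻ x, ‖H φ x‖ₑ * ∫⁻ y, ‖k (x - y)‖ₑ * ‖f y‖ₑ < ⊤ := by
        have h3 := (sq_lintegral_mul_le hHs.enorm.aemeasurable hm.aemeasurable).trans_lt
          (ENNReal.mul_lt_top (lintegral_enorm_sq_lt_top_of_compact (hcont φ hφ) (hcomp φ hφ))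
            ((lintegral_sq_conv_le hkm hf).trans_lt
              (ENNReal.mul_lt_top (ENNReal.pow_lt_top hk.2) (lintegral_enorm_sq_lt_top f))))
        by_contra h0
        rw [not_lt, top_le_iff] at h0
        simp [h0] at h3
      refine (lintegral_mono fun x => ?_).trans_lt h2
      rw [← lintegral_const_mul' _ _ enorm_ne_top]
      refine lintegral_mono fun y => ?_
      exact (ContinuousLinearMap.le_opENorm _ _).trans
        (mul_le_mul_right (ContinuousLinearMap.le_opENorm _ _) _)
    rw [e1, integral_integral_swap hint]
    refine integral_congr_ae (Eventually.of_forall fun y => ?_)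
    change ∫ x, H φ x (k (x - y) (f y)) = φ y • f y
    rw [← hright φ hφ y (f y), ← integral_add_left_eq_self _ y]
    simp
  refine ⟨R, fun f u => ⟨fun h => ?_, fun h => ?_⟩, hR⟩
  · subst h
    exact (hA _ _).2 (hkey f)
  · have h1 := (hA _ _).1 h
    suffices h0 : u - R f = 0 from (sub_eq_zero.1 h0).symm
    set v := u - R f with hv
    have hHv : ∀ φ : Space → ℂ, IsTest φ → ∫ x, H φ x (v x) = 0 := by
      intro φ hφ
      have e : ∀ᵐ x, H φ x (v x) = H φ x (u x) - H φ x (R f x) := by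
        filter_upwards [Lp.coeFn_sub u (R f)] with x hx
        rw [hv, hx, Pi.sub_apply, map_sub]
      rw [integral_congr_ae e, integral_sub (integrable_clm_apply (hcont φ hφ) (hcomp φ hφ) u)
        (integrable_clm_apply (hcont φ hφ) (hcomp φ hφ) (R f)), h1 φ hφ, hkey f φ hφ, sub_self]
    refine lp_eq_zero_of_integral_test fun φ hφ => ?_
    have hvm := Lp.stronglyMeasurable v
    have hHs := (hcont φ hφ).stronglyMeasurable
    -- Uniqueness. The difference v solves the homogeneous weak equation. The left fundamental
    -- solution property writes φ as an average over r of translated symbols, and after exchanging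
    -- the integrals each translate pairs to zero with v.
    have e1 : ∫ x, φ x • v x = ∫ x, ∫ r, k r (H φ (x + r) (v x)) := by
      refine integral_congr_ae (Eventually.of_forall fun x => ?_)
      exact (hleft φ hφ x (v x)).symm
    have hsm : StronglyMeasurable (fun p : Space × Space => k p.2 (H φ (p.1 + p.2) (v p.1))) := by
      have h1 : StronglyMeasurable (fun p : Space × Space => H φ (p.1 + p.2) (v p.1)) :=
        (ContinuousLinearMap.apply ℂ Spinor).flip.continuous₂.comp_stronglyMeasurable
          ((hHs.comp_measurable (measurable_fst.add measurable_snd)).prodMk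
            (hvm.comp_measurable measurable_fst))
      exact (ContinuousLinearMap.apply ℂ Spinor).flip.continuous₂.comp_stronglyMeasurable
        ((hkm.comp measurable_snd).stronglyMeasurable.prodMk h1)
    have hint : Integrable (Function.uncurry fun x r => k r (H φ (x + r) (v x)))
        (volume.prod volume) := by
      refine ⟨hsm.aestronglyMeasurable, ?_⟩
      change ∫⁻ p : Space × Space, ‖k p.2 (H φ (p.1 + p.2) (v p.1))‖ₑ ∂(volume.prod volume) < ⊤
      rw [lintegral_prod_symm _ hsm.enorm.aemeasurable]
      have hfin : ∀ r, (∫⁻ x, ‖H φ (x + r)‖ₑ * ‖v x‖ₑ) ^ 2 ≤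
          (∫⁻ x, ‖H φ x‖ₑ ^ 2) * ∫⁻ x, ‖v x‖ₑ ^ 2 := fun r => by
        refine (sq_lintegral_mul_le ?_ hvm.enorm.aemeasurable).trans_eq ?_
        · exact (hHs.comp_measurable (measurable_id.add_const r)).enorm.aemeasurable
        · rw [lintegral_add_right_eq_self (fun x => ‖H φ x‖ₑ ^ 2) r]
      set M := (∫⁻ x, ‖H φ x‖ₑ ^ 2) * ∫⁻ x, ‖v x‖ₑ ^ 2 with hM
      have hMt : M < ⊤ := ENNReal.mul_lt_top
        (lintegral_enorm_sq_lt_top_of_compact (hcont φ hφ) (hcomp φ hφ))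
        (lintegral_enorm_sq_lt_top v)
      -- This replaces a square root: X² ≤ M already forces X ≤ M + 1, and any finite bound uniform
      -- in r suffices.
      have hfin' : ∀ r, ∫⁻ x, ‖H φ (x + r)‖ₑ * ‖v x‖ₑ ≤ M + 1 := fun r => by
        by_contra h0
        rw [not_le] at h0
        have h3 : (M + 1) ^ 2 ≤ M := (pow_le_pow_left' h0.le 2).trans (hfin r)
        have h4 : M + 1 ≤ (M + 1) ^ 2 := by
          rw [sq]; exact le_mul_of_one_le_left' (by simp)
        exact absurd (h4.trans h3) (not_le.2 (ENNReal.lt_add_right hMt.ne one_ne_zero))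
      have h2 : ∫⁻ r, ‖k r‖ₑ * (M + 1) < ⊤ := by
        rw [lintegral_mul_const _ hkm.enorm]
        exact ENNReal.mul_lt_top hk.2 (by simp [hMt])
      refine (lintegral_mono fun r => ?_).trans_lt h2
      refine le_trans ?_ (mul_le_mul_right (hfin' r) _)
      rw [← lintegral_const_mul' _ _ enorm_ne_top]
      refine lintegral_mono fun y => ?_
      exact (ContinuousLinearMap.le_opENorm _ _).trans
        (mul_le_mul_right (ContinuousLinearMap.le_opENorm _ _) _)
    rw [e1, integral_integral_swap hint]
    refine integral_eq_zero_of_ae (Eventually.of_forall fun r => ?_)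
    -- Translation invariance: the homogeneous equation may be tested with every translate of φ.
    have ht : IsTest (fun x => φ (r + x)) := hφ.comp_add_left r
    have h2 := hHv _ ht
    simp only [htrans] at h2
    simp only [add_comm r] at h2
    change ∫ x, k r (H φ (x + r) (v x)) = 0
    have hc : Continuous fun x => H φ (x + r) := (hcont φ hφ).comp (continuous_add_const r)
    have hcs : HasCompactSupport fun x => H φ (x + r) :=
      (hcomp φ hφ).comp_homeomorph (Homeomorph.addRight r)
    rw [ContinuousLinearMap.integral_comp_comm _ (integrable_clm_apply hc hcs v), h2, map_zero]

end ResolventKernel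

/-! ### Adjoint kernels and the Dirac resolvent. -/

section Adjoint

lemma gK_conj (κ : ℂ) (r : Space) :
    (starRingEnd ℂ) (gK κ r) = gK (-(starRingEnd ℂ) κ) (-r) := by
  unfold gK
  simp only [map_div₀, map_mul, Complex.conj_I, Complex.conj_ofReal, norm_neg, ← Complex.exp_conj,
    map_ofNat]
  ring_nf

lemma dgK_conj (κ : ℂ) (k : Fin 3) (r : Space) :
    (starRingEnd ℂ) (dgK κ k r) = -dgK (-(starRingEnd ℂ) κ) k (-r) := by
  unfold dgK
  simp only [map_div₀, map_mul, map_sub, map_pow, map_one, Complex.conj_I, Complex.conj_ofReal,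
    norm_neg, ← Complex.exp_conj, map_ofNat, PiLp.neg_apply, neg_div, Complex.ofReal_neg]
  ring_nf

/-- The adjoint of (𝒟 - z)⁻¹ is the resolvent at the conjugate of z, on whose side of the axis the
decaying exponential carries the opposite sign. It rests on the matrices being Hermitian, and serves
both for the right fundamental solution property and for duality in the local bound. -/
lemma inner_kern_left (s : ℤˣ) (z : ℂ) (r : Space) (a b : Spinor) :
    inner ℂ (kern s z r a) b = inner ℂ a (kern (-s) ((starRingEnd ℂ) z) (-r) b) := by
  have e : -(starRingEnd ℂ) (((s : ℤ) : ℂ) * z) = (((-s : ℤˣ) : ℤ) : ℂ) * (starRingEnd ℂ) z := by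
    simp
  have e1 := gK_conj (((s : ℤ) : ℂ) * z) r
  have e2 := fun k => dgK_conj (((s : ℤ) : ℂ) * z) k r
  rw [e] at e1
  simp only [e] at e2
  have e3 : (starRingEnd ℂ) (z * gK (((s : ℤ) : ℂ) * z) r) =
      (starRingEnd ℂ) z * gK ((((-s : ℤˣ) : ℤ) : ℂ) * (starRingEnd ℂ) z) (-r) := by
    rw [map_mul, e1]
  have e4 : ∀ k, (starRingEnd ℂ) (-Complex.I * dgK (((s : ℤ) : ℂ) * z) k r) =
      -Complex.I * dgK ((((-s : ℤˣ) : ℤ) : ℂ) * (starRingEnd ℂ) z) k (-r) := fun k => by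
    rw [map_mul, e2, map_neg, Complex.conj_I]; ring
  simp only [kern, _root_.add_apply, _root_.sum_apply, _root_.smul_apply,
    ContinuousLinearMap.id_apply, inner_add_left, inner_add_right, sum_inner, inner_sum,
    inner_smul_left, inner_smul_right, inner_alpha_left, e3, e4]

end Adjoint

section DiracResolvent

/-- The formal transpose of `𝒟 - z` applied to a scalar function. -/
noncomputable def diracSymbol (z : ℂ) (φ : Space → ℂ) (x : Space) : Spinor →L[ℂ] Spinor :=
  (∑ k, (Complex.I * partialDeriv k φ x) • alpha k) - (z * φ x) • ContinuousLinearMap.id ℂ Spinor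

lemma diracSymbol_apply (z : ℂ) (φ : Space → ℂ) (x : Space) (c : Spinor) :
    diracSymbol z φ x c =
      Complex.I • (∑ k, partialDeriv k φ x • alpha k c) - z • φ x • c := by
  simp [diracSymbol, Finset.smul_sum, mul_smul]

lemma continuous_diracSymbol (z : ℂ) {φ : Space → ℂ} (h : IsTest φ) :
    Continuous (diracSymbol z φ) := by
  unfold diracSymbol
  have := fun k => (h.partialDeriv k).continuous
  have := h.continuous
  fun_prop

lemma hasCompactSupport_diracSymbol (z : ℂ) {φ : Space → ℂ} (h : IsTest φ) :
    HasCompactSupport (diracSymbol z φ) := by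
  refine HasCompactSupport.intro h.2 fun x hx => ?_
  have h0 : ∀ k, partialDeriv k φ x = 0 := fun k => by
    have : fderiv ℝ φ x = 0 := by
      have := (support_fderiv_subset ℝ (f := φ))
      by_contra h1
      exact hx (this h1)
    simp [partialDeriv, this]
  ext1 c
  rw [diracSymbol_apply]
  simp [h0, image_eq_zero_of_notMem_tsupport hx]

/-- The symbol acts on constant spinors as `𝒟 - z` does on the reflected function. -/
lemma diracSymbol_apply_add (z : ℂ) {φ : Space → ℂ} (h : IsTest φ) (x r : Space) (c : Spinor) :
    diracSymbol z φ (x + r) c =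
      diracSmooth (fun w => φ (x - w) • c) (-r) + (-z) • φ (x - -r) • c := by
  have e : ∀ k, partialDeriv k (fun w => φ (x - w) • c) (-r) = -partialDeriv k φ (x + r) • c := by
    intro k
    have h1 := partialDeriv_clm (h.comp_sub_left x).differentiable
      ((ContinuousLinearMap.id ℝ ℂ).smulRight c) k (-r)
    simp only [ContinuousLinearMap.smulRight_apply, ContinuousLinearMap.id_apply] at h1
    rw [h1, partialDeriv_comp_sub_left h.differentiable, sub_neg_eq_add]
  rw [diracSymbol_apply, diracSmooth]
  simp only [e, map_smul, neg_smul, Finset.sum_neg_distrib, smul_neg, sub_neg_eq_add, map_neg]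
  simp [sub_eq_add_neg]

lemma isTest_smul_const {F : Type*} [NormedAddCommGroup F] [NormedSpace ℂ F] {φ : Space → ℂ}
    (h : IsTest φ) (x : Space) (c : F) : IsTest (fun w => φ (x - w) • c) := by
  have := (h.comp_sub_left x).clm ((ContinuousLinearMap.id ℝ ℂ).smulRight c)
  simpa using this

/-- This is `kernOp_dirac_sub` for the reflected test function w ↦ φ(x - w)c, evaluated at the
origin. -/
lemma integral_kern_diracSymbol {s : ℤˣ} {z : ℂ} (hz : 0 ≤ (((s : ℤ) : ℂ) * z).im) {φ : Space → ℂ}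
    (h : IsTest φ) (x : Space) (c : Spinor) :
    ∫ r, kern s z r (diracSymbol z φ (x + r) c) = φ x • c := by
  have h1 := kernOp_dirac_sub hz (isTest_smul_const h x c) 0
  rw [kernOp_eq] at h1
  simp only [zero_sub, sub_zero] at h1
  rw [← h1]
  simp only [diracSymbol_apply_add z h]

lemma inner_diracSymbol_left (z : ℂ) {φ : Space → ℂ} (h : IsTest φ) (x : Space) (a b : Spinor) :
    inner ℂ (diracSymbol z φ x a) b =
      inner ℂ a (diracSymbol ((starRingEnd ℂ) z) (fun w => (starRingEnd ℂ) (φ (-w))) (-x) b) := by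
  have e : ∀ k, partialDeriv k (fun w => (starRingEnd ℂ) (φ (-w))) (-x) =
      -(starRingEnd ℂ) (partialDeriv k φ x) := by
    intro k
    have h0 := h.comp_sub_left 0
    simp only [zero_sub] at h0
    have h1 := partialDeriv_clm h0.differentiable (Complex.conjCLE : ℂ →L[ℝ] ℂ) k (-x)
    have h2 := partialDeriv_comp_sub_left h.differentiable 0 (-x) k
    simp only [zero_sub, neg_neg] at h2
    simp only [ContinuousLinearEquiv.coe_coe, Complex.conjCLE_apply] at h1
    rw [h1, h2, map_neg]
  simp only [diracSymbol_apply, e, inner_sub_left, inner_sub_right, inner_smul_left,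
    inner_smul_right, sum_inner, inner_sum, inner_alpha_left, Complex.conj_I, neg_neg, neg_mul,
    Finset.sum_neg_distrib, mul_neg]

/-- Follows from the left version by pairing with a fixed spinor: passing to adjoints reverses the
order of symbol and kernel and leads to -s, the conjugate of z and the reflected conjugate of φ. -/
lemma integral_diracSymbol_kern {s : ℤˣ} {z : ℂ} (hz : 0 < (((s : ℤ) : ℂ) * z).im) {φ : Space → ℂ}
    (h : IsTest φ) (x : Space) (c : Spinor) :
    ∫ r, diracSymbol z φ (x + r) (kern s z r c) = φ x • c := by
  set ψ : Space → ℂ := fun w => (starRingEnd ℂ) (φ (-w)) with hψ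
  have hψt : IsTest ψ := by
    have h0 := h.comp_sub_left 0
    simp only [zero_sub] at h0
    exact h0.clm (Complex.conjCLE : ℂ →L[ℝ] ℂ)
  have hz' : 0 < ((((-s : ℤˣ) : ℤ) : ℂ) * (starRingEnd ℂ) z).im := by
    rcases Int.units_eq_one_or s with rfl | rfl <;> simp at hz ⊢ <;> linarith
  have hint : Integrable fun r => diracSymbol z φ (x + r) (kern s z r c) := by
    obtain ⟨C, hC⟩ := (continuous_diracSymbol z h).bounded_above_of_compact_support
      (hasCompactSupport_diracSymbol z h)
    have hk := (integrable_kern hz).norm.const_mul (C * ‖c‖)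
    refine hk.mono' ?_ (Eventually.of_forall fun r => ?_)
    · have m1 : StronglyMeasurable fun r => diracSymbol z φ (x + r) :=
        ((continuous_diracSymbol z h).comp (continuous_const_add x)).stronglyMeasurable
      have m2 : StronglyMeasurable fun r => kern s z r c :=
        (ContinuousLinearMap.apply ℂ Spinor c).continuous.comp_stronglyMeasurable
          (measurable_kern s z).stronglyMeasurable
      exact ((ContinuousLinearMap.apply ℂ Spinor).flip.continuous₂.comp_stronglyMeasurable
        (m1.prodMk m2)).aestronglyMeasurable
    · refine (ContinuousLinearMap.le_opNorm _ _).trans ?_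
      calc _ ≤ C * (‖kern s z r‖ * ‖c‖) :=
            mul_le_mul (hC _) (ContinuousLinearMap.le_opNorm _ _) (norm_nonneg _)
              ((norm_nonneg _).trans (hC 0))
        _ = _ := by ring
  refine ext_inner_right ℂ fun d => ?_
  have h1 := integral_kern_diracSymbol hz'.le hψt (-x) d
  have h2 : inner ℂ (∫ r, diracSymbol z φ (x + r) (kern s z r c)) d =
      ∫ r, inner ℂ (diracSymbol z φ (x + r) (kern s z r c)) d := by
    rw [← inner_conj_symm, ← integral_inner hint, ← integral_conj]
    simp only [inner_conj_symm]
  have hint' : Integrable fun r => kern (-s) ((starRingEnd ℂ) z) r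
      (diracSymbol ((starRingEnd ℂ) z) ψ (-x + r) d) := by
    obtain ⟨C, hC⟩ := (continuous_diracSymbol ((starRingEnd ℂ) z)
      hψt).bounded_above_of_compact_support (hasCompactSupport_diracSymbol _ hψt)
    have hk := (integrable_kern hz').norm.mul_const (C * ‖d‖)
    refine hk.mono' ?_ (Eventually.of_forall fun r => ?_)
    · have m1 : StronglyMeasurable fun r => diracSymbol ((starRingEnd ℂ) z) ψ (-x + r) d :=
        (((continuous_diracSymbol _ hψt).comp (continuous_const_add (-x))).clm_apply
          continuous_const).stronglyMeasurable
      exact ((ContinuousLinearMap.apply ℂ Spinor).flip.continuous₂.comp_stronglyMeasurable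
        ((measurable_kern _ _).stronglyMeasurable.prodMk m1)).aestronglyMeasurable
    · refine (ContinuousLinearMap.le_opNorm _ _).trans
        (mul_le_mul_of_nonneg_left ?_ (norm_nonneg _))
      exact (ContinuousLinearMap.le_opNorm _ _).trans
        (mul_le_mul_of_nonneg_right (hC _) (norm_nonneg _))
  rw [h2, ← integral_neg_eq_self]
  simp only [inner_diracSymbol_left z h, inner_kern_left, neg_neg]
  have h3 : ∀ r : Space, -(x + -r) = -x + r := fun r => by abel
  simp only [h3]
  rw [integral_inner hint', h1, inner_smul_left, inner_smul_right]
  simp [hψ]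

lemma isDirac_add_smul_iff (z : ℂ) (u f : L2) : IsDirac u (f + z • u) ↔
    ∀ φ : Space → ℂ, IsTest φ → ∫ x, diracSymbol z φ x (u x) = ∫ x, φ x • f x := by
  refine forall₂_congr fun φ h => ?_
  have i1 : ∀ k, Integrable fun x => partialDeriv k φ x • alpha k (u x) := fun k => by
    have := (alpha k).integrable_comp (integrable_test_smul (h.partialDeriv k) u)
    simpa only [map_smul] using this
  have e1 : ∫ x, diracSymbol z φ x (u x) =
      Complex.I • (∑ k, ∫ x, partialDeriv k φ x • alpha k (u x)) - z • ∫ x, φ x • u x := by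
    simp only [diracSymbol_apply]
    have i2 : Integrable fun x => z • φ x • u x := (integrable_test_smul h u).smul z
    have i3 : Integrable fun x => Complex.I • ∑ k, partialDeriv k φ x • alpha k (u x) :=
      (integrable_finsetSum Finset.univ fun k _ => i1 k).smul Complex.I
    rw [integral_sub i3 i2, integral_smul, integral_smul,
      integral_finsetSum _ fun k _ => i1 k]
  rw [e1, integral_test_smul_add_smul h, sub_eq_iff_eq_add]

theorem exists_dirac_resolvent {s : ℤˣ} {z : ℂ} (hz : 0 < (((s : ℤ) : ℂ) * z).im) :
    ∃ R : L2 →L[ℂ] L2, IsResolvent IsDirac z R ∧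
      ∀ f : L2, R f =ᵐ[volume] kernOp s z f :=
  exists_resolvent_of_kernel (measurable_kern s z) (integrable_kern hz)
    (H := diracSymbol z) (isDirac_add_smul_iff z) (fun _ h => continuous_diracSymbol z h)
    (fun _ h => hasCompactSupport_diracSymbol z h)
    (fun φ r x => by simp [diracSymbol, partialDeriv_comp_add_left])
    (fun _ h => integral_kern_diracSymbol hz.le h) (fun _ h => integral_diracSymbol_kern hz h)

end DiracResolvent

/-! ### The resolvent of the Laplacian. -/

section FreeResolvent

/-- `-Δ - z` applied to a scalar function, as a multiple of the identity. -/
noncomputable def lapSymbol (z : ℂ) (φ : Space → ℂ) (x : Space) : Spinor →L[ℂ] Spinor :=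
  (-(lap φ x + z * φ x)) • ContinuousLinearMap.id ℂ Spinor

lemma lapSymbol_apply (z : ℂ) (φ : Space → ℂ) (x : Space) (c : Spinor) :
    lapSymbol z φ x c = -(lap φ x • c) - z • φ x • c := by
  simp only [lapSymbol, _root_.smul_apply, ContinuousLinearMap.id_apply, neg_smul, add_smul,
    mul_smul, neg_add_rev]
  abel

lemma lap_comp_add_left (φ : Space → ℂ) (x r : Space) :
    lap (fun r => φ (x + r)) r = lap φ (x + r) := by
  unfold lap
  refine Finset.sum_congr rfl fun k _ => ?_
  have : partialDeriv k (fun r => φ (x + r)) = fun r => partialDeriv k φ (x + r) :=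
    funext fun r => partialDeriv_comp_add_left φ x r k
  rw [this, partialDeriv_comp_add_left]

lemma lap_comp_sub_left {φ : Space → ℂ} (h : IsTest φ) (x r : Space) :
    lap (fun r => φ (x - r)) r = lap φ (x - r) := by
  unfold lap
  refine Finset.sum_congr rfl fun k _ => ?_
  have : partialDeriv k (fun r => φ (x - r)) = fun r => (-1 : ℂ) • partialDeriv k φ (x - r) :=
    funext fun r => by rw [partialDeriv_comp_sub_left h.differentiable, neg_one_smul]
  rw [this]
  have h1 := partialDeriv_clm ((h.partialDeriv k).comp_sub_left x).differentiable
    (((-1 : ℂ) • ContinuousLinearMap.id ℂ ℂ).restrictScalars ℝ) k r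
  simp only [ContinuousLinearMap.coe_restrictScalars', _root_.smul_apply,
    ContinuousLinearMap.id_apply] at h1
  rw [h1, partialDeriv_comp_sub_left (h.partialDeriv k).differentiable]
  simp

lemma integral_gK_lapSymbol {κ : ℂ} (hκ : 0 ≤ κ.im) {φ : Space → ℂ} (h : IsTest φ) (x : Space)
    (c : Spinor) : ∫ r, gK κ r • lapSymbol (κ ^ 2) φ (x + r) c = φ x • c := by
  have h0 : IsTest fun w => φ (x - w) := h.comp_sub_left x
  have h1 := integral_gK_smul hκ h0 0
  simp only [zero_sub, sub_zero, lap_comp_sub_left h, sub_neg_eq_add] at h1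
  have e : ∀ r, gK κ r • lapSymbol (κ ^ 2) φ (x + r) c =
      (-(gK κ r • (lap φ (x + r) + κ ^ 2 • φ (x + r)))) • c := fun r => by
    simp only [lapSymbol, _root_.smul_apply, ContinuousLinearMap.id_apply, smul_smul, smul_eq_mul]
    ring_nf
  simp only [e]
  rw [integral_smul_const, integral_neg, h1, neg_neg]

lemma isNegLaplacian_add_smul_iff (z : ℂ) (u f : L2) : IsNegLaplacian u (f + z • u) ↔
    ∀ φ : Space → ℂ, IsTest φ → ∫ x, lapSymbol z φ x (u x) = ∫ x, φ x • f x := by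
  refine forall₂_congr fun φ h => ?_
  have e1 : ∫ x, lapSymbol z φ x (u x) =
      -(∫ x, (∑ k, partialDeriv k (partialDeriv k φ) x) • u x) - z • ∫ x, φ x • u x := by
    simp only [lapSymbol_apply]
    have i2 : Integrable fun x => z • φ x • u x := (integrable_test_smul h u).smul z
    have i3 : Integrable fun x => -(lap φ x • u x) := (integrable_test_smul h.lap u).neg
    rw [integral_sub i3 i2, integral_smul, integral_neg]
    rfl
  rw [e1, integral_test_smul_add_smul h, sub_eq_iff_eq_add]

theorem exists_free_resolvent {κ : ℂ} (hκ : 0 < κ.im) :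
    ∃ R : L2 →L[ℂ] L2, IsResolvent IsNegLaplacian (κ ^ 2) R ∧
      ∀ f : L2, R f =ᵐ[volume] fun x => ∫ y, gK κ (x - y) • f y := by
  have hc : ∀ φ : Space → ℂ, IsTest φ → IsTest (fun x => -(lap φ x + κ ^ 2 * φ x)) := fun φ h => by
    have := (h.lap.add (h.const_smul (κ ^ 2))).const_smul (-1 : ℂ)
    simpa using this
  have := exists_resolvent_of_kernel (k := fun r => gK κ r • ContinuousLinearMap.id ℂ Spinor)
    (A := IsNegLaplacian) (z := κ ^ 2)
    ((measurable_gK κ).smul_const _) ((integrable_gK hκ).smul_const _)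
    (H := lapSymbol (κ ^ 2)) (isNegLaplacian_add_smul_iff _)
    (fun φ h => (hc φ h).continuous.smul continuous_const)
    (fun φ h => (hc φ h).2.smul_right (f' := fun _ => ContinuousLinearMap.id ℂ Spinor))
    (fun φ r x => by simp [lapSymbol, lap_comp_add_left])
    (fun _ h => by simpa using integral_gK_lapSymbol hκ.le h)
    -- Kernel and symbol are scalar multiples of the identity, so the left and right properties
    -- coincide.
    (fun _ h x c => by
      rw [← integral_gK_lapSymbol hκ.le h]
      simp)
  simpa using this

end FreeResolvent

/-! ### Identification of the resolvents off the real axis. -/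

section Resolvent

lemma IsResolvent.unique {A : L2 → L2 → Prop} {z : ℂ} {R R' : L2 →L[ℂ] L2}
    (h : IsResolvent A z R) (h' : IsResolvent A z R') : R = R' := by
  ext1 f
  exact ((h' f (R f)).2 ((h f (R f)).1 rfl)).symm

lemma IsResolvent.resolvent_eq {A : L2 → L2 → Prop} {z : ℂ} {R : L2 →L[ℂ] L2}
    (h : IsResolvent A z R) : resolvent A z = R := by
  have h0 : ∃ R, IsResolvent A z R := ⟨R, h⟩
  unfold resolvent
  rw [dif_pos h0]
  exact h0.choose_spec.unique h

/-- The sign of a real number, as a unit. -/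
noncomputable def signUnit (t : ℝ) : ℤˣ := if 0 < t then 1 else -1

lemma im_signUnit_mul {z : ℂ} (hz : z.im ≠ 0) : 0 < (((signUnit z.im : ℤ) : ℂ) * z).im := by
  unfold signUnit
  split_ifs with h
  · simpa using h
  · have : z.im < 0 := lt_of_le_of_ne (not_lt.1 h) hz
    simpa using this

theorem isResolvent_diracResolvent {z : ℂ} (hz : z.im ≠ 0) :
    IsResolvent IsDirac z (diracResolvent z) := by
  obtain ⟨R, hR, -⟩ := exists_dirac_resolvent (im_signUnit_mul hz)
  rw [diracResolvent, hR.resolvent_eq]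
  exact hR

theorem diracResolvent_ae_eq {s : ℤˣ} {z : ℂ} (hz : 0 < (((s : ℤ) : ℂ) * z).im) (f : L2) :
    diracResolvent z f =ᵐ[volume] kernOp s z f := by
  obtain ⟨R, hR, hR'⟩ := exists_dirac_resolvent hz
  rw [diracResolvent, hR.resolvent_eq]
  exact hR' f

lemma exists_sq_eq_im_pos {z : ℂ} (hz : z.im ≠ 0) : ∃ κ : ℂ, κ ^ 2 = z ∧ 0 < κ.im := by
  obtain ⟨κ, hκ⟩ := IsAlgClosed.exists_pow_nat_eq z (n := 2) (by norm_num)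
  have h0 : κ.im ≠ 0 := by
    intro h
    apply hz
    rw [← hκ, sq, Complex.mul_im, h]; ring
  rcases lt_or_gt_of_ne h0 with h | h
  · exact ⟨-κ, by rw [neg_sq, hκ], by simpa using h⟩
  · exact ⟨κ, hκ, h⟩

theorem isResolvent_freeResolvent {z : ℂ} (hz : z.im ≠ 0) :
    IsResolvent IsNegLaplacian z (freeResolvent z) := by
  obtain ⟨κ, rfl, hκ⟩ := exists_sq_eq_im_pos hz
  obtain ⟨R, hR, -⟩ := exists_free_resolvent hκ
  rw [freeResolvent, hR.resolvent_eq]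
  exact hR

theorem freeResolvent_ae_eq {κ : ℂ} (hκ : 0 < κ.im) (f : L2) :
    freeResolvent (κ ^ 2) f =ᵐ[volume] fun x => ∫ y, gK κ (x - y) • f y := by
  obtain ⟨R, hR, hR'⟩ := exists_free_resolvent hκ
  rw [freeResolvent, hR.resolvent_eq]
  exact hR' f

end Resolvent

/-! ### Spherical integrals and Plancherel's identity. -/

open scoped FourierTransform

section SphereIntegral

lemma integrable_sphere {E : Type*} [NormedAddCommGroup E]
    {Φ : Metric.sphere (0 : Space) 1 → E} (h : Continuous Φ) :
    Integrable Φ sphereMeasure :=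
  h.integrable_of_hasCompactSupport (HasCompactSupport.of_compactSpace _)

variable {E : Type*} [NormedAddCommGroup E] [NormedSpace ℝ E]

lemma continuous_sphere_integral {X : Type*} [TopologicalSpace X] [FirstCountableTopology X]
    [LocallyCompactSpace X] {Φ : X → Metric.sphere (0 : Space) 1 → E}
    (h : Continuous (Function.uncurry Φ)) : Continuous fun p => ∫ u, Φ p u ∂sphereMeasure := by
  have := continuous_parametric_integral_of_continuous (μ := sphereMeasure) h
    (isCompact_univ : IsCompact (Set.univ : Set (Metric.sphere (0 : Space) 1)))
  simpa using this

lemma hasDerivAt_sphere_integral {F : Space → E} (hF : ContDiff ℝ 1 F) (t : ℝ) :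
    HasDerivAt (fun t : ℝ => ∫ u, F (t • u.1) ∂sphereMeasure)
      (∫ u, fderiv ℝ F (t • u.1) u.1 ∂sphereMeasure) t := by
  have hd := hF.continuous_fderiv one_ne_zero
  obtain ⟨C, hC⟩ := (isCompact_closedBall (0 : Space) (|t| + 1)).exists_bound_of_continuousOn
    hd.continuousOn
  have hs : ∀ u : Metric.sphere (0 : Space) 1, ‖u.1‖ = 1 := fun u => norm_eq_of_mem_sphere u
  refine (hasDerivAt_integral_of_dominated_loc_of_deriv_le (bound := fun _ => C)
    (F' := fun (t : ℝ) (u : Metric.sphere (0 : Space) 1) => fderiv ℝ F (t • u.1) u.1)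
    (Metric.ball_mem_nhds t one_pos) (Eventually.of_forall fun t => ?_) ?_ ?_ ?_
    (integrable_const _) ?_).2
  · have : Continuous fun u : Metric.sphere (0 : Space) 1 => F (t • u.1) :=
      hF.continuous.comp (by fun_prop)
    exact this.aestronglyMeasurable
  · exact integrable_sphere (hF.continuous.comp (by fun_prop))
  · have : Continuous fun u : Metric.sphere (0 : Space) 1 => fderiv ℝ F (t • u.1) u.1 :=
      (hd.comp (by fun_prop)).clm_apply continuous_subtype_val
    exact this.aestronglyMeasurable
  · refine Eventually.of_forall fun u r hr => ?_
    refine ((fderiv ℝ F (r • u.1)).le_opNorm _).trans ?_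
    rw [hs, mul_one]
    refine hC _ ?_
    rw [mem_closedBall_zero_iff, norm_smul, hs, mul_one, Real.norm_eq_abs]
    rw [Metric.mem_ball, Real.dist_eq] at hr
    have := abs_add_le (r - t) t
    rw [sub_add_cancel] at this
    linarith
  · refine Eventually.of_forall fun u r _ => ?_
    have h1 : HasDerivAt (fun r : ℝ => r • u.1) u.1 r := by
      simpa using (hasDerivAt_id r).smul_const u.1
    exact ((hF.differentiable one_ne_zero _).hasFDerivAt).comp_hasDerivAt r h1

end SphereIntegral

section Plancherel

lemma lintegral_enorm_sq_eq_ofReal {E : Type*} [NormedAddCommGroup E] {g : Space → E} (h : Integrable fun x => ‖g x‖ ^ 2) :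
    ∫⁻ x, ‖g x‖ₑ ^ 2 = ENNReal.ofReal (∫ x, ‖g x‖ ^ 2) := by
  rw [ofReal_integral_eq_lintegral_ofReal h (Eventually.of_forall fun _ => by positivity)]
  refine lintegral_congr fun x => ?_
  rw [ENNReal.ofReal_pow (norm_nonneg _), ofReal_norm]

lemma integrable_norm_sq_of_compact {E : Type*} [NormedAddCommGroup E] {g : Space → E} (hc : Continuous g)
    (hs : HasCompactSupport g) : Integrable fun x => ‖g x‖ ^ 2 :=
  (by fun_prop : Continuous fun x => ‖g x‖ ^ 2).integrable_of_hasCompactSupport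
    (hs.comp_left (g := fun v => ‖v‖ ^ 2) (by simp))

variable {E : Type*} [NormedAddCommGroup E] [InnerProductSpace ℂ E] [CompleteSpace E]

/-- Move one Fourier transform across the sesquilinear pairing: it becomes the inverse transform,
which undoes the other one. -/
lemma integral_norm_sq_fourier_of_integrable {h : Space → E} (hc : Continuous h)
    (hi : Integrable h) (hf : Integrable (𝓕 h)) : ∫ ξ, ‖𝓕 h ξ‖ ^ 2 = ∫ x, ‖h x‖ ^ 2 := by
  have h1 := VectorFourier.integral_sesq_fourierIntegral_eq_neg_flip (innerSL ℂ (E := E))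
    (L := innerₗ Space) Real.continuous_fourierChar continuous_inner hi hf
  have e := hc.fourierInv_fourier_eq hi hf
  have h2 : ∀ x, VectorFourier.fourierIntegral Real.fourierChar volume (-(innerₗ Space).flip)
      (𝓕 h) x = h x := fun x => by
    conv_rhs => rw [← e]
    rw [Real.fourierInv_eq]
    simp [VectorFourier.fourierIntegral, real_inner_comm]
  simp only [h2] at h1
  have h3 : ∀ ξ, VectorFourier.fourierIntegral Real.fourierChar volume (innerₗ Space) h ξ = 𝓕 h ξ :=
    fun ξ => rfl
  simp only [h3, innerSL_apply_apply, inner_self_eq_norm_sq_to_K] at h1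
  have h4 : ((∫ ξ, ‖𝓕 h ξ‖ ^ 2 : ℝ) : ℂ) = ((∫ x, ‖h x‖ ^ 2 : ℝ) : ℂ) := by
    rw [← integral_complex_ofReal, ← integral_complex_ofReal]
    simpa using h1
  exact_mod_cast h4

/-- Comparison of `L²` norms through a pointwise comparison of Fourier transforms. -/
lemma lintegral_enorm_sq_le_of_fourier {h f : Space → E} (hc : Continuous h)
    (hs : HasCompactSupport h) (hf : IsTest f) {C : ℝ}
    (hle : ∀ᵐ ξ, ‖𝓕 h ξ‖ ≤ C * ‖𝓕 f ξ‖) :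
    ∫⁻ x, ‖h x‖ₑ ^ 2 ≤ ENNReal.ofReal (C ^ 2) * ∫⁻ x, ‖f x‖ₑ ^ 2 := by
  have hi : Integrable h := hc.integrable_of_hasCompactSupport hs
  have hFc : Continuous (𝓕 h) := by
    have := VectorFourier.fourierIntegral_continuous (L := innerₗ Space)
      Real.continuous_fourierChar continuous_inner hi
    exact this
  have hFcf : Continuous (𝓕 f) := by
    have := VectorFourier.fourierIntegral_continuous (L := innerₗ Space)
      Real.continuous_fourierChar continuous_inner hf.integrable
    exact this
  have hFi : Integrable (𝓕 h) :=
    (hf.integrable_fourier.norm.const_mul C).mono' hFc.aestronglyMeasurable hle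
  have hbd : ∀ ξ, ‖𝓕 f ξ‖ ≤ ∫ x, ‖f x‖ := fun ξ =>
    VectorFourier.norm_fourierIntegral_le_integral_norm Real.fourierChar volume (innerₗ Space) f ξ
  -- The transform of f is integrable and bounded by the L¹ norm of f, hence square integrable.
  have hsq : Integrable fun ξ => ‖𝓕 f ξ‖ ^ 2 := by
    refine (hf.integrable_fourier.norm.const_mul (∫ x, ‖f x‖)).mono'
      (hFcf.norm.pow 2).aestronglyMeasurable (Eventually.of_forall fun ξ => ?_)
    rw [norm_pow, norm_norm, sq]
    exact mul_le_mul_of_nonneg_right (hbd ξ) (norm_nonneg _)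
  rw [lintegral_enorm_sq_eq_ofReal (integrable_norm_sq_of_compact hc hs),
    lintegral_enorm_sq_eq_ofReal (integrable_norm_sq_of_compact hf.continuous hf.2),
    ← ENNReal.ofReal_mul (sq_nonneg C), ← integral_norm_sq_fourier_of_integrable hc hi hFi,
    ← integral_norm_sq_fourier_of_integrable hf.continuous hf.integrable hf.integrable_fourier,
    ← integral_const_mul]
  refine ENNReal.ofReal_le_ofReal (integral_mono_of_nonneg
    (Eventually.of_forall fun _ => by positivity) (hsq.const_mul _) ?_)
  filter_upwards [hle] with ξ h1
  rw [← mul_pow]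
  exact pow_le_pow_left₀ (norm_nonneg _) h1 2

end Plancherel

/-! ### The Dirac propagator by spherical means. -/

section Propagator

variable {F : Type*} [NormedAddCommGroup F] [NormedSpace ℂ F]

lemma fourier_fderiv_apply [CompleteSpace F] {φ : Space → F} (h : IsTest φ) (v ξ : Space) :
    𝓕 (fun y => fderiv ℝ φ y v) ξ =
      (2 * (Real.pi : ℂ) * Complex.I * ((inner ℝ v ξ : ℝ) : ℂ)) • 𝓕 φ ξ := by
  have hi : Integrable (fderiv ℝ φ) :=
    (h.1.continuous_fderiv (by simp)).integrable_of_hasCompactSupport (h.2.fderiv ℝ)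
  have h1 := congrFun (Real.fourier_fderiv h.integrable h.differentiable hi) ξ
  have h2 := congrArg (fun L : Space →L[ℝ] F => L v) h1
  simp only [VectorFourier.fourierSMulRight_apply] at h2
  have h3 : 𝓕 (fun y => fderiv ℝ φ y v) ξ = (𝓕 (fderiv ℝ φ) ξ) v := by
    rw [Real.fourier_eq, Real.fourier_eq, ContinuousLinearMap.integral_apply]
    · rfl
    · exact (Real.fourierIntegral_convergent_iff ξ).2 hi
  rw [h3, h2]
  have h4 : (-innerSL ℝ) ξ v = -(inner ℝ v ξ) := by
    change -(inner ℝ ξ v) = _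
    rw [real_inner_comm]
  rw [h4, ← Complex.coe_smul, smul_smul]
  congr 1
  push_cast
  ring

/-- The density on the sphere of radius `t` whose integral gives `e^{-itsD}`, up to a factor. -/
noncomputable def propDensity (s : ℤˣ) (f : Space → Spinor) (t : ℝ)
    (u y : Space) : Spinor :=
  (t : ℂ) • diracSmooth f y +
    (Complex.I * ((s : ℤ) : ℂ)) • (f y - (t : ℂ) • fderiv ℝ f y u)

/-- The propagator of the Dirac equation, by spherical means. -/
noncomputable def prop (s : ℤˣ) (f : Space → Spinor) (t : ℝ) (x : Space) : Spinor :=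
  (4 * (Real.pi : ℂ))⁻¹ • ∫ u, propDensity s f t u.1 (x - t • u.1) ∂sphereMeasure

lemma continuous_propDensity {f : Space → Spinor} (h : IsTest f) (s : ℤˣ) :
    Continuous fun p : ℝ × Space × Space => propDensity s f p.1 p.2.1 p.2.2 := by
  have h1 := h.continuous
  have h2 := h.diracSmooth.continuous
  have h3 := h.1.continuous_fderiv (by simp)
  unfold propDensity
  fun_prop

lemma continuous_prop {f : Space → Spinor} (h : IsTest f) (s : ℤˣ) :
    Continuous fun p : ℝ × Space => prop s f p.1 p.2 := by
  unfold prop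
  have : Continuous fun p : ℝ × Space =>
      ∫ u, propDensity s f p.1 u.1 (p.2 - p.1 • u.1) ∂sphereMeasure := by
    refine continuous_sphere_integral (X := ℝ × Space)
      (Φ := fun p u => propDensity s f p.1 u.1 (p.2 - p.1 • u.1)) ?_
    exact (continuous_propDensity h s).comp (f := fun q : (ℝ × Space) × Metric.sphere (0 : Space) 1 =>
    (q.1.1, q.2.1, q.1.2 - q.1.1 • q.2.1)) (by fun_prop)
  exact (continuous_const (y := (4 * (Real.pi : ℂ))⁻¹)).smul this

/-- The inequality R < |y| is strict so that f vanishes in a neighbourhood of y, and its derivatives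
with it. -/
lemma propDensity_eq_zero {f : Space → Spinor} {R : ℝ}
    (hR : ∀ x, R ≤ ‖x‖ → f x = 0) (s : ℤˣ) (t : ℝ) (u : Space) {y : Space} (hy : R < ‖y‖) :
    propDensity s f t u y = 0 := by
  have h0 : f =ᶠ[𝓝 y] fun _ => 0 := by
    filter_upwards [continuous_norm.continuousAt.eventually (lt_mem_nhds hy)] with z hz
    exact hR z (le_of_lt hz)
  have h1 : fderiv ℝ f y = 0 := by rw [h0.fderiv_eq]; simp
  have h2 : diracSmooth f y = 0 := by simp [diracSmooth, partialDeriv, h1]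
  simp [propDensity, h1, h2, h0.self_of_nhds]

/-- Huygens' principle. -/
lemma prop_eq_zero {f : Space → Spinor} {R : ℝ} (hR : ∀ x, R ≤ ‖x‖ → f x = 0)
    (s : ℤˣ) {t : ℝ} {x : Space} (ht : 0 ≤ t) (h : R < |‖x‖ - t|) : prop s f t x = 0 := by
  unfold prop
  rw [integral_eq_zero_of_ae, smul_zero]
  refine Eventually.of_forall fun u => propDensity_eq_zero hR s t _ ?_
  have h1 : ‖t • u.1‖ = t := by
    rw [norm_smul, norm_eq_of_mem_sphere u, mul_one, Real.norm_of_nonneg ht]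
  have := abs_norm_sub_norm_le x (t • u.1)
  rw [h1] at this
  exact h.trans_le this

lemma hasCompactSupport_prop {f : Space → Spinor} (h : IsTest f) (s : ℤˣ) {t : ℝ} (ht : 0 ≤ t) :
    HasCompactSupport (prop s f t) := by
  obtain ⟨R, -, hR⟩ := h.exists_radius
  refine HasCompactSupport.intro (isCompact_closedBall (0 : Space) (R + t)) fun x hx => ?_
  refine prop_eq_zero hR s ht ?_
  rw [mem_closedBall_zero_iff, not_le] at hx
  have := le_abs_self (‖x‖ - t)
  linarith

lemma fourier_propDensity {f : Space → Spinor} (h : IsTest f) (s : ℤˣ) (t : ℝ) (u ξ : Space) :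
    𝓕 (propDensity s f t u) ξ = (t : ℂ) • 𝓕 (diracSmooth f) ξ + (Complex.I * ((s : ℤ) : ℂ) *
      (1 + t * (Complex.I * ((inner ℝ u (-(2 * Real.pi) • ξ) : ℝ) : ℂ)))) • 𝓕 f ξ := by
  have e : propDensity s f t u = fun y => (t : ℂ) • diracSmooth f y +
      ((Complex.I * ((s : ℤ) : ℂ)) • f y +
        (-(Complex.I * ((s : ℤ) : ℂ) * t)) • fderiv ℝ f y u) := by
    ext1 y
    rw [propDensity, smul_sub, smul_smul, neg_smul, sub_eq_add_neg]
  have hi : Integrable fun y => fderiv ℝ f y u :=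
    ((h.1.continuous_fderiv (by simp)).clm_apply continuous_const).integrable_of_hasCompactSupport
      (HasCompactSupport.fderiv_apply (𝕜 := ℝ) h.2 u)
  have i1 : Integrable fun y => (t : ℂ) • diracSmooth f y := h.diracSmooth.integrable.smul (t : ℂ)
  have i2 : Integrable fun y => (Complex.I * ((s : ℤ) : ℂ)) • f y :=
    h.integrable.smul (Complex.I * ((s : ℤ) : ℂ))
  have i3 : Integrable fun y => (-(Complex.I * ((s : ℤ) : ℂ) * t)) • fderiv ℝ f y u :=
    hi.smul (-(Complex.I * ((s : ℤ) : ℂ) * t))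
  have i4 : Integrable fun y => (Complex.I * ((s : ℤ) : ℂ)) • f y +
      (-(Complex.I * ((s : ℤ) : ℂ) * t)) • fderiv ℝ f y u := i2.add i3
  rw [e, fourier_add i1 i4, fourier_add i2 i3, fourier_const_smul, fourier_const_smul,
    fourier_const_smul, fourier_fderiv_apply h, smul_smul, ← add_smul, inner_smul_right]
  congr 2
  push_cast
  ring

lemma contDiff_exp_inner (η : Space) :
    ContDiff ℝ 1 fun y : Space => Complex.exp (Complex.I * ((inner ℝ y η : ℝ) : ℂ)) := by
  refine ContDiff.cexp (contDiff_const.mul ?_)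
  exact Complex.ofRealCLM.contDiff.comp (contDiff_id.inner ℝ contDiff_const)

lemma fderiv_exp_inner (η y v : Space) :
    fderiv ℝ (fun y : Space => Complex.exp (Complex.I * ((inner ℝ y η : ℝ) : ℂ))) y v =
      Complex.exp (Complex.I * ((inner ℝ y η : ℝ) : ℂ)) *
        (Complex.I * ((inner ℝ v η : ℝ) : ℂ)) := by
  have h1 : HasFDerivAt (fun y : Space => inner ℝ y η) ((innerSL ℝ).flip η) y :=
    ((innerSL ℝ).flip η).hasFDerivAt
  have h2 := (Complex.ofRealCLM.hasFDerivAt.comp y h1).const_mul Complex.I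
  have h3 := h2.cexp
  have h4 := congrArg (fun L : Space →L[ℝ] ℂ => L v) h3.fderiv
  exact h4

/-- The Fourier transforms of the radial mean and of its derivative. -/
lemma integral_sphere_exp_deriv {η : Space} (hη : η ≠ 0) {t : ℝ} (ht : 0 < t) :
    (∫ u, Complex.exp (Complex.I * ((inner ℝ (t • u.1) η : ℝ) : ℂ)) ∂sphereMeasure) +
      t * ∫ u, Complex.exp (Complex.I * ((inner ℝ (t • u.1) η : ℝ) : ℂ)) *
        (Complex.I * ((inner ℝ u.1 η : ℝ) : ℂ)) ∂sphereMeasure =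
      ((4 * Real.pi * Real.cos (‖η‖ * t) : ℝ) : ℂ) := by
  have h1 := hasDerivAt_sphere_integral (contDiff_exp_inner η) t
  simp only [fderiv_exp_inner] at h1
  -- The left-hand side is the derivative of tΦ(t), where Φ(t) is the spherical integral; by the
  -- transform of the sphere, tΦ(t) = 4π sin(|η|t)/|η| for t > 0.
  have h2 := (hasDerivAt_id t).ofReal_comp.mul h1
  have hn : ‖η‖ ≠ 0 := norm_ne_zero_iff.2 hη
  have h3 : HasDerivAt (fun t : ℝ => ((4 * Real.pi * Real.sin (‖η‖ * t) / ‖η‖ : ℝ) : ℂ))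
      ((4 * Real.pi * Real.cos (‖η‖ * t) : ℝ) : ℂ) t := by
    have h4 : HasDerivAt (fun t : ℝ => 4 * Real.pi * Real.sin (‖η‖ * t) / ‖η‖)
        (4 * Real.pi * Real.cos (‖η‖ * t)) t := by
      have := (((hasDerivAt_id t).const_mul ‖η‖).sin.const_mul (4 * Real.pi)).div_const ‖η‖
      refine this.congr_deriv ?_
      simp only [id]
      field_simp
    exact h4.ofReal_comp
  have h5 : (fun t : ℝ => ((4 * Real.pi * Real.sin (‖η‖ * t) / ‖η‖ : ℝ) : ℂ)) =ᶠ[𝓝 t]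
      ((fun y : ℝ => ((id y : ℝ) : ℂ)) * fun t =>
        ∫ u, Complex.exp (Complex.I * ((inner ℝ (t • u.1) η : ℝ) : ℂ)) ∂sphereMeasure) := by
    filter_upwards [lt_mem_nhds ht] with r hr
    simp only [Pi.mul_apply, real_inner_smul_left, integral_sphere_exp hη hr, id]
    have : (r : ℂ) ≠ 0 := by exact_mod_cast hr.ne'
    push_cast
    field_simp
  have h6 := h2.unique (h3.congr_of_eventuallyEq h5.symm)
  rw [← h6]
  simp

/-- Identifies `prop s f t` with i s e^{-ist𝒟} f, since the latter is (sin(t|𝒟|)/|𝒟|) 𝒟f + i s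
cos(t|𝒟|) f and |𝒟| has symbol 2π|ξ|. -/
lemma fourier_prop {f : Space → Spinor} (h : IsTest f) (s : ℤˣ) {t : ℝ} (ht : 0 < t) {ξ : Space}
    (hξ : ξ ≠ 0) : 𝓕 (prop s f t) ξ =
      ((Real.sin (2 * Real.pi * ‖ξ‖ * t) / (2 * Real.pi * ‖ξ‖) : ℝ) : ℂ) • 𝓕 (diracSmooth f) ξ +
      (Complex.I * ((s : ℤ) : ℂ) * (Real.cos (2 * Real.pi * ‖ξ‖ * t) : ℝ)) • 𝓕 f ξ := by
  set η : Space := -(2 * Real.pi) • ξ with hη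
  have hη0 : η ≠ 0 := smul_ne_zero (by simp [Real.pi_ne_zero]) hξ
  have hn : ‖η‖ = 2 * Real.pi * ‖ξ‖ := by
    rw [hη, norm_smul, norm_neg, Real.norm_of_nonneg (by positivity)]
  set e : Space → ℂ := fun y => Complex.exp (Complex.I * ((inner ℝ y η : ℝ) : ℂ)) with he
  have hec : Continuous e := (contDiff_exp_inner η).continuous
  obtain ⟨R, -, hR⟩ := h.exists_radius
  have hsphere : ∀ u : Metric.sphere (0 : Space) 1, ‖t • u.1‖ = t := fun u => by
    rw [norm_smul, norm_eq_of_mem_sphere u, mul_one, Real.norm_of_nonneg ht.le]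
  have hint : Integrable (Function.uncurry fun (x : Space) (u : Metric.sphere (0 : Space) 1) =>
      e x • propDensity s f t u.1 (x - t • u.1)) (volume.prod sphereMeasure) := by
    refine Continuous.integrable_of_hasCompactSupport ?_ ?_
    · refine Continuous.smul (hec.comp continuous_fst) ?_
      exact (continuous_propDensity h s).comp
        (f := fun q : Space × Metric.sphere (0 : Space) 1 => (t, q.2.1, q.1 - t • q.2.1))
        (by fun_prop)
    · refine HasCompactSupport.intro
        ((isCompact_closedBall (0 : Space) (R + t)).prod isCompact_univ) fun q hq => ?_
      have hq1 : R + t < ‖q.1‖ := by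
        by_contra h0
        exact hq ⟨mem_closedBall_zero_iff.2 (not_lt.1 h0), Set.mem_univ _⟩
      change e q.1 • propDensity s f t q.2.1 (q.1 - t • q.2.1) = 0
      rw [propDensity_eq_zero hR, smul_zero]
      have := norm_sub_norm_le q.1 (t • q.2.1)
      rw [hsphere] at this
      linarith
  -- Shifting by tu produces the plane wave at tu. After averaging over u this is the transform of
  -- the sphere, or its t-derivative for the term containing the derivative of f along u.
  have hu : ∀ u : Space, ∫ x, e x • propDensity s f t u (x - t • u) =
      e (t • u) • 𝓕 (propDensity s f t u) ξ := by
    intro u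
    rw [← integral_add_right_eq_self _ (t • u), Real.fourier_eq, ← integral_smul]
    refine integral_congr_ae (Eventually.of_forall fun y => ?_)
    simp only [add_sub_cancel_right, Circle.smul_def, fourierChar_neg_inner, ← hη, he, smul_smul,
      ← Complex.exp_add, inner_add_left]
    congr 2
    push_cast; ring
  set M := ∫ u : Metric.sphere (0 : Space) 1, e (t • u.1) ∂sphereMeasure with hM
  set M' := ∫ u : Metric.sphere (0 : Space) 1, e (t • u.1) *
    (Complex.I * ((inner ℝ u.1 η : ℝ) : ℂ)) ∂sphereMeasure with hM'
  have hMM : M + t * M' = ((4 * Real.pi * Real.cos (‖η‖ * t) : ℝ) : ℂ) :=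
    integral_sphere_exp_deriv hη0 ht
  have hMv : M = ((4 * Real.pi * Real.sin (‖η‖ * t) / (‖η‖ * t) : ℝ) : ℂ) := by
    rw [← integral_sphere_exp hη0 ht]
    simp only [hM, he, real_inner_smul_left]
  have i1 : Integrable (fun u : Metric.sphere (0 : Space) 1 => e (t • u.1)) sphereMeasure :=
    integrable_sphere (hec.comp (by fun_prop))
  have i2 : Integrable (fun u : Metric.sphere (0 : Space) 1 => e (t • u.1) *
      (Complex.I * ((inner ℝ u.1 η : ℝ) : ℂ))) sphereMeasure :=
    integrable_sphere ((hec.comp (by fun_prop)).mul (by fun_prop))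
  have hsum : ∫ u : Metric.sphere (0 : Space) 1, e (t • u.1) • 𝓕 (propDensity s f t u.1) ξ
      ∂sphereMeasure = ((t : ℂ) * M) • 𝓕 (diracSmooth f) ξ +
        (Complex.I * ((s : ℤ) : ℂ) * (M + t * M')) • 𝓕 f ξ := by
    have e2 : ∀ u : Metric.sphere (0 : Space) 1, e (t • u.1) • 𝓕 (propDensity s f t u.1) ξ =
        ((t : ℂ) * e (t • u.1)) • 𝓕 (diracSmooth f) ξ + (Complex.I * ((s : ℤ) : ℂ) *
          (e (t • u.1) + t * (e (t • u.1) * (Complex.I * ((inner ℝ u.1 η : ℝ) : ℂ))))) • 𝓕 f ξ := by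
      intro u
      rw [fourier_propDensity h, ← hη, smul_add, smul_smul, smul_smul]
      congr 2 <;> ring
    simp only [e2]
    have i3 : Integrable (fun u : Metric.sphere (0 : Space) 1 =>
        ((t : ℂ) * e (t • u.1)) • 𝓕 (diracSmooth f) ξ) sphereMeasure :=
      (i1.const_mul (t : ℂ)).smul_const _
    have i4 : Integrable (fun u : Metric.sphere (0 : Space) 1 => (Complex.I * ((s : ℤ) : ℂ) *
        (e (t • u.1) + t * (e (t • u.1) * (Complex.I * ((inner ℝ u.1 η : ℝ) : ℂ))))) • 𝓕 f ξ)
        sphereMeasure :=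
      ((i1.add (i2.const_mul (t : ℂ))).const_mul _).smul_const _
    rw [integral_add i3 i4, integral_smul_const,
      integral_smul_const, integral_const_mul, integral_const_mul,
      integral_add i1 (i2.const_mul (t : ℂ)), integral_const_mul]
  have hF : 𝓕 (prop s f t) ξ = (4 * (Real.pi : ℂ))⁻¹ • ∫ x, ∫ u : Metric.sphere (0 : Space) 1,
      e x • propDensity s f t u.1 (x - t • u.1) ∂sphereMeasure := by
    rw [Real.fourier_eq, ← integral_smul]
    refine integral_congr_ae (Eventually.of_forall fun x => ?_)
    simp only [prop, Circle.smul_def, fourierChar_neg_inner, ← hη]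
    rw [integral_smul, smul_comm]
  have hπ : (Real.pi : ℂ) ≠ 0 := by exact_mod_cast Real.pi_ne_zero
  have htc : (t : ℂ) ≠ 0 := by exact_mod_cast ht.ne'
  have hbc : (‖η‖ : ℂ) ≠ 0 := by exact_mod_cast (norm_ne_zero_iff.2 hη0)
  rw [hF, integral_integral_swap hint]
  simp only [hu]
  rw [hsum, hMM, hMv, smul_add, smul_smul, smul_smul, ← hn]
  congr 2
  · push_cast
    field_simp
  · push_cast
    field_simp

/-- A bound for the propagator on `L²`. -/
noncomputable def propConst : ℝ := (∑ k, ‖alpha k‖) + 1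

lemma propConst_pos : 0 < propConst :=
  add_pos_of_nonneg_of_pos (Finset.sum_nonneg fun _ _ => norm_nonneg _) one_pos

/-- With b = 2π|ξ|, the factor 1/b in front of the sine absorbs the factor b lost by 𝒟, so the bound
is independent of t. Unitarity would give the constant 1; a cruder one suffices. -/
lemma norm_fourier_prop_le {f : Space → Spinor} (h : IsTest f) (s : ℤˣ) {t : ℝ} (ht : 0 < t)
    {ξ : Space} (hξ : ξ ≠ 0) : ‖𝓕 (prop s f t) ξ‖ ≤ propConst * ‖𝓕 f ξ‖ := by
  have hπ := Real.pi_pos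
  have hξn := norm_pos_iff.2 hξ
  set b := 2 * Real.pi * ‖ξ‖ with hb
  have hbpos : 0 < b := by positivity
  have hD : ‖𝓕 (diracSmooth f) ξ‖ ≤ b * ((∑ k, ‖alpha k‖) * ‖𝓕 f ξ‖) := by
    have e : 𝓕 (diracSmooth f) ξ =
        (-Complex.I) • ∑ k, alpha k (𝓕 (partialDeriv k f) ξ) := by
      have h1 : diracSmooth f = fun y => (-Complex.I) • ∑ k, alpha k (partialDeriv k f y) := rfl
      rw [h1, fourier_const_smul]
      congr 1
      rw [Real.fourier_eq]
      simp only [Finset.smul_sum]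
      have hi : ∀ k, Integrable fun v : Space =>
          Real.fourierChar (-inner ℝ v ξ) • alpha k (partialDeriv k f v) := fun k =>
        (Real.fourierIntegral_convergent_iff ξ).2 ((h.partialDeriv k).alpha k).integrable
      rw [integral_finsetSum _ fun k _ => hi k]
      refine Finset.sum_congr rfl fun k _ => ?_
      rw [Real.fourier_eq, ← ContinuousLinearMap.integral_comp_comm _
        ((Real.fourierIntegral_convergent_iff ξ).2 (h.partialDeriv k).integrable)]
      simp only [Circle.smul_def, map_smul]
    rw [e, norm_smul, norm_neg, Complex.norm_I, one_mul]
    refine (norm_sum_le _ _).trans ?_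
    rw [Finset.sum_mul, Finset.mul_sum]
    refine Finset.sum_le_sum fun k _ => ?_
    refine ((alpha k).le_opNorm _).trans ?_
    rw [fourier_partialDeriv h, norm_smul]
    have : ‖2 * (Real.pi : ℂ) * Complex.I * (ξ k : ℂ)‖ ≤ b := by
      rw [norm_mul, norm_mul, norm_mul, Complex.norm_I, Complex.norm_real, Complex.norm_real,
        Complex.norm_ofNat, Real.norm_of_nonneg hπ.le, mul_one, hb]
      exact mul_le_mul_of_nonneg_left (PiLp.norm_apply_le ξ k) (by positivity)
    calc ‖alpha k‖ * (‖2 * (Real.pi : ℂ) * Complex.I * (ξ k : ℂ)‖ * ‖𝓕 f ξ‖)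
        ≤ ‖alpha k‖ * (b * ‖𝓕 f ξ‖) := by gcongr
      _ = _ := by ring
  rw [fourier_prop h s ht hξ, ← hb]
  refine (norm_add_le _ _).trans ?_
  rw [norm_smul, norm_smul, norm_mul, norm_mul, Complex.norm_I, norm_units_int, Complex.norm_real,
    Complex.norm_real, one_mul, one_mul, Real.norm_eq_abs, Real.norm_eq_abs, abs_div,
    abs_of_pos hbpos]
  have h1 : |Real.sin (b * t)| / b * ‖𝓕 (diracSmooth f) ξ‖ ≤ (∑ k, ‖alpha k‖) * ‖𝓕 f ξ‖ := by
    calc _ ≤ 1 / b * (b * ((∑ k, ‖alpha k‖) * ‖𝓕 f ξ‖)) := by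
          gcongr
          exact Real.abs_sin_le_one _
      _ = _ := by field_simp
  have h2 : |Real.cos (b * t)| * ‖𝓕 f ξ‖ ≤ 1 * ‖𝓕 f ξ‖ := by
    gcongr; exact Real.abs_cos_le_one _
  unfold propConst
  linarith

lemma lintegral_prop_le {f : Space → Spinor} (h : IsTest f) (s : ℤˣ) {t : ℝ} (ht : 0 < t) :
    ∫⁻ x, ‖prop s f t x‖ₑ ^ 2 ≤ ENNReal.ofReal (propConst ^ 2) * ∫⁻ x, ‖f x‖ₑ ^ 2 := by
  have hc : Continuous (prop s f t) := Continuous.comp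
    (g := fun p : ℝ × Space => prop s f p.1 p.2) (f := fun x : Space => (t, x))
    (continuous_prop h s) (by fun_prop)
  have hle : ∀ᵐ ξ, ‖𝓕 (prop s f t) ξ‖ ≤ propConst * ‖𝓕 f ξ‖ :=
    ae_ne_zero.mono fun ξ hξ => norm_fourier_prop_le h s ht hξ
  have hs : HasCompactSupport (prop s f t) := hasCompactSupport_prop h s ht.le
  have := lintegral_enorm_sq_le_of_fourier (E := Spinor) (h := prop s f t) (f := f)
    (C := propConst) hc hs h hle
  exact this

end Propagator

/-! ### Laplace representation and local bound for test functions. -/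

section Huygens

/-- Polar coordinates in the convolution with `gK`. -/
lemma gConv_eq_integral_sphere {κ : ℂ} (hκ : 0 ≤ κ.im) {ψ : Space → Spinor} (h : IsTest ψ)
    (x : Space) : gConv κ ψ x = ∫ t in Set.Ioi (0 : ℝ), Complex.exp (Complex.I * κ * t) •
      ((t : ℂ) / (4 * (Real.pi : ℂ))) • ∫ u, ψ (x - t • u.1) ∂sphereMeasure := by
  unfold gConv
  rw [integral_polar (integrable_gK_smul hκ h x)]
  refine setIntegral_congr_fun measurableSet_Ioi fun t ht => ?_
  have ht : 0 < t := ht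
  have htc : (t : ℂ) ≠ 0 := by exact_mod_cast ht.ne'
  simp only [gK_smul_sphere κ ht]
  rw [integral_smul, ← Complex.coe_smul, smul_smul, smul_smul]
  congr 1
  push_cast
  field_simp

lemma sphere_eq_zero {ψ : Space → Spinor} {R : ℝ} (hR : ∀ x, R ≤ ‖x‖ → ψ x = 0) {x : Space} {t : ℝ}
    (ht : R + ‖x‖ ≤ |t|) : ∫ u, ψ (x - t • u.1) ∂sphereMeasure = 0 := by
  refine integral_eq_zero_of_ae (Eventually.of_forall fun u => hR _ ?_)
  have := norm_sub_norm_le (t • u.1) x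
  rw [norm_smul, norm_eq_of_mem_sphere u, mul_one, Real.norm_eq_abs, norm_sub_rev] at this
  linarith

/-- The resolvent kernel as the Laplace transform of the propagator. -/
lemma kernOp_eq_integral_prop {s : ℤˣ} {z : ℂ} (hz : 0 ≤ (((s : ℤ) : ℂ) * z).im)
    {f : Space → Spinor} (h : IsTest f) (x : Space) :
    kernOp s z f x = ∫ t in Set.Ioi (0 : ℝ),
      Complex.exp (Complex.I * (((s : ℤ) : ℂ) * z) * t) • prop s f t x := by
  set κ := ((s : ℤ) : ℂ) * z with hκ
  obtain ⟨R, -, hR⟩ := h.exists_radius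
  set S : (Space → Spinor) → ℝ → Spinor := fun ψ t => ∫ u, ψ (x - t • u.1) ∂sphereMeasure with hS
  have hSc : ∀ ψ : Space → Spinor, Continuous ψ → Continuous (S ψ) := fun ψ hψ =>
    continuous_sphere_integral (Φ := fun (t : ℝ) u => ψ (x - t • u.1)) (hψ.comp (by fun_prop))
  -- P is e^{iκt} t/(4π) times the spherical integral of f, and Q will be its derivative. P vanishes
  -- at t = 0 and for large t, so Q integrates to zero over the half-line and multiples of it may be
  -- added freely.
  set P : ℝ → Spinor := fun t => Complex.exp (Complex.I * κ * t) •
    ((t : ℂ) / (4 * (Real.pi : ℂ))) • S f t with hP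
  set Q : ℝ → Spinor := fun t => Complex.exp (Complex.I * κ * t) •
    (((Complex.I * κ * t + 1) / (4 * (Real.pi : ℂ))) • S f t -
      ((t : ℂ) / (4 * (Real.pi : ℂ))) • ∫ u, fderiv ℝ f (x - t • u.1) u.1 ∂sphereMeasure) with hQ
  have hder : ∀ t, HasDerivAt P (Q t) t := by
    intro t
    have h1 : HasDerivAt (fun t : ℝ => Complex.exp (Complex.I * κ * t))
        (Complex.exp (Complex.I * κ * t) * (Complex.I * κ)) t := by
      have := ((hasDerivAt_id t).ofReal_comp.const_mul (Complex.I * κ)).cexp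
      simpa using this
    have h2 : HasDerivAt (fun t : ℝ => (t : ℂ) / (4 * (Real.pi : ℂ))) (1 / (4 * (Real.pi : ℂ))) t := by
      have := (hasDerivAt_id t).ofReal_comp.div_const (4 * (Real.pi : ℂ))
      simpa using this
    have h3 := hasDerivAt_sphere_integral ((h.comp_sub_left x).1.of_le (m := 1) (by simp)) t
    have h4 : ∀ y v : Space, fderiv ℝ (fun r => f (x - r)) y v = -fderiv ℝ f (x - y) v := by
      intro y v
      have h5 : HasFDerivAt (fun r => x - r) (-ContinuousLinearMap.id ℝ Space) y := by
        simpa using (hasFDerivAt_id y).const_sub x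
      have h6 : HasFDerivAt (fun r => f (x - r))
          ((fderiv ℝ f (x - y)).comp (-ContinuousLinearMap.id ℝ Space)) y :=
        (h.differentiable (x - y)).hasFDerivAt.comp y h5
      rw [h6.fderiv]
      simp
    simp only [h4, integral_neg] at h3
    set D := ∫ u, fderiv ℝ f (x - t • u.1) u.1 ∂sphereMeasure with hD
    have h7 : HasDerivAt P (Complex.exp (Complex.I * κ * t) •
        (((t : ℂ) / (4 * (Real.pi : ℂ))) • (-D) + (1 / (4 * (Real.pi : ℂ))) • S f t) +
        (Complex.exp (Complex.I * κ * t) * (Complex.I * κ)) •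
          (((t : ℂ) / (4 * (Real.pi : ℂ))) • S f t)) t := h1.smul (h2.smul h3)
    refine h7.congr_deriv ?_
    simp only [hQ, ← hD]
    module
  have hdc : Continuous fun t : ℝ => ∫ u, fderiv ℝ f (x - t • u.1) u.1 ∂sphereMeasure :=
    continuous_sphere_integral (Φ := fun (t : ℝ) u => fderiv ℝ f (x - t • u.1) u.1)
      (((h.1.continuous_fderiv (by simp)).comp (by fun_prop)).clm_apply (by fun_prop))
  have hQc : Continuous Q := by
    have := hSc f h.continuous
    simp only [hQ]
    fun_prop
  have hPs : HasCompactSupport P := by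
    refine HasCompactSupport.intro (isCompact_closedBall (0 : ℝ) (R + ‖x‖)) fun t ht => ?_
    rw [mem_closedBall_zero_iff, not_le, Real.norm_eq_abs] at ht
    simp only [hP, hS, sphere_eq_zero hR ht.le, smul_zero]
  have hP1 : ContDiff ℝ 1 P := by
    rw [contDiff_one_iff_deriv]
    refine ⟨fun t => (hder t).differentiableAt, ?_⟩
    rw [show deriv P = Q from funext fun t => (hder t).deriv]
    exact hQc
  have hQs : HasCompactSupport Q := by
    have := hPs.deriv
    rwa [show deriv P = Q from funext fun t => (hder t).deriv] at this
  have hint : ∫ t in Set.Ioi (0 : ℝ), Q t = 0 := by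
    have := hPs.integral_Ioi_deriv_eq hP1 0
    rw [show deriv P = Q from funext fun t => (hder t).deriv] at this
    rw [this]
    simp [hP]
  rw [kernOp_test hz h, gConv_eq_integral_sphere hz (isTest_dirac_add h z)]
  have hQi : IntegrableOn (fun t => (Complex.I * ((s : ℤ) : ℂ)) • Q t) (Set.Ioi 0) :=
    ((hQc.integrable_of_hasCompactSupport hQs).integrableOn).smul (Complex.I * ((s : ℤ) : ℂ))
  have hDi : IntegrableOn (fun t : ℝ => Complex.exp (Complex.I * κ * t) •
      ((t : ℂ) / (4 * (Real.pi : ℂ))) • S (fun x => diracSmooth f x + z • f x) t) (Set.Ioi 0) := by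
    obtain ⟨R', -, hR'⟩ := (isTest_dirac_add h z).exists_radius
    have hc : Continuous fun t : ℝ => Complex.exp (Complex.I * κ * t) •
      ((t : ℂ) / (4 * (Real.pi : ℂ))) • S (fun x => diracSmooth f x + z • f x) t := by
      have := hSc _ (isTest_dirac_add h z).continuous
      fun_prop
    refine (hc.integrable_of_hasCompactSupport (HasCompactSupport.intro
      (isCompact_closedBall (0 : ℝ) (R' + ‖x‖)) fun t ht => ?_)).integrableOn
    rw [mem_closedBall_zero_iff, not_le, Real.norm_eq_abs] at ht
    simp only [hS, sphere_eq_zero hR' ht.le, smul_zero]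
  -- Differentiating the exponential inside i s Q gives the factor is·iκ = -z. This removes the z f
  -- part of 𝒟f + zf and leaves a propagator that does not depend on z.
  have key : ∀ t : ℝ, Complex.exp (Complex.I * κ * t) • prop s f t x =
      Complex.exp (Complex.I * κ * t) • ((t : ℂ) / (4 * (Real.pi : ℂ))) •
        S (fun x => diracSmooth f x + z • f x) t + (Complex.I * ((s : ℤ) : ℂ)) • Q t := by
    intro t
    have c1 : Continuous fun u : Metric.sphere (0 : Space) 1 => diracSmooth f (x - t • u.1) :=
      h.diracSmooth.continuous.comp (by fun_prop)
    have c2 : Continuous fun u : Metric.sphere (0 : Space) 1 => f (x - t • u.1) :=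
      h.continuous.comp (by fun_prop)
    have c3 : Continuous fun u : Metric.sphere (0 : Space) 1 => fderiv ℝ f (x - t • u.1) u.1 :=
      ((h.1.continuous_fderiv (by simp)).comp (by fun_prop)).clm_apply (by fun_prop)
    have e1 : S (fun x => diracSmooth f x + z • f x) t = S (diracSmooth f) t + z • S f t := by
      have i2 : Integrable (fun u : Metric.sphere (0 : Space) 1 => z • f (x - t • u.1))
        sphereMeasure := integrable_sphere (c2.const_smul z)
      simp only [hS]
      rw [integral_add (integrable_sphere c1) i2, integral_smul]
    have e2 : prop s f t x = (4 * (Real.pi : ℂ))⁻¹ • ((t : ℂ) • S (diracSmooth f) t +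
        (Complex.I * ((s : ℤ) : ℂ)) • (S f t - (t : ℂ) •
          ∫ u, fderiv ℝ f (x - t • u.1) u.1 ∂sphereMeasure)) := by
      simp only [prop, propDensity, hS]
      have i1 : Integrable (fun u : Metric.sphere (0 : Space) 1 =>
        (t : ℂ) • diracSmooth f (x - t • u.1)) sphereMeasure := integrable_sphere (c1.const_smul (t : ℂ))
      have i3 : Integrable (fun u : Metric.sphere (0 : Space) 1 =>
        (t : ℂ) • fderiv ℝ f (x - t • u.1) u.1) sphereMeasure := integrable_sphere (c3.const_smul (t : ℂ))
      have i4 : Integrable (fun u : Metric.sphere (0 : Space) 1 => (Complex.I * ((s : ℤ) : ℂ)) •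
        (f (x - t • u.1) - (t : ℂ) • fderiv ℝ f (x - t • u.1) u.1)) sphereMeasure :=
        ((integrable_sphere c2).sub i3).smul (Complex.I * ((s : ℤ) : ℂ))
      rw [integral_add i1 i4, integral_smul, integral_smul, integral_sub (integrable_sphere c2) i3,
        integral_smul]
    have e3 : Complex.I * ((s : ℤ) : ℂ) * (Complex.I * κ) = -z := by
      rw [hκ]
      linear_combination (Complex.I * Complex.I * z) * units_mul_self s + z * Complex.I_mul_I
    have e4 : (Complex.I * ((s : ℤ) : ℂ)) • Q t = Complex.exp (Complex.I * κ * t) •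
        ((-((t : ℂ) / (4 * (Real.pi : ℂ))) * z) • S f t +
        ((4 * (Real.pi : ℂ))⁻¹ * (Complex.I * ((s : ℤ) : ℂ))) • (S f t - (t : ℂ) •
          ∫ u, fderiv ℝ f (x - t • u.1) u.1 ∂sphereMeasure)) := by
      simp only [hQ]
      rw [show -((t : ℂ) / (4 * (Real.pi : ℂ))) * z =
        ((t : ℂ) / (4 * (Real.pi : ℂ))) * (Complex.I * ((s : ℤ) : ℂ) * (Complex.I * κ)) by
          rw [e3]; ring]
      module
    rw [e1, e2, e4, ← smul_add]
    congr 1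
    simp only [smul_add, smul_smul]
    rw [show (4 * (Real.pi : ℂ))⁻¹ * (t : ℂ) = (t : ℂ) / (4 * (Real.pi : ℂ)) by ring, neg_mul, neg_smul]
    abel
  simp only [key]
  rw [integral_add hDi hQi, integral_smul, hint, smul_zero, add_zero]

/-- By Huygens' principle only times with |t - |x|| ≤ R₁ contribute at x. Cauchy–Schwarz in t gives
the factor 2R₁; integrating the L² bound of the propagator over 0 < t < 2R₂ gives 2R₂. The parameter
z enters only through an exponential of modulus at most 1. -/
lemma lintegral_kernOp_test_le {s : ℤˣ} {z : ℂ} (hz : 0 ≤ (((s : ℤ) : ℂ) * z).im)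
    {f : Space → Spinor} (h : IsTest f) {R₁ R₂ : ℝ} (hR₁ : 0 < R₁) (hR : R₁ ≤ R₂)
    (hf : ∀ x, R₁ ≤ ‖x‖ → f x = 0) :
    ∫⁻ x in Metric.ball 0 R₂, ‖kernOp s z f x‖ₑ ^ 2 ≤
      ENNReal.ofReal (4 * R₁ * R₂ * propConst ^ 2) * ∫⁻ x, ‖f x‖ₑ ^ 2 := by
  have hR₂ : 0 < R₂ := hR₁.trans_le hR
  have hpc : Continuous fun p : ℝ × Space => prop s f p.1 p.2 := continuous_prop h s
  have hpt : ∀ x, Continuous fun t => prop s f t x := fun x =>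
    hpc.comp (f := fun t : ℝ => (t, x)) (by fun_prop)
  have hpoint : ∀ x ∈ Metric.ball (0 : Space) R₂, ‖kernOp s z f x‖ₑ ^ 2 ≤
      ENNReal.ofReal (2 * R₁) * ∫⁻ t in Set.Ioo 0 (2 * R₂), ‖prop s f t x‖ₑ ^ 2 := by
    intro x hx
    rw [mem_ball_zero_iff] at hx
    set J : Set ℝ := Set.Icc (‖x‖ - R₁) (‖x‖ + R₁) with hJ
    have h1 : ‖kernOp s z f x‖ₑ ≤
        ∫⁻ t in Set.Ioo 0 (2 * R₂), J.indicator 1 t * ‖prop s f t x‖ₑ := by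
      rw [kernOp_eq_integral_prop hz h]
      refine (enorm_integral_le_lintegral_enorm _).trans ?_
      rw [← lintegral_indicator measurableSet_Ioi, ← lintegral_indicator measurableSet_Ioo]
      refine lintegral_mono fun t => ?_
      by_cases ht : 0 < t
      swap
      · rw [Set.indicator_of_notMem (by simpa using ht)]; exact zero_le
      rw [Set.indicator_of_mem (by simpa using ht)]
      by_cases ht' : R₁ < |‖x‖ - t|
      · rw [prop_eq_zero hf s ht.le ht', smul_zero, enorm_zero]; exact zero_le
      rw [not_lt, abs_le] at ht'
      -- Here R₁ ≤ R₂ is used: t ≤ |x| + R₁ < 2R₂.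
      have m1 : t ∈ Set.Ioo 0 (2 * R₂) := ⟨ht, by linarith⟩
      have m2 : t ∈ J := ⟨by linarith, by linarith⟩
      rw [Set.indicator_of_mem m1, Set.indicator_of_mem m2, Pi.one_apply, one_mul, enorm_smul]
      refine mul_le_of_le_one_left' ?_
      rw [← ofReal_norm, norm_exp_I_mul]
      refine (ENNReal.ofReal_le_ofReal (exp_neg_mul_le_one hz ht.le)).trans ?_
      simp
    refine (pow_le_pow_left' h1 2).trans ((sq_lintegral_mul_le
      (measurable_one.indicator measurableSet_Icc).aemeasurable
      (hpt x).measurable.enorm.aemeasurable).trans ?_)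
    refine mul_le_mul_left ?_ _
    calc ∫⁻ t in Set.Ioo 0 (2 * R₂), J.indicator (1 : ℝ → ℝ≥0∞) t ^ 2
        ≤ ∫⁻ t, J.indicator (1 : ℝ → ℝ≥0∞) t ^ 2 := setLIntegral_le_lintegral _ _
      _ = ∫⁻ t, J.indicator (1 : ℝ → ℝ≥0∞) t := by
          refine lintegral_congr fun t => ?_
          by_cases ht : t ∈ J <;> simp [ht]
      _ = volume J := lintegral_indicator_one measurableSet_Icc
      _ ≤ ENNReal.ofReal (2 * R₁) := by
          rw [hJ, Real.volume_Icc]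
          exact ENNReal.ofReal_le_ofReal (by linarith)
  calc ∫⁻ x in Metric.ball 0 R₂, ‖kernOp s z f x‖ₑ ^ 2
      ≤ ∫⁻ x in Metric.ball 0 R₂, ENNReal.ofReal (2 * R₁) *
          ∫⁻ t in Set.Ioo 0 (2 * R₂), ‖prop s f t x‖ₑ ^ 2 :=
        setLIntegral_mono' measurableSet_ball hpoint
    _ ≤ ∫⁻ x, ENNReal.ofReal (2 * R₁) *
          ∫⁻ t in Set.Ioo 0 (2 * R₂), ‖prop s f t x‖ₑ ^ 2 := setLIntegral_le_lintegral _ _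
    _ = ENNReal.ofReal (2 * R₁) * ∫⁻ t in Set.Ioo 0 (2 * R₂), ∫⁻ x, ‖prop s f t x‖ₑ ^ 2 := by
        rw [lintegral_const_mul' _ _ ENNReal.ofReal_ne_top, lintegral_lintegral_swap]
        have : Continuous fun p : Space × ℝ => prop s f p.2 p.1 :=
          hpc.comp (f := fun p : Space × ℝ => (p.2, p.1)) (by fun_prop)
        exact (this.measurable.enorm.pow_const 2).aemeasurable
    _ ≤ ENNReal.ofReal (2 * R₁) * ∫⁻ t in Set.Ioo 0 (2 * R₂),
          ENNReal.ofReal (propConst ^ 2) * ∫⁻ x, ‖f x‖ₑ ^ 2 := by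
        refine mul_le_mul_right (setLIntegral_mono' measurableSet_Ioo fun t ht => ?_) _
        exact lintegral_prop_le h s ht.1
    _ = _ := by
        have e : ENNReal.ofReal (4 * R₁ * R₂ * propConst ^ 2) = ENNReal.ofReal (2 * R₁) *
            ENNReal.ofReal (propConst ^ 2) * ENNReal.ofReal (2 * R₂) := by
          rw [← ENNReal.ofReal_mul (by positivity), ← ENNReal.ofReal_mul (by positivity)]
          congr 1; ring
        rw [setLIntegral_const, Real.volume_Ioo, sub_zero, e]
        ring

/-- The restriction of the resolvent kernel to a ball. -/
noncomputable def kernLoc (s : ℤˣ) (z : ℂ) (R : ℝ) : Space → Spinor →L[ℂ] Spinor :=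
  (Metric.ball 0 R).indicator (kern s z)

lemma measurable_kernLoc (s : ℤˣ) (z : ℂ) (R : ℝ) : Measurable (kernLoc s z R) :=
  (measurable_kern s z).indicator measurableSet_ball

lemma integrable_kernLoc {s : ℤˣ} {z : ℂ} (hz : 0 ≤ (((s : ℤ) : ℂ) * z).im) (R : ℝ) :
    Integrable (kernLoc s z R) := by
  have h : IntegrableOn (kern s z) (Metric.ball 0 R) :=
    ((locallyIntegrable_kern hz).integrableOn_isCompact
      (isCompact_closedBall (0 : Space) R)).mono_set Metric.ball_subset_closedBall
  have h' : Integrable ((Metric.ball 0 R).indicator fun r => ‖kern s z r‖) :=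
    (integrable_indicator_iff measurableSet_ball).2 h.norm
  refine h'.mono' (measurable_kernLoc s z R).stronglyMeasurable.aestronglyMeasurable
    (Eventually.of_forall fun r => ?_)
  rw [kernLoc, norm_indicator_eq_indicator_norm]

/-- With x and the support of f bounded, only the kernel on a ball matters, and there it is
integrable even for real z. This makes Young's inequality available, though with a constant
depending on z. -/
lemma enorm_kern_mul_eq {s : ℤˣ} {z : ℂ} {R₁ R₂ : ℝ} {f : Space → Spinor}
    (hf : ∀ y, R₁ ≤ ‖y‖ → f y = 0) {x : Space} (hx : ‖x‖ < R₂) (y : Space) :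
    ‖kern s z (x - y)‖ₑ * ‖f y‖ₑ = ‖kernLoc s z (R₁ + R₂) (x - y)‖ₑ * ‖f y‖ₑ := by
  by_cases hy : R₁ ≤ ‖y‖
  · simp [hf y hy]
  · rw [not_le] at hy
    have : x - y ∈ Metric.ball (0 : Space) (R₁ + R₂) := by
      rw [mem_ball_zero_iff]
      have := norm_sub_le x y
      linarith
    rw [kernLoc, Set.indicator_of_mem this]

lemma lintegral_sq_kern_ball_le {s : ℤˣ} {z : ℂ} {R₁ : ℝ} (R₂ : ℝ) {f : Space → Spinor}
    (hfm : StronglyMeasurable f) (hf : ∀ y, R₁ ≤ ‖y‖ → f y = 0) :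
    ∫⁻ x in Metric.ball 0 R₂, (∫⁻ y, ‖kern s z (x - y)‖ₑ * ‖f y‖ₑ) ^ 2 ≤
      (∫⁻ r, ‖kernLoc s z (R₁ + R₂) r‖ₑ) ^ 2 * ∫⁻ y, ‖f y‖ₑ ^ 2 := by
  refine le_trans ?_ (lintegral_sq_conv_le (measurable_kernLoc s z (R₁ + R₂)) hfm)
  refine (setLIntegral_mono' measurableSet_ball fun x hx => ?_).trans
    (setLIntegral_le_lintegral (Metric.ball 0 R₂) _)
  rw [mem_ball_zero_iff] at hx
  refine pow_le_pow_left' (lintegral_mono fun y => ?_) 2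
  exact (enorm_kern_mul_eq hf hx y).le

lemma measurable_lintegral_kern (s : ℤˣ) (z : ℂ) {f : Space → Spinor}
    (hfm : StronglyMeasurable f) :
    Measurable fun x => ∫⁻ y, ‖kern s z (x - y)‖ₑ * ‖f y‖ₑ :=
  Measurable.lintegral_prod_right' (f := fun p : Space × Space =>
    ‖kern s z (p.1 - p.2)‖ₑ * ‖f p.2‖ₑ)
    (((measurable_kern s z).comp (measurable_fst.sub measurable_snd)).enorm.mul
      (hfm.measurable.comp measurable_snd).enorm)

lemma ae_integrable_kern_of_bounded_support {s : ℤˣ} {z : ℂ} (hz : 0 ≤ (((s : ℤ) : ℂ) * z).im)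
    {R₁ : ℝ} {f : Space → Spinor} (hfm : StronglyMeasurable f) (hf : ∀ y, R₁ ≤ ‖y‖ → f y = 0)
    (hf2 : ∫⁻ y, ‖f y‖ₑ ^ 2 < ⊤) : ∀ᵐ x, ∫⁻ y, ‖kern s z (x - y)‖ₑ * ‖f y‖ₑ < ⊤ := by
  have key : ∀ n : ℕ, ∀ᵐ x, x ∈ Metric.ball (0 : Space) n →
      ∫⁻ y, ‖kern s z (x - y)‖ₑ * ‖f y‖ₑ < ⊤ := fun n => by
    have h1 := (lintegral_sq_kern_ball_le (s := s) (z := z) (n : ℝ) hfm hf).trans_lt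
      (ENNReal.mul_lt_top (ENNReal.pow_lt_top (integrable_kernLoc hz _).2) hf2)
    have h2 := ae_lt_top ((measurable_lintegral_kern s z hfm).pow_const 2) h1.ne
    rw [ae_restrict_iff' measurableSet_ball] at h2
    filter_upwards [h2] with x hx hx'
    exact (ENNReal.pow_lt_top_iff.1 (hx hx')).resolve_right (by norm_num)
  filter_upwards [ae_all_iff.2 key] with x hx
  obtain ⟨n, hn⟩ := exists_nat_gt ‖x‖
  exact hx n (mem_ball_zero_iff.2 hn)

lemma kernOp_sub {s : ℤˣ} {z : ℂ} {f g : Space → Spinor} (hf : StronglyMeasurable f)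
    (hg : StronglyMeasurable g) {x : Space} (h1 : ∫⁻ y, ‖kern s z (x - y)‖ₑ * ‖f y‖ₑ < ⊤)
    (h2 : ∫⁻ y, ‖kern s z (x - y)‖ₑ * ‖g y‖ₑ < ⊤) :
    kernOp s z (fun y => f y - g y) x = kernOp s z f x - kernOp s z g x := by
  unfold kernOp
  rw [← integral_sub (integrable_conv_of_lintegral (measurable_kern s z) hf h1)
    (integrable_conv_of_lintegral (measurable_kern s z) hg h2)]
  simp only [map_sub]

lemma enorm_kernOp_le (s : ℤˣ) (z : ℂ) (f : Space → Spinor) (x : Space) :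
    ‖kernOp s z f x‖ₑ ≤ ∫⁻ y, ‖kern s z (x - y)‖ₑ * ‖f y‖ₑ :=
  lintegral_enorm_conv_le x f

lemma stronglyMeasurable_kernOp (s : ℤˣ) (z : ℂ) {f : Space → Spinor}
    (hf : StronglyMeasurable f) : StronglyMeasurable (kernOp s z f) :=
  stronglyMeasurable_conv (measurable_kern s z) hf

/-- Approximation in `L²` by test functions with controlled support. -/
lemma exists_test_approx {f : Space → Spinor} (hf : MemLp f 2) {R : ℝ} (hR : 0 < R)
    (hfR : ∀ y, R ≤ ‖y‖ → f y = 0) {ε : ℝ} (hε : 0 < ε) :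
    ∃ g : Space → Spinor, IsTest g ∧ (∀ y, 2 * R ≤ ‖y‖ → g y = 0) ∧
      eLpNorm (fun x => f x - g x) 2 ≤ ENNReal.ofReal ε := by
  obtain ⟨g, hg1, hg2, hg3⟩ := hf.exist_eLpNorm_sub_le (by norm_num) (by norm_num) hε
  -- Cutting the approximant off between R and 2R does not increase the error, because f vanishes
  -- where χ differs from 1.
  let χ : ContDiffBump (0 : Space) := ⟨R, 2 * R, hR, by linarith⟩
  have hs : ContDiff ℝ ∞ fun x => χ x • g x := ContDiff.smul χ.contDiff hg2
  have hc : HasCompactSupport fun x => χ x • g x :=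
    HasCompactSupport.smul_left (f := fun x => χ x) hg1
  refine ⟨fun x => χ x • g x, ⟨hs, hc⟩, fun y hy => ?_, ?_⟩
  · change χ y • g y = 0
    rw [χ.zero_of_le_dist (by simpa using hy), zero_smul]
  · refine le_trans (eLpNorm_mono fun x => ?_) hg3
    change ‖f x - χ x • g x‖ ≤ ‖f x - g x‖
    by_cases hx : R ≤ ‖x‖
    · rw [hfR x hx, zero_sub, zero_sub, norm_neg, norm_neg, norm_smul,
        Real.norm_of_nonneg χ.nonneg]
      exact mul_le_of_le_one_left (norm_nonneg _) χ.le_one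
    · rw [χ.one_of_mem_closedBall (by simpa using (not_le.1 hx).le), one_smul]

end Huygens

/-! ### The local bound for general functions, and duality. -/

section LocalBound

lemma integral_inner_left {g : Space → Spinor} (hg : Integrable g) (c : Spinor) :
    ∫ x, inner ℂ (g x) c = inner ℂ (∫ x, g x) c := by
  rw [← inner_conj_symm, ← integral_inner hg, ← integral_conj]
  simp only [inner_conj_symm]

lemma enorm_inner_le (a b : Spinor) : ‖inner ℂ a b‖ₑ ≤ ‖a‖ₑ * ‖b‖ₑ := by
  rw [← ofReal_norm, ← ofReal_norm, ← ofReal_norm, ← ENNReal.ofReal_mul (norm_nonneg _)]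
  exact ENNReal.ofReal_le_ofReal (norm_inner_le_norm _ _)

lemma eLpNorm_le_add_eLpNorm_sub {μ : Measure Space} {f g : Space → Spinor}
    (hf : StronglyMeasurable f) (hg : StronglyMeasurable g) :
    eLpNorm g 2 μ ≤ eLpNorm f 2 μ + eLpNorm (fun x => f x - g x) 2 μ := by
  have h := eLpNorm_sub_le (f := f) (g := f - g) (μ := μ) (p := 2) hf.aestronglyMeasurable
    (hf.sub hg).aestronglyMeasurable (by norm_num)
  rw [sub_sub_cancel] at h
  exact h

/-- The constant in the local `L²` bound for the resolvent kernel. -/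
noncomputable def localConst : ℝ := 16 * propConst ^ 2

lemma localConst_pos : 0 < localConst := by
  have := propConst_pos
  unfold localConst
  positivity

lemma lintegral_kernOp_ball_le_of_le {s : ℤˣ} {z : ℂ} (hz : 0 ≤ (((s : ℤ) : ℂ) * z).im)
    {f : Space → Spinor} (hfm : StronglyMeasurable f) (hf2 : ∫⁻ y, ‖f y‖ₑ ^ 2 < ⊤) {R₁ R₂ : ℝ}
    (hR₁ : 0 < R₁) (hR : R₁ ≤ R₂) (hf : ∀ x, R₁ ≤ ‖x‖ → f x = 0) :
    ∫⁻ x in Metric.ball 0 R₂, ‖kernOp s z f x‖ₑ ^ 2 ≤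
      ENNReal.ofReal (localConst * (R₁ * R₂)) * ∫⁻ x, ‖f x‖ₑ ^ 2 := by
  have hR₂ := hR₁.trans_le hR
  have hc := propConst_pos
  have hfL : MemLp f 2 := (memLp_two_iff_lintegral hfm.aestronglyMeasurable).2 hf2
  set μ := (volume : Measure Space).restrict (Metric.ball 0 R₂) with hμ
  set L : ℝ := √(localConst * (R₁ * R₂)) with hL
  have hLsq : L ^ 2 = localConst * (R₁ * R₂) :=
    Real.sq_sqrt (by have := localConst_pos; positivity)
  set Y : ℝ≥0∞ := ∫⁻ r, ‖kernLoc s z (2 * R₁ + R₂) r‖ₑ with hY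
  have hYt : Y < ⊤ := (integrable_kernLoc hz _).2
  have htest : ∀ g : Space → Spinor, IsTest g → (∀ y, 2 * R₁ ≤ ‖y‖ → g y = 0) →
      eLpNorm (kernOp s z g) 2 μ ≤ ENNReal.ofReal L * eLpNorm g 2 := by
    intro g hg hg0
    rw [← ENNReal.pow_le_pow_left_iff two_ne_zero, mul_pow, eLpNorm_two_sq, eLpNorm_two_sq,
      ← ENNReal.ofReal_pow (Real.sqrt_nonneg _), hLsq]
    -- The approximants live in the ball of radius 2R₁. Doubling both radii preserves their order
    -- and yields 4·2·2 = 16 in `localConst`.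
    have h1 := lintegral_kernOp_test_le hz hg (R₁ := 2 * R₁) (R₂ := 2 * R₂) (by positivity)
      (by linarith) hg0
    refine (lintegral_mono_set (Metric.ball_subset_ball (by linarith))).trans (h1.trans_eq ?_)
    congr 2
    unfold localConst; ring
  have hyoung : ∀ g : Space → Spinor, StronglyMeasurable g → (∀ y, 2 * R₁ ≤ ‖y‖ → g y = 0) →
      eLpNorm (kernOp s z g) 2 μ ≤ Y * eLpNorm g 2 := by
    intro g hg hg0
    rw [← ENNReal.pow_le_pow_left_iff two_ne_zero, mul_pow, eLpNorm_two_sq, eLpNorm_two_sq]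
    refine le_trans (lintegral_mono fun x => ?_) (lintegral_sq_kern_ball_le R₂ hg hg0)
    exact pow_le_pow_left' (enorm_kernOp_le s z g x) 2
  have hf' : ∀ y, 2 * R₁ ≤ ‖y‖ → f y = 0 := fun y hy => hf y (by linarith)
  -- The z-dependent Young constant Y multiplies only the approximation error, so it disappears as ε
  -- → 0 and the uniform constant remains.
  have key : ∀ ε : ℝ, 0 < ε → eLpNorm (kernOp s z f) 2 μ ≤
      ENNReal.ofReal L * eLpNorm f 2 + (ENNReal.ofReal L + Y) * ENNReal.ofReal ε := by
    intro ε hε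
    obtain ⟨g, hg, hg0, hfg⟩ := exists_test_approx hfL hR₁ hf hε
    have hgm : StronglyMeasurable g := hg.continuous.stronglyMeasurable
    have hg2 : ∫⁻ y, ‖g y‖ₑ ^ 2 < ⊤ := (memLp_two_iff_lintegral (hg.memLp 2).1).1 (hg.memLp 2)
    have e : kernOp s z f =ᵐ[μ] kernOp s z g + kernOp s z (fun y => f y - g y) := by
      refine ae_restrict_of_ae ?_
      filter_upwards [ae_integrable_kern_of_bounded_support hz hfm hf hf2,
        ae_integrable_kern_of_bounded_support hz hgm hg0 hg2] with x h1 h2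
      rw [Pi.add_apply, kernOp_sub hfm hgm h1 h2]
      abel
    have hd0 : ∀ y, 2 * R₁ ≤ ‖y‖ → f y - g y = 0 := fun y hy => by rw [hf' y hy, hg0 y hy, sub_zero]
    have hg' : eLpNorm g 2 ≤ eLpNorm f 2 + ENNReal.ofReal ε :=
      (eLpNorm_le_add_eLpNorm_sub hfm hgm).trans (add_le_add_right hfg _)
    rw [eLpNorm_congr_ae e]
    have hdm : StronglyMeasurable fun y => f y - g y := hfm.sub hgm
    have t1 := eLpNorm_add_le (μ := μ) (p := 2) (stronglyMeasurable_kernOp s z hgm).aestronglyMeasurable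
      (stronglyMeasurable_kernOp s z hdm).aestronglyMeasurable (by norm_num)
    have t2 := (htest g hg hg0).trans (mul_le_mul_right hg' _)
    have t3 := (hyoung _ hdm hd0).trans (mul_le_mul_right hfg _)
    refine t1.trans ((add_le_add t2 t3).trans_eq ?_)
    ring
  have hlim : eLpNorm (kernOp s z f) 2 μ ≤ ENNReal.ofReal L * eLpNorm f 2 := by
    have h1 : Tendsto (fun ε : ℝ => ENNReal.ofReal L * eLpNorm f 2 +
        (ENNReal.ofReal L + Y) * ENNReal.ofReal ε) (𝓝[>] 0)
        (𝓝 (ENNReal.ofReal L * eLpNorm f 2 + (ENNReal.ofReal L + Y) * ENNReal.ofReal 0)) := by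
      refine Tendsto.const_add _ (ENNReal.Tendsto.const_mul ?_
        (Or.inr (ENNReal.add_lt_top.2 ⟨ENNReal.ofReal_lt_top, hYt⟩).ne))
      exact (ENNReal.continuous_ofReal.tendsto 0).mono_left nhdsWithin_le_nhds
    rw [ENNReal.ofReal_zero, mul_zero, add_zero] at h1
    exact ge_of_tendsto h1 (eventually_mem_nhdsWithin.mono fun ε hε => key ε hε)
  have := pow_le_pow_left' hlim 2
  rwa [mul_pow, eLpNorm_two_sq, eLpNorm_two_sq, ← ENNReal.ofReal_pow (Real.sqrt_nonneg _),
    hLsq] at this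

lemma im_neg_conj (s : ℤˣ) (z : ℂ) :
    ((((-s : ℤˣ) : ℤ) : ℂ) * (starRingEnd ℂ) z).im = (((s : ℤ) : ℂ) * z).im := by
  rcases Int.units_eq_one_or s with rfl | rfl <;> simp

/-- The local `L²` bound for the resolvent kernel, uniform in the spectral parameter. -/
lemma lintegral_kernOp_ball_le {s : ℤˣ} {z : ℂ} (hz : 0 ≤ (((s : ℤ) : ℂ) * z).im)
    {f : Space → Spinor} (hfm : StronglyMeasurable f) (hf2 : ∫⁻ y, ‖f y‖ₑ ^ 2 < ⊤) {R₁ R₂ : ℝ}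
    (hR₁ : 0 < R₁) (hR₂ : 0 < R₂) (hf : ∀ x, R₁ ≤ ‖x‖ → f x = 0) :
    ∫⁻ x in Metric.ball 0 R₂, ‖kernOp s z f x‖ₑ ^ 2 ≤
      ENNReal.ofReal (localConst * (R₁ * R₂)) * ∫⁻ x, ‖f x‖ₑ ^ 2 := by
  rcases le_or_gt R₁ R₂ with hR | hR
  · exact lintegral_kernOp_ball_le_of_le hz hfm hf2 hR₁ hR hf
  -- Case R₁ > R₂, by duality. With g = 1_B Kf, the norm G of g squared is ⟨g, Kf⟩ = ⟨K*g, f⟩. Now g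
  -- lives in the smaller ball, and K* is an operator of the same family, so the case already proved
  -- bounds K*g on the larger ball.
  set B := Metric.ball (0 : Space) R₂ with hB
  set g : Space → Spinor := B.indicator (kernOp s z f) with hg
  have hgm : StronglyMeasurable g := (stronglyMeasurable_kernOp s z hfm).indicator measurableSet_ball
  have hg0 : ∀ y, R₂ ≤ ‖y‖ → g y = 0 := fun y hy =>
    Set.indicator_of_notMem (by rw [hB, mem_ball_zero_iff]; exact not_lt.2 hy) _
  have hge : ∀ y, ‖g y‖ₑ ^ 2 = B.indicator (fun y => ‖kernOp s z f y‖ₑ ^ 2) y := fun y => by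
    by_cases hy : y ∈ B <;> simp [hg, hy]
  set G := ∫⁻ x, ‖g x‖ₑ ^ 2 with hG
  have hGeq : ∫⁻ x in B, ‖kernOp s z f x‖ₑ ^ 2 = G := by
    rw [hG, lintegral_congr hge, lintegral_indicator measurableSet_ball]
  have hyoung := lintegral_sq_kern_ball_le (s := s) (z := z) R₂ hfm hf
  have hyt := hyoung.trans_lt
    (ENNReal.mul_lt_top (ENNReal.pow_lt_top (integrable_kernLoc hz (R₁ + R₂)).2) hf2)
  -- Finiteness, from the z-dependent Young bound, is needed in order to divide by G at the end.
  have hGt : G < ⊤ := by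
    rw [← hGeq]
    exact (lintegral_mono fun x => pow_le_pow_left' (enorm_kernOp_le s z f x) 2).trans_lt hyt
  have hz' : 0 ≤ ((((-s : ℤˣ) : ℤ) : ℂ) * (starRingEnd ℂ) z).im := by rwa [im_neg_conj]
  have hdual := lintegral_kernOp_ball_le_of_le hz' hgm hGt hR₂ hR.le hg0
  -- the pairing of `K f` with its restriction to the ball
  have hsm : StronglyMeasurable (fun p : Space × Space =>
      inner ℂ (g p.1) (kern s z (p.1 - p.2) (f p.2))) := by
    have h1 : StronglyMeasurable (fun p : Space × Space => kern s z (p.1 - p.2) (f p.2)) :=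
      (ContinuousLinearMap.apply ℂ Spinor).flip.continuous₂.comp_stronglyMeasurable
        (((measurable_kern s z).comp (measurable_fst.sub measurable_snd)).stronglyMeasurable.prodMk
          (hfm.comp_measurable measurable_snd))
    exact (hgm.comp_measurable measurable_fst).inner h1
  have hint : Integrable (Function.uncurry fun x y => inner ℂ (g x) (kern s z (x - y) (f y)))
      (volume.prod volume) := by
    refine ⟨hsm.aestronglyMeasurable, ?_⟩
    change ∫⁻ p : Space × Space, ‖inner ℂ (g p.1) (kern s z (p.1 - p.2) (f p.2))‖ₑ
      ∂(volume.prod volume) < ⊤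
    rw [lintegral_prod _ hsm.enorm.aemeasurable]
    have h2 : ∫⁻ x in B, ‖g x‖ₑ * ∫⁻ y, ‖kern s z (x - y)‖ₑ * ‖f y‖ₑ < ⊤ := by
      have h3 := (sq_lintegral_mul_le (μ := volume.restrict B) hgm.enorm.aemeasurable
        (measurable_lintegral_kern s z hfm).aemeasurable).trans_lt (ENNReal.mul_lt_top
          ((setLIntegral_le_lintegral _ _).trans_lt hGt) hyt)
      exact (ENNReal.pow_lt_top_iff.1 h3).resolve_right (by norm_num)
    refine lt_of_le_of_lt ?_ h2
    rw [← lintegral_indicator measurableSet_ball]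
    refine lintegral_mono fun x => ?_
    by_cases hx : x ∈ B
    · rw [Set.indicator_of_mem hx, ← lintegral_const_mul' _ _ enorm_ne_top]
      refine lintegral_mono fun y => ?_
      exact (enorm_inner_le _ _).trans
        (mul_le_mul_right (ContinuousLinearMap.le_opENorm _ _) _)
    · simp [hg, hx]
  have hf_ae := ae_integrable_kern_of_bounded_support hz hfm hf hf2
  have hg_ae := ae_integrable_kern_of_bounded_support hz' hgm hg0 hGt
  have e1 : ∫ x, inner ℂ (g x) (g x) = ∫ x, ∫ y, inner ℂ (g x) (kern s z (x - y) (f y)) := by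
    refine integral_congr_ae ?_
    filter_upwards [hf_ae] with x hx
    rw [integral_inner (integrable_conv_of_lintegral (measurable_kern s z) hfm hx)]
    by_cases hxB : x ∈ B
    · rw [show g x = kernOp s z f x from Set.indicator_of_mem hxB _]; rfl
    · simp [hg, hxB]
  have e2 : ∫ x, ∫ y, inner ℂ (g x) (kern s z (x - y) (f y)) =
      ∫ y, inner ℂ (kernOp (-s) ((starRingEnd ℂ) z) g y) (f y) := by
    rw [integral_integral_swap hint]
    refine integral_congr_ae ?_
    filter_upwards [hg_ae] with y hy
    have h3 := integral_inner_left (integrable_conv_of_lintegral (measurable_kern _ _) hgm hy) (f y)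
    rw [kernOp, ← h3]
    simp only [inner_kern_left, neg_neg, Complex.conj_conj, neg_sub]
  have hnorm : Integrable fun x => ‖g x‖ ^ 2 := by
    have := (memLp_two_iff_integrable_sq_norm hgm.aestronglyMeasurable).1
      ((memLp_two_iff_lintegral hgm.aestronglyMeasurable).2 hGt)
    exact this
  have e3 : G ≤ ∫⁻ y in Metric.ball 0 R₁,
      ‖kernOp (-s) ((starRingEnd ℂ) z) g y‖ₑ * ‖f y‖ₑ := by
    have h4 : G = ‖∫ x, inner ℂ (g x) (g x)‖ₑ := by
      rw [hG, lintegral_enorm_sq_eq_ofReal hnorm]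
      simp only [inner_self_eq_norm_sq_to_K]
      have h5 : ∫ x, ((‖g x‖ : ℂ)) ^ 2 = ((∫ x, ‖g x‖ ^ 2 : ℝ) : ℂ) := by
        rw [← integral_complex_ofReal]; simp
      have h6 : 0 ≤ ∫ x, ‖g x‖ ^ 2 := integral_nonneg fun _ => by positivity
      simp only [Complex.coe_algebraMap]
      rw [h5, ← ofReal_norm, Complex.norm_real, Real.norm_of_nonneg h6]
    rw [h4, e1, e2, ← lintegral_indicator measurableSet_ball]
    refine (enorm_integral_le_lintegral_enorm _).trans (lintegral_mono fun y => ?_)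
    by_cases hy : y ∈ Metric.ball (0 : Space) R₁
    · rw [Set.indicator_of_mem hy]; exact enorm_inner_le _ _
    · rw [mem_ball_zero_iff, not_lt] at hy
      simp [hf y hy]
  -- Cauchy–Schwarz in the pairing, with the dual local bound for K*g; cancelling one G gives the
  -- claim.
  have e4 : G ^ 2 ≤ (ENNReal.ofReal (localConst * (R₂ * R₁)) * ∫⁻ x, ‖f x‖ₑ ^ 2) * G := by
    refine (pow_le_pow_left' e3 2).trans ((sq_lintegral_mul_le
      (stronglyMeasurable_kernOp _ _ hgm).enorm.aemeasurable hfm.enorm.aemeasurable).trans ?_)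
    calc _ ≤ (ENNReal.ofReal (localConst * (R₂ * R₁)) * G) * ∫⁻ x, ‖f x‖ₑ ^ 2 :=
          mul_le_mul' hdual (setLIntegral_le_lintegral _ _)
      _ = _ := by ring
  rw [hGeq, mul_comm R₁ R₂]
  by_cases h0 : G = 0
  · rw [h0]; exact zero_le
  · rw [sq] at e4
    exact (ENNReal.mul_le_mul_iff_left h0 hGt.ne).1 e4

end LocalBound

/-! ### Weighted measures and convergence of the kernel integrals. -/

section WeightedMeasure

lemma measurable_ofReal_weight (β : ℝ) : Measurable fun x => ENNReal.ofReal (weight β x) :=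
  (measurable_weight β).ennreal_ofReal

lemma measurable_ofReal_inv_weight (β : ℝ) : Measurable fun x => ENNReal.ofReal (weight β x)⁻¹ :=
  (measurable_weight β).inv.ennreal_ofReal

lemma lintegral_weightMeasure (β : ℝ) {g : Space → ℝ≥0∞} (hg : Measurable g) :
    ∫⁻ x, g x ∂(weightMeasure β) = ∫⁻ x, ENNReal.ofReal (weight β x) * g x := by
  rw [weightMeasure, lintegral_withDensity_eq_lintegral_mul _ (measurable_ofReal_weight β) hg]
  rfl

lemma lintegral_invWeightMeasure (β : ℝ) {g : Space → ℝ≥0∞} (hg : Measurable g) :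
    ∫⁻ x, g x ∂(invWeightMeasure β) = ∫⁻ x, ENNReal.ofReal (weight β x)⁻¹ * g x := by
  rw [invWeightMeasure,
    lintegral_withDensity_eq_lintegral_mul _ (measurable_ofReal_inv_weight β) hg]
  rfl

lemma invWeightMeasure_ac (β : ℝ) : invWeightMeasure β ≪ (volume : Measure Space) :=
  withDensity_absolutelyContinuous _ _

/-- The density is positive off the origin. Lebesgue measure and the weighted measures therefore
have the same null sets, and almost-everywhere statements pass freely between them. -/
lemma ac_weightMeasure (β : ℝ) : (volume : Measure Space) ≪ weightMeasure β :=
  withDensity_absolutelyContinuous' (measurable_ofReal_weight β).aemeasurable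
    (ae_ne_zero.mono fun x hx => by simpa using weight_pos β hx)

lemma ac_invWeightMeasure (β : ℝ) : (volume : Measure Space) ≪ invWeightMeasure β :=
  withDensity_absolutelyContinuous' (measurable_ofReal_inv_weight β).aemeasurable
    (ae_ne_zero.mono fun x hx => by simpa using weight_pos β hx)

/-- Cauchy–Schwarz with the weight. -/
lemma sq_lintegral_mul_le_weight (β : ℝ) {a : Space → ℝ} (ha : Measurable a) (ha0 : ∀ y, 0 ≤ a y)
    {f : Space → ℝ≥0∞} (hf : Measurable f) :
    (∫⁻ y, ENNReal.ofReal (a y) * f y) ^ 2 ≤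
      (∫⁻ y, ENNReal.ofReal (a y ^ 2 * (weight β y)⁻¹)) *
        ∫⁻ y, ENNReal.ofReal (weight β y) * f y ^ 2 := by
  have e : ∫⁻ y, ENNReal.ofReal (a y) * f y = ∫⁻ y, ENNReal.ofReal (a y * √(weight β y)⁻¹) *
      (ENNReal.ofReal √(weight β y) * f y) := by
    refine lintegral_congr_ae ?_
    filter_upwards [ae_ne_zero] with y hy
    have hw := weight_pos β hy
    rw [← mul_assoc, ← ENNReal.ofReal_mul (mul_nonneg (ha0 y) (Real.sqrt_nonneg _)), mul_assoc,
      ← Real.sqrt_mul (inv_nonneg.2 hw.le), inv_mul_cancel₀ hw.ne', Real.sqrt_one, mul_one]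
  have m1 : Measurable fun y => ENNReal.ofReal (a y * √(weight β y)⁻¹) :=
    (ha.mul (measurable_weight β).inv.sqrt).ennreal_ofReal
  have m2 : Measurable fun y => ENNReal.ofReal √(weight β y) * f y :=
    (measurable_weight β).sqrt.ennreal_ofReal.mul hf
  rw [e]
  refine (sq_lintegral_mul_le m1.aemeasurable m2.aemeasurable).trans_eq ?_
  congr 1
  · refine lintegral_congr fun y => ?_
    rw [← ENNReal.ofReal_pow (mul_nonneg (ha0 y) (Real.sqrt_nonneg _)), mul_pow,
      Real.sq_sqrt (inv_nonneg.2 (weight_nonneg β y))]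
  · refine lintegral_congr fun y => ?_
    rw [mul_pow, ← ENNReal.ofReal_pow (Real.sqrt_nonneg _), Real.sq_sqrt (weight_nonneg β y)]

lemma lt_top_of_sq_le {a b : ℝ≥0∞} (h : a ^ 2 ≤ b) (hb : b < ⊤) : a < ⊤ :=
  (ENNReal.pow_lt_top_iff.1 (h.trans_lt hb)).resolve_right (by norm_num)

variable {β : ℝ}

lemma lintegral_inv_sub_mul_lt_top (hβ : 1 < β) {f : Space → ℝ≥0∞} (hf : Measurable f)
    (hF : ∫⁻ y, ENNReal.ofReal (weight β y) * f y ^ 2 < ⊤) (x : Space) :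
    ∫⁻ y, ENNReal.ofReal ‖x - y‖⁻¹ * f y < ⊤ := by
  obtain ⟨A, -, hA⟩ := exists_lintegral_inv_sq_sub_mul_inv_weight_le hβ
  exact lt_top_of_sq_le (sq_lintegral_mul_le_weight β (a := fun y => ‖x - y‖⁻¹)
    (by fun_prop) (fun y => by positivity) hf)
    (ENNReal.mul_lt_top ((hA x).trans_lt ENNReal.ofReal_lt_top) hF)

lemma lintegral_ball_lt_top (hβ : 1 < β) {f : Space → ℝ≥0∞} (hf : Measurable f)
    (hF : ∫⁻ y, ENNReal.ofReal (weight β y) * f y ^ 2 < ⊤) (R : ℝ) :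
    ∫⁻ y in Metric.ball 0 R, f y < ⊤ := by
  set a : Space → ℝ := (Metric.ball (0 : Space) R).indicator 1 with ha
  have ham : Measurable a := measurable_one.indicator measurableSet_ball
  have h1 := sq_lintegral_mul_le_weight β ham
    (fun y => Set.indicator_nonneg (fun _ _ => zero_le_one) y) hf
  have e1 : ∫⁻ y, ENNReal.ofReal (a y) * f y = ∫⁻ y in Metric.ball 0 R, f y := by
    rw [← lintegral_indicator measurableSet_ball]
    refine lintegral_congr fun y => ?_
    by_cases hy : y ∈ Metric.ball (0 : Space) R <;> simp [ha, hy]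
  have e2 : ∫⁻ y, ENNReal.ofReal (a y ^ 2 * (weight β y)⁻¹) =
      ∫⁻ y in Metric.ball 0 R, ENNReal.ofReal (weight β y)⁻¹ := by
    rw [← lintegral_indicator measurableSet_ball]
    refine lintegral_congr fun y => ?_
    by_cases hy : y ∈ Metric.ball (0 : Space) R <;> simp [ha, hy]
  rw [e1, e2] at h1
  refine lt_top_of_sq_le h1 (ENNReal.mul_lt_top ?_ hF)
  have h2 := (integrableOn_inv_weight hβ R).mono_set Metric.ball_subset_closedBall
  exact h2.lintegral_lt_top

/-- Since |x-y|⁻⁴ is not locally integrable, Cauchy–Schwarz at fixed x is not available here. On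
bounded sets one integrates in x first, which gives finiteness for almost every x; at distance at
least 1 the kernel is dominated by |x-y|⁻¹. -/
lemma ae_lintegral_inv_sq_sub_mul_lt_top (hβ : 1 < β) {f : Space → ℝ≥0∞} (hf : Measurable f)
    (hF : ∫⁻ y, ENNReal.ofReal (weight β y) * f y ^ 2 < ⊤) :
    ∀ᵐ x, ∫⁻ y, ENNReal.ofReal (‖x - y‖⁻¹ ^ 2) * f y < ⊤ := by
  have hm2 : Measurable fun p : Space × Space => ENNReal.ofReal (‖p.1 - p.2‖⁻¹ ^ 2) * f p.2 := by
    refine Measurable.mul ?_ (hf.comp measurable_snd)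
    exact Measurable.ennreal_ofReal (by fun_prop)
  have key : ∀ n : ℕ, ∀ᵐ x, x ∈ Metric.ball (0 : Space) n →
      ∫⁻ y in Metric.ball 0 ((n : ℝ) + 1), ENNReal.ofReal (‖x - y‖⁻¹ ^ 2) * f y < ⊤ := by
    intro n
    set B := Metric.ball (0 : Space) n with hB
    set B' := Metric.ball (0 : Space) ((n : ℝ) + 1) with hB'
    have h1 : ∫⁻ x in B, ∫⁻ y in B', ENNReal.ofReal (‖x - y‖⁻¹ ^ 2) * f y < ⊤ := by
      rw [lintegral_lintegral_swap hm2.aemeasurable]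
      have h2 : ∀ y ∈ B', ∫⁻ x in B, ENNReal.ofReal (‖x - y‖⁻¹ ^ 2) * f y ≤
          (∫⁻ r in Metric.ball (0 : Space) (2 * n + 1), ENNReal.ofReal (‖r‖⁻¹ ^ 2)) * f y := by
        intro y hy
        have hm : Measurable fun x : Space => ENNReal.ofReal (‖x - y‖⁻¹ ^ 2) :=
          Measurable.ennreal_ofReal (by fun_prop)
        rw [lintegral_mul_const _ hm]
        refine mul_le_mul_left ?_ _
        rw [← lintegral_indicator measurableSet_ball, ← lintegral_indicator measurableSet_ball,
          ← lintegral_sub_right_eq_self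
            ((Metric.ball (0 : Space) (2 * n + 1)).indicator fun r => ENNReal.ofReal (‖r‖⁻¹ ^ 2)) y]
        refine lintegral_mono fun x => ?_
        by_cases hx : x ∈ B
        · rw [Set.indicator_of_mem hx, Set.indicator_of_mem]
          rw [mem_ball_zero_iff]
          rw [hB, mem_ball_zero_iff] at hx
          rw [hB', mem_ball_zero_iff] at hy
          have := norm_sub_le x y
          linarith
        · rw [Set.indicator_of_notMem hx]; exact zero_le
      refine (setLIntegral_mono' measurableSet_ball h2).trans_lt ?_
      rw [lintegral_const_mul _ hf, lintegral_inv_norm_sq_ball _ (by positivity)]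
      exact ENNReal.mul_lt_top ENNReal.ofReal_lt_top (lintegral_ball_lt_top hβ hf hF _)
    have hm3 : Measurable fun x => ∫⁻ y in B', ENNReal.ofReal (‖x - y‖⁻¹ ^ 2) * f y :=
      Measurable.lintegral_prod_right' hm2
    have h3 := ae_lt_top hm3 h1.ne
    rwa [ae_restrict_iff' measurableSet_ball] at h3
  filter_upwards [ae_all_iff.2 key] with x hx
  obtain ⟨n, hn⟩ := exists_nat_gt ‖x‖
  -- With |x| < n, points y outside the ball of radius n + 1 satisfy |x-y| ≥ 1.
  rw [← lintegral_add_compl _ (measurableSet_ball (x := (0 : Space)) (ε := (n : ℝ) + 1))]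
  refine ENNReal.add_lt_top.2 ⟨hx n (mem_ball_zero_iff.2 hn), ?_⟩
  refine lt_of_le_of_lt ?_ (lintegral_inv_sub_mul_lt_top hβ hf hF x)
  refine (setLIntegral_mono' measurableSet_ball.compl fun y hy => ?_).trans
    (setLIntegral_le_lintegral (Metric.ball 0 ((n : ℝ) + 1))ᶜ _)
  refine mul_le_mul_left (ENNReal.ofReal_le_ofReal ?_) _
  rw [Set.mem_compl_iff, mem_ball_zero_iff, not_lt] at hy
  have h1 : 1 ≤ ‖x - y‖ := by
    have := norm_sub_norm_le y x
    rw [norm_sub_rev] at this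
    linarith
  have h2 : ‖x - y‖⁻¹ ≤ 1 := inv_le_one_of_one_le₀ h1
  rw [sq]
  exact mul_le_of_le_one_left (by positivity) h2

lemma enorm_kern_le {s : ℤˣ} {z : ℂ} (hz : 0 ≤ (((s : ℤ) : ℂ) * z).im) (r : Space) :
    ‖kern s z r‖ₑ ≤ ENNReal.ofReal (alphaConst * ‖z‖) * ENNReal.ofReal ‖r‖⁻¹ +
      ENNReal.ofReal alphaConst * ENNReal.ofReal (‖r‖⁻¹ ^ 2) := by
  have ha := alphaConst_pos.le
  rw [← ENNReal.ofReal_mul (by positivity), ← ENNReal.ofReal_mul ha,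
    ← ENNReal.ofReal_add (by positivity) (by positivity), ← ofReal_norm]
  refine ENNReal.ofReal_le_ofReal ((norm_kern_le hz r).trans_eq ?_)
  ring

lemma ae_lintegral_kern_lt_top (hβ : 1 < β) {s : ℤˣ} {z : ℂ} (hz : 0 ≤ (((s : ℤ) : ℂ) * z).im)
    {f : Space → Spinor} (hf : StronglyMeasurable f)
    (hF : ∫⁻ y, ENNReal.ofReal (weight β y) * ‖f y‖ₑ ^ 2 < ⊤) :
    ∀ᵐ x, ∫⁻ y, ‖kern s z (x - y)‖ₑ * ‖f y‖ₑ < ⊤ := by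
  have hfm := hf.measurable.enorm
  filter_upwards [ae_lintegral_inv_sq_sub_mul_lt_top hβ hfm hF] with x hx
  have hx' := lintegral_inv_sub_mul_lt_top hβ hfm hF x
  have m1 : Measurable fun y => ENNReal.ofReal ‖x - y‖⁻¹ * ‖f y‖ₑ :=
    (Measurable.ennreal_ofReal (by fun_prop)).mul hfm
  calc ∫⁻ y, ‖kern s z (x - y)‖ₑ * ‖f y‖ₑ
      ≤ ∫⁻ y, (ENNReal.ofReal (alphaConst * ‖z‖) * (ENNReal.ofReal ‖x - y‖⁻¹ * ‖f y‖ₑ) +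
          ENNReal.ofReal alphaConst * (ENNReal.ofReal (‖x - y‖⁻¹ ^ 2) * ‖f y‖ₑ)) := by
        refine lintegral_mono fun y => ?_
        refine (mul_le_mul_left (enorm_kern_le hz (x - y)) _).trans_eq ?_
        ring
    _ < ⊤ := by
        rw [lintegral_add_left (m1.const_mul _), lintegral_const_mul' _ _ ENNReal.ofReal_ne_top,
          lintegral_const_mul' _ _ ENNReal.ofReal_ne_top]
        exact ENNReal.add_lt_top.2 ⟨ENNReal.mul_lt_top ENNReal.ofReal_lt_top hx',
          ENNReal.mul_lt_top ENNReal.ofReal_lt_top hx⟩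

end WeightedMeasure

/-! ### Exponential shells. -/

section Shells

/-- Dyadic-type shells `e^j ≤ |x| < e^{j+1}`. -/
def shell (j : ℤ) : Set Space := {x | x ≠ 0 ∧ ⌊Real.log ‖x‖⌋ = j}

lemma measurableSet_shell (j : ℤ) : MeasurableSet (shell j) := by
  refine (measurableSet_singleton (0 : Space)).compl.inter ?_
  have : Measurable fun x : Space => ⌊Real.log ‖x‖⌋ := by fun_prop
  exact this (measurableSet_singleton j)

lemma pairwise_disjoint_shell : Pairwise (Function.onFun Disjoint shell) := by
  intro i j hij
  refine Set.disjoint_left.2 fun x hi hj => hij ?_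
  exact hi.2.symm.trans hj.2

lemma iUnion_shell : ⋃ j, shell j = {0}ᶜ := by
  ext x
  simp [shell]

lemma exp_le_norm_of_mem_shell {j : ℤ} {x : Space} (h : x ∈ shell j) : Real.exp j ≤ ‖x‖ := by
  have hx := norm_pos_iff.2 h.1
  rw [← Real.le_log_iff_exp_le hx, ← h.2]
  exact Int.floor_le _

lemma norm_lt_exp_of_mem_shell {j : ℤ} {x : Space} (h : x ∈ shell j) :
    ‖x‖ < Real.exp (j + 1) := by
  have hx := norm_pos_iff.2 h.1
  rw [← Real.log_lt_iff_lt_exp hx, ← h.2]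
  exact Int.lt_floor_add_one _

/-- Lower bound for the weight on a shell. -/
lemma weight_ge_of_mem_shell {β : ℝ} (hβ : 0 ≤ β) {j : ℤ} {x : Space} (h : x ∈ shell j) :
    Real.exp j * (1 + |(j : ℝ)|) ^ β * (2 : ℝ) ^ (-β) ≤ weight β x := by
  have h1 : (1 + |(j : ℝ)|) / 2 ≤ |Real.log ‖x‖| + 1 := by
    have h2 : (j : ℝ) ≤ Real.log ‖x‖ := by rw [← h.2]; exact Int.floor_le _
    have h3 : Real.log ‖x‖ < j + 1 := by rw [← h.2]; exact Int.lt_floor_add_one _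
    have h4 : |(j : ℝ)| ≤ |Real.log ‖x‖| + 1 := by
      rw [abs_le]
      have h5 := neg_abs_le (Real.log ‖x‖)
      have h6 := le_abs_self (Real.log ‖x‖)
      constructor <;> linarith
    have := abs_nonneg (Real.log ‖x‖)
    linarith
  have h2 : (1 + |(j : ℝ)|) ^ β * (2 : ℝ) ^ (-β) = ((1 + |(j : ℝ)|) / 2) ^ β := by
    rw [Real.div_rpow (by positivity) (by norm_num), Real.rpow_neg (by norm_num), div_eq_mul_inv]
  rw [mul_assoc, h2, weight]
  exact mul_le_mul (exp_le_norm_of_mem_shell h) (Real.rpow_le_rpow (by positivity) h1 hβ)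
    (by positivity) (norm_nonneg _)

/-- The summable weights `(1 + |j|)^{-β}`. -/
noncomputable def shellWeight (β : ℝ) (j : ℤ) : ℝ := (1 + |(j : ℝ)|) ^ (-β)

lemma shellWeight_pos (β : ℝ) (j : ℤ) : 0 < shellWeight β j := by
  unfold shellWeight; positivity

lemma summable_shellWeight {β : ℝ} (hβ : 1 < β) : Summable (shellWeight β) := by
  have h : Summable fun n : ℕ => (1 + (n : ℝ)) ^ (-β) := by
    have := (summable_nat_add_iff 1).2 (Real.summable_nat_rpow.2 (show -β < -1 by linarith))
    refine this.congr fun n => ?_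
    push_cast; ring_nf
  refine Summable.of_nat_of_neg ?_ ?_ <;> simpa [shellWeight] using h

end Shells

/-! ### The uniform weighted bound. -/

section UniformBound

lemma setLIntegral_compl_zero (g : Space → ℝ≥0∞) :
    ∫⁻ x in ({0}ᶜ : Set Space), g x = ∫⁻ x, g x := by
  rw [restrict_compl_singleton]

lemma lintegral_eq_tsum_shell (g : Space → ℝ≥0∞) :
    ∫⁻ x, g x = ∑' j, ∫⁻ x in shell j, g x := by
  rw [← lintegral_iUnion measurableSet_shell pairwise_disjoint_shell, iUnion_shell,
    setLIntegral_compl_zero]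

lemma enorm_kernOp_le_tsum {s : ℤˣ} {z : ℂ} {f : Space → Spinor} (hf : StronglyMeasurable f)
    {x : Space} (h : ∫⁻ y, ‖kern s z (x - y)‖ₑ * ‖f y‖ₑ < ⊤) :
    ‖kernOp s z f x‖ₑ ≤ ∑' j, ‖kernOp s z ((shell j).indicator f) x‖ₑ := by
  have hi := integrable_conv_of_lintegral (measurable_kern s z) hf h
  have h1 := hasSum_integral_iUnion measurableSet_shell pairwise_disjoint_shell hi.integrableOn
  rw [iUnion_shell, restrict_compl_singleton] at h1
  have e : ∀ j, kernOp s z ((shell j).indicator f) x =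
      ∫ y in shell j, kern s z (x - y) (f y) := by
    intro j
    rw [kernOp, ← integral_indicator (measurableSet_shell j)]
    refine integral_congr_ae (Eventually.of_forall fun y => ?_)
    by_cases hy : y ∈ shell j <;> simp [hy]
  simp only [e]
  rw [kernOp, ← h1.tsum_eq]
  by_cases htop : ∑' j, ‖∫ y in shell j, kern s z (x - y) (f y)‖ₑ = ⊤
  · rw [htop]; exact le_top
  · exact enorm_tsum_le_tsum_enorm

lemma inv_weight_le_of_mem_shell {β : ℝ} (hβ : 0 ≤ β) {j : ℤ} {x : Space} (h : x ∈ shell j) :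
    (weight β x)⁻¹ ≤ (2 : ℝ) ^ β * Real.exp (-j) * shellWeight β j := by
  have h1 := weight_ge_of_mem_shell hβ h
  have h2 : 0 < Real.exp j * (1 + |(j : ℝ)|) ^ β * (2 : ℝ) ^ (-β) := by positivity
  refine (inv_anti₀ h2 h1).trans_eq ?_
  rw [shellWeight, Real.rpow_neg (by norm_num), Real.rpow_neg (by positivity), Real.exp_neg]
  field_simp

lemma exp_mul_inv_shellWeight_le {β : ℝ} (hβ : 0 ≤ β) {j : ℤ} {x : Space} (h : x ∈ shell j) :
    Real.exp j * (shellWeight β j)⁻¹ ≤ (2 : ℝ) ^ β * weight β x := by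
  have h1 := weight_ge_of_mem_shell hβ h
  have h2 : (0 : ℝ) < (2 : ℝ) ^ β := by positivity
  rw [shellWeight, Real.rpow_neg (by positivity), inv_inv]
  calc _ = (2 : ℝ) ^ β * (Real.exp j * (1 + |(j : ℝ)|) ^ β * (2 : ℝ) ^ (-β)) := by
        rw [Real.rpow_neg (by norm_num)]; field_simp
    _ ≤ _ := mul_le_mul_of_nonneg_left h1 h2.le

/-- `L²(w_β dx) → L²(w_β⁻¹ dx)` bound for the resolvent kernel, uniform in the spectral
parameter. -/
theorem exists_uniform_bound {β : ℝ} (hβ : 1 < β) : ∃ C : ℝ, 0 ≤ C ∧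
    ∀ (s : ℤˣ) (z : ℂ), 0 ≤ (((s : ℤ) : ℂ) * z).im → ∀ f : Space → Spinor, StronglyMeasurable f →
      ∫⁻ y, ENNReal.ofReal (weight β y) * ‖f y‖ₑ ^ 2 < ⊤ →
      ∫⁻ x, ENNReal.ofReal (weight β x)⁻¹ * ‖kernOp s z f x‖ₑ ^ 2 ≤
        ENNReal.ofReal (C ^ 2) * ∫⁻ y, ENNReal.ofReal (weight β y) * ‖f y‖ₑ ^ 2 := by
  have hβ0 : 0 ≤ β := by linarith
  have hl := localConst_pos
  set T : ℝ := ∑' j, shellWeight β j with hT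
  have hT0 : 0 ≤ T := tsum_nonneg fun j => (shellWeight_pos β j).le
  have hsum : ∑' j, ENNReal.ofReal (shellWeight β j) = ENNReal.ofReal T :=
    (ENNReal.ofReal_tsum_of_nonneg (fun j => (shellWeight_pos β j).le)
      (summable_shellWeight hβ)).symm
  -- The local bound with radii e^{j+1} and e^{k+1} gives e²·e^j·e^k; the factor 2^β compares the
  -- weight with its value read off from the shell index.
  set c₁ : ℝ := localConst * Real.exp 2 * (2 : ℝ) ^ β with hc₁
  have hc₁0 : 0 ≤ c₁ := by positivity
  -- One factor T comes from summing the pieces of f, the other from summing over the shells in x.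
  -- The second 2^β comes from bounding the inverse weight on the outer shells.
  refine ⟨√(T * T * (2 : ℝ) ^ β * c₁), Real.sqrt_nonneg _, fun s z hz f hf hF => ?_⟩
  rw [Real.sq_sqrt (by positivity)]
  set F := ∫⁻ y, ENNReal.ofReal (weight β y) * ‖f y‖ₑ ^ 2 with hFdef
  have hshell : ∀ j : ℤ, ENNReal.ofReal (Real.exp j * (shellWeight β j)⁻¹) *
      ∫⁻ y in shell j, ‖f y‖ₑ ^ 2 ≤ ENNReal.ofReal ((2 : ℝ) ^ β) *
        ∫⁻ y in shell j, ENNReal.ofReal (weight β y) * ‖f y‖ₑ ^ 2 := by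
    intro j
    rw [← lintegral_const_mul' _ _ ENNReal.ofReal_ne_top,
      ← lintegral_const_mul' _ _ ENNReal.ofReal_ne_top]
    refine setLIntegral_mono' (measurableSet_shell j) fun y hy => ?_
    rw [← mul_assoc, ← ENNReal.ofReal_mul (by positivity)]
    exact mul_le_mul_left (ENNReal.ofReal_le_ofReal (exp_mul_inv_shellWeight_le hβ0 hy)) _
  have hfin : ∀ j : ℤ, ∫⁻ y in shell j, ‖f y‖ₑ ^ 2 < ⊤ := by
    intro j
    have h1 := (hshell j).trans_lt (ENNReal.mul_lt_top ENNReal.ofReal_lt_top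
      ((setLIntegral_le_lintegral _ _).trans_lt hF))
    have h2 : ENNReal.ofReal (Real.exp j * (shellWeight β j)⁻¹) ≠ 0 := by
      have := shellWeight_pos β j
      rw [Ne, ENNReal.ofReal_eq_zero, not_le]; positivity
    by_contra h3
    rw [not_lt, top_le_iff] at h3
    rw [h3, ENNReal.mul_top h2] at h1
    exact lt_irrefl _ h1
  have hfj : ∀ j : ℤ, StronglyMeasurable ((shell j).indicator f) := fun j =>
    hf.indicator (measurableSet_shell j)
  have hfj2 : ∀ j : ℤ, ∫⁻ y, ‖(shell j).indicator f y‖ₑ ^ 2 = ∫⁻ y in shell j, ‖f y‖ₑ ^ 2 := by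
    intro j
    rw [← lintegral_indicator (measurableSet_shell j)]
    refine lintegral_congr fun y => ?_
    by_cases hy : y ∈ shell j <;> simp [hy]
  have hfj0 : ∀ (j : ℤ) (y : Space), Real.exp (j + 1) ≤ ‖y‖ → (shell j).indicator f y = 0 :=
    fun j y hy => Set.indicator_of_notMem (fun h => absurd (norm_lt_exp_of_mem_shell h) (not_lt.2 hy)) _
  -- Linear growth of the squared L² norm over balls, as in Agmon–Hörmander estimates.
  -- Cauchy–Schwarz over the source shells with weights (1+|j|)^{-β} makes the sum over j converge,
  -- and its cost is absorbed by the weight of f.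
  have hball : ∀ k : ℤ, ∫⁻ x in Metric.ball 0 (Real.exp (k + 1)), ‖kernOp s z f x‖ₑ ^ 2 ≤
      ENNReal.ofReal (T * c₁ * Real.exp k) * F := by
    intro k
    calc ∫⁻ x in Metric.ball 0 (Real.exp (k + 1)), ‖kernOp s z f x‖ₑ ^ 2
        ≤ ∫⁻ x in Metric.ball 0 (Real.exp (k + 1)), ENNReal.ofReal T *
            ∑' j, (ENNReal.ofReal (shellWeight β j))⁻¹ *
              ‖kernOp s z ((shell j).indicator f) x‖ₑ ^ 2 := by
          refine lintegral_mono_ae (ae_restrict_of_ae ?_)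
          filter_upwards [ae_lintegral_kern_lt_top hβ hz hf hF] with x hx
          refine (pow_le_pow_left' (enorm_kernOp_le_tsum hf hx) 2).trans ?_
          rw [← hsum]
          exact sq_tsum_le _ _ (fun j => by simpa using shellWeight_pos β j)
            fun j => ENNReal.ofReal_ne_top
      _ = ENNReal.ofReal T * ∑' j, (ENNReal.ofReal (shellWeight β j))⁻¹ *
            ∫⁻ x in Metric.ball 0 (Real.exp (k + 1)),
              ‖kernOp s z ((shell j).indicator f) x‖ₑ ^ 2 := by
          have hm : ∀ j : ℤ, Measurable fun x => ‖kernOp s z ((shell j).indicator f) x‖ₑ ^ 2 :=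
            fun j => (stronglyMeasurable_kernOp s z (hfj j)).measurable.enorm.pow_const 2
          rw [lintegral_const_mul' _ _ ENNReal.ofReal_ne_top,
            lintegral_tsum fun j => ((hm j).const_mul _).aemeasurable]
          congr 1
          refine tsum_congr fun j => ?_
          rw [lintegral_const_mul _ (hm j)]
      _ ≤ ENNReal.ofReal T * ∑' j, ENNReal.ofReal (c₁ * Real.exp k) *
            ∫⁻ y in shell j, ENNReal.ofReal (weight β y) * ‖f y‖ₑ ^ 2 := by
          refine mul_le_mul_right (ENNReal.tsum_le_tsum fun j => ?_) _
          have hsw := shellWeight_pos β j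
          have h1 := lintegral_kernOp_ball_le hz (hfj j) (by rw [hfj2]; exact hfin j)
            (Real.exp_pos (j + 1)) (Real.exp_pos (k + 1)) (hfj0 j)
          rw [hfj2] at h1
          calc _ ≤ (ENNReal.ofReal (shellWeight β j))⁻¹ *
                (ENNReal.ofReal (localConst * (Real.exp (j + 1) * Real.exp (k + 1))) *
                  ∫⁻ y in shell j, ‖f y‖ₑ ^ 2) := mul_le_mul_right h1 _
            _ = ENNReal.ofReal (localConst * Real.exp 2 * Real.exp k) *
                (ENNReal.ofReal (Real.exp j * (shellWeight β j)⁻¹) *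
                  ∫⁻ y in shell j, ‖f y‖ₑ ^ 2) := by
                have e : ENNReal.ofReal (shellWeight β j)⁻¹ *
                    ENNReal.ofReal (localConst * (Real.exp (j + 1) * Real.exp (k + 1))) =
                    ENNReal.ofReal (localConst * Real.exp 2 * Real.exp k) *
                    ENNReal.ofReal (Real.exp j * (shellWeight β j)⁻¹) := by
                  rw [← ENNReal.ofReal_mul (by positivity), ← ENNReal.ofReal_mul (by positivity)]
                  congr 1
                  rw [show (2 : ℝ) = 1 + 1 by norm_num, Real.exp_add, Real.exp_add, Real.exp_add]
                  ring
                rw [← ENNReal.ofReal_inv_of_pos hsw, ← mul_assoc, e, mul_assoc]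
            _ ≤ ENNReal.ofReal (localConst * Real.exp 2 * Real.exp k) *
                (ENNReal.ofReal ((2 : ℝ) ^ β) *
                  ∫⁻ y in shell j, ENNReal.ofReal (weight β y) * ‖f y‖ₑ ^ 2) :=
                mul_le_mul_right (hshell j) _
            _ = _ := by
                rw [← mul_assoc, ← ENNReal.ofReal_mul (by positivity)]
                congr 2
                rw [hc₁]; ring
      _ = _ := by
          rw [ENNReal.tsum_mul_left, ← lintegral_eq_tsum_shell, ← mul_assoc,
            ← ENNReal.ofReal_mul hT0, ← mul_assoc]
  -- On the k-th shell the inverse weight is of size e^{-k}(1+|k|)^{-β}: the exponential cancels the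
  -- growth over balls and the rest is summable.
  rw [lintegral_eq_tsum_shell]
  calc ∑' k, ∫⁻ x in shell k, ENNReal.ofReal (weight β x)⁻¹ * ‖kernOp s z f x‖ₑ ^ 2
      ≤ ∑' k : ℤ, ENNReal.ofReal (shellWeight β k) *
          (ENNReal.ofReal (T * (2 : ℝ) ^ β * c₁) * F) := by
        refine ENNReal.tsum_le_tsum fun k => ?_
        have hsw := shellWeight_pos β k
        calc ∫⁻ x in shell k, ENNReal.ofReal (weight β x)⁻¹ * ‖kernOp s z f x‖ₑ ^ 2
            ≤ ∫⁻ x in shell k, ENNReal.ofReal ((2 : ℝ) ^ β * Real.exp (-k) * shellWeight β k) *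
                ‖kernOp s z f x‖ₑ ^ 2 := by
              refine setLIntegral_mono' (measurableSet_shell k) fun x hx => ?_
              exact mul_le_mul_left (ENNReal.ofReal_le_ofReal (inv_weight_le_of_mem_shell hβ0 hx)) _
          _ ≤ ENNReal.ofReal ((2 : ℝ) ^ β * Real.exp (-k) * shellWeight β k) *
                ∫⁻ x in Metric.ball 0 (Real.exp (k + 1)), ‖kernOp s z f x‖ₑ ^ 2 := by
              rw [lintegral_const_mul' _ _ ENNReal.ofReal_ne_top]
              refine mul_le_mul_right (lintegral_mono_set fun x hx => ?_) _
              exact mem_ball_zero_iff.2 (norm_lt_exp_of_mem_shell hx)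
          _ ≤ ENNReal.ofReal ((2 : ℝ) ^ β * Real.exp (-k) * shellWeight β k) *
                (ENNReal.ofReal (T * c₁ * Real.exp k) * F) := mul_le_mul_right (hball k) _
          _ = _ := by
              have e : ENNReal.ofReal ((2 : ℝ) ^ β * Real.exp (-k) * shellWeight β k) *
                  ENNReal.ofReal (T * c₁ * Real.exp k) =
                  ENNReal.ofReal (shellWeight β k) * ENNReal.ofReal (T * (2 : ℝ) ^ β * c₁) := by
                rw [← ENNReal.ofReal_mul (by positivity), ← ENNReal.ofReal_mul (by positivity)]
                congr 1
                rw [Real.exp_neg]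
                field_simp
              rw [← mul_assoc, e, mul_assoc]
    _ = _ := by
        rw [ENNReal.tsum_mul_right, hsum, ← mul_assoc, ← ENNReal.ofReal_mul hT0]
        congr 2
        ring

end UniformBound

/-! ### The operators between the weighted spaces. -/

section WeightedOperator

variable {β : ℝ}

lemma lintegral_weight_Lp (f : L2Weight β) :
    ∫⁻ y, ENNReal.ofReal (weight β y) * ‖f y‖ₑ ^ 2 = ENNReal.ofReal (‖f‖ ^ 2) := by
  rw [← lintegral_enorm_sq_Lp, lintegral_weightMeasure β]
  exact (Lp.stronglyMeasurable f).measurable.enorm.pow_const 2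

lemma lintegral_invWeight_Lp (f : L2InvWeight β) :
    ∫⁻ y, ENNReal.ofReal (weight β y)⁻¹ * ‖f y‖ₑ ^ 2 = ENNReal.ofReal (‖f‖ ^ 2) := by
  rw [← lintegral_enorm_sq_Lp, lintegral_invWeightMeasure β]
  exact (Lp.stronglyMeasurable f).measurable.enorm.pow_const 2

lemma lintegral_weight_Lp_lt_top (f : L2Weight β) :
    ∫⁻ y, ENNReal.ofReal (weight β y) * ‖f y‖ₑ ^ 2 < ⊤ := by
  rw [lintegral_weight_Lp]; exact ENNReal.ofReal_lt_top

lemma memLp_invWeight_iff {g : Space → Spinor} (hg : StronglyMeasurable g) :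
    MemLp g 2 (invWeightMeasure β) ↔
      ∫⁻ x, ENNReal.ofReal (weight β x)⁻¹ * ‖g x‖ₑ ^ 2 < ⊤ := by
  rw [memLp_two_iff_lintegral hg.aestronglyMeasurable, lintegral_invWeightMeasure β]
  exact hg.measurable.enorm.pow_const 2

/-- The bounded operators between the weighted spaces given by the resolvent kernel. -/
theorem exists_weighted_resolvent (hβ : 1 < β) : ∃ C : ℝ, 0 ≤ C ∧
    ∀ (s : ℤˣ) (z : ℂ), 0 ≤ (((s : ℤ) : ℂ) * z).im →
      ∃ T : L2Weight β →L[ℂ] L2InvWeight β,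
        (∀ f : L2Weight β, T f =ᵐ[volume] kernOp s z f) ∧ ∀ f, ‖T f‖ ≤ C * ‖f‖ := by
  obtain ⟨C, hC0, hC⟩ := exists_uniform_bound hβ
  refine ⟨C, hC0, fun s z hz => ?_⟩
  have hb : ∀ f : L2Weight β, ∫⁻ x, ENNReal.ofReal (weight β x)⁻¹ * ‖kernOp s z f x‖ₑ ^ 2 ≤
      ENNReal.ofReal ((C * ‖f‖) ^ 2) := fun f => by
    refine (hC s z hz f (Lp.stronglyMeasurable f) (lintegral_weight_Lp_lt_top f)).trans_eq ?_
    rw [lintegral_weight_Lp, ← ENNReal.ofReal_mul (sq_nonneg C), mul_pow]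
  have hmem : ∀ f : L2Weight β, MemLp (kernOp s z f) 2 (invWeightMeasure β) := fun f =>
    (memLp_invWeight_iff (stronglyMeasurable_kernOp s z (Lp.stronglyMeasurable f))).2
      ((hb f).trans_lt ENNReal.ofReal_lt_top)
  have hint : ∀ f : L2Weight β, ∀ᵐ x, Integrable fun y => kern s z (x - y) (f y) := fun f => by
    filter_upwards [ae_lintegral_kern_lt_top hβ hz (Lp.stronglyMeasurable f)
      (lintegral_weight_Lp_lt_top f)] with x hx
    exact integrable_conv_of_lintegral (measurable_kern s z) (Lp.stronglyMeasurable f) hx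
  let T : L2Weight β →ₗ[ℂ] L2InvWeight β :=
    { toFun := fun f => (hmem f).toLp
      map_add' := fun f g => by
        rw [← MemLp.toLp_add]
        apply MemLp.toLp_congr
        refine invWeightMeasure_ac β ?_
        filter_upwards [hint f, hint g] with x h1 h2
        simp only [Pi.add_apply, kernOp]
        rw [← integral_add h1 h2]
        have : ∀ᵐ y, kern s z (x - y) ((f + g : L2Weight β) y) =
            kern s z (x - y) (f y) + kern s z (x - y) (g y) := by
          filter_upwards [ac_weightMeasure β (Lp.coeFn_add f g)] with y hy
          rw [hy, Pi.add_apply, map_add]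
        exact integral_congr_ae this
      map_smul' := fun c f => by
        rw [RingHom.id_apply, ← MemLp.toLp_const_smul]
        apply MemLp.toLp_congr
        refine Eventually.of_forall fun x => ?_
        simp only [Pi.smul_apply, kernOp]
        rw [← integral_smul]
        have : ∀ᵐ y, kern s z (x - y) ((c • f : L2Weight β) y) = c • kern s z (x - y) (f y) := by
          filter_upwards [ac_weightMeasure β (Lp.coeFn_smul c f)] with y hy
          rw [hy, Pi.smul_apply, map_smul]
        exact integral_congr_ae this }
  have hT : ∀ f : L2Weight β, T f =ᵐ[volume] kernOp s z f := fun f =>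
    ac_invWeightMeasure β (hmem f).coeFn_toLp
  have hTb : ∀ f, ‖T f‖ ≤ C * ‖f‖ := fun f => by
    refine norm_Lp_le_of_lintegral (by positivity) ?_
    rw [lintegral_invWeightMeasure β ((Lp.stronglyMeasurable _).measurable.enorm.pow_const 2)]
    refine le_trans (le_of_eq (lintegral_congr_ae ?_)) (hb f)
    filter_upwards [hT f] with x hx
    rw [hx]
  exact ⟨T.mkContinuous C hTb, hT, hTb⟩

end WeightedOperator

/-! ### Differences of kernels. -/

section KernelDifference

/-- On the closed upper half-plane, which is convex, the derivative of e^{ix} has modulus at most 1.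
-/
lemma norm_exp_I_mul_sub_le {a b : ℂ} (ha : 0 ≤ a.im) (hb : 0 ≤ b.im) :
    ‖Complex.exp (Complex.I * a) - Complex.exp (Complex.I * b)‖ ≤ ‖a - b‖ := by
  have h := (convex_halfSpace_im_ge 0).norm_image_sub_le_of_norm_hasDerivWithin_le
    (f := fun x : ℂ => Complex.exp (Complex.I * x))
    (f' := fun x : ℂ => Complex.exp (Complex.I * x) * (Complex.I * 1)) (C := 1) (x := b) (y := a)
    (fun x _ => (((hasDerivAt_id x).const_mul Complex.I).cexp).hasDerivWithinAt)
    (fun x hx => by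
      have hx' : 0 ≤ x.im := hx
      simp only [norm_mul, Complex.norm_exp, Complex.norm_I, mul_one]
      rw [Real.exp_le_one_iff]
      simpa using hx') hb ha
  simpa using h

lemma norm_sub_le_two_mul_min {ε ρ : ℝ} (hε : 0 ≤ ε) (hρ : 0 ≤ ρ) {κ κ' : ℂ} (h : 0 ≤ κ.im)
    (h' : 0 ≤ κ'.im) (hd : ‖κ - κ'‖ ≤ ε) :
    ‖Complex.exp (Complex.I * κ * (ρ : ℂ)) - Complex.exp (Complex.I * κ' * (ρ : ℂ))‖ ≤
      2 * min (ε * (ρ + 1)) 1 := by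
  rw [mul_min_of_nonneg _ _ (by norm_num), le_min_iff]
  constructor
  · have h1 := norm_exp_I_mul_sub_le (a := κ * (ρ : ℂ)) (b := κ' * (ρ : ℂ))
      (by simpa using mul_nonneg h hρ) (by simpa using mul_nonneg h' hρ)
    rw [← mul_assoc, ← mul_assoc, ← sub_mul, norm_mul, Complex.norm_real,
      Real.norm_of_nonneg hρ] at h1
    nlinarith [mul_le_mul_of_nonneg_right hd hρ, mul_nonneg hε hρ]
  · refine (norm_sub_le _ _).trans ?_
    rw [norm_exp_I_mul, norm_exp_I_mul]
    have := exp_neg_mul_le_one h hρ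
    have := exp_neg_mul_le_one h' hρ
    linarith

lemma norm_four_pi_inv_le : ‖(4 * (Real.pi : ℂ))⁻¹‖ ≤ 1 := by
  rw [norm_inv]; exact inv_le_one_of_one_le₀ one_le_norm_four_pi

/-- The |r|⁻² singularity does not depend on the spectral parameter and cancels. Only |r|⁻¹ is left,
and its square is integrable against the inverse weight, uniformly in the centre. -/
lemma norm_kern_sub_le {s : ℤˣ} {z w : ℂ} {M ε : ℝ} (hz : 0 ≤ (((s : ℤ) : ℂ) * z).im)
    (hw : 0 ≤ (((s : ℤ) : ℂ) * w).im) (hM : ‖w‖ ≤ M) (hd : ‖z - w‖ ≤ ε) (hε : ε ≤ 1) (r : Space) :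
    ‖kern s z r - kern s w r‖ ≤ alphaConst * (2 * (M + 1)) * (min (ε * (‖r‖ + 1)) 1 * ‖r‖⁻¹) := by
  have hM0 : 0 ≤ M := (norm_nonneg w).trans hM
  have hε0 : 0 ≤ ε := (norm_nonneg _).trans hd
  set ρ := ‖r‖ with hρ
  have hρ0 : 0 ≤ ρ := norm_nonneg r
  set μ := min (ε * (ρ + 1)) 1 with hμ
  have hεμ : ε ≤ μ := le_min (by nlinarith) hε
  have hμ0 : 0 ≤ μ := hε0.trans hεμ
  set κ := ((s : ℤ) : ℂ) * z
  set κ' := ((s : ℤ) : ℂ) * w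
  have hκd : ‖κ - κ'‖ ≤ ε := by
    rw [← mul_sub, norm_mul, norm_units_int, one_mul]; exact hd
  have hκ'M : ‖κ'‖ ≤ M := by
    rw [norm_mul, norm_units_int, one_mul]; exact hM
  set e := Complex.exp (Complex.I * κ * (ρ : ℂ)) with he
  set e' := Complex.exp (Complex.I * κ' * (ρ : ℂ)) with he'
  have hm : ‖e - e'‖ ≤ 2 * μ := norm_sub_le_two_mul_min hε0 hρ0 hz hw hκd
  have hmρ : ‖e - e'‖ ≤ ε * ρ := by
    have h1 := norm_exp_I_mul_sub_le (a := κ * (ρ : ℂ)) (b := κ' * (ρ : ℂ))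
      (by simpa using mul_nonneg hz hρ0) (by simpa using mul_nonneg hw hρ0)
    rw [← mul_assoc Complex.I κ, ← mul_assoc Complex.I κ', ← sub_mul, norm_mul,
      Complex.norm_real, Real.norm_of_nonneg hρ0] at h1
    exact h1.trans (mul_le_mul_of_nonneg_right hκd hρ0)
  have he1 : ‖e‖ ≤ 1 := by
    rw [he, norm_exp_I_mul]; exact exp_neg_mul_le_one hz hρ0
  have hρi : ‖(ρ : ℂ)⁻¹‖ = ρ⁻¹ := by rw [norm_inv, Complex.norm_real, Real.norm_of_nonneg hρ0]
  have hi0 : 0 ≤ ρ⁻¹ := inv_nonneg.2 hρ0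
  have h4 := norm_four_pi_inv_le
  have hg : ‖z * gK κ r - w * gK κ' r‖ ≤ 2 * (M + 1) * (μ * ρ⁻¹) := by
    have e1 : z * gK κ r - w * gK κ' r =
        (4 * (Real.pi : ℂ))⁻¹ * ((ρ : ℂ)⁻¹ * ((z - w) * e + w * (e - e'))) := by
      unfold gK
      rw [← hρ, ← he, ← he', div_eq_mul_inv, div_eq_mul_inv, mul_inv]; ring
    rw [e1, norm_mul, norm_mul, hρi]
    have h2 : ‖(z - w) * e + w * (e - e')‖ ≤ 2 * (M + 1) * μ := by
      refine (norm_add_le _ _).trans ?_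
      rw [norm_mul, norm_mul]
      have := mul_le_mul hd he1 (norm_nonneg _) hε0
      have := mul_le_mul hM hm (norm_nonneg _) hM0
      linarith
    calc _ ≤ 1 * (ρ⁻¹ * (2 * (M + 1) * μ)) := by gcongr
      _ = _ := by ring
  have hdg : ∀ k, ‖dgK κ k r - dgK κ' k r‖ ≤ 2 * (M + 1) * (μ * ρ⁻¹) := by
    intro k
    have e1 : dgK κ k r - dgK κ' k r = (4 * (Real.pi : ℂ))⁻¹ * ((r k / ‖r‖ : ℝ) : ℂ) *
        ((ρ : ℂ)⁻¹ * (Complex.I * ((κ - κ') * e + κ' * (e - e'))) -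
          (ρ : ℂ)⁻¹ * ((ρ : ℂ)⁻¹ * (e - e'))) := by
      unfold dgK
      rw [← hρ, ← he, ← he', div_eq_mul_inv, div_eq_mul_inv, div_eq_mul_inv, div_eq_mul_inv,
        div_eq_mul_inv]
      ring
    rw [e1, norm_mul, norm_mul, Complex.norm_real]
    have h0 := abs_apply_div_norm_le r k
    rw [← Real.norm_eq_abs] at h0
    -- The Lipschitz bound |e - e'| ≤ ερ gains one power of ρ here; ε ≤ 1 guarantees ε ≤ μ.
    have h3 : ‖(ρ : ℂ)⁻¹ * (e - e')‖ ≤ μ := by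
      rw [norm_mul, hρi]
      rcases hρ0.eq_or_lt with h | h
      · rw [← h]; simpa using hμ0
      · calc ρ⁻¹ * ‖e - e'‖ ≤ ρ⁻¹ * (ε * ρ) := by gcongr
          _ = ε := by field_simp
          _ ≤ μ := hεμ
    have h2 : ‖Complex.I * ((κ - κ') * e + κ' * (e - e'))‖ ≤ (1 + 2 * M) * μ := by
      rw [norm_mul, Complex.norm_I, one_mul]
      refine (norm_add_le _ _).trans ?_
      rw [norm_mul, norm_mul]
      have := mul_le_mul hκd he1 (norm_nonneg _) hε0
      have := mul_le_mul hκ'M hm (norm_nonneg _) hM0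
      linarith
    have h5 : ‖(ρ : ℂ)⁻¹ * (Complex.I * ((κ - κ') * e + κ' * (e - e'))) -
          (ρ : ℂ)⁻¹ * ((ρ : ℂ)⁻¹ * (e - e'))‖ ≤ ρ⁻¹ * ((1 + 2 * M) * μ) + ρ⁻¹ * μ := by
      refine (norm_sub_le _ _).trans ?_
      rw [norm_mul, norm_mul (ρ : ℂ)⁻¹ ((ρ : ℂ)⁻¹ * (e - e')), hρi]
      gcongr
    calc _ ≤ 1 * 1 * (ρ⁻¹ * ((1 + 2 * M) * μ) + ρ⁻¹ * μ) := by gcongr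
      _ = _ := by ring
  set B := 2 * (M + 1) * (μ * ρ⁻¹) with hB
  have hB0 : 0 ≤ B := by positivity
  have e2 : kern s z r - kern s w r = (z * gK κ r - w * gK κ' r) • ContinuousLinearMap.id ℂ Spinor +
      ∑ k, (-Complex.I * (dgK κ k r - dgK κ' k r)) • alpha k := by
    unfold kern
    rw [add_sub_add_comm, ← Finset.sum_sub_distrib]
    congr 1
    · exact (sub_smul _ _ _).symm
    · refine Finset.sum_congr rfl fun k _ => ?_
      rw [mul_sub]
      exact (sub_smul _ _ _).symm
  rw [e2]
  have h' : ‖ContinuousLinearMap.id ℂ Spinor‖ ≤ 1 := ContinuousLinearMap.norm_id_le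
  calc _ ≤ B * 1 + ∑ k, B * ‖alpha k‖ := by
        refine (norm_add_le _ _).trans (add_le_add ?_ ((norm_sum_le _ _).trans
          (Finset.sum_le_sum fun k _ => ?_)))
        · rw [norm_smul]; gcongr
        · rw [norm_smul, norm_mul, norm_neg, Complex.norm_I, one_mul]
          exact mul_le_mul_of_nonneg_right (hdg k) (norm_nonneg _)
    _ = _ := by rw [← Finset.mul_sum, hB, alphaConst]; ring

end KernelDifference

/-! ### Trading a power of the logarithm for smallness. -/

section WeightComparison

lemma one_le_abs_add_one_rpow {γ : ℝ} (hγ : 0 ≤ γ) (t : ℝ) : 1 ≤ (|t| + 1) ^ γ :=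
  Real.one_le_rpow (by linarith [abs_nonneg t]) hγ

/-- Lowering the exponent from β to β' leaves a spare power of the logarithm, which is the source of
smallness at infinity in the convergence proofs. -/
lemma weight_eq_mul (β β' : ℝ) (x : Space) :
    weight β x = weight β' x * (|Real.log ‖x‖| + 1) ^ (β - β') := by
  have : 0 < |Real.log ‖x‖| + 1 := by positivity
  rw [weight, weight, mul_assoc, ← Real.rpow_add this]
  congr 2; ring

lemma weight_mono {β β' : ℝ} (h : β' ≤ β) (x : Space) : weight β' x ≤ weight β x := by
  rw [weight_eq_mul β β' x]
  exact le_mul_of_one_le_right (weight_nonneg _ _) (one_le_abs_add_one_rpow (by linarith) _)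

/-- Smallness of a cut-off factor compared with a power of the logarithm. -/
lemma eventually_min_sq_le (R : ℝ) {γ δ : ℝ} (hR : 0 ≤ R) (hγ : 0 < γ) (hδ : 0 < δ) :
    ∀ᶠ ε : ℝ in 𝓝[>] (0 : ℝ), ∀ y : Space,
      min (ε * (‖y‖ + R)) 1 ^ 2 ≤ δ * (|Real.log ‖y‖| + 1) ^ γ := by
  -- Beyond the radius N the logarithm alone dominates the bound 1 of the minimum; inside, the
  -- minimum is at most ε(N+R), which is small.
  obtain ⟨N, hN1, hN⟩ : ∃ N : ℝ, 1 ≤ N ∧ ∀ t, N ≤ t → 1 ≤ δ * (|Real.log t| + 1) ^ γ := by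
    have h1 : Tendsto (fun t => δ * (|Real.log t| + 1) ^ γ) atTop atTop := by
      refine Tendsto.const_mul_atTop hδ ((tendsto_rpow_atTop hγ).comp ?_)
      exact tendsto_atTop_add_const_right _ _ (tendsto_abs_atTop_atTop.comp Real.tendsto_log_atTop)
    obtain ⟨N, hN⟩ := eventually_atTop.1 (h1.eventually_ge_atTop 1)
    exact ⟨max N 1, le_max_right _ _, fun t ht => hN t ((le_max_left _ _).trans ht)⟩
  have h2 : ∀ᶠ ε : ℝ in 𝓝[>] (0 : ℝ), (ε * (N + R)) ^ 2 < δ := by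
    have : Tendsto (fun ε : ℝ => (ε * (N + R)) ^ 2) (𝓝[>] 0) (𝓝 0) := by
      have : Continuous fun ε : ℝ => (ε * (N + R)) ^ 2 := by fun_prop
      simpa using (this.tendsto 0).mono_left nhdsWithin_le_nhds
    exact this.eventually_lt_const hδ
  filter_upwards [h2, self_mem_nhdsWithin] with ε hε hε0 y
  have hε0' : 0 < ε := hε0
  have hm0 : 0 ≤ min (ε * (‖y‖ + R)) 1 := le_min (by positivity) zero_le_one
  rcases le_total N ‖y‖ with h | h
  · refine le_trans ?_ (hN _ h)
    exact pow_le_one₀ hm0 (min_le_right _ _)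
  · calc min (ε * (‖y‖ + R)) 1 ^ 2 ≤ (ε * (N + R)) ^ 2 := by
          refine pow_le_pow_left₀ hm0 ((min_le_left _ _).trans ?_) 2
          gcongr
      _ ≤ δ := hε.le
      _ ≤ _ := le_mul_of_one_le_right hδ.le (one_le_abs_add_one_rpow hγ.le _)

end WeightComparison

/-! ### Convergence to the boundary values in weighted L². -/

section Convergence

variable {β : ℝ}

/-- The spectral parameter at distance `ε` from the boundary value. -/
lemma im_boundary_param (s : ℤˣ) (l ε : ℝ) :
    (((s : ℤ) : ℂ) * ((l : ℂ) + Complex.I * ((s : ℤ) : ℂ) * (ε : ℂ))).im = ε := by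
  rcases Int.units_eq_one_or s with rfl | rfl <;> simp

lemma im_boundary_value (s : ℤˣ) (l : ℝ) : (((s : ℤ) : ℂ) * (l : ℂ)).im = 0 := by
  rcases Int.units_eq_one_or s with rfl | rfl <;> simp

lemma norm_boundary_param_sub (s : ℤˣ) (l : ℝ) {ε : ℝ} (hε : 0 ≤ ε) :
    ‖((l : ℂ) + Complex.I * ((s : ℤ) : ℂ) * (ε : ℂ)) - l‖ = ε := by
  rw [add_sub_cancel_left, norm_mul, norm_mul, norm_units_int, Complex.norm_I, Complex.norm_real,
    Real.norm_of_nonneg hε]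
  ring

/-- Locally uniform smallness of the difference of the resolvent and its boundary value. -/
lemma eventually_enorm_kernOp_sub_le (hβ : 1 < β) (s : ℤˣ) (l : ℝ) {R δ : ℝ} (hR : 0 ≤ R)
    (hδ : 0 < δ) : ∀ᶠ ε : ℝ in 𝓝[>] (0 : ℝ), ∀ f : Space → Spinor, StronglyMeasurable f →
      ∫⁻ y, ENNReal.ofReal (weight β y) * ‖f y‖ₑ ^ 2 < ⊤ → ∀ᵐ x, ‖x‖ ≤ R →
        ‖kernOp s ((l : ℂ) + Complex.I * ((s : ℤ) : ℂ) * (ε : ℂ)) f x - kernOp s l f x‖ₑ ^ 2 ≤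
          ENNReal.ofReal δ * ∫⁻ y, ENNReal.ofReal (weight β y) * ‖f y‖ₑ ^ 2 := by
  -- Half-way between 1 and β: still large enough for the uniform integral bound, yet leaving a
  -- positive power of the logarithm.
  set β' := (1 + β) / 2 with hβ'
  have h1β' : 1 < β' := by rw [hβ']; linarith
  obtain ⟨A, hA0, hA⟩ := exists_lintegral_inv_sq_sub_mul_inv_weight_le h1β'
  set M : ℝ := |l| with hM
  set c : ℝ := alphaConst * (2 * (M + 1)) with hc
  have hc0 : 0 < c := by have := alphaConst_pos; positivity
  have hδ' : 0 < δ / (c ^ 2 * (A + 1)) := by positivity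
  filter_upwards [eventually_min_sq_le (R + 1) (γ := β - β') (by linarith)
    (by rw [hβ']; linarith) hδ', self_mem_nhdsWithin,
    mem_nhdsWithin_of_mem_nhds (Iic_mem_nhds zero_lt_one)] with ε hε hε0 hε1 f hf hF
  have hε0' : 0 < ε := hε0
  set z := (l : ℂ) + Complex.I * ((s : ℤ) : ℂ) * (ε : ℂ) with hzdef
  have hz : 0 ≤ (((s : ℤ) : ℂ) * z).im := by rw [hzdef, im_boundary_param]; exact hε0'.le
  have hl : 0 ≤ (((s : ℤ) : ℂ) * (l : ℂ)).im := (im_boundary_value s l).ge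
  have hd : ‖z - l‖ ≤ ε := (norm_boundary_param_sub s l hε0'.le).le
  filter_upwards [ae_lintegral_kern_lt_top hβ hz hf hF, ae_lintegral_kern_lt_top hβ hl hf hF]
    with x hx1 hx2 hxR
  have i1 := integrable_conv_of_lintegral (measurable_kern s z) hf hx1
  have i2 := integrable_conv_of_lintegral (measurable_kern s l) hf hx2
  -- For |x| ≤ R one has |x-y| + 1 ≤ |y| + R + 1, so the small factor can be made to depend on y
  -- alone and be compared with the weight at y.
  set a : Space → ℝ := fun y => c * (min (ε * (‖y‖ + (R + 1))) 1 * ‖x - y‖⁻¹) with ha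
  have ha0 : ∀ y, 0 ≤ a y := fun y => by
    have : 0 ≤ min (ε * (‖y‖ + (R + 1))) 1 := le_min (by positivity) zero_le_one
    positivity
  have ham : Measurable a := by
    have : Measurable fun y : Space => min (ε * (‖y‖ + (R + 1))) 1 :=
      (Measurable.min (by fun_prop) measurable_const)
    exact (this.mul (by fun_prop)).const_mul c
  have hb : ‖kernOp s z f x - kernOp s l f x‖ₑ ≤ ∫⁻ y, ENNReal.ofReal (a y) * ‖f y‖ₑ := by
    unfold kernOp
    rw [← integral_sub i1 i2]
    refine (enorm_integral_le_lintegral_enorm _).trans (lintegral_mono fun y => ?_)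
    have h1 := norm_kern_sub_le hz hl (M := M) (by rw [Complex.norm_real, Real.norm_eq_abs]) hd
      hε1 (x - y)
    have h2 : ‖kern s z (x - y) - kern s l (x - y)‖ ≤ a y := by
      refine h1.trans ?_
      have : ‖x - y‖ + 1 ≤ ‖y‖ + (R + 1) := by linarith [norm_sub_le x y]
      rw [ha]
      dsimp only
      gcongr
    rw [← ofReal_norm, ← ofReal_norm, ← ENNReal.ofReal_mul (ha0 y)]
    refine ENNReal.ofReal_le_ofReal ?_
    calc ‖kern s z (x - y) (f y) - kern s l (x - y) (f y)‖
        = ‖(kern s z (x - y) - kern s l (x - y)) (f y)‖ := rfl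
      _ ≤ ‖kern s z (x - y) - kern s l (x - y)‖ * ‖f y‖ := ContinuousLinearMap.le_opNorm _ _
      _ ≤ a y * ‖f y‖ := by gcongr
  refine (pow_le_pow_left' hb 2).trans ((sq_lintegral_mul_le_weight β ham ha0
    hf.measurable.enorm).trans (mul_le_mul_left ?_ _))
  calc ∫⁻ y, ENNReal.ofReal (a y ^ 2 * (weight β y)⁻¹)
      ≤ ∫⁻ y, ENNReal.ofReal (c ^ 2 * (δ / (c ^ 2 * (A + 1)))) *
          ENNReal.ofReal (‖x - y‖⁻¹ ^ 2 * (weight β' y)⁻¹) := by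
        refine lintegral_mono fun y => ?_
        rw [← ENNReal.ofReal_mul (by positivity)]
        refine ENNReal.ofReal_le_ofReal ?_
        have h3 := hε y
        have hp : 0 < (|Real.log ‖y‖| + 1) ^ (β - β') := by positivity
        have hw := inv_nonneg.2 (weight_nonneg β' y)
        rw [weight_eq_mul β β' y, mul_inv]
        calc a y ^ 2 * ((weight β' y)⁻¹ * ((|Real.log ‖y‖| + 1) ^ (β - β'))⁻¹)
            = c ^ 2 * (min (ε * (‖y‖ + (R + 1))) 1 ^ 2 * ((|Real.log ‖y‖| + 1) ^ (β - β'))⁻¹) *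
              (‖x - y‖⁻¹ ^ 2 * (weight β' y)⁻¹) := by rw [ha]; ring
          _ ≤ c ^ 2 * (δ / (c ^ 2 * (A + 1))) * (‖x - y‖⁻¹ ^ 2 * (weight β' y)⁻¹) := by
              gcongr
              rwa [← div_eq_mul_inv, div_le_iff₀ hp]
    _ = ENNReal.ofReal (c ^ 2 * (δ / (c ^ 2 * (A + 1)))) *
          ∫⁻ y, ENNReal.ofReal (‖x - y‖⁻¹ ^ 2 * (weight β' y)⁻¹) :=
        lintegral_const_mul' _ _ ENNReal.ofReal_ne_top
    _ ≤ ENNReal.ofReal (c ^ 2 * (δ / (c ^ 2 * (A + 1)))) * ENNReal.ofReal A :=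
        mul_le_mul_right (hA x) _
    _ ≤ ENNReal.ofReal δ := by
        rw [← ENNReal.ofReal_mul (by positivity)]
        refine ENNReal.ofReal_le_ofReal ?_
        have e : c ^ 2 * (δ / (c ^ 2 * (A + 1))) * A = δ * (A / (A + 1)) := by field_simp
        rw [e]
        exact mul_le_of_le_one_right hδ.le ((div_le_one (by positivity)).2 (by linarith))

lemma sq_enorm_sub_le (a b : Spinor) : ‖a - b‖ₑ ^ 2 ≤ 2 * ‖a‖ₑ ^ 2 + 2 * ‖b‖ₑ ^ 2 := by
  simp only [← ofReal_norm, ← ENNReal.ofReal_pow (norm_nonneg _)]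
  have e : ∀ t : ℝ, 2 * ENNReal.ofReal t = ENNReal.ofReal (2 * t) := fun t => by
    rw [ENNReal.ofReal_mul zero_le_two]; simp
  rw [e, e, ← ENNReal.ofReal_add (by positivity) (by positivity)]
  refine ENNReal.ofReal_le_ofReal ?_
  have := norm_sub_le a b
  nlinarith [norm_nonneg (a - b), sq_nonneg (‖a‖ - ‖b‖), norm_nonneg a, norm_nonneg b]

lemma lintegral_mul_add_le {a b c : Space → ℝ≥0∞} (ha : Measurable a) (hb : Measurable b)
    (hc : Measurable c) (A : ℝ≥0∞) :
    ∫⁻ x, a x * (A * b x + A * c x) = A * (∫⁻ x, a x * b x) + A * ∫⁻ x, a x * c x := by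
  have h1 : Measurable fun x => a x * b x := ha.mul hb
  have h2 : Measurable fun x => a x * c x := ha.mul hc
  rw [← lintegral_const_mul _ h1, ← lintegral_const_mul _ h2, ← lintegral_add_left (h1.const_mul _)]
  exact lintegral_congr fun x => by ring

/-- Convergence of the resolvent to its boundary value in the weighted `L²` operator norm. -/
theorem eventually_lintegral_kernOp_sub_le (hβ : 1 < β) (s : ℤˣ) (l : ℝ) {δ : ℝ} (hδ : 0 < δ) :
    ∀ᶠ ε : ℝ in 𝓝[>] (0 : ℝ), ∀ f : Space → Spinor, StronglyMeasurable f →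
      ∫⁻ y, ENNReal.ofReal (weight β y) * ‖f y‖ₑ ^ 2 < ⊤ →
        ∫⁻ x, ENNReal.ofReal (weight β x)⁻¹ * ‖kernOp s
          ((l : ℂ) + Complex.I * ((s : ℤ) : ℂ) * (ε : ℂ)) f x - kernOp s l f x‖ₑ ^ 2 ≤
          ENNReal.ofReal δ * ∫⁻ y, ENNReal.ofReal (weight β y) * ‖f y‖ₑ ^ 2 := by
  set β' := (1 + β) / 2 with hβ'
  have h1β' : 1 < β' := by rw [hβ']; linarith
  have hγ : 0 < β - β' := by rw [hβ']; linarith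
  obtain ⟨C, hC0, hC⟩ := exists_uniform_bound h1β'
  -- Outside radius R the inverse weight with exponent β is at most δ/(8(C²+1)) times the one with
  -- β'. The 8 is 4 from squaring a difference of two terms, each bounded through C², times 2 for
  -- the half of δ allotted to this region.
  obtain ⟨R, hR1, hR⟩ : ∃ R : ℝ, 1 ≤ R ∧ ∀ t, R ≤ t →
      8 * (C ^ 2 + 1) ≤ δ * (|Real.log t| + 1) ^ (β - β') := by
    have h1 : Tendsto (fun t => δ * (|Real.log t| + 1) ^ (β - β')) atTop atTop := by
      refine Tendsto.const_mul_atTop hδ ((tendsto_rpow_atTop hγ).comp ?_)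
      exact tendsto_atTop_add_const_right _ _ (tendsto_abs_atTop_atTop.comp Real.tendsto_log_atTop)
    obtain ⟨N, hN⟩ := eventually_atTop.1 (h1.eventually_ge_atTop (8 * (C ^ 2 + 1)))
    exact ⟨max N 1, le_max_right _ _, fun t ht => hN t ((le_max_left _ _).trans ht)⟩
  set V : ℝ := ∫ x in Metric.closedBall (0 : Space) R, (weight β x)⁻¹ with hV
  have hV0 : 0 ≤ V := integral_nonneg fun x => inv_nonneg.2 (weight_nonneg β x)
  have hVl : ∫⁻ x in Metric.closedBall (0 : Space) R, ENNReal.ofReal (weight β x)⁻¹ =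
      ENNReal.ofReal V :=
    (ofReal_integral_eq_lintegral_ofReal (integrableOn_inv_weight hβ R)
      (Eventually.of_forall fun x => inv_nonneg.2 (weight_nonneg β x))).symm
  have hδ2 : 0 < δ / (2 * (V + 1)) := by positivity
  filter_upwards [eventually_enorm_kernOp_sub_le hβ s l (zero_le_one.trans hR1) hδ2,
    self_mem_nhdsWithin] with ε hε hε0 f hf hF
  have hε0' : 0 < ε := hε0
  set z := (l : ℂ) + Complex.I * ((s : ℤ) : ℂ) * (ε : ℂ) with hzdef
  have hz : 0 ≤ (((s : ℤ) : ℂ) * z).im := by rw [hzdef, im_boundary_param]; exact hε0'.le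
  have hl : 0 ≤ (((s : ℤ) : ℂ) * (l : ℂ)).im := (im_boundary_value s l).ge
  set F := ∫⁻ y, ENNReal.ofReal (weight β y) * ‖f y‖ₑ ^ 2 with hFdef
  have hF' : ∫⁻ y, ENNReal.ofReal (weight β' y) * ‖f y‖ₑ ^ 2 ≤ F :=
    lintegral_mono fun y => mul_le_mul_left
      (ENNReal.ofReal_le_ofReal (weight_mono (by linarith) y)) _
  rw [← lintegral_add_compl _ (measurableSet_closedBall (x := (0 : Space)) (ε := R))]
  -- Inside, the difference is small almost everywhere, and the inverse weight has finite integral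
  -- V.
  have hin : ∫⁻ x in Metric.closedBall (0 : Space) R, ENNReal.ofReal (weight β x)⁻¹ *
      ‖kernOp s z f x - kernOp s l f x‖ₑ ^ 2 ≤ ENNReal.ofReal (δ / 2) * F := by
    calc _ ≤ ∫⁻ x in Metric.closedBall (0 : Space) R, ENNReal.ofReal (weight β x)⁻¹ *
          (ENNReal.ofReal (δ / (2 * (V + 1))) * F) := by
          refine lintegral_mono_ae ((ae_restrict_iff' measurableSet_closedBall).2 ?_)
          filter_upwards [hε f hf hF] with x hx hxR
          exact mul_le_mul_right (hx (mem_closedBall_zero_iff.1 hxR)) _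
      _ = ENNReal.ofReal V * (ENNReal.ofReal (δ / (2 * (V + 1))) * F) := by
          rw [lintegral_mul_const' _ _ (ENNReal.mul_lt_top ENNReal.ofReal_lt_top hF).ne, hVl]
      _ ≤ _ := by
          rw [← mul_assoc, ← ENNReal.ofReal_mul hV0]
          refine mul_le_mul_left (ENNReal.ofReal_le_ofReal ?_) _
          have e : V * (δ / (2 * (V + 1))) = δ / 2 * (V / (V + 1)) := by field_simp
          rw [e]
          exact mul_le_of_le_one_right (by positivity)
            ((div_le_one (by positivity)).2 (by linarith))
  have hK1 := (hC s z hz f hf (hF'.trans_lt hF)).trans (mul_le_mul_right hF' _)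
  have hK2 := (hC s l hl f hf (hF'.trans_lt hF)).trans (mul_le_mul_right hF' _)
  have hout : ∫⁻ x in (Metric.closedBall (0 : Space) R)ᶜ, ENNReal.ofReal (weight β x)⁻¹ *
      ‖kernOp s z f x - kernOp s l f x‖ₑ ^ 2 ≤ ENNReal.ofReal (δ / 2) * F := by
    set q : ℝ := δ / (8 * (C ^ 2 + 1)) with hq
    have hq0 : 0 < q := by positivity
    calc _ ≤ ∫⁻ x in (Metric.closedBall (0 : Space) R)ᶜ, ENNReal.ofReal q *
          (ENNReal.ofReal (weight β' x)⁻¹ *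
            (2 * ‖kernOp s z f x‖ₑ ^ 2 + 2 * ‖kernOp s l f x‖ₑ ^ 2)) := by
          refine setLIntegral_mono' measurableSet_closedBall.compl fun x hx => ?_
          rw [← mul_assoc, ← ENNReal.ofReal_mul hq0.le]
          refine mul_le_mul' (ENNReal.ofReal_le_ofReal ?_) (sq_enorm_sub_le _ _)
          have hx' : R ≤ ‖x‖ := by
            have : ¬ ‖x‖ ≤ R := fun h => hx (mem_closedBall_zero_iff.2 h)
            exact (not_le.1 this).le
          have h1 := hR _ hx'
          have hp : 0 < (|Real.log ‖x‖| + 1) ^ (β - β') := by positivity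
          rw [weight_eq_mul β β' x, mul_inv, mul_comm]
          refine mul_le_mul_of_nonneg_right ?_ (inv_nonneg.2 (weight_nonneg _ _))
          rw [hq, inv_eq_one_div, div_le_div_iff₀ hp (by positivity)]
          linarith
      _ ≤ ∫⁻ x, ENNReal.ofReal q * (ENNReal.ofReal (weight β' x)⁻¹ *
            (2 * ‖kernOp s z f x‖ₑ ^ 2 + 2 * ‖kernOp s l f x‖ₑ ^ 2)) :=
          setLIntegral_le_lintegral _ _
      _ = ENNReal.ofReal q * (2 * (∫⁻ x, ENNReal.ofReal (weight β' x)⁻¹ * ‖kernOp s z f x‖ₑ ^ 2) +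
            2 * ∫⁻ x, ENNReal.ofReal (weight β' x)⁻¹ * ‖kernOp s l f x‖ₑ ^ 2) := by
          rw [lintegral_const_mul' _ _ ENNReal.ofReal_ne_top, lintegral_mul_add_le
            (measurable_ofReal_inv_weight β')
            ((stronglyMeasurable_kernOp s z hf).measurable.enorm.pow_const 2)
            ((stronglyMeasurable_kernOp s l hf).measurable.enorm.pow_const 2)]
      _ ≤ ENNReal.ofReal q * (2 * (ENNReal.ofReal (C ^ 2) * F) +
            2 * (ENNReal.ofReal (C ^ 2) * F)) := by gcongr
      _ = ENNReal.ofReal (q * (4 * C ^ 2)) * F := by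
          rw [ENNReal.ofReal_mul hq0.le, ENNReal.ofReal_mul (by norm_num : (0 : ℝ) ≤ 4),
            show ENNReal.ofReal 4 = 4 by simp]
          ring
      _ ≤ _ := by
          refine mul_le_mul_left (ENNReal.ofReal_le_ofReal ?_) _
          rw [hq, div_mul_eq_mul_div, div_le_div_iff₀ (by positivity) two_pos]
          nlinarith [sq_nonneg C]
  calc _ ≤ ENNReal.ofReal (δ / 2) * F + ENNReal.ofReal (δ / 2) * F := add_le_add hin hout
    _ = _ := by
      rw [← add_mul, ← ENNReal.ofReal_add (by positivity) (by positivity), add_halves]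

/-- The same convergence with the additional singular weight `|x|⁻²`. -/
theorem eventually_lintegral_inv_sq_kernOp_sub_le (hβ : 1 < β) (s : ℤˣ) (l : ℝ) {δ : ℝ}
    (hδ : 0 < δ) :
    ∀ᶠ ε : ℝ in 𝓝[>] (0 : ℝ), ∀ f : Space → Spinor, StronglyMeasurable f →
      ∫⁻ y, ENNReal.ofReal (weight β y) * ‖f y‖ₑ ^ 2 < ⊤ →
        ∫⁻ x, ENNReal.ofReal (‖x‖⁻¹ ^ 2 * (weight β x)⁻¹) * ‖kernOp s
          ((l : ℂ) + Complex.I * ((s : ℤ) : ℂ) * (ε : ℂ)) f x - kernOp s l f x‖ₑ ^ 2 ≤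
          ENNReal.ofReal δ * ∫⁻ y, ENNReal.ofReal (weight β y) * ‖f y‖ₑ ^ 2 := by
  set V : ℝ := ∫ x : Space, ‖x‖⁻¹ ^ 2 * (weight β x)⁻¹ with hV
  have hnn : ∀ x : Space, 0 ≤ ‖x‖⁻¹ ^ 2 * (weight β x)⁻¹ := fun x =>
    mul_nonneg (by positivity) (inv_nonneg.2 (weight_nonneg β x))
  have hV0 : 0 ≤ V := integral_nonneg hnn
  have hVl : ∫⁻ x : Space, ENNReal.ofReal (‖x‖⁻¹ ^ 2 * (weight β x)⁻¹) = ENNReal.ofReal V :=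
    (ofReal_integral_eq_lintegral_ofReal (integrable_inv_sq_mul_inv_weight hβ)
      (Eventually.of_forall hnn)).symm
  have hδ2 : 0 < δ / (2 * (V + 1)) := by positivity
  -- On the unit ball the difference is small almost everywhere and |x|⁻²w⁻¹ is integrable; outside,
  -- the extra factor |x|⁻² is at most 1.
  filter_upwards [eventually_enorm_kernOp_sub_le hβ s l zero_le_one hδ2,
    eventually_lintegral_kernOp_sub_le hβ s l (half_pos hδ)] with ε h1 h2 f hf hF
  set z := (l : ℂ) + Complex.I * ((s : ℤ) : ℂ) * (ε : ℂ) with hzdef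
  set F := ∫⁻ y, ENNReal.ofReal (weight β y) * ‖f y‖ₑ ^ 2 with hFdef
  rw [← lintegral_add_compl _ (measurableSet_closedBall (x := (0 : Space)) (ε := 1))]
  have hin : ∫⁻ x in Metric.closedBall (0 : Space) 1, ENNReal.ofReal (‖x‖⁻¹ ^ 2 * (weight β x)⁻¹) *
      ‖kernOp s z f x - kernOp s l f x‖ₑ ^ 2 ≤ ENNReal.ofReal (δ / 2) * F := by
    calc _ ≤ ∫⁻ x in Metric.closedBall (0 : Space) 1, ENNReal.ofReal (‖x‖⁻¹ ^ 2 * (weight β x)⁻¹) *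
          (ENNReal.ofReal (δ / (2 * (V + 1))) * F) := by
          refine lintegral_mono_ae ((ae_restrict_iff' measurableSet_closedBall).2 ?_)
          filter_upwards [h1 f hf hF] with x hx hxR
          exact mul_le_mul_right (hx (mem_closedBall_zero_iff.1 hxR)) _
      _ ≤ ∫⁻ x : Space, ENNReal.ofReal (‖x‖⁻¹ ^ 2 * (weight β x)⁻¹) *
          (ENNReal.ofReal (δ / (2 * (V + 1))) * F) := setLIntegral_le_lintegral _ _
      _ = ENNReal.ofReal V * (ENNReal.ofReal (δ / (2 * (V + 1))) * F) := by
          rw [lintegral_mul_const' _ _ (ENNReal.mul_lt_top ENNReal.ofReal_lt_top hF).ne, hVl]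
      _ ≤ _ := by
          rw [← mul_assoc, ← ENNReal.ofReal_mul hV0]
          refine mul_le_mul_left (ENNReal.ofReal_le_ofReal ?_) _
          have e : V * (δ / (2 * (V + 1))) = δ / 2 * (V / (V + 1)) := by field_simp
          rw [e]
          exact mul_le_of_le_one_right (by positivity)
            ((div_le_one (by positivity)).2 (by linarith))
  have hout : ∫⁻ x in (Metric.closedBall (0 : Space) 1)ᶜ,
      ENNReal.ofReal (‖x‖⁻¹ ^ 2 * (weight β x)⁻¹) *
      ‖kernOp s z f x - kernOp s l f x‖ₑ ^ 2 ≤ ENNReal.ofReal (δ / 2) * F := by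
    refine le_trans ?_ ((setLIntegral_le_lintegral (Metric.closedBall (0 : Space) 1)ᶜ _).trans
      (h2 f hf hF))
    refine setLIntegral_mono' measurableSet_closedBall.compl fun x hx => ?_
    refine mul_le_mul_left (ENNReal.ofReal_le_ofReal ?_) _
    have hx' : 1 ≤ ‖x‖ := by
      have : ¬ ‖x‖ ≤ 1 := fun h => hx (mem_closedBall_zero_iff.2 h)
      exact (not_le.1 this).le
    exact mul_le_of_le_one_left (inv_nonneg.2 (weight_nonneg _ _))
      (pow_le_one₀ (by positivity) (inv_le_one_of_one_le₀ hx'))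
  calc _ ≤ ENNReal.ofReal (δ / 2) * F + ENNReal.ofReal (δ / 2) * F := add_le_add hin hout
    _ = _ := by
      rw [← add_mul, ← ENNReal.ofReal_add (by positivity) (by positivity), add_halves]

end Convergence

/-! ### Integration by parts and the energy identity. -/

section IntegrationByParts

variable {F G H : Type*} [NormedAddCommGroup F] [NormedSpace ℝ F] [NormedAddCommGroup G]
  [NormedSpace ℝ G] [NormedAddCommGroup H] [NormedSpace ℝ H]

lemma integral_bilinear_partialDeriv (B : F →L[ℝ] G →L[ℝ] H) {φ : Space → F} (h : IsTest φ)
    {u : Space → G} (hu : ContDiff ℝ ∞ u) (k : Fin 3) :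
    ∫ x, B (partialDeriv k φ x) (u x) = -∫ x, B (φ x) (partialDeriv k u x) := by
  have hint : ∀ (φ : Space → F) (u : Space → G), IsTest φ → Continuous u →
      Integrable fun x => B (φ x) (u x) := fun φ u h hu => by
    refine Continuous.integrable_of_hasCompactSupport
      ((B.continuous.comp h.continuous).clm_apply hu) ?_
    refine h.2.mono fun x hx => ?_
    contrapose! hx
    simp only [Function.mem_support, not_not] at hx ⊢
    simp [hx]
  have := integral_bilinear_hasFDerivAt_right_eq_neg_left_of_integrable (μ := volume) (B := B)
    (f := φ) (f' := fderiv ℝ φ) (g := u) (g' := fderiv ℝ u) (v := EuclideanSpace.single k 1)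
    (hint _ _ (h.partialDeriv k) hu.continuous) (hint _ _ h (contDiff_partialDeriv hu k).continuous)
    (hint _ _ h hu.continuous) (fun x _ => (h.differentiable x).hasFDerivAt)
    (fun x _ => ((hu.differentiable (by simp)) x).hasFDerivAt)
  simp only [partialDeriv]
  rw [this, neg_neg]

lemma hasWeakPartial_of_contDiff {u : Space → Spinor} (hu : ContDiff ℝ ∞ u) (k : Fin 3) :
    HasWeakPartial k u (partialDeriv k u) := fun _ h =>
  integral_bilinear_partialDeriv (ContinuousLinearMap.lsmul ℝ ℂ) h hu k

lemma integral_inner_partialDeriv {v w : Space → Spinor} (hv : IsTest v) (hw : ContDiff ℝ ∞ w)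
    (k : Fin 3) :
    ∫ x, inner ℂ (partialDeriv k v x) (w x) = -∫ x, inner ℂ (v x) (partialDeriv k w x) := by
  have hb : IsBoundedBilinearMap ℝ fun p : Spinor × Spinor => inner ℂ p.1 p.2 :=
    isBoundedBilinearMap_inner
  exact integral_bilinear_partialDeriv hb.toContinuousLinearMap hv hw k

lemma integrable_inner_test {v w : Space → Spinor} (hv : IsTest v) (hw : Continuous w) :
    Integrable fun x => (inner ℂ (v x) (w x) : ℂ) := by
  refine Continuous.integrable_of_hasCompactSupport (hv.continuous.inner hw) ?_
  refine hv.2.mono fun x hx => ?_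
  contrapose! hx
  simp only [Function.mem_support, not_not] at hx ⊢
  simp [hx]

/-- Symmetry of the Dirac operator on test functions. -/
lemma integral_inner_diracSmooth {v w : Space → Spinor} (hv : IsTest v) (hw : IsTest w) :
    ∫ x, inner ℂ (diracSmooth v x) (w x) = ∫ x, inner ℂ (v x) (diracSmooth w x) := by
  have h1 : ∀ k, Integrable fun x => (inner ℂ (partialDeriv k v x) (alpha k (w x)) : ℂ) :=
    fun k => integrable_inner_test (hv.partialDeriv k) (hw.alpha k).continuous
  have h2 : ∀ k, Integrable fun x => (inner ℂ (v x) (alpha k (partialDeriv k w x)) : ℂ) :=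
    fun k => integrable_inner_test hv ((hw.partialDeriv k).alpha k).continuous
  simp only [diracSmooth, inner_smul_left, inner_smul_right, sum_inner, inner_sum,
    inner_alpha_left, map_neg, Complex.conj_I, neg_neg]
  rw [integral_const_mul, integral_const_mul, integral_finsetSum _ fun k _ => h1 k,
    integral_finsetSum _ fun k _ => h2 k, neg_mul, ← mul_neg, ← Finset.sum_neg_distrib]
  congr 1
  refine Finset.sum_congr rfl fun k _ => ?_
  rw [integral_inner_partialDeriv hv (hw.alpha k).1]
  simp only [partialDeriv_alpha hw.differentiable]

lemma ofReal_integral_norm_sq (v : Space → Spinor) :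
    ((∫ x, ‖v x‖ ^ 2 : ℝ) : ℂ) = ∫ x, inner ℂ (v x) (v x) := by
  rw [← integral_complex_ofReal]
  refine integral_congr_ae (Eventually.of_forall fun x => ?_)
  simp [inner_self_eq_norm_sq_to_K]

lemma integrable_norm_sq_test {v : Space → Spinor} (hv : IsTest v) :
    Integrable fun x => ‖v x‖ ^ 2 := by
  refine Continuous.integrable_of_hasCompactSupport (hv.continuous.norm.pow 2) ?_
  refine hv.2.mono fun x hx => ?_
  contrapose! hx
  simp only [Function.mem_support, not_not] at hx ⊢
  simp [hx]

/-- `‖𝒟 v‖ = ‖∇ v‖` in `L²`. -/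
lemma integral_norm_sq_diracSmooth {v : Space → Spinor} (hv : IsTest v) :
    ∫ x, ‖diracSmooth v x‖ ^ 2 = ∑ k, ∫ x, ‖partialDeriv k v x‖ ^ 2 := by
  have h : ((∫ x, ‖diracSmooth v x‖ ^ 2 : ℝ) : ℂ) =
      ((∑ k, ∫ x, ‖partialDeriv k v x‖ ^ 2 : ℝ) : ℂ) := by
    -- By symmetry ‖𝒟v‖² = ⟨v, 𝒟²v⟩ = -⟨v, Δv⟩; integrating by parts once more gives the gradient.
    rw [ofReal_integral_norm_sq (diracSmooth v), integral_inner_diracSmooth hv hv.diracSmooth,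
      Complex.ofReal_sum]
    simp only [diracSmooth_diracSmooth hv.1, inner_neg_right, lap, inner_sum]
    rw [integral_neg, integral_finsetSum _ fun k _ => integrable_inner_test hv
      ((hv.partialDeriv k).partialDeriv k).continuous, ← Finset.sum_neg_distrib]
    refine Finset.sum_congr rfl fun k _ => ?_
    rw [ofReal_integral_norm_sq (partialDeriv k v),
      integral_inner_partialDeriv hv (hv.partialDeriv k).1]
  exact_mod_cast h

lemma lintegral_enorm_sq_partialDeriv_le {v : Space → Spinor} (hv : IsTest v) (k : Fin 3) :
    ∫⁻ x, ‖partialDeriv k v x‖ₑ ^ 2 ≤ ∫⁻ x, ‖diracSmooth v x‖ₑ ^ 2 := by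
  have e : ∀ {w : Space → Spinor}, IsTest w →
      ∫⁻ x, ‖w x‖ₑ ^ 2 = ENNReal.ofReal (∫ x, ‖w x‖ ^ 2) := fun {w} hw => by
    rw [ofReal_integral_eq_lintegral_ofReal (integrable_norm_sq_test hw)
      (Eventually.of_forall fun x => sq_nonneg _)]
    exact lintegral_congr fun x => by rw [← ofReal_norm, ENNReal.ofReal_pow (norm_nonneg _)]
  rw [e (hv.partialDeriv k), e hv.diracSmooth, integral_norm_sq_diracSmooth hv]
  exact ENNReal.ofReal_le_ofReal (Finset.single_le_sum
    (f := fun k => ∫ x, ‖partialDeriv k v x‖ ^ 2)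
    (fun j _ => integral_nonneg fun x => sq_nonneg _) (Finset.mem_univ k))

end IntegrationByParts

/-! ### Cut-offs that are functions of the logarithm of the radius. -/

section LogCutoff

/-- A smooth function of `log |x|`, set to zero at the origin. -/
noncomputable def logRadial (Q : ℝ → ℝ) (x : Space) : ℝ := if x = 0 then 0 else Q (Real.log ‖x‖)

variable {Q : ℝ → ℝ}

lemma logRadial_of_ne {x : Space} (hx : x ≠ 0) : logRadial Q x = Q (Real.log ‖x‖) := if_neg hx

/-- The function vanishes near the origin and near infinity, where |log |x|| ≥ m, and log |x| is
smooth in between. -/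
lemma isTest_logRadial (hQ : ContDiff ℝ ∞ Q) {m : ℝ} (hm : ∀ τ, m ≤ |τ| → Q τ = 0) :
    IsTest (logRadial Q) := by
  constructor
  · rw [contDiff_iff_contDiffAt]
    intro x
    rcases eq_or_ne x 0 with rfl | hx
    · have h : logRadial Q =ᶠ[𝓝 0] fun _ => 0 := by
        filter_upwards [Metric.ball_mem_nhds (0 : Space) (Real.exp_pos (-m))] with y hy
        by_cases hy0 : y = 0
        · simp [logRadial, hy0]
        rw [logRadial_of_ne hy0, hm]
        have h1 := Real.log_lt_log (norm_pos_iff.2 hy0) (mem_ball_zero_iff.1 hy)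
        rw [Real.log_exp] at h1
        linarith [neg_abs_le (Real.log ‖y‖)]
      exact contDiffAt_const.congr_of_eventuallyEq h
    · have h : logRadial Q =ᶠ[𝓝 x] fun y => Q (Real.log ‖y‖) := by
        filter_upwards [isOpen_ne.mem_nhds hx] with y hy
        exact logRadial_of_ne hy
      refine ContDiffAt.congr_of_eventuallyEq ?_ h
      exact hQ.contDiffAt.comp x ((contDiffAt_norm ℝ hx).log (norm_ne_zero_iff.2 hx))
  · refine HasCompactSupport.intro (isCompact_closedBall (0 : Space) (Real.exp m)) fun x hx => ?_
    have hx' : Real.exp m < ‖x‖ := not_le.1 fun h => hx (mem_closedBall_zero_iff.2 h)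
    have hx0 : x ≠ 0 := norm_pos_iff.1 ((Real.exp_pos m).trans hx')
    rw [logRadial_of_ne hx0, hm]
    have := (Real.lt_log_iff_exp_lt (norm_pos_iff.2 hx0)).2 hx'
    exact this.le.trans (le_abs_self _)

/-- The chain rule, with |∇ log |x|| ≤ |x|⁻¹ because the norm is 1-Lipschitz. -/
lemma abs_partialDeriv_logRadial_le (hQ : ContDiff ℝ ∞ Q) (k : Fin 3) {x : Space} (hx : x ≠ 0) :
    |partialDeriv k (logRadial Q) x| ≤ |deriv Q (Real.log ‖x‖)| * ‖x‖⁻¹ := by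
  have h : logRadial Q =ᶠ[𝓝 x] fun y => Q (Real.log ‖y‖) := by
    filter_upwards [isOpen_ne.mem_nhds hx] with y hy
    exact logRadial_of_ne hy
  have hn : HasFDerivAt (fun y : Space => ‖y‖) (fderiv ℝ (fun y : Space => ‖y‖) x) x :=
    ((contDiffAt_norm ℝ hx (n := 1)).differentiableAt (by simp)).hasFDerivAt
  have hl := hn.log (norm_ne_zero_iff.2 hx)
  have hq : HasDerivAt Q (deriv Q (Real.log ‖x‖)) (Real.log ‖x‖) :=
    (hQ.differentiable (by simp) _).hasDerivAt
  have hc := hq.comp_hasFDerivAt x hl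
  have hL : ‖fderiv ℝ (fun y : Space => ‖y‖) x‖ ≤ 1 := by
    simpa using norm_fderiv_le_of_lipschitz ℝ (x₀ := x) (lipschitzWith_one_norm (E := Space))
  rw [partialDeriv, h.fderiv_eq, show (fun y : Space => Q (Real.log ‖y‖)) =
    Q ∘ fun y : Space => Real.log ‖y‖ from rfl, hc.fderiv]
  simp only [smul_apply, smul_eq_mul, abs_mul, abs_inv, abs_norm]
  have h1 : |(fderiv ℝ (fun y : Space => ‖y‖) x) (EuclideanSpace.single k 1)| ≤ 1 := by
    rw [← Real.norm_eq_abs]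
    refine (ContinuousLinearMap.le_opNorm _ _).trans ?_
    simpa using hL
  exact mul_le_mul_of_nonneg_left (mul_le_of_le_one_right (by positivity) h1) (abs_nonneg _)

end LogCutoff

/-! ### The weighted elliptic estimate. -/

section GradientBound

variable {β : ℝ}

/-- A smooth profile comparable with the square root of `e^{-τ} (1 + |τ|)^{-β}`. -/
noncomputable def profile (β τ : ℝ) : ℝ := Real.exp (-τ / 2) * (1 + τ ^ 2) ^ (-β / 4)

lemma profile_pos (β τ : ℝ) : 0 < profile β τ := by unfold profile; positivity

lemma hasDerivAt_profile (β τ : ℝ) :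
    HasDerivAt (profile β) (profile β τ * (-1 / 2 - β / 2 * (τ / (1 + τ ^ 2)))) τ := by
  have h0 : 0 < 1 + τ ^ 2 := by positivity
  have h1 : HasDerivAt (fun τ : ℝ => Real.exp (-τ / 2)) (Real.exp (-τ / 2) * (-1 / 2)) τ :=
    (((hasDerivAt_id τ).neg).div_const 2).exp
  have h2 : HasDerivAt (fun τ : ℝ => 1 + τ ^ 2) (2 * τ) τ := by
    simpa using (hasDerivAt_pow 2 τ).const_add 1
  have h3 := h2.rpow_const (p := -β / 4) (Or.inl h0.ne')
  refine (h1.mul h3).congr_deriv ?_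
  rw [profile, Real.rpow_sub_one h0.ne']
  field_simp
  ring

lemma contDiff_profile (β : ℝ) : ContDiff ℝ ∞ (profile β) := by
  have h1 : ContDiff ℝ ∞ fun τ : ℝ => Real.exp (-τ / 2) := by fun_prop
  have h2 : ContDiff ℝ ∞ fun τ : ℝ => (1 + τ ^ 2) ^ (-β / 4) :=
    ContDiff.rpow_const_of_ne (by fun_prop) fun τ => by positivity
  exact h1.mul h2

lemma abs_deriv_profile_le (hβ : 0 ≤ β) (τ : ℝ) :
    |deriv (profile β) τ| ≤ profile β τ * (1 + β) := by
  rw [(hasDerivAt_profile β τ).deriv, abs_mul, abs_of_pos (profile_pos β τ)]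
  refine mul_le_mul_of_nonneg_left ?_ (profile_pos β τ).le
  have h : |τ / (1 + τ ^ 2)| ≤ 1 := by
    rw [abs_div, abs_of_pos (by positivity : 0 < 1 + τ ^ 2), div_le_one (by positivity)]
    nlinarith [sq_abs τ, sq_nonneg (|τ| - 1)]
  rw [abs_le] at h ⊢
  constructor <;> nlinarith [h.1, h.2]

lemma profile_sq (β τ : ℝ) : profile β τ ^ 2 = Real.exp (-τ) * (1 + τ ^ 2) ^ (-β / 2) := by
  rw [profile, mul_pow, ← Real.exp_nat_mul, ← Real.rpow_natCast _ 2, ← Real.rpow_mul (by positivity)]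
  congr 2 <;> push_cast <;> ring

lemma inv_weight_eq {x : Space} (hx : x ≠ 0) (β : ℝ) :
    (weight β x)⁻¹ = Real.exp (-Real.log ‖x‖) * (|Real.log ‖x‖| + 1) ^ (-β) := by
  rw [weight, mul_inv, Real.exp_neg, Real.exp_log (norm_pos_iff.2 hx),
    Real.rpow_neg (by positivity)]

lemma inv_weight_le_profile_sq (hβ : 0 ≤ β) {x : Space} (hx : x ≠ 0) :
    (weight β x)⁻¹ ≤ profile β (Real.log ‖x‖) ^ 2 := by
  rw [inv_weight_eq hx, profile_sq]
  set τ := Real.log ‖x‖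
  refine mul_le_mul_of_nonneg_left ?_ (Real.exp_pos _).le
  have h1 : (|τ| + 1) ^ (-β) = ((|τ| + 1) ^ 2) ^ (-β / 2) := by
    rw [← Real.rpow_natCast, ← Real.rpow_mul (by positivity)]
    congr 1; push_cast; ring
  rw [h1]
  refine Real.rpow_le_rpow_of_nonpos (by positivity) ?_ (by linarith)
  nlinarith [sq_abs τ, abs_nonneg τ]

lemma profile_sq_le (hβ : 0 ≤ β) {x : Space} (hx : x ≠ 0) :
    profile β (Real.log ‖x‖) ^ 2 ≤ 2 ^ (β / 2) * (weight β x)⁻¹ := by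
  rw [inv_weight_eq hx, profile_sq, mul_left_comm]
  set τ := Real.log ‖x‖
  refine mul_le_mul_of_nonneg_left ?_ (Real.exp_pos _).le
  have h1 : (|τ| + 1) ^ (-β) = ((|τ| + 1) ^ 2) ^ (-β / 2) := by
    rw [← Real.rpow_natCast, ← Real.rpow_mul (by positivity)]
    congr 1; push_cast; ring
  have h2 : (2 : ℝ) ^ (β / 2) = (1 / 2) ^ (-β / 2) := by
    rw [one_div, Real.inv_rpow zero_le_two, ← Real.rpow_neg zero_le_two]; congr 1; ring
  rw [h1, h2, ← Real.mul_rpow (by positivity) (by positivity)]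
  refine Real.rpow_le_rpow_of_nonpos (by positivity) ?_ (by linarith)
  nlinarith [sq_abs τ, sq_nonneg (|τ| - 1)]

/-- Smooth cut-off approximations of the square root of the inverse weight. -/
lemma exists_cutoff (hβ : 0 ≤ β) : ∃ C : ℝ, 0 ≤ C ∧ ∀ n : ℕ, ∃ W : Space → ℝ, IsTest W ∧
    (∀ x, x ≠ 0 → |Real.log ‖x‖| ≤ n + 1 → (weight β x)⁻¹ ≤ W x ^ 2) ∧
    (∀ x, x ≠ 0 → W x ^ 2 ≤ C * (weight β x)⁻¹) ∧
    ∀ k x, x ≠ 0 → partialDeriv k W x ^ 2 ≤ C * (‖x‖⁻¹ ^ 2 * (weight β x)⁻¹) := by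
  let χ : ContDiffBump (0 : ℝ) := ⟨1, 2, zero_lt_one, one_lt_two⟩
  have hχ : ContDiff ℝ ∞ χ := χ.contDiff
  obtain ⟨M, hM⟩ := (hχ.continuous_deriv (by simp)).bounded_above_of_compact_support
    χ.hasCompactSupport.deriv
  have hM0 : 0 ≤ M := (norm_nonneg _).trans (hM 0)
  have hc : (0 : ℝ) < 2 ^ (β / 2) := by positivity
  refine ⟨(1 + (1 + β + M) ^ 2) * 2 ^ (β / 2), by positivity, fun n => ?_⟩
  -- The cut-off is stretched in the logarithmic variable. As m ≥ 1, this does not increase its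
  -- derivative, so all constants are independent of n.
  set m : ℝ := n + 1 with hm
  have hm1 : 1 ≤ m := by rw [hm]; linarith [n.cast_nonneg (α := ℝ)]
  have hm0 : 0 < m := by linarith
  set Q : ℝ → ℝ := fun τ => profile β τ * χ (τ / m) with hQ
  have hQc : ContDiff ℝ ∞ Q := (contDiff_profile β).mul (hχ.comp (by fun_prop))
  have hQ0 : ∀ τ, 2 * m ≤ |τ| → Q τ = 0 := fun τ hτ => by
    have : χ (τ / m) = 0 := χ.zero_of_le_dist (by
      rw [Real.dist_eq, sub_zero, abs_div, abs_of_pos hm0]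
      exact (le_div_iff₀ hm0).2 hτ)
    rw [hQ]; simp [this]
  have hQsq : ∀ τ, Q τ ^ 2 ≤ profile β τ ^ 2 := fun τ => by
    rw [hQ]; dsimp only
    rw [mul_pow]
    exact mul_le_of_le_one_right (sq_nonneg _) (pow_le_one₀ χ.nonneg χ.le_one)
  have hQd : ∀ τ, |deriv Q τ| ≤ profile β τ * (1 + β + M) := fun τ => by
    have h1 : HasDerivAt (fun τ : ℝ => χ (τ / m)) (deriv χ (τ / m) * (1 / m)) τ :=
      HasDerivAt.comp (h₂ := ⇑χ) τ (hχ.differentiable (by simp) _).hasDerivAt ((hasDerivAt_id τ).div_const m)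
    have h2 : HasDerivAt Q _ τ := (hasDerivAt_profile β τ).mul h1
    rw [h2.deriv, ← (hasDerivAt_profile β τ).deriv]
    have h3 := abs_deriv_profile_le hβ τ
    have h4 : |χ (τ / m)| ≤ 1 := by rw [abs_of_nonneg χ.nonneg]; exact χ.le_one
    have h5 : |deriv χ (τ / m) * (1 / m)| ≤ M := by
      rw [abs_mul, abs_of_pos (by positivity : 0 < 1 / m)]
      calc _ ≤ M * 1 := mul_le_mul (hM _) ((div_le_one hm0).2 hm1) (by positivity) hM0
        _ = M := mul_one M
    have hp := profile_pos β τ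
    calc _ ≤ |deriv (profile β) τ| * |χ (τ / m)| + |profile β τ| * |deriv χ (τ / m) * (1 / m)| := by
          rw [← abs_mul, ← abs_mul]; exact abs_add_le _ _
      _ ≤ (profile β τ * (1 + β)) * 1 + profile β τ * M := by
          rw [abs_of_pos hp]; gcongr
      _ = _ := by ring
  have hw : ∀ x : Space, 0 ≤ (weight β x)⁻¹ := fun x => inv_nonneg.2 (weight_nonneg β x)
  refine ⟨logRadial Q, isTest_logRadial hQc hQ0, fun x hx hlog => ?_, fun x hx => ?_,
    fun k x hx => ?_⟩
  · rw [logRadial_of_ne hx]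
    have : χ (Real.log ‖x‖ / m) = 1 := χ.one_of_mem_closedBall (by
      rw [Metric.mem_closedBall, Real.dist_eq, sub_zero, abs_div, abs_of_pos hm0]
      exact (div_le_one hm0).2 hlog)
    rw [hQ]; dsimp only
    rw [this, mul_one]
    exact inv_weight_le_profile_sq hβ hx
  · rw [logRadial_of_ne hx]
    refine (hQsq _).trans ((profile_sq_le hβ hx).trans ?_)
    refine mul_le_mul_of_nonneg_right ?_ (hw x)
    exact le_mul_of_one_le_left hc.le (by nlinarith [sq_nonneg (1 + β + M)])
  · have h1 := (abs_partialDeriv_logRadial_le hQc k hx).trans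
      (mul_le_mul_of_nonneg_right (hQd _) (by positivity))
    calc partialDeriv k (logRadial Q) x ^ 2 = |partialDeriv k (logRadial Q) x| ^ 2 := (sq_abs _).symm
      _ ≤ (profile β (Real.log ‖x‖) * (1 + β + M) * ‖x‖⁻¹) ^ 2 :=
          pow_le_pow_left₀ (abs_nonneg _) h1 2
      _ = (1 + β + M) ^ 2 * ‖x‖⁻¹ ^ 2 * profile β (Real.log ‖x‖) ^ 2 := by ring
      _ ≤ (1 + β + M) ^ 2 * ‖x‖⁻¹ ^ 2 * (2 ^ (β / 2) * (weight β x)⁻¹) :=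
          mul_le_mul_of_nonneg_left (profile_sq_le hβ hx) (by positivity)
      _ = ((1 + β + M) ^ 2 * 2 ^ (β / 2)) * (‖x‖⁻¹ ^ 2 * (weight β x)⁻¹) := by ring
      _ ≤ _ := by
          refine mul_le_mul_of_nonneg_right ?_ (mul_nonneg (by positivity) (hw x))
          nlinarith

end GradientBound

section GradientBound

variable {β : ℝ}

lemma enorm_sq_eq_ofReal {E : Type*} [SeminormedAddCommGroup E] (a : E) :
    ‖a‖ₑ ^ 2 = ENNReal.ofReal (‖a‖ ^ 2) := by
  rw [← ofReal_norm, ENNReal.ofReal_pow (norm_nonneg _)]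

lemma partialDeriv_smul {W : Space → ℝ} {u : Space → Spinor} (hW : Differentiable ℝ W)
    (hu : Differentiable ℝ u) (k : Fin 3) (x : Space) :
    partialDeriv k (fun y => W y • u y) x = partialDeriv k W x • u x + W x • partialDeriv k u x := by
  rw [partialDeriv, partialDeriv, partialDeriv, fderiv_fun_smul (hW x) (hu x)]
  simp [add_comm]

lemma IsTest.smul_contDiff {W : Space → ℝ} {u : Space → Spinor} (hW : IsTest W)
    (hu : ContDiff ℝ ∞ u) : IsTest fun x => W x • u x :=
  ⟨hW.1.smul hu, hW.2.smul_right⟩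

lemma diracSmooth_smul {W : Space → ℝ} {u : Space → Spinor} (hW : Differentiable ℝ W)
    (hu : Differentiable ℝ u) (x : Space) :
    diracSmooth (fun y => W y • u y) x =
      W x • diracSmooth u x + (-Complex.I) • ∑ k, partialDeriv k W x • alpha k (u x) := by
  simp only [diracSmooth, partialDeriv_smul hW hu, map_add, ContinuousLinearMap.map_smul_of_tower,
    Finset.sum_add_distrib, smul_add, ← Finset.smul_sum]
  rw [add_comm, smul_comm]

lemma norm_sum_smul_alpha_le {d : Fin 3 → ℝ} {p : ℝ} (hd : ∀ k, |d k| ≤ p) (a : Spinor) :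
    ‖∑ k, d k • alpha k a‖ ≤ alphaConst * p * ‖a‖ := by
  have hp : 0 ≤ p := (abs_nonneg _).trans (hd 0)
  calc _ ≤ ∑ k, p * (‖alpha k‖ * ‖a‖) := by
        refine (norm_sum_le _ _).trans (Finset.sum_le_sum fun k _ => ?_)
        rw [norm_smul, Real.norm_eq_abs]
        exact mul_le_mul (hd k) (ContinuousLinearMap.le_opNorm _ _) (norm_nonneg _) hp
    _ = p * (∑ k, ‖alpha k‖) * ‖a‖ := by rw [← Finset.mul_sum, ← Finset.sum_mul]; ring
    _ ≤ p * alphaConst * ‖a‖ := by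
        have : ∑ k, ‖alpha k‖ ≤ alphaConst := by unfold alphaConst; linarith
        gcongr
    _ = _ := by ring

/-- Weighted elliptic estimate for the Dirac operator. -/
theorem exists_gradient_bound (hβ : 0 ≤ β) : ∃ C : ℝ, 0 ≤ C ∧ ∀ u : Space → Spinor,
    ContDiff ℝ ∞ u → ∀ k, ∫⁻ x, ENNReal.ofReal (weight β x)⁻¹ * ‖partialDeriv k u x‖ₑ ^ 2 ≤
      ENNReal.ofReal C * ((∫⁻ x, ENNReal.ofReal (weight β x)⁻¹ * ‖diracSmooth u x‖ₑ ^ 2) +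
        ∫⁻ x, ENNReal.ofReal (‖x‖⁻¹ ^ 2 * (weight β x)⁻¹) * ‖u x‖ₑ ^ 2) := by
  obtain ⟨c, hc0, hc⟩ := exists_cutoff hβ
  have ha0 := alphaConst_pos
  refine ⟨4 * c * (1 + alphaConst ^ 2), by positivity, fun u hu k => ?_⟩
  have hud : Differentiable ℝ u := hu.differentiable (by simp)
  set G : Space → ℝ≥0∞ := fun x => ENNReal.ofReal (weight β x)⁻¹ * ‖partialDeriv k u x‖ₑ ^ 2 with hG
  -- These sets exhaust the punctured space. The estimate is proved on each with a constant
  -- independent of n, so no finiteness of the gradient integral is assumed beforehand.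
  set E : ℕ → Set Space := fun n => {x | x ≠ 0 ∧ |Real.log ‖x‖| ≤ n + 1} with hE
  have hEm : ∀ n, MeasurableSet (E n) := fun n => by
    refine (measurableSet_singleton (0 : Space)).compl.inter ?_
    exact measurableSet_le (continuous_abs.measurable.comp
      (Real.measurable_log.comp measurable_norm)) measurable_const
  have hEU : ⋃ n, E n = {0}ᶜ := by
    ext x
    simp only [hE, Set.mem_iUnion, Set.mem_ofPred_eq, Set.mem_compl_iff, Set.mem_singleton_iff]
    refine ⟨fun ⟨n, h, _⟩ => h, fun h => ?_⟩
    obtain ⟨n, hn⟩ := exists_nat_ge |Real.log ‖x‖|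
    exact ⟨n, h, hn.trans (by linarith)⟩
  have hEd : Directed (· ⊆ ·) E := by
    refine Monotone.directed_le fun m n hmn x hx => ⟨hx.1, hx.2.trans ?_⟩
    have : (m : ℝ) ≤ n := by exact_mod_cast hmn
    linarith
  have hlim : ∫⁻ x, G x = ⨆ n, ∫⁻ x in E n, G x := by
    rw [← setLIntegral_iUnion_of_directed G hEd, hEU]
    refine (setLIntegral_congr ?_).trans (setLIntegral_univ _) |>.symm
    exact eventuallyEq_univ.2 ae_ne_zero
  rw [hlim]
  refine iSup_le fun n => ?_
  obtain ⟨W, hWt, hW1, hW2, hW3⟩ := hc n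
  have hWd := hWt.differentiable
  -- Since v is a test function, each partial derivative is controlled by 𝒟v in L². Exchanging W
  -- with a derivative or with 𝒟 costs |∇W||u|, at most a constant times |x|⁻¹w^{-1/2}|u|.
  set v : Space → Spinor := fun x => W x • u x with hv
  have hvt : IsTest v := hWt.smul_contDiff hu
  set g : Space → ℝ := fun x => ‖x‖⁻¹ ^ 2 * (weight β x)⁻¹ with hg
  have hg0 : ∀ x, 0 ≤ g x := fun x =>
    mul_nonneg (by positivity) (inv_nonneg.2 (weight_nonneg β x))
  have hgm : Measurable g := by
    have := measurable_weight β
    fun_prop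
  set A := ∫⁻ x, ENNReal.ofReal (weight β x)⁻¹ * ‖diracSmooth u x‖ₑ ^ 2
  set B := ∫⁻ x, ENNReal.ofReal (g x) * ‖u x‖ₑ ^ 2 with hB
  have mu : Measurable fun x => ‖u x‖ₑ ^ 2 := hu.continuous.enorm.measurable.pow_const 2
  have mgu : Measurable fun x => ENNReal.ofReal (g x) * ‖u x‖ₑ ^ 2 := hgm.ennreal_ofReal.mul mu
  have mv : Measurable fun x => ‖partialDeriv k v x‖ₑ ^ 2 :=
    (hvt.partialDeriv k).continuous.enorm.measurable.pow_const 2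
  have hd : ∀ x, x ≠ 0 → ∀ j, |partialDeriv j W x| ≤ √(c * g x) := fun x hx j =>
    Real.abs_le_sqrt (hW3 j x hx)
  have hs : ∀ x, √(c * g x) ^ 2 = c * g x := fun x => Real.sq_sqrt (mul_nonneg hc0 (hg0 x))
  have h1 : ∀ x ∈ E n, G x ≤ 2 * ‖partialDeriv k v x‖ₑ ^ 2 +
      ENNReal.ofReal (2 * c) * (ENNReal.ofReal (g x) * ‖u x‖ₑ ^ 2) := by
    rintro x ⟨hx, hxl⟩
    have e : partialDeriv k v x = partialDeriv k W x • u x + W x • partialDeriv k u x :=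
      partialDeriv_smul hWd hud k x
    have e' : W x • partialDeriv k u x = partialDeriv k v x - partialDeriv k W x • u x := by
      rw [e, add_sub_cancel_left]
    have h2 : G x ≤ ‖W x • partialDeriv k u x‖ₑ ^ 2 := by
      rw [hG]; dsimp only
      rw [enorm_smul, mul_pow]
      refine mul_le_mul_left ?_ _
      rw [enorm_sq_eq_ofReal, Real.norm_eq_abs, sq_abs]
      exact ENNReal.ofReal_le_ofReal (hW1 x hx hxl)
    refine h2.trans ?_
    rw [e']
    refine (sq_enorm_sub_le _ _).trans (add_le_add_right ?_ _)
    rw [enorm_smul, mul_pow, ← mul_assoc, ← mul_assoc]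
    refine mul_le_mul_left ?_ _
    rw [enorm_sq_eq_ofReal, Real.norm_eq_abs, sq_abs, ← ENNReal.ofReal_mul (by positivity),
      show (2 : ℝ≥0∞) = ENNReal.ofReal 2 by simp, ← ENNReal.ofReal_mul zero_le_two, mul_assoc]
    exact ENNReal.ofReal_le_ofReal (mul_le_mul_of_nonneg_left (hW3 k x hx) zero_le_two)
  have h2 : ∀ᵐ x, ‖diracSmooth v x‖ₑ ^ 2 ≤
      ENNReal.ofReal (2 * c) * (ENNReal.ofReal (weight β x)⁻¹ * ‖diracSmooth u x‖ₑ ^ 2) +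
      ENNReal.ofReal (2 * c * alphaConst ^ 2) * (ENNReal.ofReal (g x) * ‖u x‖ₑ ^ 2) := by
    filter_upwards [ae_ne_zero] with x hx
    have hw := inv_nonneg.2 (weight_nonneg β x)
    have e : diracSmooth v x = W x • diracSmooth u x -
        Complex.I • ∑ k, partialDeriv k W x • alpha k (u x) := by
      rw [hv, diracSmooth_smul hWd hud, neg_smul, sub_eq_add_neg]
    have h3 := norm_sum_smul_alpha_le (hd x hx) (u x)
    rw [e]
    refine (sq_enorm_sub_le _ _).trans ?_
    simp only [enorm_sq_eq_ofReal]
    rw [show (2 : ℝ≥0∞) * ENNReal.ofReal (‖W x • diracSmooth u x‖ ^ 2) =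
      ENNReal.ofReal (2 * ‖W x • diracSmooth u x‖ ^ 2) by
        rw [ENNReal.ofReal_mul zero_le_two]; simp,
      show (2 : ℝ≥0∞) * ENNReal.ofReal (‖Complex.I • ∑ k, partialDeriv k W x • alpha k (u x)‖ ^ 2) =
        ENNReal.ofReal (2 * ‖Complex.I • ∑ k, partialDeriv k W x • alpha k (u x)‖ ^ 2) by
        rw [ENNReal.ofReal_mul zero_le_two]; simp,
      ← ENNReal.ofReal_mul hw, ← ENNReal.ofReal_mul (by positivity), ← ENNReal.ofReal_mul (hg0 x),
      ← ENNReal.ofReal_mul (by positivity)]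
    refine add_le_add (ENNReal.ofReal_le_ofReal ?_) (ENNReal.ofReal_le_ofReal ?_)
    · rw [norm_smul, mul_pow, Real.norm_eq_abs, sq_abs]
      have := mul_le_mul_of_nonneg_right (hW2 x hx) (sq_nonneg ‖diracSmooth u x‖)
      linarith
    · rw [norm_smul, Complex.norm_I, one_mul]
      calc 2 * ‖∑ k, partialDeriv k W x • alpha k (u x)‖ ^ 2
          ≤ 2 * (alphaConst * √(c * g x) * ‖u x‖) ^ 2 := by gcongr
        _ = 2 * (alphaConst ^ 2 * √(c * g x) ^ 2 * ‖u x‖ ^ 2) := by ring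
        _ = _ := by rw [hs]; ring
  have h3 : ∫⁻ x, ‖diracSmooth v x‖ₑ ^ 2 ≤
      ENNReal.ofReal (2 * c) * A + ENNReal.ofReal (2 * c * alphaConst ^ 2) * B := by
    refine (lintegral_mono_ae h2).trans_eq ?_
    rw [lintegral_add_right _ (mgu.const_mul _), lintegral_const_mul' _ _ ENNReal.ofReal_ne_top,
      lintegral_const_mul' _ _ ENNReal.ofReal_ne_top]
  calc ∫⁻ x in E n, G x ≤ ∫⁻ x in E n, (2 * ‖partialDeriv k v x‖ₑ ^ 2 +
        ENNReal.ofReal (2 * c) * (ENNReal.ofReal (g x) * ‖u x‖ₑ ^ 2)) :=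
        setLIntegral_mono' (hEm n) h1
    _ ≤ ∫⁻ x, (2 * ‖partialDeriv k v x‖ₑ ^ 2 +
        ENNReal.ofReal (2 * c) * (ENNReal.ofReal (g x) * ‖u x‖ₑ ^ 2)) :=
        setLIntegral_le_lintegral _ _
    _ = 2 * (∫⁻ x, ‖partialDeriv k v x‖ₑ ^ 2) + ENNReal.ofReal (2 * c) * B := by
        rw [lintegral_add_right _ (mgu.const_mul _), lintegral_const_mul _ mv,
          lintegral_const_mul' _ _ ENNReal.ofReal_ne_top]
    _ ≤ 2 * (ENNReal.ofReal (2 * c) * A + ENNReal.ofReal (2 * c * alphaConst ^ 2) * B) +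
        ENNReal.ofReal (2 * c) * B :=
        add_le_add_left (mul_le_mul_right ((lintegral_enorm_sq_partialDeriv_le hvt k).trans h3) _) _
    _ = ENNReal.ofReal (4 * c) * A +
        ENNReal.ofReal (4 * c * alphaConst ^ 2 + 2 * c) * B := by
        have e1 : ENNReal.ofReal (4 * c) = 2 * ENNReal.ofReal (2 * c) := by
          rw [show 4 * c = 2 * (2 * c) by ring, ENNReal.ofReal_mul zero_le_two]; simp
        have e2 : ENNReal.ofReal (4 * c * alphaConst ^ 2) =
            2 * ENNReal.ofReal (2 * c * alphaConst ^ 2) := by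
          rw [show 4 * c * alphaConst ^ 2 = 2 * (2 * c * alphaConst ^ 2) by ring,
            ENNReal.ofReal_mul zero_le_two]; simp
        rw [ENNReal.ofReal_add (by positivity) (by positivity), e1, e2]
        ring
    _ ≤ ENNReal.ofReal (4 * c * (1 + alphaConst ^ 2)) * A +
        ENNReal.ofReal (4 * c * (1 + alphaConst ^ 2)) * B := by
        refine add_le_add (mul_le_mul_left (ENNReal.ofReal_le_ofReal ?_) _)
          (mul_le_mul_left (ENNReal.ofReal_le_ofReal ?_) _)
        · nlinarith [sq_nonneg alphaConst]
        · nlinarith [sq_nonneg alphaConst]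
    _ = _ := (mul_add _ _ _).symm

end GradientBound

/-! ### Density of test functions and extension of weak derivatives. -/

section Density

variable {β : ℝ}

lemma isFiniteMeasureOnCompacts_weightMeasure (hβ : 1 < β) :
    IsFiniteMeasureOnCompacts (weightMeasure β) := by
  refine ⟨fun K hK => ?_⟩
  obtain ⟨R, hR⟩ := hK.isBounded.exists_norm_le
  obtain ⟨C, hC0, hC⟩ := weight_le_of_norm_le hβ R
  rw [weightMeasure, withDensity_apply _ hK.measurableSet]
  calc _ ≤ ∫⁻ x in K, ENNReal.ofReal C :=
        setLIntegral_mono' hK.measurableSet fun x hx => ENNReal.ofReal_le_ofReal (hC x (hR x hx))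
    _ = ENNReal.ofReal C * volume K := by rw [lintegral_const, Measure.restrict_apply_univ]
    _ < ⊤ := ENNReal.mul_lt_top ENNReal.ofReal_lt_top hK.measure_lt_top

/-- The elements of `L²(w_β dx)` which are represented by test functions. -/
def testSubgroup (β : ℝ) : AddSubgroup (L2Weight β) where
  carrier := {f | ∃ φ : Space → Spinor, IsTest φ ∧ f =ᵐ[weightMeasure β] φ}
  zero_mem' := ⟨fun _ => 0, IsTest.zero, Lp.coeFn_zero _ _ _⟩
  add_mem' := by
    rintro f g ⟨φ, hφ, hf⟩ ⟨ψ, hψ, hg⟩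
    exact ⟨_, hφ.add hψ, (Lp.coeFn_add f g).trans (hf.add hg)⟩
  neg_mem' := by
    rintro f ⟨φ, hφ, hf⟩
    refine ⟨fun x => (-1 : ℂ) • φ x, hφ.const_smul (-1 : ℂ), (Lp.coeFn_neg f).trans ?_⟩
    filter_upwards [hf] with x hx
    simp [hx]

/-- The weight is locally bounded, so w_β dx is finite on compact sets and the standard density
theorem applies. -/
lemma topologicalClosure_testSubgroup (hβ : 1 < β) : (testSubgroup β).topologicalClosure = ⊤ := by
  have := isFiniteMeasureOnCompacts_weightMeasure hβ
  have hd := Lp.dense_hasCompactSupport_contDiff (μ := weightMeasure β) (F := Spinor) (p := 2)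
    (by norm_num)
  rw [eq_top_iff]
  intro f _
  have hs : {f : L2Weight β | ∃ g : Space → Spinor, f =ᵐ[weightMeasure β] g ∧ HasCompactSupport g ∧
      ContDiff ℝ ∞ g} ⊆ testSubgroup β := by
    rintro f ⟨g, h1, h2, h3⟩
    exact ⟨g, ⟨h3, h2⟩, h1⟩
  exact closure_mono hs (hd f)

/-- The two weighted spaces pair under the unweighted integral. -/
lemma sq_lintegral_mul_le_inv_weight (β : ℝ) {a : Space → ℝ≥0∞} (ha : Measurable a)
    {f : Space → ℝ≥0∞} (hf : Measurable f) :
    (∫⁻ y, a y * f y) ^ 2 ≤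
      (∫⁻ y, ENNReal.ofReal (weight β y) * a y ^ 2) *
        ∫⁻ y, ENNReal.ofReal (weight β y)⁻¹ * f y ^ 2 := by
  have e : ∫⁻ y, a y * f y = ∫⁻ y, (ENNReal.ofReal √(weight β y) * a y) *
      (ENNReal.ofReal √(weight β y)⁻¹ * f y) := by
    refine lintegral_congr_ae ?_
    filter_upwards [ae_ne_zero] with y hy
    have hw := weight_pos β hy
    rw [mul_mul_mul_comm, ← ENNReal.ofReal_mul (Real.sqrt_nonneg _), ← Real.sqrt_mul hw.le,
      mul_inv_cancel₀ hw.ne', Real.sqrt_one, ENNReal.ofReal_one, one_mul]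
  have hwm := measurable_weight β
  rw [e]
  refine (sq_lintegral_mul_le (a := fun y => ENNReal.ofReal √(weight β y) * a y)
    (b := fun y => ENNReal.ofReal √(weight β y)⁻¹ * f y)
    ((hwm.sqrt.ennreal_ofReal.mul ha).aemeasurable)
    ((hwm.inv.sqrt.ennreal_ofReal.mul hf).aemeasurable)).trans_eq ?_
  congr 1
  · refine lintegral_congr fun y => ?_
    rw [mul_pow, ← ENNReal.ofReal_pow (Real.sqrt_nonneg _), Real.sq_sqrt (weight_nonneg β y)]
  · refine lintegral_congr fun y => ?_
    rw [mul_pow, ← ENNReal.ofReal_pow (Real.sqrt_nonneg _),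
      Real.sq_sqrt (inv_nonneg.2 (weight_nonneg β y))]

lemma lintegral_weight_test_lt_top (hβ : 1 < β) {F : Type*} [NormedAddCommGroup F]
    [NormedSpace ℝ F] {φ : Space → F} (h : IsTest φ) :
    ∫⁻ y, ENNReal.ofReal (weight β y) * ‖φ y‖ₑ ^ 2 < ⊤ := by
  have := isFiniteMeasureOnCompacts_weightMeasure hβ
  have h1 : MemLp φ 2 (weightMeasure β) := h.continuous.memLp_of_hasCompactSupport h.2
  have h2 := h1.eLpNorm_lt_top
  rw [← lintegral_weightMeasure β (h.continuous.enorm.measurable.pow_const 2), ← eLpNorm_two_sq]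
  exact ENNReal.pow_lt_top h2

/-- Pairing with a test function is continuous on `L²(w_β⁻¹ dx)`. -/
lemma exists_testPairing (hβ : 1 < β) {φ : Space → ℂ} (h : IsTest φ) :
    ∃ L : L2InvWeight β →L[ℂ] Spinor, ∀ u, L u = ∫ x, φ x • u x := by
  set a := ∫⁻ y, ENNReal.ofReal (weight β y) * ‖φ y‖ₑ ^ 2 with ha
  have hat : a < ⊤ := lintegral_weight_test_lt_top hβ h
  have hcs : ∀ u : L2InvWeight β, (∫⁻ y, ‖φ y‖ₑ * ‖u y‖ₑ) ^ 2 ≤ ENNReal.ofReal ((√a.toReal * ‖u‖) ^ 2) :=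
    fun u => by
    refine (sq_lintegral_mul_le_inv_weight β h.continuous.enorm.measurable
      (Lp.stronglyMeasurable u).measurable.enorm).trans_eq ?_
    rw [lintegral_invWeight_Lp, ← ha, mul_pow, Real.sq_sqrt ENNReal.toReal_nonneg,
      ENNReal.ofReal_mul ENNReal.toReal_nonneg, ENNReal.ofReal_toReal hat.ne]
  have hi : ∀ u : L2InvWeight β, Integrable fun x => φ x • u x := fun u => by
    refine ⟨(h.continuous.stronglyMeasurable.smul (Lp.stronglyMeasurable u)).aestronglyMeasurable, ?_⟩
    simp only [HasFiniteIntegral, enorm_smul]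
    exact lt_top_of_sq_le (hcs u) ENNReal.ofReal_lt_top
  let L : L2InvWeight β →ₗ[ℂ] Spinor :=
    { toFun := fun u => ∫ x, φ x • u x
      map_add' := fun u v => by
        rw [← integral_add (hi u) (hi v)]
        refine integral_congr_ae ?_
        filter_upwards [ac_invWeightMeasure β (Lp.coeFn_add u v)] with x hx
        rw [hx, Pi.add_apply, smul_add]
      map_smul' := fun c u => by
        rw [RingHom.id_apply, ← integral_smul]
        refine integral_congr_ae ?_
        filter_upwards [ac_invWeightMeasure β (Lp.coeFn_smul c u)] with x hx
        rw [hx, Pi.smul_apply, smul_comm] }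
  refine ⟨L.mkContinuous √a.toReal fun u => ?_, fun u => rfl⟩
  have h1 : ‖L u‖ₑ ≤ ∫⁻ y, ‖φ y‖ₑ * ‖u y‖ₑ := by
    refine (enorm_integral_le_lintegral_enorm _).trans_eq ?_
    simp only [enorm_smul]
  have h2 := (pow_le_pow_left' h1 2).trans (hcs u)
  rw [enorm_sq_eq_ofReal, ENNReal.ofReal_le_ofReal_iff (sq_nonneg _)] at h2
  exact (pow_le_pow_iff_left₀ (norm_nonneg _) (by positivity) two_ne_zero).1 h2

lemma hasWeakPartial_congr {k : Fin 3} {u u' v v' : Space → Spinor} (hu : u =ᵐ[volume] u')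
    (hv : v =ᵐ[volume] v') (h : HasWeakPartial k u v) : HasWeakPartial k u' v' := fun φ hφ => by
  rw [integral_congr_ae (g := fun x => partialDeriv k φ x • u x), h φ hφ,
    integral_congr_ae (g := fun x => φ x • v' x)]
  · filter_upwards [hv] with x hx; rw [hx]
  · filter_upwards [hu] with x hx; rw [hx]

/-- Weak derivatives with a norm bound on test functions extend by density. -/
theorem exists_weakPartial_of_test (hβ : 1 < β) (S : L2Weight β →L[ℂ] L2InvWeight β) (k : Fin 3)
    {δ : ℝ} (hδ : 0 < δ)
    (h : ∀ f ∈ testSubgroup β, ∃ v : L2InvWeight β, HasWeakPartial k (S f) v ∧ ‖v‖ ≤ δ * ‖f‖)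
    (f : L2Weight β) : ∃ v : L2InvWeight β, HasWeakPartial k (S f) v ∧ ‖v‖ ≤ 2 * δ * ‖f‖ := by
  have hpair : ∀ φ : Space → ℂ, IsTest φ → ∃ L : L2Weight β × L2InvWeight β →L[ℂ] Spinor,
      ∀ p, L p = 0 ↔ ∫ x, partialDeriv k φ x • S p.1 x = -∫ x, φ x • ((δ : ℂ) • p.2) x := by
    intro φ hφ
    obtain ⟨L₁, hL₁⟩ := exists_testPairing hβ (hφ.partialDeriv k)
    obtain ⟨L₂, hL₂⟩ := exists_testPairing hβ hφ
    refine ⟨(L₁.comp S).comp (ContinuousLinearMap.fst ℂ _ _) +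
      (δ : ℂ) • L₂.comp (ContinuousLinearMap.snd ℂ _ _), fun p => ?_⟩
    rw [← hL₁, ← hL₂, map_smul, eq_neg_iff_add_eq_zero]
    rfl
  choose L hL using hpair
  -- The graph of f ↦ δ⁻¹∂ₖ(Sf). It is closed, being an intersection of kernels of continuous maps,
  -- one for each test function. Dividing by δ makes the lifts of test functions have norm at most
  -- ‖f‖ in the maximum norm of the product.
  let G : Submodule ℂ (L2Weight β × L2InvWeight β) := ⨅ φ, ⨅ hφ, (L φ hφ).ker
  have hG : ∀ p, p ∈ G ↔ HasWeakPartial k (S p.1) ((δ : ℂ) • p.2 : L2InvWeight β) := fun p => by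
    simp only [G, Submodule.mem_iInf, LinearMap.mem_ker, ContinuousLinearMap.coe_coe, hL]
    rfl
  have hGc : IsClosed (G : Set (L2Weight β × L2InvWeight β)) := by
    simp only [G, Submodule.coe_iInf]
    exact isClosed_iInter fun φ => isClosed_iInter fun hφ => (L φ hφ).isClosed_ker
  have : CompleteSpace G := hGc.completeSpace_coe
  let F : NormedAddGroupHom G (L2Weight β) :=
    AddMonoidHom.mkNormedAddGroupHom
      ((AddMonoidHom.fst (L2Weight β) (L2InvWeight β)).comp G.subtype.toAddMonoidHom) 1
      (fun p => by rw [one_mul]; exact norm_fst_le (p : L2Weight β × L2InvWeight β))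
  have hF : ∀ p : G, F p = (p : L2Weight β × L2InvWeight β).1 := fun p => rfl
  have hδ' : ‖(δ : ℂ)‖ = δ := by rw [Complex.norm_real, Real.norm_of_nonneg hδ.le]
  have hδ0 : (δ : ℂ) ≠ 0 := by exact_mod_cast hδ.ne'
  have hs : F.SurjectiveOnWith (testSubgroup β) 1 := by
    intro g hg
    obtain ⟨v, hv, hvn⟩ := h g hg
    refine ⟨⟨(g, (δ : ℂ)⁻¹ • v), (hG _).2 ?_⟩, rfl, ?_⟩
    · rwa [smul_smul, mul_inv_cancel₀ hδ0, one_smul]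
    · rw [one_mul]
      refine max_le le_rfl ?_
      change ‖(δ : ℂ)⁻¹ • v‖ ≤ ‖g‖
      rw [norm_smul, norm_inv, hδ', inv_mul_le_iff₀ hδ]
      exact hvn
  -- Norm-controlled lifts of a dense subgroup through a complete space extend to its closure, with
  -- the constant raised from 1 to 1 + 1. This is the factor 2 in the conclusion.
  have hcl := controlled_closure_of_complete one_pos one_pos hs
  rw [topologicalClosure_testSubgroup hβ] at hcl
  obtain ⟨p, hp, hpn⟩ := hcl f trivial
  rw [hF] at hp
  refine ⟨(δ : ℂ) • (p : L2Weight β × L2InvWeight β).2, ?_, ?_⟩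
  · rw [← hp]; exact (hG _).1 p.2
  · rw [norm_smul, hδ']
    have := (norm_snd_le (p : L2Weight β × L2InvWeight β)).trans hpn
    calc δ * ‖(p : L2Weight β × L2InvWeight β).2‖ ≤ δ * ((1 + 1) * ‖f‖) := by gcongr
      _ = _ := by ring

end Density

/-! ### Convergence in the weighted H¹ norm. -/

section EnergyConvergence

variable {β : ℝ}

lemma kernOp_congr_ae (s : ℤˣ) (z : ℂ) {f g : Space → Spinor} (h : f =ᵐ[volume] g) :
    kernOp s z f = kernOp s z g := by
  ext1 x
  refine integral_congr_ae ?_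
  filter_upwards [h] with y hy
  rw [hy]

/-- Each operator inverts 𝒟 minus its parameter, so the two copies of φ cancel. With w on the
boundary, the first term is small by the factor z - w and the second by weighted L² convergence. -/
lemma diracSmooth_kernOp_sub {s : ℤˣ} {z w : ℂ} (hz : 0 ≤ (((s : ℤ) : ℂ) * z).im)
    (hw : 0 ≤ (((s : ℤ) : ℂ) * w).im) {φ : Space → Spinor} (h : IsTest φ) (x : Space) :
    diracSmooth (fun y => kernOp s z φ y - kernOp s w φ y) x =
      (z - w) • kernOp s z φ x + w • (kernOp s z φ x - kernOp s w φ x) := by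
  have d1 := (contDiff_kernOp hz h).differentiable (by simp)
  have d2 := (contDiff_kernOp hw h).differentiable (by simp)
  have e : (fun y => kernOp s z φ y - kernOp s w φ y) =
      fun y => kernOp s z φ y + (-1 : ℂ) • kernOp s w φ y := by
    ext1 y; rw [neg_one_smul, sub_eq_add_neg]
  have d3 : Differentiable ℝ fun y => (-1 : ℂ) • kernOp s w φ y := d2.const_smul (-1 : ℂ)
  rw [e, diracSmooth_add d1 d3, diracSmooth_const_smul d2, diracSmooth_kernOp hz h,
    diracSmooth_kernOp hw h]
  module

lemma eventually_lintegral_partialDeriv_kernOp_sub_le (hβ : 1 < β) (s : ℤˣ) (l : ℝ) {δ : ℝ}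
    (hδ : 0 < δ) :
    ∀ᶠ ε : ℝ in 𝓝[>] (0 : ℝ), ∀ φ : Space → Spinor, IsTest φ → ∀ k,
        ∫⁻ x, ENNReal.ofReal (weight β x)⁻¹ * ‖partialDeriv k (fun y => kernOp s
          ((l : ℂ) + Complex.I * ((s : ℤ) : ℂ) * (ε : ℂ)) φ y - kernOp s l φ y) x‖ₑ ^ 2 ≤
          ENNReal.ofReal δ * ∫⁻ y, ENNReal.ofReal (weight β y) * ‖φ y‖ₑ ^ 2 := by
  obtain ⟨c, hc0, hc⟩ := exists_gradient_bound (β := β) (by linarith)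
  obtain ⟨C, hC0, hC⟩ := exists_uniform_bound hβ
  -- Chosen so that c(2l² + 1)η ≤ δ/2. The 2l² comes from the term l(K_z - K_l)φ and the 1 from the
  -- singular weight; the other half of δ pays for the term with z - l.
  set η : ℝ := δ / (2 * (c + 1) * (2 * l ^ 2 + 1)) with hη
  have hη0 : 0 < η := by positivity
  have h0 : ∀ᶠ ε : ℝ in 𝓝[>] (0 : ℝ), c * (2 * ε ^ 2 * C ^ 2) < δ / 2 := by
    have h1 : Continuous fun ε : ℝ => c * (2 * ε ^ 2 * C ^ 2) := by fun_prop
    have h2 : Tendsto (fun ε : ℝ => c * (2 * ε ^ 2 * C ^ 2)) (𝓝[>] 0) (𝓝 0) := by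
      simpa using (h1.tendsto 0).mono_left nhdsWithin_le_nhds
    exact h2.eventually_lt_const (half_pos hδ)
  filter_upwards [h0, eventually_lintegral_kernOp_sub_le hβ s l hη0,
    eventually_lintegral_inv_sq_kernOp_sub_le hβ s l hη0, self_mem_nhdsWithin]
    with ε h1 h2 h3 hε0 φ hφ k
  have hε0' : 0 < ε := hε0
  have hf := hφ.continuous.stronglyMeasurable
  have hF := lintegral_weight_test_lt_top hβ hφ
  replace h2 := h2 φ hf hF
  replace h3 := h3 φ hf hF
  set z := (l : ℂ) + Complex.I * ((s : ℤ) : ℂ) * (ε : ℂ) with hzdef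
  have hz : 0 ≤ (((s : ℤ) : ℂ) * z).im := by rw [hzdef, im_boundary_param]; exact hε0'.le
  have hl : 0 ≤ (((s : ℤ) : ℂ) * (l : ℂ)).im := (im_boundary_value s l).ge
  have hd : ‖z - l‖ = ε := norm_boundary_param_sub s l hε0'.le
  have h4 := hC s z hz φ hf hF
  set F := ∫⁻ y, ENNReal.ofReal (weight β y) * ‖φ y‖ₑ ^ 2 with hFdef
  have cd : ContDiff ℝ ∞ fun y => kernOp s z φ y - kernOp s l φ y :=
    (contDiff_kernOp hz hφ).sub (contDiff_kernOp hl hφ)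
  have h5 : ∫⁻ x, ENNReal.ofReal (weight β x)⁻¹ *
      ‖diracSmooth (fun y => kernOp s z φ y - kernOp s l φ y) x‖ₑ ^ 2 ≤
      ENNReal.ofReal (2 * ε ^ 2 * C ^ 2) * F + ENNReal.ofReal (2 * l ^ 2 * η) * F := by
    have m1 : Measurable fun x => ENNReal.ofReal (weight β x)⁻¹ * ‖kernOp s z φ x‖ₑ ^ 2 :=
      (measurable_ofReal_inv_weight β).mul
        ((stronglyMeasurable_kernOp s z hf).measurable.enorm.pow_const 2)
    calc _ ≤ ∫⁻ x, (ENNReal.ofReal (2 * ε ^ 2) *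
            (ENNReal.ofReal (weight β x)⁻¹ * ‖kernOp s z φ x‖ₑ ^ 2) +
          ENNReal.ofReal (2 * l ^ 2) * (ENNReal.ofReal (weight β x)⁻¹ *
            ‖kernOp s z φ x - kernOp s l φ x‖ₑ ^ 2)) := by
          refine lintegral_mono fun x => ?_
          rw [diracSmooth_kernOp_sub hz hl hφ, ← mul_assoc, ← mul_assoc,
            mul_comm (ENNReal.ofReal (2 * ε ^ 2)), mul_comm (ENNReal.ofReal (2 * l ^ 2)), mul_assoc,
            mul_assoc, ← mul_add]
          refine mul_le_mul_right ?_ _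
          simp only [enorm_sq_eq_ofReal]
          rw [← ENNReal.ofReal_mul (by positivity), ← ENNReal.ofReal_mul (by positivity),
            ← ENNReal.ofReal_add (by positivity) (by positivity)]
          refine ENNReal.ofReal_le_ofReal ?_
          have h6 := norm_add_le ((z - l) • kernOp s z φ x)
            ((l : ℂ) • (kernOp s z φ x - kernOp s l φ x))
          rw [norm_smul, norm_smul, hd, Complex.norm_real, Real.norm_eq_abs] at h6
          rw [← sq_abs l]
          set a := ‖kernOp s z φ x‖
          set b := ‖kernOp s z φ x - kernOp s l φ x‖
          calc _ ≤ (ε * a + |l| * b) ^ 2 := pow_le_pow_left₀ (norm_nonneg _) h6 2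
            _ ≤ _ := by nlinarith [sq_nonneg (ε * a - |l| * b)]
      _ = ENNReal.ofReal (2 * ε ^ 2) * (∫⁻ x, ENNReal.ofReal (weight β x)⁻¹ *
            ‖kernOp s z φ x‖ₑ ^ 2) + ENNReal.ofReal (2 * l ^ 2) *
            ∫⁻ x, ENNReal.ofReal (weight β x)⁻¹ * ‖kernOp s z φ x - kernOp s l φ x‖ₑ ^ 2 := by
          rw [lintegral_add_left (m1.const_mul _), lintegral_const_mul' _ _ ENNReal.ofReal_ne_top,
            lintegral_const_mul' _ _ ENNReal.ofReal_ne_top]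
      _ ≤ ENNReal.ofReal (2 * ε ^ 2) * (ENNReal.ofReal (C ^ 2) * F) +
            ENNReal.ofReal (2 * l ^ 2) * (ENNReal.ofReal η * F) := by gcongr
      _ = _ := by
          rw [← mul_assoc, ← mul_assoc, ENNReal.ofReal_mul (p := 2 * ε ^ 2) (by positivity),
            ENNReal.ofReal_mul (p := 2 * l ^ 2) (by positivity)]
  refine (hc _ cd k).trans ?_
  calc _ ≤ ENNReal.ofReal c * ((ENNReal.ofReal (2 * ε ^ 2 * C ^ 2) * F +
        ENNReal.ofReal (2 * l ^ 2 * η) * F) + ENNReal.ofReal η * F) :=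
        mul_le_mul_right (add_le_add h5 h3) _
    _ = ENNReal.ofReal (c * (2 * ε ^ 2 * C ^ 2 + 2 * l ^ 2 * η + η)) * F := by
        rw [ENNReal.ofReal_mul hc0, ENNReal.ofReal_add (by positivity) hη0.le,
          ENNReal.ofReal_add (by positivity) (by positivity)]
        ring
    _ ≤ _ := by
        refine mul_le_mul_left (ENNReal.ofReal_le_ofReal ?_) _
        have e : c * ((2 * l ^ 2 + 1) * η) = δ / 2 * (c / (c + 1)) := by
          rw [hη]; field_simp
        have h7 : δ / 2 * (c / (c + 1)) ≤ δ / 2 :=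
          mul_le_of_le_one_right (by positivity) ((div_le_one (by positivity)).2 (by linarith))
        linarith

lemma exists_weakPartial_kernOp_sub {S : L2Weight β →L[ℂ] L2InvWeight β} {s : ℤˣ} {z w : ℂ}
    (hz : 0 ≤ (((s : ℤ) : ℂ) * z).im) (hw : 0 ≤ (((s : ℤ) : ℂ) * w).im)
    (hS : ∀ f, S f =ᵐ[volume] fun x => kernOp s z f x - kernOp s w f x) {δ : ℝ} (hδ : 0 < δ)
    (k : Fin 3)
    (h : ∀ φ : Space → Spinor, IsTest φ → ∫⁻ x, ENNReal.ofReal (weight β x)⁻¹ *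
      ‖partialDeriv k (fun y => kernOp s z φ y - kernOp s w φ y) x‖ₑ ^ 2 ≤
        ENNReal.ofReal (δ ^ 2) * ∫⁻ y, ENNReal.ofReal (weight β y) * ‖φ y‖ₑ ^ 2) :
    ∀ f ∈ testSubgroup β, ∃ v : L2InvWeight β, HasWeakPartial k (S f) v ∧ ‖v‖ ≤ δ * ‖f‖ := by
  rintro f ⟨φ, hφ, hfφ⟩
  have hfφ' := ac_weightMeasure β hfφ
  set u := fun y => kernOp s z φ y - kernOp s w φ y with hu
  have cd : ContDiff ℝ ∞ u := (contDiff_kernOp hz hφ).sub (contDiff_kernOp hw hφ)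
  have hc := (contDiff_partialDeriv cd k).continuous
  have hb : ∫⁻ x, ENNReal.ofReal (weight β x)⁻¹ * ‖partialDeriv k u x‖ₑ ^ 2 ≤
      ENNReal.ofReal ((δ * ‖f‖) ^ 2) := by
    refine (h φ hφ).trans_eq ?_
    rw [mul_pow, ENNReal.ofReal_mul (sq_nonneg δ), ← lintegral_weight_Lp]
    congr 1
    refine lintegral_congr_ae ?_
    filter_upwards [hfφ'] with y hy
    rw [hy]
  have hm : MemLp (partialDeriv k u) 2 (invWeightMeasure β) :=
    (memLp_invWeight_iff hc.stronglyMeasurable).2 (hb.trans_lt ENNReal.ofReal_lt_top)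
  have hv := ac_invWeightMeasure β hm.coeFn_toLp
  refine ⟨hm.toLp, hasWeakPartial_congr ?_ (EventuallyEq.symm hv) (hasWeakPartial_of_contDiff cd k), ?_⟩
  · filter_upwards [hS f] with x hx
    rw [hx, kernOp_congr_ae s z hfφ', kernOp_congr_ae s w hfφ']
  · refine norm_Lp_le_of_lintegral (by positivity) ?_
    rw [lintegral_invWeightMeasure β ((Lp.stronglyMeasurable _).measurable.enorm.pow_const 2)]
    refine le_trans (le_of_eq (lintegral_congr_ae ?_)) hb
    filter_upwards [hv] with x hx
    rw [hx]

/-- Limiting absorption in the operator norm from `L²(w_β dx)` to `H¹(w_β⁻¹ dx)`. -/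
theorem tendstoInL2H1_kernOp (hβ : 1 < β) (s : ℤˣ) (l : ℝ)
    {S : ℝ → L2Weight β →L[ℂ] L2InvWeight β} {S₀ : L2Weight β →L[ℂ] L2InvWeight β}
    (hS : ∀ ε : ℝ, 0 < ε → ∀ f, S ε f =ᵐ[volume]
      kernOp s ((l : ℂ) + Complex.I * ((s : ℤ) : ℂ) * (ε : ℂ)) f)
    (hS₀ : ∀ f, S₀ f =ᵐ[volume] kernOp s l f) : TendstoInL2H1 β S S₀ := by
  intro δ hδ
  -- The function contributes (1/4)² and each of the three derivatives (2/4)², altogether 13/16 of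
  -- δ²‖f‖².
  have hδ1 : 0 < δ / 4 := by positivity
  filter_upwards [eventually_lintegral_kernOp_sub_le hβ s l (pow_pos hδ1 2),
    eventually_lintegral_partialDeriv_kernOp_sub_le hβ s l (pow_pos hδ1 2), self_mem_nhdsWithin]
    with ε h1 h2 hε0 f
  have hε0' : 0 < ε := hε0
  set z := (l : ℂ) + Complex.I * ((s : ℤ) : ℂ) * (ε : ℂ) with hzdef
  have hz : 0 ≤ (((s : ℤ) : ℂ) * z).im := by rw [hzdef, im_boundary_param]; exact hε0'.le
  have hl : 0 ≤ (((s : ℤ) : ℂ) * (l : ℂ)).im := (im_boundary_value s l).ge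
  have hD : ∀ f, (S ε - S₀) f =ᵐ[volume] fun x => kernOp s z f x - kernOp s l f x := fun f => by
    have e : (S ε - S₀) f = S ε f - S₀ f := rfl
    rw [e]
    filter_upwards [ac_invWeightMeasure β (Lp.coeFn_sub (S ε f) (S₀ f)), hS ε hε0' f, hS₀ f]
      with x hx hx1 hx2
    rw [hx, Pi.sub_apply, hx1, hx2]
  have hn : ‖(S ε - S₀) f‖ ≤ δ / 4 * ‖f‖ := by
    refine norm_Lp_le_of_lintegral (by positivity) ?_
    rw [lintegral_invWeightMeasure β ((Lp.stronglyMeasurable _).measurable.enorm.pow_const 2),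
      mul_pow, ENNReal.ofReal_mul (sq_nonneg _), ← lintegral_weight_Lp]
    refine le_trans (le_of_eq (lintegral_congr_ae ?_))
      (h1 f (Lp.stronglyMeasurable f) (lintegral_weight_Lp_lt_top f))
    filter_upwards [hD f] with x hx
    rw [hx]
  have hg : ∀ k, ∃ v : L2InvWeight β, HasWeakPartial k ((S ε - S₀) f) v ∧
      ‖v‖ ≤ 2 * (δ / 4) * ‖f‖ := fun k =>
    exists_weakPartial_of_test hβ (S ε - S₀) k hδ1
      (exists_weakPartial_kernOp_sub hz hl hD hδ1 k fun φ hφ => h2 φ hφ k) f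
  choose v hv hvn using hg
  refine ⟨v, hv, ?_⟩
  rw [Real.sqrt_le_left (by positivity)]
  have hn' : ‖S ε f - S₀ f‖ ^ 2 ≤ (δ / 4 * ‖f‖) ^ 2 := pow_le_pow_left₀ (norm_nonneg _) hn 2
  have hs : ∑ k, ‖v k‖ ^ 2 ≤ ∑ _k : Fin 3, (2 * (δ / 4) * ‖f‖) ^ 2 :=
    Finset.sum_le_sum fun k _ => pow_le_pow_left₀ (norm_nonneg _) (hvn k) 2
  simp only [Finset.sum_const, Finset.card_univ, Fintype.card_fin, nsmul_eq_mul] at hs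
  push_cast at hs
  nlinarith [sq_nonneg (δ * ‖f‖)]

end EnergyConvergence

/-! ### Boundary values of the free resolvent. -/

section FreeBoundaryValue

variable {β : ℝ}

lemma norm_gK_sub_le {κ κ' : ℂ} {d : ℝ} (h : 0 ≤ κ.im) (h' : 0 ≤ κ'.im) (hd : ‖κ - κ'‖ ≤ d)
    (r : Space) : ‖gK κ r - gK κ' r‖ ≤ 2 * (min (d * (‖r‖ + 1)) 1 * ‖r‖⁻¹) := by
  have hd0 : 0 ≤ d := (norm_nonneg _).trans hd
  have h1 := norm_sub_le_two_mul_min hd0 (norm_nonneg r) h h' hd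
  have e : gK κ r - gK κ' r = (4 * (Real.pi : ℂ))⁻¹ * ((‖r‖ : ℂ)⁻¹ *
      (Complex.exp (Complex.I * κ * (‖r‖ : ℂ)) - Complex.exp (Complex.I * κ' * (‖r‖ : ℂ)))) := by
    unfold gK
    rw [div_eq_mul_inv, div_eq_mul_inv, mul_inv]; ring
  rw [e, norm_mul, norm_mul, norm_inv (‖r‖ : ℂ), Complex.norm_real, norm_norm]
  have h4 := norm_four_pi_inv_le
  calc _ ≤ 1 * (‖r‖⁻¹ * (2 * min (d * (‖r‖ + 1)) 1)) := by gcongr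
    _ = _ := by ring

/-- Cauchy–Schwarz for the measure f dy, then Tonelli and the uniform bound for the integral of
|y-x|⁻²w(x)⁻¹ in x. -/
lemma lintegral_inv_weight_mul_potential_sq_le (hβ : 1 < β) : ∃ A : ℝ, 0 ≤ A ∧
    ∀ f : Space → ℝ≥0∞, Measurable f →
      ∫⁻ x, ENNReal.ofReal (weight β x)⁻¹ * (∫⁻ y, f y * ENNReal.ofReal ‖x - y‖⁻¹) ^ 2 ≤
        ENNReal.ofReal A * (∫⁻ y, f y) ^ 2 := by
  obtain ⟨A, hA0, hA⟩ := exists_lintegral_inv_sq_sub_mul_inv_weight_le hβ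
  refine ⟨A, hA0, fun f hf => ?_⟩
  have hwm := measurable_weight β
  have m2 : Measurable fun p : Space × Space =>
      f p.2 * ENNReal.ofReal (‖p.2 - p.1‖⁻¹ ^ 2 * (weight β p.1)⁻¹) := by
    refine (hf.comp measurable_snd).mul (Measurable.ennreal_ofReal ?_)
    have : Measurable fun p : Space × Space => weight β p.1 := hwm.comp measurable_fst
    exact Measurable.mul (by fun_prop) this.inv
  calc _ ≤ ∫⁻ x, (∫⁻ y, f y) * ∫⁻ y, f y * ENNReal.ofReal (‖y - x‖⁻¹ ^ 2 * (weight β x)⁻¹) := by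
        refine lintegral_mono fun x => ?_
        have h1 := sq_lintegral_mul_le_mul (μ := volume) (a := f)
          (b := fun y => ENNReal.ofReal ‖x - y‖⁻¹) hf.aemeasurable
          (Measurable.ennreal_ofReal (by fun_prop)).aemeasurable
        refine (mul_le_mul_right h1 _).trans_eq ?_
        rw [mul_left_comm, ← lintegral_const_mul' _ _ ENNReal.ofReal_ne_top]
        congr 1
        refine lintegral_congr fun y => ?_
        rw [← ENNReal.ofReal_pow (by positivity), norm_sub_rev, mul_left_comm,
          ← ENNReal.ofReal_mul (inv_nonneg.2 (weight_nonneg β x)), mul_comm (weight β x)⁻¹]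
    _ = (∫⁻ y, f y) * ∫⁻ y, f y * ∫⁻ x, ENNReal.ofReal (‖y - x‖⁻¹ ^ 2 * (weight β x)⁻¹) := by
        rw [lintegral_const_mul _ m2.lintegral_prod_right',
          lintegral_lintegral_swap m2.aemeasurable]
        congr 1
        refine lintegral_congr fun y => ?_
        dsimp only
        rw [lintegral_const_mul]
        exact Measurable.ennreal_ofReal (Measurable.mul (by fun_prop) hwm.inv)
    _ ≤ (∫⁻ y, f y) * ∫⁻ y, f y * ENNReal.ofReal A :=
        mul_le_mul_right (lintegral_mono fun y => mul_le_mul_right (hA y) _) _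
    _ = _ := by rw [lintegral_mul_const' _ _ ENNReal.ofReal_ne_top]; ring

lemma gConv_eq_sub (κ : ℂ) (ψ : Space → Spinor) (x : Space) :
    gConv κ ψ x = ∫ y, gK κ (x - y) • ψ y := by
  rw [← integral_sub_left_eq_self (fun y => gK κ (x - y) • ψ y) volume x]
  simp [gConv]

/-- The estimate depends only on the distance of the two square roots, so the energy zero needs no
separate treatment. The small factor is now placed on the x variable, since y stays in the bounded
support of ψ. -/
lemma eventually_lintegral_gConv_sub_le (hβ : 1 < β) {ψ : Space → Spinor} (hψ : IsTest ψ) {δ : ℝ}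
    (hδ : 0 < δ) : ∀ᶠ d : ℝ in 𝓝[>] (0 : ℝ), ∀ κ κ' : ℂ, 0 ≤ κ.im → 0 ≤ κ'.im → ‖κ - κ'‖ ≤ d →
      ∫⁻ x, ENNReal.ofReal (weight β x)⁻¹ * ‖gConv κ ψ x - gConv κ' ψ x‖ₑ ^ 2 ≤
        ENNReal.ofReal δ := by
  set β' := (1 + β) / 2 with hβ'
  have h1β' : 1 < β' := by rw [hβ']; linarith
  obtain ⟨A, hA0, hA⟩ := lintegral_inv_weight_mul_potential_sq_le h1β'
  obtain ⟨R, hR0, hR⟩ := hψ.exists_radius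
  set I : ℝ := ∫ y, ‖ψ y‖ with hI
  have hI0 : 0 ≤ I := integral_nonneg fun y => norm_nonneg _
  have hIl : ∫⁻ y, ‖ψ y‖ₑ = ENNReal.ofReal I := (ofReal_integral_norm_eq_lintegral_enorm hψ.integrable).symm
  set η : ℝ := δ / (4 * (A * I ^ 2 + 1)) with hη
  have hη0 : 0 < η := by positivity
  filter_upwards [eventually_min_sq_le (R + 1) (γ := β - β') (by linarith)
    (by rw [hβ']; linarith) hη0, self_mem_nhdsWithin] with d hd hd0 κ κ' h h' hκ
  have hd0' : 0 < d := hd0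
  have hp : ∀ x, ‖gConv κ ψ x - gConv κ' ψ x‖ₑ ≤
      ENNReal.ofReal (2 * min (d * (‖x‖ + (R + 1))) 1) * ∫⁻ y, ‖ψ y‖ₑ * ENNReal.ofReal ‖x - y‖⁻¹ := by
    intro x
    have hm0 : 0 ≤ min (d * (‖x‖ + (R + 1))) 1 := le_min (by positivity) zero_le_one
    rw [gConv, gConv, ← integral_sub (integrable_gK_smul h hψ x) (integrable_gK_smul h' hψ x),
      ← integral_sub_left_eq_self (fun r => gK κ r • ψ (x - r) - gK κ' r • ψ (x - r)) volume x,
      ← lintegral_const_mul' _ _ ENNReal.ofReal_ne_top]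
    refine (enorm_integral_le_lintegral_enorm _).trans (lintegral_mono fun y => ?_)
    simp only [sub_sub_cancel]
    rw [← sub_smul, enorm_smul]
    by_cases hy : R ≤ ‖y‖
    · simp [hR y hy]
    rw [mul_left_comm, mul_comm, ← ENNReal.ofReal_mul (by positivity), ← ofReal_norm (gK κ _ - _)]
    refine mul_le_mul_right (ENNReal.ofReal_le_ofReal ((norm_gK_sub_le h h' hκ _).trans ?_)) _
    rw [← mul_assoc]
    have : ‖x - y‖ + 1 ≤ ‖x‖ + (R + 1) := by linarith [norm_sub_le x y]
    gcongr
  calc _ ≤ ∫⁻ x, ENNReal.ofReal (4 * η) * (ENNReal.ofReal (weight β' x)⁻¹ *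
        (∫⁻ y, ‖ψ y‖ₑ * ENNReal.ofReal ‖x - y‖⁻¹) ^ 2) := by
        refine lintegral_mono fun x => ?_
        have hm0 : 0 ≤ min (d * (‖x‖ + (R + 1))) 1 := le_min (by positivity) zero_le_one
        have hq : 0 < (|Real.log ‖x‖| + 1) ^ (β - β') := by positivity
        have hw := inv_nonneg.2 (weight_nonneg β' x)
        refine (mul_le_mul_right (pow_le_pow_left' (hp x) 2) _).trans ?_
        rw [mul_pow, ← mul_assoc, ← mul_assoc, ← ENNReal.ofReal_pow (by positivity),
          ← ENNReal.ofReal_mul (inv_nonneg.2 (weight_nonneg β x)),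
          ← ENNReal.ofReal_mul (by positivity)]
        refine mul_le_mul_left (ENNReal.ofReal_le_ofReal ?_) _
        rw [weight_eq_mul β β' x, mul_inv]
        calc _ = 4 * (min (d * (‖x‖ + (R + 1))) 1 ^ 2 * ((|Real.log ‖x‖| + 1) ^ (β - β'))⁻¹) *
              (weight β' x)⁻¹ := by ring
          _ ≤ _ := by
              gcongr
              rw [← div_eq_mul_inv, div_le_iff₀ hq]
              exact hd x
    _ = ENNReal.ofReal (4 * η) * ∫⁻ x, ENNReal.ofReal (weight β' x)⁻¹ *
        (∫⁻ y, ‖ψ y‖ₑ * ENNReal.ofReal ‖x - y‖⁻¹) ^ 2 :=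
        lintegral_const_mul' _ _ ENNReal.ofReal_ne_top
    _ ≤ ENNReal.ofReal (4 * η) * (ENNReal.ofReal A * ENNReal.ofReal I ^ 2) := by
        rw [← hIl]
        exact mul_le_mul_right (hA _ hψ.continuous.enorm.measurable) _
    _ ≤ _ := by
        rw [← ENNReal.ofReal_pow hI0, ← ENNReal.ofReal_mul hA0, ← ENNReal.ofReal_mul (by positivity)]
        refine ENNReal.ofReal_le_ofReal ?_
        have e : 4 * η * (A * I ^ 2) = δ * (A * I ^ 2 / (A * I ^ 2 + 1)) := by
          rw [hη]; field_simp
        rw [e]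
        exact mul_le_of_le_one_right hδ.le ((div_le_one (by positivity)).2 (by linarith))

/-- One has |κ-a||κ+a| = ε. As Im κ > 0, the real part of κ has the sign s, which is also that of a,
so κ - a is the smaller of the two factors. -/
lemma norm_sub_le_sqrt {κ : ℂ} {a ε : ℝ} (hε : 0 ≤ ε) (s : ℤˣ) (hκ : 0 < κ.im)
    (h : κ ^ 2 = ((a ^ 2 : ℝ) : ℂ) + Complex.I * ((s : ℤ) : ℂ) * (ε : ℂ))
    (ha : 0 ≤ ((s : ℤ) : ℝ) * a) : ‖κ - a‖ ≤ √ε := by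
  have hss : ((s : ℤ) : ℝ) * ((s : ℤ) : ℝ) = 1 := by
    rcases Int.units_eq_one_or s with rfl | rfl <;> simp
  have him : 2 * κ.re * κ.im = ((s : ℤ) : ℝ) * ε := by
    have := congrArg Complex.im h
    simp [sq] at this
    linarith
  have hre : 0 ≤ a * κ.re := by
    have h1 : 0 ≤ ((s : ℤ) : ℝ) * κ.re := by
      by_contra h2
      rw [not_le] at h2
      have h3 : ((s : ℤ) : ℝ) * (2 * κ.re * κ.im) = ε := by rw [him, ← mul_assoc, hss, one_mul]
      nlinarith [mul_neg_of_neg_of_pos h2 hκ]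
    have h2 := mul_nonneg ha h1
    nlinarith
  have h1 : ‖κ - a‖ ≤ ‖κ + a‖ := by
    rw [← abs_norm, ← abs_norm (κ + a), ← sq_le_sq, ← Complex.normSq_eq_norm_sq,
      ← Complex.normSq_eq_norm_sq, Complex.normSq_apply, Complex.normSq_apply]
    simp
    nlinarith
  have h2 : ‖κ - a‖ * ‖κ + a‖ = ε := by
    rw [← norm_mul, show (κ - a) * (κ + a) = κ ^ 2 - (a : ℂ) ^ 2 by ring, h, Complex.ofReal_pow,
      add_sub_cancel_left, norm_mul, norm_mul, norm_units_int, Complex.norm_I, Complex.norm_real,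
      Real.norm_of_nonneg hε]
    ring
  refine Real.le_sqrt_of_sq_le ?_
  rw [sq, ← h2]
  exact mul_le_mul_of_nonneg_left h1 (norm_nonneg _)

/-- The boundary values of the Dirac resolvent in terms of those of the free resolvent. -/
theorem isFreeBoundaryValue_kernOp (hβ : 1 < β) (σ s : ℤˣ) (l : ℝ)
    (hs : 0 ≤ ((s : ℤ) : ℝ) * ((σ : ℤ) : ℝ) * l) {φ : Space → Spinor} (hφ : IsTest φ) {g : L2}
    (hg : g =ᵐ[volume] fun x => diracSmooth φ x + (l : ℂ) • φ x) {u : L2InvWeight β}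
    (hu : u =ᵐ[volume] kernOp σ l φ) : IsFreeBoundaryValue β (l ^ 2) s g u := by
  have hl : 0 ≤ (((σ : ℤ) : ℂ) * (l : ℂ)).im := (im_boundary_value σ l).ge
  set ψ := fun x => diracSmooth φ x + (l : ℂ) • φ x with hψ
  have hψt : IsTest ψ := isTest_dirac_add hφ l
  rw [IsFreeBoundaryValue, ENNReal.tendsto_nhds_zero]
  intro η hη
  rcases eq_or_ne η ⊤ with rfl | hηt
  · exact Eventually.of_forall fun _ => le_top
  have hη' : 0 < η.toReal := ENNReal.toReal_pos hη.ne' hηt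
  have hsq : Tendsto (fun ε : ℝ => √ε) (𝓝[>] 0) (𝓝[>] 0) := by
    refine tendsto_nhdsWithin_iff.2 ⟨?_, ?_⟩
    · simpa using (Real.continuous_sqrt.tendsto 0).mono_left nhdsWithin_le_nhds
    · filter_upwards [self_mem_nhdsWithin] with ε hε using Real.sqrt_pos.2 hε
  filter_upwards [hsq.eventually (eventually_lintegral_gConv_sub_le hβ hψt (pow_pos hη' 2)),
    self_mem_nhdsWithin] with ε h hε
  have hε' : 0 < ε := hε
  -- The root that defines the free resolvent. The hypothesis on sσl makes it approach σl, the
  -- frequency in `kern σ l`, rather than -σl.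
  obtain ⟨κ, hκ, hκ0⟩ := exists_sq_eq_im_pos
    (z := ((l ^ 2 : ℝ) : ℂ) + Complex.I * ((s : ℤ) : ℂ) * (ε : ℂ)) (by
      rcases Int.units_eq_one_or s with rfl | rfl <;> simp [-Complex.ofReal_pow, hε'.ne'])
  have hcast : ((σ : ℤ) : ℂ) * (l : ℂ) = ((((σ : ℤ) : ℝ) * l : ℝ) : ℂ) := by push_cast; rfl
  have hσσ : (((σ : ℤ) : ℝ) * l) ^ 2 = l ^ 2 := by
    rcases Int.units_eq_one_or σ with rfl | rfl <;> simp
  have hd : ‖κ - ((σ : ℤ) : ℂ) * (l : ℂ)‖ ≤ √ε := by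
    rw [hcast]
    refine norm_sub_le_sqrt hε'.le s hκ0 ?_ (by rw [← mul_assoc]; exact hs)
    rw [hσσ, hκ]
  have hb := h κ _ hκ0.le hl hd
  have e : (fun x => freeResolvent (((l ^ 2 : ℝ) : ℂ) + Complex.I * ((s : ℤ) : ℂ) * (ε : ℂ)) g x -
      u x) =ᵐ[volume] fun x => gConv κ ψ x - gConv (((σ : ℤ) : ℂ) * (l : ℂ)) ψ x := by
    rw [← hκ]
    filter_upwards [freeResolvent_ae_eq hκ0 g, hu] with x h1 h2
    rw [h1, h2, kernOp_test hl hφ, gConv_eq_sub κ]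
    congr 1
    refine integral_congr_ae ?_
    filter_upwards [hg] with y hy
    rw [hy]
  rw [eLpNorm_congr_ae (invWeightMeasure_ac β e)]
  have h3 : eLpNorm (fun x => gConv κ ψ x - gConv (((σ : ℤ) : ℂ) * (l : ℂ)) ψ x) 2
      (invWeightMeasure β) ^ 2 ≤ η ^ 2 := by
    have hm : Measurable fun x => ‖gConv κ ψ x - gConv (((σ : ℤ) : ℂ) * (l : ℂ)) ψ x‖ₑ ^ 2 :=
      ((contDiff_gConv hκ0.le hψt).continuous.sub
        (contDiff_gConv hl hψt).continuous).enorm.measurable.pow_const 2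
    rw [eLpNorm_two_sq, lintegral_invWeightMeasure β hm]
    refine hb.trans_eq ?_
    rw [ENNReal.ofReal_pow hη'.le, ENNReal.ofReal_toReal hηt]
  exact (ENNReal.pow_le_pow_left_iff two_ne_zero).1 h3

end FreeBoundaryValue

/-! ### The explicit integral formula. -/

section IntegralKernel

variable {β : ℝ}

lemma norm_phase (σ : ℤˣ) (l : ℝ) (r : Space) : ‖phase σ l r‖ = 1 := by
  rw [phase, mul_assoc Complex.I, norm_exp_I_mul, im_boundary_value]
  simp

lemma alphaDir_apply (r : Space) (a : Spinor) :
    alphaDir r a = ∑ k, (r k / ‖r‖) • alpha k a := by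
  simp only [alphaDir, sum_apply, smul_apply]
  rfl

lemma norm_alphaDir_le (r : Space) (a : Spinor) : ‖alphaDir r a‖ ≤ alphaConst * ‖a‖ := by
  rw [alphaDir_apply]
  simpa using norm_sum_smul_alpha_le (abs_apply_div_norm_le r) a

/-- With κ = σl one has -i(iκ/|r| - 1/|r|²) = σl/|r| + i/|r|²: the first summand joins the scalar
term in the far part, the second is the near part. -/
lemma kern_eq_far_add_near (σ : ℤˣ) (l : ℝ) (f : Space → Spinor) (x y : Space) :
    kern σ l (x - y) (f y) =
      ((l : ℂ) / (4 * (Real.pi : ℂ))) • farIntegrand σ l f x y +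
        (Complex.I / (4 * (Real.pi : ℂ))) • nearIntegrand σ l f x y := by
  set r := x - y with hr
  set a := f y with ha
  have e1 : phase σ l r = Complex.exp (Complex.I * (((σ : ℤ) : ℂ) * (l : ℂ)) * (‖r‖ : ℂ)) := by
    rw [phase, mul_assoc Complex.I]
  have e2 : ∀ k, -Complex.I * dgK (((σ : ℤ) : ℂ) * (l : ℂ)) k r =
      ((l : ℂ) / (4 * (Real.pi : ℂ)) * (phase σ l r / (‖r‖ : ℂ)) * ((σ : ℤ) : ℂ) +
        Complex.I / (4 * (Real.pi : ℂ)) * (phase σ l r / (‖r‖ : ℂ) ^ 2)) *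
          ((r k / ‖r‖ : ℝ) : ℂ) := fun k => by
    rw [dgK, ← e1]
    have hI : Complex.I * Complex.I = -1 := Complex.I_mul_I
    simp only [div_eq_mul_inv]
    linear_combination (-(((σ : ℤ) : ℂ) * (l : ℂ) * (‖r‖ : ℂ)⁻¹ * phase σ l r *
      (4 * (Real.pi : ℂ))⁻¹ * ((r k * ‖r‖⁻¹ : ℝ) : ℂ))) * hI
  have e3 : (l : ℂ) * gK (((σ : ℤ) : ℂ) * (l : ℂ)) r =
      (l : ℂ) / (4 * (Real.pi : ℂ)) * (phase σ l r / (‖r‖ : ℂ)) := by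
    rw [gK, ← e1, div_eq_mul_inv, div_eq_mul_inv, div_eq_mul_inv, mul_inv]; ring
  have e4 : kern σ l r a = ((l : ℂ) * gK (((σ : ℤ) : ℂ) * (l : ℂ)) r) • a +
      ∑ k, (-Complex.I * dgK (((σ : ℤ) : ℂ) * (l : ℂ)) k r) • alpha k a := by
    simp [kern]
  have e5 : alphaDir r a = ∑ k, ((r k / ‖r‖ : ℝ) : ℂ) • alpha k a := by
    simp only [alphaDir, sum_apply, smul_apply]
  have e6 : ∑ k, (-Complex.I * dgK (((σ : ℤ) : ℂ) * (l : ℂ)) k r) • alpha k a =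
      ((l : ℂ) / (4 * (Real.pi : ℂ)) * (phase σ l r / (‖r‖ : ℂ)) * ((σ : ℤ) : ℂ) +
        Complex.I / (4 * (Real.pi : ℂ)) * (phase σ l r / (‖r‖ : ℂ) ^ 2)) • alphaDir r a := by
    rw [e5, Finset.smul_sum]
    exact Finset.sum_congr rfl fun k _ => by rw [e2 k, smul_smul]
  rw [e4, e6, e3, farIntegrand, nearIntegrand, ← hr, ← ha]
  module

lemma stronglyMeasurable_alphaDir {f : Space → Spinor} (hf : StronglyMeasurable f) (x : Space) :
    StronglyMeasurable fun y => alphaDir (x - y) (f y) := by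
  have h : (fun y => alphaDir (x - y) (f y)) =
      fun y => ∑ k, ((x - y) k / ‖x - y‖) • alpha k (f y) := funext fun y => alphaDir_apply _ _
  rw [h]
  refine Finset.stronglyMeasurable_fun_sum _ fun k _ => ?_
  have h1 : Measurable fun y : Space => (x - y) k / ‖x - y‖ := by fun_prop
  exact h1.stronglyMeasurable.smul ((alpha k).continuous.comp_stronglyMeasurable hf)

lemma measurable_phase (σ : ℤˣ) (l : ℝ) (x : Space) : Measurable fun y => phase σ l (x - y) := by
  unfold phase; fun_prop

lemma integrable_farIntegrand (σ : ℤˣ) (l : ℝ) {f : Space → Spinor} (hf : StronglyMeasurable f)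
    {x : Space} (h : ∫⁻ y, ENNReal.ofReal ‖x - y‖⁻¹ * ‖f y‖ₑ < ⊤) :
    Integrable (farIntegrand σ l f x) := by
  have hp := measurable_phase σ l x
  have hm : StronglyMeasurable (farIntegrand σ l f x) := by
    have h1 : Measurable fun y => phase σ l (x - y) / (‖x - y‖ : ℂ) := hp.div (by fun_prop)
    exact h1.stronglyMeasurable.smul
      (hf.add ((stronglyMeasurable_alphaDir hf x).const_smul (((σ : ℤ) : ℂ))))
  refine ⟨hm.aestronglyMeasurable, ?_⟩
  have ha := alphaConst_pos
  calc ∫⁻ y, ‖farIntegrand σ l f x y‖ₑ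
      ≤ ∫⁻ y, ENNReal.ofReal (1 + alphaConst) * (ENNReal.ofReal ‖x - y‖⁻¹ * ‖f y‖ₑ) := by
        refine lintegral_mono fun y => ?_
        rw [← ofReal_norm, ← ofReal_norm, ← ENNReal.ofReal_mul (by positivity),
          ← ENNReal.ofReal_mul (by positivity)]
        refine ENNReal.ofReal_le_ofReal ?_
        rw [farIntegrand, norm_smul, norm_div, norm_phase, Complex.norm_real, norm_norm, one_div]
        have h1 : ‖f y + ((σ : ℤ) : ℂ) • alphaDir (x - y) (f y)‖ ≤ (1 + alphaConst) * ‖f y‖ := by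
          refine (norm_add_le _ _).trans ?_
          rw [norm_smul, norm_units_int, one_mul]
          linarith [norm_alphaDir_le (x - y) (f y)]
        calc _ ≤ ‖x - y‖⁻¹ * ((1 + alphaConst) * ‖f y‖) := by gcongr
          _ = _ := by ring
    _ < ⊤ := by
        rw [lintegral_const_mul' _ _ ENNReal.ofReal_ne_top]
        exact ENNReal.mul_lt_top ENNReal.ofReal_lt_top h

lemma integrable_nearIntegrand (σ : ℤˣ) (l : ℝ) {f : Space → Spinor} (hf : StronglyMeasurable f)
    {x : Space} (h : ∫⁻ y, ENNReal.ofReal (‖x - y‖⁻¹ ^ 2) * ‖f y‖ₑ < ⊤) :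
    Integrable (nearIntegrand σ l f x) := by
  have hp := measurable_phase σ l x
  have hm : StronglyMeasurable (nearIntegrand σ l f x) := by
    have h1 : Measurable fun y => phase σ l (x - y) / (‖x - y‖ : ℂ) ^ 2 := hp.div (by fun_prop)
    exact h1.stronglyMeasurable.smul (stronglyMeasurable_alphaDir hf x)
  refine ⟨hm.aestronglyMeasurable, ?_⟩
  have ha := alphaConst_pos
  calc ∫⁻ y, ‖nearIntegrand σ l f x y‖ₑ
      ≤ ∫⁻ y, ENNReal.ofReal alphaConst * (ENNReal.ofReal (‖x - y‖⁻¹ ^ 2) * ‖f y‖ₑ) := by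
        refine lintegral_mono fun y => ?_
        rw [← ofReal_norm, ← ofReal_norm, ← ENNReal.ofReal_mul (by positivity),
          ← ENNReal.ofReal_mul (by positivity)]
        refine ENNReal.ofReal_le_ofReal ?_
        rw [nearIntegrand, norm_smul, norm_div, norm_phase, norm_pow, Complex.norm_real, norm_norm,
          one_div, ← inv_pow]
        calc _ ≤ ‖x - y‖⁻¹ ^ 2 * (alphaConst * ‖f y‖) := by
              gcongr; exact norm_alphaDir_le _ _
          _ = _ := by ring
    _ < ⊤ := by
        rw [lintegral_const_mul' _ _ ENNReal.ofReal_ne_top]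
        exact ENNReal.mul_lt_top ENNReal.ofReal_lt_top h

end IntegralKernel

end DiracLAP

open DiracLAP in
/-- `T z` is `R_𝒟(z)` on `L²(w_β dx)` for non-real `z`, and `B 1 l`, `B (-1) l` are the boundary
values `R_𝒟(l + i0)`, `R_𝒟(l - i0)`. -/
theorem proposition3p5 (β : ℝ) (hβ : 1 < β) :
    -- the resolvents of the free operators exist
    (∀ z : ℂ, z.im ≠ 0 → IsResolvent IsDirac z (diracResolvent z)) ∧
    (∀ z : ℂ, z.im ≠ 0 → IsResolvent IsNegLaplacian z (freeResolvent z)) ∧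
    ∃ (T : ℂ → L2Weight β →L[ℂ] L2InvWeight β) (B : ℤˣ → ℝ → L2Weight β →L[ℂ] L2InvWeight β),
      -- `T z` extends the `L²` resolvent of the Dirac operator
      (∀ z : ℂ, z.im ≠ 0 → ∀ (f : L2Weight β) (g : L2), f =ᵐ[volume] g →
        T z f =ᵐ[volume] diracResolvent z g) ∧
      -- limiting absorption principle in operator norm
      (∀ (σ : ℤˣ) (l : ℝ),
        TendstoInL2H1 β (fun ε => T ((l : ℂ) + Complex.I * ((σ : ℤ) : ℂ) * (ε : ℂ))) (B σ l)) ∧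
      -- the limit is `R₀(l² + i s 0) (𝒟 + l)`, `s` being the sign of `σ l` (any sign if `l = 0`)
      (∀ (σ s : ℤˣ) (l : ℝ), 0 ≤ ((s : ℤ) : ℝ) * ((σ : ℤ) : ℝ) * l →
        ∀ φ : Space → Spinor, IsTest φ → ∀ (f : L2Weight β) (g : L2),
          f =ᵐ[volume] φ → g =ᵐ[volume] (fun x => diracSmooth φ x + (l : ℂ) • φ x) →
          IsFreeBoundaryValue β (l ^ 2) s g (B σ l f)) ∧
      -- uniform bound for all `z ∈ ℂ`, boundary values included
      (∃ C : ℝ, (∀ z : ℂ, z.im ≠ 0 → ∀ f, ‖T z f‖ ≤ C * ‖f‖) ∧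
        ∀ (σ : ℤˣ) (l : ℝ), ∀ f, ‖B σ l f‖ ≤ C * ‖f‖) ∧
      -- explicit integral kernel
      (∀ (σ : ℤˣ) (l : ℝ) (f : L2Weight β), ∀ᵐ x : Space,
        Integrable (farIntegrand σ l f x) ∧ Integrable (nearIntegrand σ l f x) ∧
        B σ l f x =
          ((l : ℂ) / (4 * (Real.pi : ℂ))) • (∫ y, farIntegrand σ l f x y) +
          (Complex.I / (4 * (Real.pi : ℂ))) • (∫ y, nearIntegrand σ l f x y)) := by
  obtain ⟨C, -, hC⟩ := exists_weighted_resolvent hβ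
  have hz : ∀ z : ℂ, ∃ T : L2Weight β →L[ℂ] L2InvWeight β, z.im ≠ 0 →
      (∀ f : L2Weight β, T f =ᵐ[volume] kernOp (signUnit z.im) z f) ∧ ∀ f, ‖T f‖ ≤ C * ‖f‖ := by
    intro z
    by_cases h : z.im = 0
    · exact ⟨0, fun h' => absurd h h'⟩
    · obtain ⟨T, hT⟩ := hC (signUnit z.im) z (im_signUnit_mul h).le
      exact ⟨T, fun _ => hT⟩
  choose T hT using hz
  choose B hB hBn using fun (σ : ℤˣ) (l : ℝ) => hC σ l (im_boundary_value σ l).ge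
  refine ⟨fun z hz => isResolvent_diracResolvent hz, fun z hz => isResolvent_freeResolvent hz, T, B,
    fun z hz f g hfg => ?_, fun σ l => ?_, fun σ s l hs φ hφ f g hf hg => ?_,
    ⟨C, fun z hz => (hT z hz).2, hBn⟩, fun σ l f => ?_⟩
  · refine ((hT z hz).1 f).trans ?_
    rw [kernOp_congr_ae _ _ hfg]
    exact (diracResolvent_ae_eq (im_signUnit_mul hz) g).symm
  · refine tendstoInL2H1_kernOp hβ σ l (fun ε hε f => ?_) (hB σ l)
    have him := im_boundary_param σ l ε
    have h1 : ((l : ℂ) + Complex.I * ((σ : ℤ) : ℂ) * (ε : ℂ)).im = ((σ : ℤ) : ℝ) * ε := by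
      rcases Int.units_eq_one_or σ with rfl | rfl <;> simp
    -- Approaching the axis from the side σ, the resolvent has the kernel with sign σ, the same as
    -- its boundary value.
    have h2 : signUnit ((l : ℂ) + Complex.I * ((σ : ℤ) : ℂ) * (ε : ℂ)).im = σ := by
      rw [h1]
      rcases Int.units_eq_one_or σ with rfl | rfl <;> simp [signUnit, hε, hε.le]
    have h3 : ((l : ℂ) + Complex.I * ((σ : ℤ) : ℂ) * (ε : ℂ)).im ≠ 0 := by
      rw [h1]
      rcases Int.units_eq_one_or σ with rfl | rfl <;> simp [hε.ne']
    have h4 := (hT _ h3).1 f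
    rwa [h2] at h4
  · refine isFreeBoundaryValue_kernOp hβ σ s l hs hφ hg ((hB σ l f).trans ?_)
    rw [kernOp_congr_ae _ _ hf]
  · have hfm := Lp.stronglyMeasurable f
    have hF := lintegral_weight_Lp_lt_top f
    filter_upwards [hB σ l f, ae_lintegral_inv_sq_sub_mul_lt_top hβ hfm.measurable.enorm hF]
      with x hx hx2
    have i1 := integrable_farIntegrand σ l hfm
      (lintegral_inv_sub_mul_lt_top hβ hfm.measurable.enorm hF x)
    have i2 := integrable_nearIntegrand σ l hfm hx2
    refine ⟨i1, i2, ?_⟩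
    rw [hx, kernOp, ← integral_smul, ← integral_smul]
    simp only [kern_eq_far_add_near]
    exact integral_add (i1.smul ((l : ℂ) / (4 * (Real.pi : ℂ))))
      (i2.smul (Complex.I / (4 * (Real.pi : ℂ))))
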